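/- Let $G=(V,E)$ be a finite simple undirected graph and let $s,t\in V$ with $s\neq t$. For $S\subseteq V$ let $\delta(S)\subseteq E$ be the set of edges with exactly one endpoint in $S$, write $x(F)=\sum_{e\in F}x_e$ for $F\subseteq E$, and let $P(G)$ be the fractional $s$-$t$ stroll polytope, i.e., the set of all $(x,y)\in\mathbb{R}_{\ge 0}^E\times\mathbb{R}_{\ge 0}^V$ such that \begin{align*} x(\delta(\{v\})) &= 2y_v && \text{for all } v\in V,\\ x(\delta(S)) &\ge 1 && \text{for all } S\subseteq V\setminus\{t\} \text{ with } s\in S,\\ x(\delta(S)) &\ge 2y_v && \text{for all } S\subseteq V\setminus\{s,t\} \text{ and } v\in S,\\ y_s=y_t&=\tfrac12 . \end{align*} Then for every $(x,y)\in P(G)$ there are a finite family $\mathcal{T}$ of subtrees of $G$ that all contain the vertices $s$ and $t$, and weights $\mu\in[0,1]^{\mathcal{T}}$ with $\sum_{T\in\mathcal{T}}\mu_T=1$, such that $$\sum_{T\in\mathcal{T}}\mu_T\,\chi^{E[T]}=x\qquad\text{and}\qquad \sum_{T\in\mathcal{T}\colon v\in V[T]}\mu_T=y_v\quad\text{for all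 } v\in V\setminus\{s,t\},$$ where $V[T]$ and $E[T]$ are the vertex set and the edge set of $T$, and $\chi^{E[T]}\in\{0,1\}^E$ is the incidence vector of $E[T]$. Moreover, there is an algorithm that, given $G$, $s\ne t$ and a rational point $(x,y)\in P(G)$, computes such a family $\mathcal{T}$ with rational weights $\mu$ in time polynomial in the size of the input, where rational numbers are encoded in binary. -/

import Mathlib

/-! ### The stroll polytope and its tree decompositions -/

namespace Stroll

/-- `δ(S)`: the edges of `G` with exactly one endpoint in `S`. -/
def cut {V : Type*} (G : SimpleGraph V) (S : Set V) : Set G.edgeSet :=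
  {e | ∃ u v : V, u ∈ S ∧ v ∉ S ∧ (e : Sym2 V) = s(u, v)}

open Classical in
/-- `x(δ(S))`, the sum of `x e` over the edges `e ∈ δ(S)`. -/
noncomputable def cutWeight {V K : Type*} [Fintype V] [Field K] (G : SimpleGraph V)
    (x : G.edgeSet → K) (S : Set V) : K :=
  ∑ e : G.edgeSet with e ∈ cut G S, x e

/-- The fractional `s`-`t` stroll polytope of `G`, over an ordered field `K` (`ℝ` or `ℚ`). -/
def polytope {V : Type*} [Fintype V] (K : Type*) [Field K] [LinearOrder K]
    (G : SimpleGraph V) (s t : V) : Set ((G.edgeSet → K) × (V → K)) :=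
  {p | (∀ e, 0 ≤ p.1 e) ∧ (∀ v, 0 ≤ p.2 v) ∧
    (∀ v, cutWeight G p.1 {v} = 2 * p.2 v) ∧
    (∀ S : Set V, t ∉ S → s ∈ S → 1 ≤ cutWeight G p.1 S) ∧
    (∀ S : Set V, s ∉ S → t ∉ S → ∀ v ∈ S, 2 * p.2 v ≤ cutWeight G p.1 S) ∧
    p.2 s = 1 / 2 ∧ p.2 t = 1 / 2}

open Classical in
/-- The finite family `T 0, …, T (m - 1)` of subtrees of `G`, all containing `s` and `t`, with
the weights `μ`, is a convex combination with edge vector `x` and coverage `y` off `s, t`. -/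
structure IsDecomposition {V K : Type*} [Field K] [LinearOrder K] {G : SimpleGraph V} (s t : V)
    (x : G.edgeSet → K) (y : V → K) {m : ℕ} (T : Fin m → G.Subgraph) (μ : Fin m → K) : Prop where
  isTree : ∀ i, (T i).coe.IsTree
  source_mem : ∀ i, s ∈ (T i).verts
  target_mem : ∀ i, t ∈ (T i).verts
  weight_mem : ∀ i, 0 ≤ μ i ∧ μ i ≤ 1
  weight_sum : ∑ i, μ i = 1
  edge_sum : ∀ e : G.edgeSet, ∑ i with (e : Sym2 V) ∈ (T i).edgeSet, μ i = x e
  vertex_sum : ∀ v, v ≠ s → v ≠ t → ∑ i with v ∈ (T i).verts, μ i = y v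

end Stroll

/-! ### Polynomial time: a random access machine with logarithmic cost

Programs work on integer registers and finitely many integer arrays with indirect addressing, and
are built from assignments by sequencing, branching and loops. Every evaluation is charged the
bit lengths of all values and addresses that occur in it. -/

namespace RAM

/-- Bit length of an integer, including its sign. -/
def bits (z : ℤ) : ℕ := Nat.size z.natAbs + 1

/-- Bit length of a word over the integers. -/
def size (w : List ℤ) : ℕ := (w.map bits).sum

/-- The memory (registers, arrays) and the output written so far. -/
structure State where
  reg : ℕ → ℤ
  arr : ℕ → ℤ → ℤ
  out : List ℤ

/-- Initially array `0` holds the input word, register `0` its length; all else is zero. -/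
def init (w : List ℤ) : State where
  reg r := if r = 0 then w.length else 0
  arr a i := if a = 0 ∧ 0 ≤ i then w.getD i.toNat 0 else 0
  out := []

inductive Expr
  | const (z : ℤ)
  | reg (r : ℕ)
  | arr (a : ℕ) (i : Expr)
  | add (e f : Expr)
  | sub (e f : Expr)
  | mul (e f : Expr)
  | div (e f : Expr)

namespace Expr

def eval (σ : State) : Expr → ℤ
  | const z => z
  | reg r => σ.reg r
  | arr a i => σ.arr a (i.eval σ)
  | add e f => e.eval σ + f.eval σ
  | sub e f => e.eval σ - f.eval σ
  | mul e f => e.eval σ * f.eval σ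
  | div e f => e.eval σ / f.eval σ

/-- The bit lengths of the values of all subexpressions, added up. -/
def cost (σ : State) : Expr → ℕ
  | const z => bits z
  | reg r => bits (σ.reg r)
  | arr a i => i.cost σ + bits (σ.arr a (i.eval σ))
  | add e f => e.cost σ + f.cost σ + bits (e.eval σ + f.eval σ)
  | sub e f => e.cost σ + f.cost σ + bits (e.eval σ - f.eval σ)
  | mul e f => e.cost σ + f.cost σ + bits (e.eval σ * f.eval σ)
  | div e f => e.cost σ + f.cost σ + bits (e.eval σ / f.eval σ)

end Expr

inductive Program
  /-- `r := e` for a register `r` -/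
  | assign (r : ℕ) (e : Expr)
  /-- `a[i] := e` for an array `a` -/
  | store (a : ℕ) (i e : Expr)
  /-- append the value of `e` to the output -/
  | emit (e : Expr)
  | seq (c d : Program)
  /-- if `e > 0` then `c` else `d` -/
  | branch (e : Expr) (c d : Program)
  /-- while `e > 0` do `c` -/
  | loop (e : Expr) (c : Program)

/-- `Run c σ τ k`: started in `σ`, the program `c` halts in `τ` at a total cost of `k`. -/
inductive Run : Program → State → State → ℕ → Prop
  | assign (r : ℕ) (e : Expr) (σ : State) :
      Run (.assign r e) σ { σ with reg := Function.update σ.reg r (e.eval σ) } (e.cost σ + 1)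
  | store (a : ℕ) (i e : Expr) (σ : State) :
      Run (.store a i e) σ
        { σ with arr := Function.update σ.arr a
                  (Function.update (σ.arr a) (i.eval σ) (e.eval σ)) }
        (i.cost σ + e.cost σ + 1)
  | emit (e : Expr) (σ : State) :
      Run (.emit e) σ { σ with out := σ.out ++ [e.eval σ] } (e.cost σ + 1)
  | seq {c d : Program} {σ τ ρ : State} {k l : ℕ} :
      Run c σ τ k → Run d τ ρ l → Run (.seq c d) σ ρ (k + l)
  | branch_pos {e : Expr} {c d : Program} {σ τ : State} {k : ℕ} :
      0 < e.eval σ → Run c σ τ k → Run (.branch e c d) σ τ (e.cost σ + 1 + k)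
  | branch_neg {e : Expr} {c d : Program} {σ τ : State} {k : ℕ} :
      ¬ 0 < e.eval σ → Run d σ τ k → Run (.branch e c d) σ τ (e.cost σ + 1 + k)
  | loop_pos {e : Expr} {c : Program} {σ τ ρ : State} {k l : ℕ} :
      0 < e.eval σ → Run c σ τ k → Run (.loop e c) τ ρ l →
        Run (.loop e c) σ ρ (e.cost σ + 1 + k + l)
  | loop_neg {e : Expr} {c : Program} {σ : State} :
      ¬ 0 < e.eval σ → Run (.loop e c) σ σ (e.cost σ + 1)

/-- The search problem "given an instance `a` with `P a`, encoded by `enc a`, find a word `w`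
with `R a w`" is solved by one program, in time polynomial in the bit length of the input. -/
def SolvableInPolyTime {α : Type*} (enc : α → List ℤ) (P : α → Prop)
    (R : α → List ℤ → Prop) : Prop :=
  ∃ (c : Program) (p : Polynomial ℕ), ∀ a, P a →
    ∃ (τ : State) (k : ℕ), Run c (init (enc a)) τ k ∧ k ≤ p.eval (size (enc a)) ∧ R a τ.out

end RAM

/-! ### The decomposition problem as a search problem on words -/

namespace Stroll

/-- A graph on `n` vertices with two vertices `s, t` and rational vectors `x`, `y`. -/
structure Input where
  n : ℕ
  G : SimpleGraph (Fin n)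
  s : Fin n
  t : Fin n
  x : G.edgeSet → ℚ
  y : Fin n → ℚ

/-- Admissible inputs: `s ≠ t`, and `(x, y)` lies in the stroll polytope. -/
def Input.Valid (I : Input) : Prop :=
  I.s ≠ I.t ∧ (I.x, I.y) ∈ polytope ℚ I.G I.s I.t

open Classical in
/-- The word `n, s, t`, then for every pair `(u, v)` the adjacency bit and the numerator and
denominator of `x_{uv}` (of `0` for a non-edge), then those of `y_v` for every `v`. -/
noncomputable def Input.encode (I : Input) : List ℤ :=
  [(I.n : ℤ), ((I.s : ℕ) : ℤ), ((I.t : ℕ) : ℤ)] ++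
  ((List.finRange I.n).flatMap fun u => (List.finRange I.n).flatMap fun v =>
    if h : I.G.Adj u v then [1, (I.x ⟨s(u, v), h⟩).num, ((I.x ⟨s(u, v), h⟩).den : ℤ)]
    else [0, 0, 1]) ++
  (List.finRange I.n).flatMap fun v => [(I.y v).num, ((I.y v).den : ℤ)]

open Classical in
/-- The list of the vertex indicators and the adjacency matrix of a subgraph. -/
noncomputable def encodeSubgraph {n : ℕ} {G : SimpleGraph (Fin n)} (T : G.Subgraph) : List ℤ :=
  ((List.finRange n).map fun v => if v ∈ T.verts then 1 else 0) ++
  (List.finRange n).flatMap fun u => (List.finRange n).map fun v => if T.Adj u v then 1 else 0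

/-- The word `m`, then for every `i < m` the fraction `a i / b i` and the subgraph `T i`. -/
noncomputable def encodeFamily {n : ℕ} {G : SimpleGraph (Fin n)} {m : ℕ}
    (T : Fin m → G.Subgraph) (a b : Fin m → ℤ) : List ℤ :=
  (m : ℤ) :: (List.finRange m).flatMap fun i => [a i, b i] ++ encodeSubgraph (T i)

/-- `w` writes out a decomposition of `(x, y)`, with weights given as (not necessarily reduced)
fractions of integers with positive denominators. -/
def IsSolution (I : Input) (w : List ℤ) : Prop :=
  ∃ (m : ℕ) (T : Fin m → I.G.Subgraph) (a b : Fin m → ℤ), (∀ i, 0 < b i) ∧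
    IsDecomposition I.s I.t I.x I.y T (fun i => (a i : ℚ) / (b i : ℚ)) ∧
    w = encodeFamily T a b

end Stroll

/-! ### Cuts of weight matrices and splitting off -/

namespace Stroll

set_option linter.unusedSectionVars false

section Cuts

variable {V K : Type*} [Fintype V] [DecidableEq V]

/-! Multiply `x` by `W` and add an auxiliary edge `st` of weight `W`. In the resulting symmetric
matrix `s` and `t` have degree `2 * W`, any other vertex `u` has degree `2 * W * y u`, and every cut
that separates `s` from a vertex `u` weighs at least the degree of `u`. This is
`feasible_scaledMatrix`; besides the constraints of the polytope it only needs the bound `y u ≤ 1`.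

Such a matrix is emptied by splitting off. Let `v` be a vertex other than `s`, `t` of least positive
degree. A step lowers `va` and `vb` by `ε` and raises `ab` by `ε`, with `ε` as large as the cut
conditions for the vertices other than `v` allow. Uncrossing of tight sets (`Tight.union`) shows
that `v` has degree zero once all pairs are blocked (`wdeg_eq_zero_of_blocked`). A blocked pair
stays blocked (`Blocked.splitOff`), so one pass over the pairs isolates `v`. When all vertices but
`s` and `t` are isolated, only the edge `st` is left, with weight `2 * W`. Without its auxiliary
half it is the single tree `st` with weight `W`.

The steps are then reversed, last one first. Given a weighted family of trees for the matrix after a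
step, the trees through `ab` weigh at least `ε`, because the weight before the step already
dominates the auxiliary edge. In an amount `ε` of them the edge `ab` gives way to the path `a`, `v`,
`b`. If `v` already lies in the tree, this closes a cycle; one edge `qv` is then left out and its
weight is noted as a demand at `q`. The demands are met by attaching `v` as a leaf at `q` in trees
that contain `q` but not `v`. Enough of them exist because `v` had least positive degree: the
coverage of `q` is at least the coverage that `v` has in the end (`SplitStep.vert_le`,
`UndoInv.attach_dem`).

For the algorithm the weights are scaled to even integers. All cuts are then even, so maximal
splitting amounts are integers; they are found by maximum flow computations with capacity scaling
(`splitOff_deficit`, `exec_maxFlow`). The program is written in a small language whose loop bounds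
are registers that cannot change and whose products have one factor of bounded length. In this
language polynomial running time follows from a decidable syntactic condition (`Cmd.run`), and
correctness is proved by loop invariants that mirror the existence proof. -/

/-- The total weight of the ordered pairs that leave `S`. -/
def outWeight [AddCommMonoid K] (X : V → V → K) (S : Finset V) : K :=
  ∑ p, ∑ q, if p ∈ S ∧ q ∉ S then X p q else 0

/-- The weighted degree. -/
def wdeg [AddCommMonoid K] (X : V → V → K) (u : V) : K := ∑ q, X u q

/-- Add `ε` to the entry `(p, q)`. -/
def bump [AddCommMonoid K] (X : V → V → K) (p q : V) (ε : K) : V → V → K :=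
  fun i j => X i j + if i = p ∧ j = q then ε else 0

theorem outWeight_bump [AddCommMonoid K] (X : V → V → K) (p q : V) (ε : K) (S : Finset V) :
    outWeight (bump X p q ε) S = outWeight X S + if p ∈ S ∧ q ∉ S then ε else 0 := by
  have h : ∀ i j, (if i ∈ S ∧ j ∉ S then bump X p q ε i j else 0) =
      (if i ∈ S ∧ j ∉ S then X i j else 0) +
        if i = p then (if j = q then (if p ∈ S ∧ q ∉ S then ε else 0) else 0) else 0 := by
    intro i j
    unfold bump
    by_cases h1 : i = p
    · by_cases h2 : j = q
      · subst h1 h2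
        by_cases h3 : i ∈ S ∧ j ∉ S <;> simp [h3]
      · simp [h2]
    · simp [h1]
  simp only [outWeight, h, Finset.sum_add_distrib]
  simp

theorem wdeg_bump [AddCommMonoid K] (X : V → V → K) (p q : V) (ε : K) (u : V) :
    wdeg (bump X p q ε) u = wdeg X u + if u = p then ε else 0 := by
  simp only [wdeg, bump, Finset.sum_add_distrib]
  by_cases h : u = p <;> simp [h]

/-- Each ordered pair is counted equally often on both sides. Keeping the defect of submodularity as
an explicit sum lets the same identity, with `B` replaced by its complement, yield a strict
inequality for the differences. -/
theorem outWeight_inter_add_union [AddCommMonoid K] (X : V → V → K) (A B : Finset V) :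
    outWeight X (A ∩ B) + outWeight X (A ∪ B) + (∑ p, ∑ q,
      if (p ∈ A \ B ∧ q ∈ B \ A) ∨ (p ∈ B \ A ∧ q ∈ A \ B) then X p q else 0) =
      outWeight X A + outWeight X B := by
  simp only [outWeight, ← Finset.sum_add_distrib]
  refine Finset.sum_congr rfl fun p _ => Finset.sum_congr rfl fun q _ => ?_
  by_cases h1 : p ∈ A <;> by_cases h2 : p ∈ B <;> by_cases h3 : q ∈ A <;> by_cases h4 : q ∈ B <;>
    simp [h1, h2, h3, h4]

theorem outWeight_compl [AddCommMonoid K] {X : V → V → K} (hX : ∀ u v, X u v = X v u)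
    (S : Finset V) : outWeight X Sᶜ = outWeight X S := by
  unfold outWeight
  rw [Finset.sum_comm]
  refine Finset.sum_congr rfl fun p _ => Finset.sum_congr rfl fun q _ => ?_
  rw [hX q p]
  congr 1
  simp [and_comm]

theorem outWeight_singleton [AddCommMonoid K] {X : V → V → K} (hX : ∀ u, X u u = 0) (u : V) :
    outWeight X {u} = wdeg X u := by
  unfold outWeight wdeg
  rw [Finset.sum_eq_single u]
  · refine Finset.sum_congr rfl fun q _ => ?_
    by_cases h : q = u
    · simp [h, hX]
    · simp [h]
  · intro b _ hb
    simp [hb]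
  · simp

variable [CommRing K] [LinearOrder K] [IsStrictOrderedRing K]

theorem outWeight_nonneg {X : V → V → K} (hX : ∀ u v, 0 ≤ X u v) (S : Finset V) :
    0 ≤ outWeight X S :=
  Finset.sum_nonneg fun p _ => Finset.sum_nonneg fun q _ => by split_ifs <;> simp [hX]

theorem outWeight_inter_add_union_le {X : V → V → K} (hX : ∀ u v, 0 ≤ X u v) (A B : Finset V) :
    outWeight X (A ∩ B) + outWeight X (A ∪ B) ≤ outWeight X A + outWeight X B := by
  rw [← outWeight_inter_add_union X A B]
  have : 0 ≤ ∑ p, ∑ q,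
      if (p ∈ A \ B ∧ q ∈ B \ A) ∨ (p ∈ B \ A ∧ q ∈ A \ B) then X p q else 0 :=
    Finset.sum_nonneg fun p _ => Finset.sum_nonneg fun q _ => by split_ifs <;> simp [hX]
  linarith

/-- Apply the identity to `A` and the complement of `B`. By symmetry `A ∪ Bᶜ` weighs as much as `B \
A`, and the defect contains the edge `av`, which runs from `A ∩ B` to the outside of both sets. -/
theorem outWeight_sdiff_add_sdiff_lt {X : V → V → K} (hX : ∀ u v, 0 ≤ X u v)
    (hs : ∀ u v, X u v = X v u) {A B : Finset V} {a v : V} (ha : a ∈ A) (ha' : a ∈ B)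
    (hv : v ∉ A) (hv' : v ∉ B) (hav : 0 < X a v) :
    outWeight X (A \ B) + outWeight X (B \ A) < outWeight X A + outWeight X B := by
  have h := outWeight_inter_add_union X A Bᶜ
  have h1 : A ∩ Bᶜ = A \ B := by ext; simp
  have h2 : A ∪ Bᶜ = (B \ A)ᶜ := by ext; simp; tauto
  rw [h1, h2, outWeight_compl hs, outWeight_compl hs] at h
  rw [← h]
  have : 0 < ∑ p, ∑ q,
      if (p ∈ A \ Bᶜ ∧ q ∈ Bᶜ \ A) ∨ (p ∈ Bᶜ \ A ∧ q ∈ A \ Bᶜ) then X p q else 0 := by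
    refine Finset.sum_pos' (fun p _ => Finset.sum_nonneg fun q _ => ?_) ⟨a, Finset.mem_univ _,
      Finset.sum_pos' (fun q _ => ?_) ⟨v, Finset.mem_univ _, ?_⟩⟩
    · split_ifs <;> simp [hX]
    · split_ifs <;> simp [hX]
    · simp [ha, ha', hv, hv', hav]
  linarith

/-- Weight matrices in which every vertex `u` is joined to `s` by as many units as its degree. -/
structure Feasible (X : V → V → K) (s t : V) : Prop where
  symm : ∀ u v, X u v = X v u
  diag : ∀ u, X u u = 0
  nonneg : ∀ u v, 0 ≤ X u v
  deg_eq : wdeg X t = wdeg X s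
  le_cut : ∀ (S : Finset V) (u : V), s ∉ S → u ∈ S → wdeg X u ≤ outWeight X S

namespace Feasible

variable {X : V → V → K} {s t v : V}

/-- Complementing a set does not change its cut, so separation from `s` may be stated without fixing
the side on which `s` lies. All later arguments use this form. -/
theorem le_outWeight (h : Feasible X s t) {S : Finset V} {u : V} (hu : s ∈ S ↔ u ∉ S) :
    wdeg X u ≤ outWeight X S := by
  by_cases hs : s ∈ S
  · rw [← outWeight_compl h.symm]
    exact h.le_cut _ _ (by simpa using hs) (by simpa using hu.1 hs)
  · exact h.le_cut _ _ hs (by tauto)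

theorem wdeg_le_source (h : Feasible X s t) (u : V) : wdeg X u ≤ wdeg X s := by
  by_cases hu : u = s
  · rw [hu]
  · rw [← outWeight_singleton h.diag s]
    exact h.le_outWeight (by simpa using hu)

theorem wdeg_nonneg (h : Feasible X s t) (u : V) : 0 ≤ wdeg X u :=
  Finset.sum_nonneg fun q _ => h.nonneg u q

end Feasible

/-- `S` separates `s` from some `u ≠ v` by a cut of the least possible weight. -/
def Tight (X : V → V → K) (s v : V) (S : Finset V) : Prop :=
  ∃ u, u ≠ v ∧ (s ∈ S ↔ u ∉ S) ∧ outWeight X S ≤ wdeg X u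

/-- Nothing can be split off at the pair of edges `va`, `vb`. -/
def Blocked (X : V → V → K) (s v a b : V) : Prop :=
  X v a ≤ 0 ∨ X v b ≤ 0 ∨ ∃ S : Finset V, v ∉ S ∧ a ∈ S ∧ b ∈ S ∧ Tight X s v S

/-- Uncrossing. Either intersection and union both separate `s` from the two witnesses, and
submodularity makes the union tight, or the two differences do. The latter is impossible, since the
edge `av` makes the inequality for the differences strict. -/
theorem Tight.union {X : V → V → K} {s t v a : V} (h : Feasible X s t) {A B : Finset V}
    (hA : Tight X s v A) (hB : Tight X s v B) (hvA : v ∉ A) (hvB : v ∉ B) (haA : a ∈ A)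
    (haB : a ∈ B) (hva : 0 < X v a) : Tight X s v (A ∪ B) := by
  obtain ⟨u, huv, hu, hu'⟩ := hA
  obtain ⟨w, hwv, hw, hw'⟩ := hB
  have hsub := outWeight_inter_add_union_le h.nonneg A B
  have hpos := outWeight_sdiff_add_sdiff_lt h.nonneg h.symm haA haB hvA hvB (by rwa [h.symm])
  -- A case distinction on the positions of `s`, `u` and `w`; the first two alternatives lead to
  -- submodularity, the last two to the contradiction.
  have key : ((s ∈ A ∩ B ↔ u ∉ A ∩ B) ∧ (s ∈ A ∪ B ↔ w ∉ A ∪ B)) ∨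
      ((s ∈ A ∩ B ↔ w ∉ A ∩ B) ∧ (s ∈ A ∪ B ↔ u ∉ A ∪ B)) ∨
      ((s ∈ A \ B ↔ u ∉ A \ B) ∧ (s ∈ B \ A ↔ w ∉ B \ A)) ∨
      ((s ∈ A \ B ↔ w ∉ A \ B) ∧ (s ∈ B \ A ↔ u ∉ B \ A)) := by
    by_cases h1 : s ∈ A <;> by_cases h2 : s ∈ B <;> by_cases h3 : u ∈ B <;> by_cases h4 : w ∈ A <;>
      simp_all
  rcases key with ⟨k1, k2⟩ | ⟨k1, k2⟩ | ⟨k1, k2⟩ | ⟨k1, k2⟩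
  · have := h.le_outWeight k1
    exact ⟨w, hwv, k2, by linarith⟩
  · have := h.le_outWeight k1
    exact ⟨u, huv, k2, by linarith⟩
  · have := h.le_outWeight k1
    have := h.le_outWeight k2
    linarith
  · have := h.le_outWeight k1
    have := h.le_outWeight k2
    linarith

/-- All edges at `v` end in `S`, so moving `v` into `S` takes all of them out of the cut and brings
no new ones in. -/
theorem outWeight_insert_add_wdeg_le {X : V → V → K} (hs : ∀ u v, X u v = X v u)
    {v : V} {S : Finset V} (hv : v ∉ S) (h : ∀ y, y ∉ S → X v y = 0) :
    outWeight X (insert v S) + wdeg X v ≤ outWeight X S := by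
  have hd : wdeg X v = ∑ p, ∑ q, if q = v then X p q else 0 := by
    simp [wdeg, hs v]
  rw [hd]
  simp only [outWeight, ← Finset.sum_add_distrib]
  refine Finset.sum_le_sum fun p _ => Finset.sum_le_sum fun q _ => ?_
  by_cases hq : q = v
  · subst hq
    by_cases hp : p ∈ S
    · simp [hp, hv]
    · simp [hp, hs p q, h p hp]
  · by_cases hp : p = v
    · subst hp
      by_cases hqS : q ∈ S
      · simp [hqS, hq]
      · simp [hqS, hq, h q hqS, hv]
    · simp [hp, hq]

/-- Extremal argument: if `v` has a neighbour `a`, take a largest tight set `A` with `a ∈ A` and `v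
∉ A`. Some neighbour `b` of `v` lies outside `A`, and the tight set that blocks `a`, `b` can be
united with `A`, against maximality. -/
theorem wdeg_eq_zero_of_blocked {X : V → V → K} {s t v : V} (h : Feasible X s t) (hst : s ≠ t)
    (hvs : v ≠ s) (hvt : v ≠ t) (hb : ∀ a b, a ≠ b → Blocked X s v a b) : wdeg X v = 0 := by
  classical
  by_contra hne
  have hpos : 0 < wdeg X v := lt_of_le_of_ne (h.wdeg_nonneg v) (Ne.symm hne)
  obtain ⟨a, -, ha⟩ : ∃ a ∈ Finset.univ, 0 < X v a := by
    by_contra hcon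
    push Not at hcon
    exact absurd (Finset.sum_nonpos hcon) (not_le.2 hpos)
  have hav : a ≠ v := by
    rintro rfl
    simp [h.diag] at ha
  let Q : Finset (Finset V) := Finset.univ.filter fun S => v ∉ S ∧ a ∈ S ∧ Tight X s v S
  have hQ : Q.Nonempty := by
    refine ⟨{a}, ?_⟩
    simp only [Q, Finset.mem_filter, Finset.mem_univ, true_and, Finset.mem_singleton]
    refine ⟨hav.symm, ?_⟩
    -- The singleton `{a}` is tight for `a` itself. If `a = s`, it is tight for `t`, because `s` and
    -- `t` have the same degree.
    by_cases has : a = s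
    · subst has
      exact ⟨t, hvt.symm, by simp [hst.symm], by rw [outWeight_singleton h.diag, h.deg_eq]⟩
    · exact ⟨a, hav, by simp [Ne.symm has], by rw [outWeight_singleton h.diag]⟩
  obtain ⟨A, hA, hmax⟩ := Finset.exists_max_image Q Finset.card hQ
  simp only [Q, Finset.mem_filter, Finset.mem_univ, true_and] at hA hmax
  obtain ⟨hvA, haA, hT⟩ := hA
  -- If all neighbours of `v` were in `A`, then `insert v A` would still separate `s` from the
  -- witness `u ≠ v`, but by a cut smaller than the degree of `u`.
  obtain ⟨b, hbA, hvb⟩ : ∃ b, b ∉ A ∧ 0 < X v b := by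
    by_contra hcon
    push Not at hcon
    obtain ⟨u, huv, hu, hu'⟩ := hT
    have h1 := outWeight_insert_add_wdeg_le h.symm hvA
      fun y hy => le_antisymm (hcon y hy) (h.nonneg v y)
    have h2 : wdeg X u ≤ outWeight X (insert v A) :=
      h.le_outWeight (by simpa [hvs.symm, huv] using hu)
    linarith
  have hab : a ≠ b := by
    rintro rfl
    exact hbA haA
  rcases hb a b hab with h1 | h1 | ⟨B, hvB, haB, hbB, hTB⟩
  · exact absurd h1 (not_le.2 ha)
  · exact absurd h1 (not_le.2 hvb)
  · have hU := hT.union h hTB hvA hvB haA haB ha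
    have := hmax (A ∪ B) ⟨by simp [hvA, hvB], by simp [haA], hU⟩
    have hlt : A.card < (A ∪ B).card := Finset.card_lt_card
      ⟨Finset.subset_union_left, fun hsub => hbA (hsub (by simp [hbB]))⟩
    omega

/-- Split off the amount `ε` of the edges `va` and `vb`. -/
def splitOff (X : V → V → K) (v a b : V) (ε : K) : V → V → K :=
  bump (bump (bump (bump (bump (bump X v a (-ε)) a v (-ε)) v b (-ε)) b v (-ε)) a b ε) b a ε

/-- The edges `va` and `vb` both cross such a cut and the new edge `ab` does not. These are the only
cuts whose weight changes; in any other cut losses and gains cancel. -/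
theorem outWeight_splitOff_of_blocking (X : V → V → K) {v a b : V} (ε : K) {S : Finset V}
    (hab : a ∈ S ↔ b ∈ S) (hv : a ∈ S ↔ v ∉ S) :
    outWeight (splitOff X v a b ε) S = outWeight X S - 2 * ε := by
  unfold splitOff
  simp only [outWeight_bump]
  by_cases h : a ∈ S
  · have hb := hab.1 h
    have hv := hv.1 h
    simp [h, hb, hv]; ring
  · have hb : b ∉ S := fun hb => h (hab.2 hb)
    have hv : v ∈ S := by tauto
    simp [h, hb, hv]; ring

theorem outWeight_splitOff_of_not_blocking (X : V → V → K) {v a b : V} (ε : K) {S : Finset V}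
    (hv : ¬ ((a ∈ S ↔ b ∈ S) ∧ (a ∈ S ↔ v ∉ S))) :
    outWeight (splitOff X v a b ε) S = outWeight X S := by
  unfold splitOff
  simp only [outWeight_bump]
  by_cases h : a ∈ S <;> by_cases hb : b ∈ S <;> by_cases hv : v ∈ S <;> simp_all

theorem wdeg_splitOff (X : V → V → K) {v a b : V} (hva : a ≠ v) (hvb : b ≠ v) (ε : K) (u : V) :
    wdeg (splitOff X v a b ε) u = wdeg X u - if u = v then 2 * ε else 0 := by
  unfold splitOff
  simp only [wdeg_bump]
  by_cases h : u = v
  · subst h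
    simp [hva.symm, hvb.symm]; ring
  · simp only [h, if_false]
    split_ifs <;> ring

theorem splitOff_apply_left (X : V → V → K) {v a b : V} (hva : a ≠ v) (hvb : b ≠ v) (ε : K)
    (c : V) : splitOff X v a b ε v c =
      X v c - (if c = a then ε else 0) - if c = b then ε else 0 := by
  unfold splitOff bump
  have h1 := hva.symm
  have h2 := hvb.symm
  simp only [h1, h2, true_and, false_and, if_false]
  split_ifs <;> ring

theorem splitOff_symm {X : V → V → K} (hX : ∀ u v, X u v = X v u) (v a b : V) (ε : K) (p q : V) :
    splitOff X v a b ε p q = splitOff X v a b ε q p := by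
  unfold splitOff bump
  simp only [hX p q, and_comm (a := q = _)]
  ring

/-- Splitting off at `v` keeps feasibility if the entries stay nonnegative and no cut that
separates `s` from a vertex `u ≠ v` becomes too small. -/
theorem Feasible.splitOff {X : V → V → K} {s t v a b : V} (h : Feasible X s t) (hva : a ≠ v)
    (hvb : b ≠ v) (hab : a ≠ b) (hvs : v ≠ s) (hvt : v ≠ t) {ε : K} (hε : 0 ≤ ε) (h1 : ε ≤ X v a)
    (h2 : ε ≤ X v b)
    (hcut : ∀ (S : Finset V) (u : V), u ≠ v → (s ∈ S ↔ u ∉ S) → (a ∈ S ↔ b ∈ S) →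
      (a ∈ S ↔ v ∉ S) → wdeg X u + 2 * ε ≤ outWeight X S) :
    Feasible (splitOff X v a b ε) s t where
  symm := splitOff_symm h.symm v a b ε
  diag u := by
    have e : ∀ c d : V, c ≠ d → ¬ (u = c ∧ u = d) := by
      rintro c d hcd ⟨rfl, rfl⟩
      exact hcd rfl
    simp [Stroll.splitOff, bump, h.diag, e _ _ hva, e _ _ hvb, e _ _ hab, e _ _ hva.symm,
      e _ _ hvb.symm, e _ _ hab.symm]
  nonneg p q := by
    have e1 : 0 ≤ X p q := h.nonneg p q
    have e2 : ∀ c, Stroll.splitOff X v a b ε v c =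
      X v c - (if c = a then ε else 0) - if c = b then ε else 0 := splitOff_apply_left X hva hvb ε
    have e3 : ∀ c, 0 ≤ Stroll.splitOff X v a b ε v c := by
      intro c
      rw [e2]
      have := h.nonneg v c
      by_cases h3 : c = a
      · subst h3; simp [hab]; linarith
      · by_cases h4 : c = b
        · subst h4; simp [h3]; linarith
        · simp [h3, h4]; linarith
    by_cases hp : p = v
    · rw [hp]; exact e3 q
    · by_cases hq : q = v
      · subst hq
        rw [splitOff_symm h.symm]; exact e3 p
      · unfold Stroll.splitOff bump
        simp only [hp, hq, false_and, and_false, if_false, add_zero]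
        have : ∀ c : Prop, [Decidable c] → 0 ≤ if c then ε else 0 := by
          intro c _
          split_ifs <;> simp [hε]
        have := this (p = a ∧ q = b)
        have : 0 ≤ if p = b ∧ q = a then ε else 0 := by split_ifs <;> simp [hε]
        linarith
  deg_eq := by
    rw [wdeg_splitOff X hva hvb, wdeg_splitOff X hva hvb, h.deg_eq]
    simp [hvs.symm, hvt.symm]
  le_cut S u hs hu := by
    rw [wdeg_splitOff X hva hvb]
    have h0 := h.le_cut S u hs hu
    by_cases hbl : (a ∈ S ↔ b ∈ S) ∧ (a ∈ S ↔ v ∉ S)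
    · rw [outWeight_splitOff_of_blocking X ε hbl.1 hbl.2]
      by_cases huv : u = v
      · simp [huv] at h0 ⊢; linarith
      · have := hcut S u huv (by tauto) hbl.1 hbl.2
        simp [huv]; linarith
    · rw [outWeight_splitOff_of_not_blocking X ε hbl]
      by_cases huv : u = v
      · simp [huv] at h0 ⊢; linarith
      · simpa [huv] using h0

/-- Splitting off raises neither the weights at `v` nor any cut, and it leaves the degrees of the
other vertices alone. A set that was tight for some `u ≠ v` therefore stays tight. -/
theorem Blocked.splitOff {X : V → V → K} {s v a b c d : V} (h : Blocked X s v c d) (hva : a ≠ v)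
    (hvb : b ≠ v) {ε : K} (hε : 0 ≤ ε) : Blocked (splitOff X v a b ε) s v c d := by
  have hle : ∀ c, Stroll.splitOff X v a b ε v c ≤ X v c := by
    intro c
    rw [splitOff_apply_left X hva hvb]
    have h1 : 0 ≤ if c = a then ε else 0 := by split_ifs <;> simp [hε]
    have h2 : 0 ≤ if c = b then ε else 0 := by split_ifs <;> simp [hε]
    linarith
  rcases h with h | h | ⟨S, hv, hc, hd, u, huv, hu, hu'⟩
  · exact Or.inl ((hle c).trans h)
  · exact Or.inr (Or.inl ((hle d).trans h))
  · refine Or.inr (Or.inr ⟨S, hv, hc, hd, u, huv, hu, ?_⟩)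
    rw [wdeg_splitOff X hva hvb]
    by_cases hbl : (a ∈ S ↔ b ∈ S) ∧ (a ∈ S ↔ v ∉ S)
    · rw [outWeight_splitOff_of_blocking X ε hbl.1 hbl.2]
      simp [huv]; linarith
    · rw [outWeight_splitOff_of_not_blocking X ε hbl]
      simpa [huv] using hu'

end Cuts

end Stroll

/-! ### Trees given by parent pointers -/

namespace Stroll

/-- `n`-fold application of the steps `f 0, …, f (n - 1)`. -/
def iter {α : Type*} (f : ℕ → α → α) : ℕ → α → α
  | 0, a => a
  | k + 1, a => f k (iter f k a)

set_option linter.unusedSectionVars false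

section Trees

variable {V : Type*} [DecidableEq V]

/-- `T` is a tree with root `s` that contains `t`: `T u` is the parent of `u`, and `none` if `u`
does not belong to the tree; the root is its own parent. -/
structure IsArb (s t : V) (T : V → Option V) : Prop where
  root : T s = some s
  target : T t ≠ none
  depth : ∃ d : V → ℕ, ∀ u p, T u = some p → T p ≠ none ∧ (u ≠ s → d p < d u)

/-- `a` and `b` are joined by an edge of `T`. -/
abbrev HasEdge (T : V → Option V) (a b : V) : Prop := T a = some b ∨ T b = some a

/-- The parent, or the vertex itself if it has none. -/
def up (T : V → Option V) (u : V) : V := (T u).getD u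

/-- `x` is an ancestor of `u`. -/
def Desc (T : V → Option V) (x u : V) : Prop := ∃ j, (up T)^[j] u = x

/-- Up to the first visit to `y` the iterates are distinct, since a repetition would give an earlier
visit. This turns the search for an ancestor into a loop of bounded length. -/
theorem exists_iterate_lt_card {α : Type*} [Fintype α] (f : α → α) {x y : α} {j : ℕ}
    (h : f^[j] x = y) : ∃ i < Fintype.card α, f^[i] x = y := by
  classical
  have hex : ∃ j, f^[j] x = y := ⟨j, h⟩
  refine ⟨Nat.find hex, ?_, Nat.find_spec hex⟩
  by_contra hge
  have hinj : Function.Injective fun i : Fin (Nat.find hex + 1) => f^[(i : ℕ)] x := by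
    have key : ∀ i k : ℕ, i < k → k ≤ Nat.find hex → f^[i] x ≠ f^[k] x := by
      intro i k hik hk heq
      have h1 : f^[(Nat.find hex - k) + i] x = y := by
        rw [Function.iterate_add_apply, heq, ← Function.iterate_add_apply, Nat.sub_add_cancel hk]
        exact Nat.find_spec hex
      exact Nat.find_min hex (by omega) h1
    intro i k hik
    rcases lt_trichotomy (i : ℕ) k with hlt | heq | hlt
    · exact absurd hik (key _ _ hlt (by omega))
    · exact Fin.ext heq
    · exact absurd hik.symm (key _ _ hlt (by omega))
  have := Fintype.card_le_of_injective _ hinj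
  rw [Fintype.card_fin] at this
  omega

theorem desc_refl (T : V → Option V) (u : V) : Desc T u u := ⟨0, rfl⟩

theorem desc_iff_of_ne {T : V → Option V} {x u p : V} (hu : T u = some p) (hx : u ≠ x) :
    Desc T x u ↔ Desc T x p := by
  have hup : up T u = p := by simp [up, hu]
  constructor
  · rintro ⟨j, hj⟩
    cases j with
    | zero => exact absurd hj hx
    | succ j => exact ⟨j, by rwa [Function.iterate_succ_apply, hup] at hj⟩
  · rintro ⟨j, hj⟩
    exact ⟨j + 1, by rwa [Function.iterate_succ_apply, hup]⟩

/-- The parent map fixes the root and lowers the depth everywhere else. -/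
theorem desc_depth {s : V} {T : V → Option V} {d : V → ℕ} (hs : T s = some s)
    (hd : ∀ u p, T u = some p → T p ≠ none ∧ (u ≠ s → d p < d u)) {x u : V} (hu : T u ≠ none)
    (h : Desc T x u) : x = u ∨ d x < d u := by
  obtain ⟨j, hj⟩ := h
  induction j generalizing u with
  | zero => exact Or.inl hj.symm
  | succ j ih =>
    obtain ⟨p, hp⟩ := Option.ne_none_iff_exists'.1 hu
    rw [Function.iterate_succ_apply, show up T u = p by simp [up, hp]] at hj
    by_cases hus : u = s
    · subst hus
      obtain rfl : u = p := by simpa [hs] using hp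
      exact ih hu hj
    · obtain ⟨h1, h2⟩ := hd u p hp
      rcases ih h1 hj with rfl | h3
      · exact Or.inr (h2 hus)
      · exact Or.inr (h3.trans (h2 hus))

open Classical in
/-- Insert `v` in the edge from `bot` to its parent `top`; if `v` is a vertex of the tree
already, its old parent edge is removed if it lies below `bot`, and the new edge from `v` to
`top` is left out otherwise. -/
noncomputable def reroute (T : V → Option V) (v top bot : V) (below : Prop) : V → Option V :=
  if T v ≠ none ∧ ¬ below then Function.update T bot (some v)
  else Function.update (Function.update T v (some top)) bot (some v)

open Classical in
/-- The other end of the edge at `v` that `reroute` leaves out. -/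
noncomputable def leftOver (T : V → Option V) (v top : V) (below : Prop) : Option V :=
  if T v ≠ none ∧ ¬ below then some top else T v

variable {s t v top bot : V} {T : V → Option V}

theorem reroute_apply_of_ne {below : Prop} {q : V} (hq : q ≠ v) :
    reroute T v top bot below q = if q = bot then some v else T q := by
  unfold reroute
  split_ifs <;> simp_all

open Classical in
theorem reroute_self {below : Prop} (hv : v ≠ bot) :
    reroute T v top bot below v = if T v ≠ none ∧ ¬ below then T v else some top := by
  unfold reroute
  split_ifs <;> simp_all

/-- Parent pointers form a tree as soon as some depth function decreases along them, so each of the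
three cases only needs a new depth function. -/
theorem IsArb.reroute (h : IsArb s t T) {below : Prop}
    (hbelow : below ↔ Desc T bot v) (hvs : v ≠ s) (hvt : v ≠ top) (hvb : v ≠ bot)
    (htb : top ≠ bot) (hbot : T bot = some top) : IsArb s t (reroute T v top bot below) := by
  obtain ⟨d, hd⟩ := h.depth
  have hbs : bot ≠ s := by
    rintro rfl
    exact htb (by simpa [hbot] using h.root)
  obtain ⟨htop, hdtop⟩ := hd bot top hbot
  have hdtop := hdtop hbs
  have hmem : ∀ p, T p ≠ none → Stroll.reroute T v top bot below p ≠ none := by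
    intro p hp
    by_cases hpv : p = v
    · subst hpv
      rw [reroute_self hvb]
      split_ifs <;> simp_all
    · rw [reroute_apply_of_ne hpv]
      split_ifs <;> simp_all
  have hmemv : Stroll.reroute T v top bot below v ≠ none := by
    rw [reroute_self hvb]
    split_ifs <;> simp_all
  refine ⟨by rw [reroute_apply_of_ne hvs.symm, if_neg hbs.symm, h.root], hmem _ h.target, ?_⟩
  by_cases hv : T v = none
  -- `v` is new: doubling all depths makes room for it strictly between `top` and `bot`.
  · refine ⟨fun u => if u = v then 2 * d top + 1 else 2 * d u, fun u p hup => ?_⟩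
    by_cases huv : u = v
    · subst huv
      rw [reroute_self hvb, if_neg (by simp [hv])] at hup
      obtain rfl : top = p := by simpa using hup
      exact ⟨hmem _ htop, fun _ => by simp [hvt.symm]⟩
    · rw [reroute_apply_of_ne huv] at hup
      by_cases hub : u = bot
      · subst hub
        obtain rfl : v = p := by simpa using hup
        exact ⟨hmemv, fun _ => by simp [hvb.symm]; omega⟩
      · rw [if_neg hub] at hup
        obtain ⟨h1, h2⟩ := hd u p hup
        have hpv : p ≠ v := by
          rintro rfl
          exact h1 hv
        exact ⟨hmem _ h1, fun hus => by simp [hpv, huv]; exact h2 hus⟩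
  · classical
    by_cases hb : below
    · have hbv := hbelow.1 hb
      have hdb : d bot < d v := by
        rcases desc_depth h.root hd hv hbv with h1 | h1
        · exact absurd h1.symm hvb
        · exact h1
      -- `v` lies below `bot`: the subtree of `v` keeps its depths, since `v` is already deeper than
      -- `top`. The rest of the subtree of `bot` is shifted down until `bot` is deeper than `v`.
      refine ⟨fun u => if Desc T bot u ∧ ¬ Desc T v u then d u + d v + 1 else d u,
        fun u p hup => ?_⟩
      by_cases huv : u = v
      · subst huv
        rw [reroute_self hvb, if_neg (by simp [hb])] at hup
        obtain rfl : top = p := by simpa using hup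
        refine ⟨hmem _ htop, fun _ => ?_⟩
        have h1 : ¬ Desc T bot top := by
          intro hcon
          rcases desc_depth h.root hd htop hcon with h1 | h1
          · exact htb h1.symm
          · omega
        simp only [h1, desc_refl, false_and, not_true, and_false, if_false]
        omega
      · rw [reroute_apply_of_ne huv] at hup
        by_cases hub : u = bot
        · subst hub
          obtain rfl : v = p := by simpa using hup
          refine ⟨hmemv, fun _ => ?_⟩
          have h1 : ¬ Desc T v u := by
            intro hcon
            rcases desc_depth h.root hd (by simp [hbot]) hcon with h1 | h1
            · exact hvb h1
            · omega
          simp only [h1, desc_refl, not_true, and_false, if_false, not_false_eq_true, and_true,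
            if_true]
          omega
        · rw [if_neg hub] at hup
          obtain ⟨h1, h2⟩ := hd u p hup
          refine ⟨hmem _ h1, fun hus => ?_⟩
          simp only [desc_iff_of_ne hup hub, desc_iff_of_ne hup huv]
          have := h2 hus
          split_ifs <;> omega
    · have hbv : ¬ Desc T bot v := fun hcon => hb (hbelow.2 hcon)
      -- `v` lies elsewhere in the tree: the whole subtree of `bot` is hung below `v`.
      refine ⟨fun u => if Desc T bot u then d u + d v + 1 else d u, fun u p hup => ?_⟩
      have hup' : (if u = bot then some v else T u) = some p := by
        by_cases huv : u = v
        · subst huv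
          rw [reroute_self hvb, if_pos ⟨hv, hb⟩] at hup
          rw [if_neg hvb, hup]
        · rwa [reroute_apply_of_ne huv] at hup
      by_cases hub : u = bot
      · subst hub
        obtain rfl : v = p := by simpa using hup'
        refine ⟨hmemv, fun _ => ?_⟩
        simp only [hbv, desc_refl, if_true, if_false]
        omega
      · rw [if_neg hub] at hup'
        obtain ⟨h1, h2⟩ := hd u p hup'
        refine ⟨hmem _ h1, fun hus => ?_⟩
        simp only [desc_iff_of_ne hup' hub]
        have := h2 hus
        split_ifs <;> omega

theorem IsArb.attach (h : IsArb s t T) {p : V} (hp : T p ≠ none) (hv : T v = none) :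
    IsArb s t (Function.update T v (some p)) := by
  obtain ⟨d, hd⟩ := h.depth
  have hpv : p ≠ v := by
    rintro rfl
    exact hp hv
  have hvs : v ≠ s := by
    rintro rfl
    simp [h.root] at hv
  have hmem : ∀ q, T q ≠ none → Function.update T v (some p) q ≠ none := by
    intro q hq
    by_cases hqv : q = v <;> simp [hqv, hq]
  refine ⟨by simp [hvs.symm, h.root], hmem _ h.target,
    fun u => if u = v then d p + 1 else d u, fun u q huq => ?_⟩
  by_cases huv : u = v
  · subst huv
    obtain rfl : p = q := by simpa using huq
    exact ⟨hmem _ hp, fun _ => by simp [hpv]⟩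
  · rw [Function.update_of_ne huv] at huq
    obtain ⟨h1, h2⟩ := hd u q huq
    have hqv : q ≠ v := by
      rintro rfl
      exact h1 hv
    exact ⟨hmem _ h1, fun hus => by simpa [huv, hqv] using h2 hus⟩

theorem IsArb.two_cycle (h : IsArb s t T) {a b : V} (hab : a ≠ b) (h1 : T a = some b) :
    T b ≠ some a := by
  intro h2
  obtain ⟨d, hd⟩ := h.depth
  have ha : a ≠ s := by
    rintro rfl
    exact hab (by simpa [h1] using h.root.symm)
  have hb : b ≠ s := by
    rintro rfl
    exact hab (by simpa [h2] using h.root)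
  have := (hd _ _ h1).2 ha
  have := (hd _ _ h2).2 hb
  omega

/-- Between vertices other than `v` only the pointer of `bot` is lost. By `two_cycle` the edge is
not also stored in the opposite direction. -/
theorem hasEdge_reroute (h : IsArb s t T) {below : Prop}
    (htb : top ≠ bot) (hbot : T bot = some top) {p q : V} (hp : p ≠ v) (hq : q ≠ v) :
    HasEdge (reroute T v top bot below) p q ↔
      HasEdge T p q ∧ ¬ ((p = top ∧ q = bot) ∨ (p = bot ∧ q = top)) := by
  have h2 := h.two_cycle htb.symm hbot
  unfold HasEdge
  rw [reroute_apply_of_ne hp, reroute_apply_of_ne hq]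
  by_cases hpb : p = bot
  · subst hpb
    by_cases hqb : q = p
    · subst hqb
      simp [hq.symm, htb.symm, hbot]
      exact htb
    · by_cases hqt : q = top
      · subst hqt
        simp [hq.symm, htb, h2]
      · simp [hq.symm, hqb, hqt, hbot, Ne.symm hqt]
  · by_cases hqb : q = bot
    · subst hqb
      by_cases hpt : p = top
      · subst hpt
        simp [hp.symm, htb, h2]
      · simp [hp.symm, hpb, hpt, hbot, Ne.symm hpt]
    · simp [hpb, hqb]

variable {K : Type*} [CommRing K]

/-- The indicator of the edge `pq`. -/
def edgeInd (K : Type*) [CommRing K] (p q : V) (T : V → Option V) : K :=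
  if HasEdge T p q then 1 else 0

/-- The indicator of the vertex `u`. -/
def vertInd (K : Type*) [CommRing K] (u : V) (T : V → Option V) : K :=
  if T u = none then 0 else 1

/-- The balance of the edges at `v`: the tree receives the two edges from `v` to the ends of the
removed edge, except that the edge which would close a cycle is handed back as left over. -/
theorem edgeInd_reroute_self (h : IsArb s t T) {below : Prop}
    (hbelow : below ↔ Desc T bot v) (hvt : v ≠ top) (hvb : v ≠ bot)
    (htb : top ≠ bot) (hbot : T bot = some top) {q : V} (hq : q ≠ v) :
    edgeInd K q v (reroute T v top bot below) + (if leftOver T v top below = some q then 1 else 0) =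
      edgeInd K q v T + if q = top ∨ q = bot then 1 else 0 := by
  obtain ⟨d, hd⟩ := h.depth
  have hbs : bot ≠ s := by
    rintro rfl
    exact htb (by simpa [hbot] using h.root)
  have h2 : T q = some v → T v ≠ some q := h.two_cycle hq
  classical
  unfold edgeInd HasEdge leftOver
  rw [reroute_apply_of_ne hq, reroute_self hvb]
  by_cases hv : T v = none
  · have hqv : T q ≠ some v := fun hcon => (hd _ _ hcon).1 hv
    by_cases h3 : q = bot
    · simp [h3, hv, hbot, hvt.symm]
    · by_cases h4 : q = top
      · simp [h4, hv, htb]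
        exact fun hcon => absurd hcon (by simpa [h4] using hqv)
      · simp [h3, h4, hv, hqv, Ne.symm h4]
  · obtain ⟨p, hp⟩ := Option.ne_none_iff_exists'.1 hv
    by_cases hb : below
    · have hbv := hbelow.1 hb
      have hdb : d bot < d v := by
        rcases desc_depth h.root hd hv hbv with h1 | h1
        · exact absurd h1.symm hvb
        · exact h1
      -- With `v` below `bot`, the vertex `top` is a proper ancestor of `v`, so the new edge from
      -- `v` to `top` was not present as a child edge of `v`.
      have htv : T top ≠ some v := by
        intro hcon
        have h5 : top ≠ s := by
          rintro rfl
          exact hvt (by simpa [hcon] using h.root)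
        have := (hd _ _ hcon).2 h5
        have := (hd _ _ hbot).2 hbs
        omega
      by_cases h3 : q = bot
      · subst h3
        simp [hb, hp, hbot, hvt.symm, htb.symm]
        by_cases h6 : p = q <;> simp [h6]
      · by_cases h4 : q = top
        · subst h4
          simp [hb, hp, htv, h3]
          by_cases h6 : p = q <;> simp [h6]
        · by_cases h6 : p = q
          · subst h6
            have h7 : T p ≠ some v := fun hcon => h2 hcon hp
            simp [hb, hp, h3, h4, Ne.symm h4, h7]
          · simp [hb, hp, h3, h4, Ne.symm h4, h6]
    · have hbv : ¬ Desc T bot v := fun hcon => hb (hbelow.2 hcon)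
      -- Otherwise `v` would lie below `bot`. Hence the new edge from `bot` to `v` does not
      -- duplicate the parent edge of `v`.
      have hpb : p ≠ bot := by
        rintro rfl
        exact hbv ((desc_iff_of_ne hp hvb).2 (desc_refl _ _))
      by_cases h3 : q = bot
      · subst h3
        simp [hb, hp, hbot, hvt.symm, htb, hpb]
      · by_cases h4 : q = top
        · subst h4
          simp [hb, hp, h3]
        · simp [hb, hp, h3, h4, Ne.symm h4]

theorem vertInd_reroute {below : Prop} (hbot : T bot = some top) {u : V}
    (hu : u ≠ v) : vertInd K u (reroute T v top bot below) = vertInd K u T := by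
  unfold vertInd
  rw [reroute_apply_of_ne hu]
  by_cases h : u = bot
  · simp [h, hbot]
  · simp [h]

/-- Either `v` is newly covered or an edge is left over, and never both. This exchange is what
balances coverage against demand. -/
theorem vertInd_reroute_self {below : Prop} (hvb : v ≠ bot) :
    vertInd K v (reroute T v top bot below) +
      (if leftOver T v top below = none then 0 else 1) = vertInd K v T + 1 := by
  unfold vertInd leftOver
  rw [reroute_self hvb]
  by_cases hv : T v = none
  · simp [hv]
  · by_cases hb : below <;> simp [hv, hb]

end Trees

end Stroll

/-! ### Weighted families of trees and the reversal of one splitting step -/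

namespace Stroll

set_option linter.unusedSectionVars false

section Families

variable {V K : Type*} [Fintype V] [DecidableEq V] [CommRing K] [LinearOrder K]
  [IsStrictOrderedRing K]

/-- The trees `T 0, …, T (m - 1)` with weights `w`. -/
structure Fam (V K : Type*) where
  m : ℕ
  w : ℕ → K
  T : ℕ → V → Option V

namespace Fam

/-- The weighted sum of the statistic `φ`. -/
def stat (F : Fam V K) (φ : (V → Option V) → K) : K := ∑ i ∈ Finset.range F.m, F.w i * φ (F.T i)

/-- If the weight of the `i`-th tree is more than `r`, cut it into two copies, such that the
`i`-th one has weight `r`. -/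
def carve (F : Fam V K) (i : ℕ) (r : K) : Fam V K :=
  if r < F.w i then
    ⟨F.m + 1, Function.update (Function.update F.w i r) F.m (F.w i - r),
      Function.update F.T F.m (F.T i)⟩
  else F

/-- Replace the `i`-th tree, up to the amount `r`. -/
def replace (F : Fam V K) (i : ℕ) (r : K) (T' : V → Option V) : Fam V K :=
  { F.carve i r with T := Function.update (F.carve i r).T i T' }

/-- All weights are positive and all members are trees. -/
def Good (F : Fam V K) (s t : V) : Prop := ∀ i < F.m, 0 < F.w i ∧ IsArb s t (F.T i)

variable {F : Fam V K} {i : ℕ} {s t : V}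

theorem stat_carve (hi : i < F.m) (r : K) (φ : (V → Option V) → K) :
    (F.carve i r).stat φ = F.stat φ := by
  unfold carve
  split_ifs with h
  · have e : ∀ j ∈ Finset.range F.m, Function.update (Function.update F.w i r) F.m (F.w i - r) j *
        φ (Function.update F.T F.m (F.T i) j) =
        F.w j * φ (F.T j) + if j = i then (r - F.w i) * φ (F.T i) else 0 := by
      intro j hj
      have hj' : j ≠ F.m := (Finset.mem_range.1 hj).ne
      by_cases hji : j = i
      · subst hji
        simp [hj']; ring
      · simp [hj', hji]
    simp only [stat]
    rw [Finset.sum_range_succ, Finset.sum_congr rfl e, Finset.sum_add_distrib]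
    simp [hi]
    ring
  · rfl

theorem carve_w (hi : i < F.m) (r : K) : (F.carve i r).w i = min r (F.w i) := by
  unfold carve
  split_ifs with h
  · simp [hi.ne, h.le]
  · simp [not_lt.1 h]

theorem carve_T (hi : i < F.m) (r : K) : (F.carve i r).T i = F.T i := by
  unfold carve
  split_ifs with h
  · simp [hi.ne]
  · rfl

theorem le_carve_m (r : K) : F.m ≤ (F.carve i r).m := by
  unfold carve
  split_ifs with h <;> simp

/-- Carving changes no statistic, and afterwards the `i`-th weight is `min r (F.w i)`; only this
tree is then exchanged. -/
theorem stat_replace (hi : i < F.m) (r : K) (T' : V → Option V) (φ : (V → Option V) → K) :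
    (F.replace i r T').stat φ = F.stat φ + min r (F.w i) * (φ T' - φ (F.T i)) := by
  rw [← stat_carve hi r φ, ← carve_w hi r, ← carve_T hi r]
  have e : ∀ j ∈ Finset.range (F.carve i r).m,
      (F.carve i r).w j * φ (Function.update (F.carve i r).T i T' j) =
      (F.carve i r).w j * φ ((F.carve i r).T j) +
        if j = i then (F.carve i r).w i * (φ T' - φ ((F.carve i r).T i)) else 0 := by
    intro j _
    by_cases hji : j = i
    · subst hji
      simp; ring
    · simp [hji]
  simp only [stat, replace]
  rw [Finset.sum_congr rfl e, Finset.sum_add_distrib]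
  simp [lt_of_lt_of_le hi (le_carve_m r)]

theorem replace_m_le (r : K) (T' : V → Option V) : (F.replace i r T').m ≤ F.m + 1 := by
  simp only [replace, carve]
  split_ifs <;> simp

/-- A tree that is used up completely is replaced in place. The family therefore grows only when the
required amount is exhausted within a tree. -/
theorem replace_of_le {r : K} (h : F.w i ≤ r) (T' : V → Option V) :
    F.replace i r T' = { F with T := Function.update F.T i T' } := by
  simp [replace, carve, not_lt.2 h]

theorem Good.replace (hF : F.Good s t) (hi : i < F.m) {r : K} (hr : 0 < r) {T' : V → Option V}
    (hT : IsArb s t T') : (F.replace i r T').Good s t := by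
  intro j hj
  by_cases h : r < F.w i
  · simp only [Fam.replace, carve, if_pos h] at hj ⊢
    by_cases hji : j = i
    · subst hji
      simp [hi.ne, hr, hT]
    · by_cases hjm : j = F.m
      · subst hjm
        simp [hji, h, (hF i hi).2]
      · have := hF j (by omega)
        simpa [hji, hjm] using this
  · rw [replace_of_le (not_lt.1 h)] at hj ⊢
    have := hF j hj
    by_cases hji : j = i
    · subst hji
      simpa [hT] using this.1
    · simpa [hji] using this

theorem Good.stat_pos (hF : F.Good s t) (hi : i < F.m) {φ : (V → Option V) → K}
    (h0 : ∀ T, 0 ≤ φ T) (h1 : 0 < φ (F.T i)) : 0 < F.stat φ :=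
  Finset.sum_pos' (fun j hj => mul_nonneg (hF j (Finset.mem_range.1 hj)).1.le (h0 _))
    ⟨i, Finset.mem_range.2 hi, mul_pos (hF i hi).1 h1⟩

end Fam

theorem edgeInd_nonneg (p q : V) (T : V → Option V) : 0 ≤ edgeInd K p q T := by
  unfold edgeInd
  split_ifs <;> simp

theorem vertInd_nonneg (p : V) (T : V → Option V) : 0 ≤ vertInd K p T := by
  unfold vertInd
  split_ifs <;> simp

/-- The state of the reversal of a splitting step: the family, the amount of the edge `ab` that
still has to be replaced, and the amounts of edges at `v` that still have to be attached. -/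
structure Undo (V K : Type*) where
  F : Fam V K
  rem : K
  dem : V → K

/-- `v` lies below `bot`. -/
def Below (T : V → Option V) (v bot : V) : Prop :=
  ∃ j < Fintype.card V, (up T)^[j] v = bot

theorem below_iff (T : V → Option V) (v bot : V) : Below T v bot ↔ Desc T bot v :=
  ⟨fun ⟨j, _, h⟩ => ⟨j, h⟩, fun ⟨_, h⟩ => exists_iterate_lt_card _ h⟩

/-- The upper end of the edge `ab`. -/
def topEnd (T : V → Option V) (a b : V) : V := if T b = some a then a else b

/-- The lower end of the edge `ab`. -/
def botEnd (T : V → Option V) (a b : V) : V := if T b = some a then b else a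

/-- The tree `T` with `v` inserted in its edge `ab`. -/
noncomputable def insertTree (T : V → Option V) (a b v : V) : V → Option V :=
  reroute T v (topEnd T a b) (botEnd T a b) (Below T v (botEnd T a b))

/-- The other end of the edge at `v` that `insertTree` leaves out. -/
noncomputable def insertLeft (T : V → Option V) (a b v : V) : Option V :=
  leftOver T v (topEnd T a b) (Below T v (botEnd T a b))

section Insert

variable {s t a b v : V} {T : V → Option V}

theorem ends_cases (h : HasEdge T a b) :
    (topEnd T a b = a ∧ botEnd T a b = b ∧ T b = some a) ∨
      (topEnd T a b = b ∧ botEnd T a b = a ∧ T a = some b) := by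
  rcases em (T b = some a) with h1 | h1
  · exact Or.inl ⟨by simp [topEnd, h1], by simp [botEnd, h1], h1⟩
  · exact Or.inr ⟨by simp [topEnd, h1], by simp [botEnd, h1], h.resolve_right h1⟩

theorem ends_spec (h : HasEdge T a b) (hab : a ≠ b) (hav : a ≠ v) (hbv : b ≠ v) :
    T (botEnd T a b) = some (topEnd T a b) ∧ topEnd T a b ≠ botEnd T a b ∧ v ≠ topEnd T a b ∧
      v ≠ botEnd T a b := by
  rcases ends_cases h with ⟨h1, h2, h3⟩ | ⟨h1, h2, h3⟩ <;> rw [h1, h2]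
  exacts [⟨h3, hab, hav.symm, hbv.symm⟩, ⟨h3, hab.symm, hbv.symm, hav.symm⟩]

theorem IsArb.insertTree (hT : IsArb s t T) (h : HasEdge T a b) (hab : a ≠ b) (hav : a ≠ v)
    (hbv : b ≠ v) (hvs : v ≠ s) : IsArb s t (insertTree T a b v) := by
  obtain ⟨h1, h2, h3, h4⟩ := ends_spec h hab hav hbv
  exact hT.reroute (below_iff T v _) hvs h3 h4 h2 h1

theorem hasEdge_insertTree (hT : IsArb s t T) (h : HasEdge T a b) (hab : a ≠ b) (hav : a ≠ v)
    (hbv : b ≠ v) {p q : V} (hp : p ≠ v) (hq : q ≠ v) : HasEdge (insertTree T a b v) p q ↔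
      HasEdge T p q ∧ ¬ ((p = a ∧ q = b) ∨ (p = b ∧ q = a)) := by
  obtain ⟨h1, h2, h3, h4⟩ := ends_spec h hab hav hbv
  unfold insertTree
  rw [hasEdge_reroute hT h2 h1 hp hq]
  rcases ends_cases h with ⟨e1, e2, -⟩ | ⟨e1, e2, -⟩ <;> rw [e1, e2]
  rw [or_comm (a := p = a ∧ q = b)]

theorem edgeInd_insertTree (hT : IsArb s t T) (h : HasEdge T a b) (hab : a ≠ b) (hav : a ≠ v)
    (hbv : b ≠ v) {p q : V} (hp : p ≠ v) (hq : q ≠ v) :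
    edgeInd K p q (insertTree T a b v) - edgeInd K p q T =
        - if (p = a ∧ q = b) ∨ (p = b ∧ q = a) then 1 else 0 := by
  have h2 := hasEdge_insertTree hT h hab hav hbv hp hq
  unfold edgeInd
  by_cases h4 : (p = a ∧ q = b) ∨ (p = b ∧ q = a)
  · have h5 : HasEdge T p q := by
      rcases h4 with ⟨rfl, rfl⟩ | ⟨rfl, rfl⟩
      · exact h
      · exact h.symm
    have h6 : ¬ HasEdge (insertTree T a b v) p q := fun hcon => (h2.1 hcon).2 h4
    rw [if_neg h6, if_pos h5, if_pos h4]
    ring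
  · have h5 : HasEdge (insertTree T a b v) p q ↔ HasEdge T p q := by tauto
    simp only [h5, h4, if_false]
    ring

theorem edgeInd_insertTree_self (hT : IsArb s t T) (h : HasEdge T a b) (hab : a ≠ b)
    (hav : a ≠ v) (hbv : b ≠ v) {q : V} (hq : q ≠ v) :
    edgeInd K q v (insertTree T a b v) + (if insertLeft T a b v = some q then 1 else 0) =
      edgeInd K q v T + if q = a ∨ q = b then 1 else 0 := by
  obtain ⟨h1, h2, h3, h4⟩ := ends_spec h hab hav hbv
  unfold insertTree insertLeft
  have := edgeInd_reroute_self (K := K) hT (below_iff T v _) h3 h4 h2 h1 hq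
  have hor : (q = topEnd T a b ∨ q = botEnd T a b) ↔ (q = a ∨ q = b) := by
    rcases ends_cases h with ⟨e1, e2, -⟩ | ⟨e1, e2, -⟩ <;> rw [e1, e2]
    rw [or_comm]
  simp only [hor] at this
  exact this

/-- A demand only arises at a vertex of some tree of positive weight. Thus a vertex with a demand
has positive coverage, which the comparison of degrees later requires. -/
theorem insertLeft_mem (hT : IsArb s t T) (h : HasEdge T a b) (hab : a ≠ b) (hav : a ≠ v)
    (hbv : b ≠ v) (hvs : v ≠ s) {q : V} (hq : insertLeft T a b v = some q) :
    q ≠ v ∧ T q ≠ none := by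
  obtain ⟨h1, h2, h3, h4⟩ := ends_spec h hab hav hbv
  obtain ⟨d, hd⟩ := hT.depth
  unfold insertLeft leftOver at hq
  split_ifs at hq
  · obtain rfl : topEnd T a b = q := by simpa using hq
    exact ⟨h3.symm, (hd _ _ h1).1⟩
  · refine ⟨?_, (hd _ _ hq).1⟩
    rintro rfl
    exact absurd ((hd _ _ hq).2 hvs) (lt_irrefl _)

end Insert

/-- Replace the edge `ab` of the `i`-th tree. -/
noncomputable def Undo.insertStep (a b v : V) (i : ℕ) (u : Undo V K) : Undo V K :=
  if i < u.F.m ∧ 0 < u.rem ∧ HasEdge (u.F.T i) a b then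
    { F := u.F.replace i u.rem (insertTree (u.F.T i) a b v)
      rem := u.rem - min u.rem (u.F.w i)
      dem := fun q => u.dem q +
        if insertLeft (u.F.T i) a b v = some q then min u.rem (u.F.w i) else 0 }
  else u

/-- Attach `v` to the vertex `p` of the `i`-th tree. -/
def Undo.attachStep (v p : V) (i : ℕ) (u : Undo V K) : Undo V K :=
  if i < u.F.m ∧ 0 < u.dem p ∧ u.F.T i p ≠ none ∧ u.F.T i v = none then
    { u with
      F := u.F.replace i (u.dem p) (Function.update (u.F.T i) v (some p))
      dem := Function.update u.dem p (u.dem p - min (u.dem p) (u.F.w i)) }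
  else u

/-- What is kept while the splitting step `(v, a, b, ε)` is reversed, where `E`, `C` and `W` are the
edge weights, the coverage and the total weight at the start. -/
structure UndoInv (s t a b v : V) (E : V → V → K) (C : V → K) (W ε : K) (u : Undo V K) : Prop where
  good : u.F.Good s t
  rem_nonneg : 0 ≤ u.rem
  dem_nonneg : ∀ q, 0 ≤ u.dem q
  edge : ∀ p q, p ≠ q → p ≠ v → q ≠ v → u.F.stat (edgeInd K p q) =
    E p q - if (p = a ∧ q = b) ∨ (p = b ∧ q = a) then ε - u.rem else 0
  edge_self : ∀ q, q ≠ v → u.F.stat (edgeInd K q v) + u.dem q =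
    E q v + if q = a ∨ q = b then ε - u.rem else 0
  vert : ∀ q, q ≠ v → u.F.stat (vertInd K q) = C q
  vert_self : u.F.stat (vertInd K v) + ∑ q, u.dem q = C v + (ε - u.rem)
  total : u.F.stat (fun _ => 1) = W
  dem_pos : ∀ q, 0 < u.dem q → q ≠ v ∧ 0 < C q

variable {s t a b v : V} {E : V → V → K} {C : V → K} {W ε : K} {u : Undo V K}

/-- Every equation of the invariant is the corresponding balance for a single tree, multiplied by
the replaced amount `min u.rem (u.F.w i)`. -/
theorem UndoInv.insertStep (h : UndoInv s t a b v E C W ε u) (hab : a ≠ b) (hav : a ≠ v)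
    (hbv : b ≠ v) (hvs : v ≠ s) (i : ℕ) : UndoInv s t a b v E C W ε (u.insertStep a b v i) := by
  unfold Undo.insertStep
  split_ifs with hc
  swap
  · exact h
  obtain ⟨hi, hrem, hedge⟩ := hc
  obtain ⟨hw, hT⟩ := h.good i hi
  have hm : 0 < min u.rem (u.F.w i) := lt_min hrem hw
  have hrw := Fam.stat_replace hi u.rem (insertTree (u.F.T i) a b v)
  refine ⟨h.good.replace hi hrem (hT.insertTree hedge hab hav hbv hvs), ?_, ?_, ?_, ?_, ?_, ?_,
    ?_, ?_⟩
  · simp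
  · intro q
    have := h.dem_nonneg q
    dsimp only
    split_ifs <;> linarith
  · intro p q hpq hpv hqv
    dsimp only
    rw [hrw, h.edge p q hpq hpv hqv, edgeInd_insertTree hT hedge hab hav hbv hpv hqv]
    split_ifs <;> ring
  · intro q hqv
    have h1 := h.edge_self q hqv
    have h2 := edgeInd_insertTree_self (K := K) hT hedge hab hav hbv hqv
    dsimp only
    rw [hrw]
    generalize min u.rem (u.F.w i) = w
    have h3 : (if insertLeft (u.F.T i) a b v = some q then w else 0) =
      w * if insertLeft (u.F.T i) a b v = some q then 1 else 0 := by simp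
    have h4 : (if q = a ∨ q = b then ε - (u.rem - w) else 0) =
      (if q = a ∨ q = b then ε - u.rem else 0) + w * if q = a ∨ q = b then 1 else 0 := by
      split_ifs <;> ring
    rw [h3, h4]
    linear_combination h1 + w * h2
  · intro q hqv
    dsimp only
    rw [hrw, h.vert q hqv, insertTree, vertInd_reroute (ends_spec hedge hab hav hbv).1 hqv]
    ring
  · have h1 := h.vert_self
    have h2 : vertInd K v (insertTree (u.F.T i) a b v) +
        (if insertLeft (u.F.T i) a b v = none then 0 else 1) = vertInd K v (u.F.T i) + 1 := by
      exact vertInd_reroute_self (K := K) (ends_spec hedge hab hav hbv).2.2.2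
    dsimp only
    rw [hrw, Finset.sum_add_distrib]
    generalize min u.rem (u.F.w i) = w
    have h3 : (∑ q, if insertLeft (u.F.T i) a b v = some q then w else 0) =
        w * if insertLeft (u.F.T i) a b v = none then 0 else 1 := by
      cases insertLeft (u.F.T i) a b v <;> simp
    rw [h3]
    linear_combination h1 + w * h2
  · dsimp only
    rw [hrw, h.total]
    ring
  · intro q hq
    dsimp only at hq
    by_cases h1 : insertLeft (u.F.T i) a b v = some q
    · obtain ⟨h2, h3⟩ := insertLeft_mem hT hedge hab hav hbv hvs h1
      refine ⟨h2, ?_⟩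
      rw [← h.vert q h2]
      exact h.good.stat_pos hi (vertInd_nonneg q) (by simp [vertInd, h3])
    · rw [if_neg h1, add_zero] at hq
      exact h.dem_pos q hq

theorem UndoInv.attachStep (h : UndoInv s t a b v E C W ε u) (p : V) (i : ℕ) :
    UndoInv s t a b v E C W ε (u.attachStep v p i) := by
  unfold Undo.attachStep
  split_ifs with hc
  swap
  · exact h
  obtain ⟨hi, hrem, hp, hv⟩ := hc
  obtain ⟨hw, hT⟩ := h.good i hi
  obtain ⟨d, hd⟩ := hT.depth
  set T := u.F.T i with hTdef
  have hpv : p ≠ v := by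
    rintro rfl
    exact hp hv
  set T' := Function.update T v (some p) with hT'
  have hrw : ∀ φ, (u.F.replace i (u.dem p) T').stat φ = u.F.stat φ + min (u.dem p) (u.F.w i) *
    (φ T' - φ T) := Fam.stat_replace hi (u.dem p) T'
  set w := min (u.dem p) (u.F.w i) with hwdef
  -- `v` is not in the tree, so nobody points to it. The edge to `p` is the only edge at `v`
  -- afterwards.
  have hqv' : ∀ q, T q ≠ some v := fun q hcon => (hd _ _ hcon).1 hv
  refine ⟨h.good.replace hi hrem (hT.attach hp hv), h.rem_nonneg, ?_, ?_, ?_, ?_, ?_, ?_, ?_⟩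
  · intro q
    have := h.dem_nonneg q
    by_cases hq : q = p
    · simp [hq, hwdef]
    · simpa [hq] using this
  · intro p' q hpq hpv hqv
    dsimp only
    rw [hrw, h.edge p' q hpq hpv hqv]
    have : edgeInd K p' q T' = edgeInd K p' q T := by
      simp [edgeInd, hT', HasEdge, hpv, hqv]
    rw [this]
    ring
  · intro q hqv
    have h1 := h.edge_self q hqv
    dsimp only
    rw [hrw]
    have h2 : edgeInd K q v T' = if q = p then 1 else 0 := by
      simp [edgeInd, hT', HasEdge, hqv, hqv', eq_comm]
    have h3 : edgeInd K q v T = 0 := by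
      simp [edgeInd, HasEdge, hqv', hv]
    rw [h2, h3, ← h1]
    by_cases hq : q = p
    · subst hq; simp
    · simp [hq]
  · intro q hqv
    dsimp only
    rw [hrw, h.vert q hqv]
    have : vertInd K q T' = vertInd K q T := by simp [vertInd, hT', hqv]
    rw [this]
    ring
  · have h1 := h.vert_self
    dsimp only
    rw [hrw, ← h1]
    have h2 : vertInd K v T' = 1 := by simp [vertInd, hT']
    have h3 : vertInd K v T = 0 := by simp [vertInd, hv]
    rw [h2, h3, Finset.sum_update_of_mem (Finset.mem_univ p),
      ← Finset.add_sum_erase _ _ (Finset.mem_univ p), Finset.sdiff_singleton_eq_erase]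
    ring
  · dsimp only
    rw [hrw, h.total]
    ring
  · intro q hq
    by_cases hqp : q = p
    · subst hqp
      exact h.dem_pos q hrem
    · simp only [Function.update_of_ne hqp] at hq
      exact h.dem_pos q hq

/-- As long as an amount remains, every treated tree was used up entirely. The number of trees is
then unchanged and no treated tree contains `ab` any more. Only the replacement that exhausts the
amount can add a tree. -/
theorem UndoInv.insert_iter (h : UndoInv s t a b v E C W ε u) (hab : a ≠ b) (hav : a ≠ v)
    (hbv : b ≠ v) (hvs : v ≠ s) (j : ℕ) :
    UndoInv s t a b v E C W ε (iter (Undo.insertStep a b v) j u) ∧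
    (iter (Undo.insertStep a b v) j u).F.m ≤ u.F.m + 1 ∧
    (0 < (iter (Undo.insertStep a b v) j u).rem →
      (iter (Undo.insertStep a b v) j u).F.m = u.F.m ∧
      ∀ i < j, i < u.F.m → ¬ HasEdge ((iter (Undo.insertStep a b v) j u).F.T i) a b) := by
  induction j with
  | zero => exact ⟨h, by simp [iter], fun _ => ⟨rfl, by simp⟩⟩
  | succ j ih =>
    simp only [iter]
    set u' := iter (Undo.insertStep a b v) j u with hu'
    obtain ⟨h1, h2, h3⟩ := ih
    refine ⟨h1.insertStep hab hav hbv hvs j, ?_, ?_⟩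
    · unfold Undo.insertStep
      split_ifs with hc
      · have := Fam.replace_m_le (F := u'.F) (i := j) u'.rem (insertTree (u'.F.T j) a b v)
        have h4 := (h3 hc.2.1).1
        dsimp only
        omega
      · exact h2
    · unfold Undo.insertStep
      split_ifs with hc
      · intro hpos
        obtain ⟨hj, hrem, hedge⟩ := hc
        obtain ⟨h4, h5⟩ := h3 hrem
        have hle : u'.F.w j ≤ u'.rem := by
          by_contra hcon
          have : min u'.rem (u'.F.w j) = u'.rem := min_eq_left (not_le.1 hcon).le
          simp [this] at hpos
        dsimp only
        rw [Fam.replace_of_le hle]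
        refine ⟨h4, fun i hi him => ?_⟩
        dsimp only
        by_cases hij : i = j
        · subst hij
          have hT := (h1.good i hj).2
          rw [Function.update_self]
          rw [hasEdge_insertTree hT hedge hab hav hbv hav hbv]
          simp
        · rw [Function.update_of_ne hij]
          exact h5 i (by omega) him
      · intro hpos
        obtain ⟨h4, h5⟩ := h3 hpos
        refine ⟨h4, fun i hi him => ?_⟩
        by_cases hij : i = j
        · subst hij
          exact fun hcon => hc ⟨by omega, hpos, hcon⟩
        · exact h5 i (by omega) him

/-- If an amount remained after all trees were treated, none of them would contain `ab`, although
the invariant leaves `ab` with the weight `E a b - (ε - rem)`, which would be positive. -/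
theorem UndoInv.insert_rem (h : UndoInv s t a b v E C W ε u) (hab : a ≠ b) (hav : a ≠ v)
    (hbv : b ≠ v) (hvs : v ≠ s) (hε : ε ≤ E a b) {N : ℕ} (hN : u.F.m ≤ N) :
    (iter (Undo.insertStep a b v) N u).rem = 0 := by
  obtain ⟨h1, -, h3⟩ := h.insert_iter hab hav hbv hvs N
  by_contra hne
  have hpos := lt_of_le_of_ne h1.rem_nonneg (Ne.symm hne)
  obtain ⟨h4, h5⟩ := h3 hpos
  have h6 := h1.edge a b hab hav hbv
  have h7 : (iter (Undo.insertStep a b v) N u).F.stat (edgeInd K a b) = 0 := by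
    refine Finset.sum_eq_zero fun i hi => ?_
    have hi' : i < u.F.m := by rw [← h4]; exact Finset.mem_range.1 hi
    simp [edgeInd, h5 i (lt_of_lt_of_le hi' hN) hi']
  rw [h7] at h6
  simp at h6
  linarith

/-- As for insertion: an unmet demand means that every treated tree was used up, so none of them
contains `p` without containing `v`. -/
theorem UndoInv.attach_iter (h : UndoInv s t a b v E C W ε u) (p : V) (j : ℕ) :
    UndoInv s t a b v E C W ε (iter (Undo.attachStep v p) j u) ∧
    (iter (Undo.attachStep v p) j u).F.m ≤ u.F.m + 1 ∧
    (iter (Undo.attachStep v p) j u).rem = u.rem ∧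
    (∀ q, q ≠ p → (iter (Undo.attachStep v p) j u).dem q = u.dem q) ∧
    (0 < (iter (Undo.attachStep v p) j u).dem p →
      (iter (Undo.attachStep v p) j u).F.m = u.F.m ∧
      ∀ i < j, i < u.F.m → ¬ ((iter (Undo.attachStep v p) j u).F.T i p ≠ none ∧
        (iter (Undo.attachStep v p) j u).F.T i v = none)) := by
  induction j with
  | zero => exact ⟨h, by simp [iter], rfl, fun _ _ => rfl, fun _ => ⟨rfl, by simp⟩⟩
  | succ j ih =>
    simp only [iter]
    set u' := iter (Undo.attachStep v p) j u with hu'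
    obtain ⟨h1, h2, hr, hd, h3⟩ := ih
    refine ⟨h1.attachStep p j, ?_, ?_, ?_, ?_⟩
    · unfold Undo.attachStep
      split_ifs with hc
      · have := Fam.replace_m_le (F := u'.F) (i := j) (u'.dem p)
          (Function.update (u'.F.T j) v (some p))
        have h4 := (h3 hc.2.1).1
        dsimp only
        omega
      · exact h2
    · unfold Undo.attachStep
      split_ifs with hc <;> exact hr
    · intro q hq
      unfold Undo.attachStep
      split_ifs with hc
      · simp [hq, hd q hq]
      · exact hd q hq
    · unfold Undo.attachStep
      split_ifs with hc
      · intro hpos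
        obtain ⟨hj, hrem, hp, hv⟩ := hc
        obtain ⟨h4, h5⟩ := h3 hrem
        have hle : u'.F.w j ≤ u'.dem p := by
          by_contra hcon
          have : min (u'.dem p) (u'.F.w j) = u'.dem p := min_eq_left (not_le.1 hcon).le
          simp [this] at hpos
        dsimp only
        rw [Fam.replace_of_le hle]
        refine ⟨h4, fun i hi him => ?_⟩
        dsimp only
        by_cases hij : i = j
        · subst hij
          simp
        · rw [Function.update_of_ne hij]
          exact h5 i (by omega) him
      · intro hpos
        obtain ⟨h4, h5⟩ := h3 hpos
        refine ⟨h4, fun i hi him => ?_⟩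
        by_cases hij : i = j
        · subst hij
          exact fun hcon => hc ⟨by omega, hpos, hcon⟩
        · exact h5 i (by omega) him

/-- If a demand at `p` remained, every tree through `p` would pass through `v`, so the coverage of
`p` would be at most that of `v`. But coverage of `v` plus all demands equals `C v + ε ≤ C p`, a
contradiction. -/
theorem UndoInv.attach_dem (h : UndoInv s t a b v E C W ε u) (hrem : u.rem = 0)
    (hC : ∀ p, p ≠ v → 0 < C p → C v + ε ≤ C p) (p : V) {N : ℕ} (hN : u.F.m ≤ N) :
    (iter (Undo.attachStep v p) N u).dem p = 0 := by
  obtain ⟨h1, -, hr, hd, h3⟩ := h.attach_iter p N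
  set u' := iter (Undo.attachStep v p) N u with hu'
  by_contra hne
  have hpos := lt_of_le_of_ne (h1.dem_nonneg p) (Ne.symm hne)
  obtain ⟨h4, h5⟩ := h3 hpos
  obtain ⟨hpv, hCp⟩ := h1.dem_pos p hpos
  have h6 := hC p hpv hCp
  have h7 := h1.vert_self
  have h8 := h1.vert p hpv
  have h9 : u'.F.stat (vertInd K p) ≤ u'.F.stat (vertInd K v) := by
    refine Finset.sum_le_sum fun i hi => ?_
    have hi' : i < u.F.m := by rw [← h4]; exact Finset.mem_range.1 hi
    refine mul_le_mul_of_nonneg_left ?_ (h1.good i (Finset.mem_range.1 hi)).1.le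
    have := h5 i (lt_of_lt_of_le hi' hN) hi'
    unfold vertInd
    by_cases e1 : u'.F.T i p = none <;> by_cases e2 : u'.F.T i v = none <;> simp_all
  have h10 : u'.dem p ≤ ∑ q, u'.dem q :=
    Finset.single_le_sum (fun q _ => h1.dem_nonneg q) (Finset.mem_univ p)
  rw [hr, hrem] at h7
  linarith

end Families

end Stroll

/-! ### Decompositions of feasible matrices -/

namespace Stroll

set_option linter.unusedSectionVars false

section Decompose

variable {V K : Type*} [Fintype V] [DecidableEq V] [CommRing K] [LinearOrder K]
  [IsStrictOrderedRing K]

/-- The weight matrix of the auxiliary edge `st`. -/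
def auxEdge (s t : V) (W : K) (p q : V) : K := if (p = s ∧ q = t) ∨ (p = t ∧ q = s) then W else 0

theorem auxEdge_symm (s t : V) (W : K) (p q : V) : auxEdge s t W p q = auxEdge s t W q p := by
  unfold auxEdge
  congr 1
  simp only [eq_iff_iff]
  tauto

theorem auxEdge_eq_zero {s t v : V} (hvs : v ≠ s) (hvt : v ≠ t) (W : K) (q : V) :
    auxEdge s t W v q = 0 := by
  simp [auxEdge, hvs, hvt]

/-- `F` decomposes `X` without the auxiliary edge. -/
structure Decomposes (s t : V) (W : K) (X : V → V → K) (F : Fam V K) : Prop where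
  good : F.Good s t
  total : F.stat (fun _ => 1) = W
  edge : ∀ p q, p ≠ q → F.stat (edgeInd K p q) = X p q - auxEdge s t W p q
  vert : ∀ u, u ≠ s → u ≠ t → 2 * F.stat (vertInd K u) = wdeg X u

/-- The point of the process at which splitting off at `v` takes place. -/
structure Ready (s t : V) (W : K) (X : V → V → K) (v : V) : Prop where
  feasible : Feasible X s t
  wdeg_source : wdeg X s = 2 * W
  le_aux : ∀ p q, auxEdge s t W p q ≤ X p q
  ne_source : v ≠ s
  ne_target : v ≠ t
  le_wdeg : ∀ p, 0 < wdeg X p → wdeg X v ≤ wdeg X p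

/-- One splitting step, at `va` and `vb` by the amount `ε`. -/
structure Rec (V K : Type*) where
  v : V
  a : V
  b : V
  ε : K

/-- `X'` arises from `X` by the splitting step `r`. -/
structure SplitStep (s t : V) (W : K) (X : V → V → K) (r : Rec V K) (X' : V → V → K) : Prop where
  ready : Ready s t W X r.v
  ne_a : r.a ≠ r.v
  ne_b : r.b ≠ r.v
  ne : r.a ≠ r.b
  nonneg : 0 ≤ r.ε
  eq : X' = splitOff X r.v r.a r.b r.ε

/-- A sequence of splitting steps. -/
inductive Chain (s t : V) (W : K) (X : V → V → K) : List (Rec V K) → (V → V → K) → Prop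
  | nil : Chain s t W X [] X
  | snoc {l : List (Rec V K)} {r : Rec V K} {X' X'' : V → V → K} :
      Chain s t W X l X' → SplitStep s t W X' r X'' → Chain s t W X (l ++ [r]) X''

variable {s t v a b : V} {W ε : K} {X X' : V → V → K}

theorem splitOff_apply_of_ne (X : V → V → K) (a b : V) (ε : K) {p q : V} (hp : p ≠ v)
    (hq : q ≠ v) : splitOff X v a b ε p q = X p q + (if p = a ∧ q = b then ε else 0) +
      if p = b ∧ q = a then ε else 0 := by
  simp [splitOff, bump, hp, hq]

theorem Ready.splitOff (h : Ready s t W X v) (hva : a ≠ v) (hvb : b ≠ v)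
    (hε : 0 ≤ ε) (hf : Feasible (splitOff X v a b ε) s t) : Ready s t W (splitOff X v a b ε) v where
  feasible := hf
  wdeg_source := by
    rw [wdeg_splitOff X hva hvb, if_neg h.ne_source.symm, sub_zero, h.wdeg_source]
  le_aux p q := by
    by_cases hp : p = v
    · rw [hp, auxEdge_eq_zero h.ne_source h.ne_target]
      exact hf.nonneg _ _
    · by_cases hq : q = v
      · rw [hq, auxEdge_symm, auxEdge_eq_zero h.ne_source h.ne_target]
        exact hf.nonneg _ _
      · rw [splitOff_apply_of_ne X a b ε hp hq]
        have := h.le_aux p q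
        have h1 : 0 ≤ if p = a ∧ q = b then ε else 0 := by split_ifs <;> simp [hε]
        have h2 : 0 ≤ if p = b ∧ q = a then ε else 0 := by split_ifs <;> simp [hε]
        linarith
  ne_source := h.ne_source
  ne_target := h.ne_target
  le_wdeg p hp := by
    rw [wdeg_splitOff X hva hvb] at hp ⊢
    rw [wdeg_splitOff X hva hvb]
    by_cases hpv : p = v
    · simp [hpv]
    · have := h.le_wdeg p (by simpa [hpv] using hp)
      simp [hpv]
      linarith

theorem edgeInd_comm (p q : V) (T : V → Option V) : edgeInd K p q T = edgeInd K q p T := by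
  simp only [edgeInd, or_comm]

theorem Fam.stat_vertInd {F : Fam V K} {u : V}
    (hu : ∀ i < F.m, F.T i u ≠ none) : F.stat (vertInd K u) = F.stat (fun _ => 1) := by
  refine Finset.sum_congr rfl fun i hi => ?_
  rw [vertInd, if_neg (hu i (Finset.mem_range.1 hi))]

/-- The start of the reversal of a splitting step. -/
def Undo.start (F : Fam V K) (ε : K) : Undo V K := ⟨F, ε, fun _ => 0⟩

theorem Decomposes.undoInv {F : Fam V K} (h : Decomposes s t W X F) (hε : 0 ≤ ε) :
    UndoInv s t a b v (fun p q => F.stat (edgeInd K p q)) (fun q => F.stat (vertInd K q)) W ε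
      (Undo.start F ε) :=
  ⟨h.good, hε, fun _ => le_rfl, by simp [Undo.start], by simp [Undo.start], by simp [Undo.start],
    by simp [Undo.start], h.total, by simp [Undo.start]⟩

/-- Before the step `ab` weighed at least as much as the auxiliary edge, and the step added `ε`; so
trees of total weight at least `ε` contain `ab`. -/
theorem SplitStep.le_edge {r : Rec V K} (hr : SplitStep s t W X r X') {F : Fam V K}
    (h : Decomposes s t W X' F) : r.ε ≤ F.stat (edgeInd K r.a r.b) := by
  rw [h.edge _ _ hr.ne, hr.eq, splitOff_apply_of_ne _ _ _ _ hr.ne_a hr.ne_b]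
  have := hr.ready.le_aux r.a r.b
  simp [hr.ne]
  linarith

/-- Twice the left side is the degree of `v` before the step, the least positive one. For `p` other
than `s` and `t`, twice the right side is the degree of `p`, which the step does not change. -/
theorem SplitStep.vert_le {r : Rec V K} (hr : SplitStep s t W X r X') {F : Fam V K}
    (h : Decomposes s t W X' F) (p : V) (hp : p ≠ r.v) (hpos : 0 < F.stat (vertInd K p)) :
    F.stat (vertInd K r.v) + r.ε ≤ F.stat (vertInd K p) := by
  have h1 := h.vert r.v hr.ready.ne_source hr.ready.ne_target
  rw [hr.eq, wdeg_splitOff _ hr.ne_a hr.ne_b, if_pos rfl] at h1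
  have h2 : wdeg X r.v ≤ 2 * F.stat (vertInd K p) := by
    -- `s` and `t` lie in every tree, so their coverage is `W`, half the largest degree.
    have hW : wdeg X r.v ≤ 2 * W :=
      (hr.ready.feasible.wdeg_le_source _).trans hr.ready.wdeg_source.le
    by_cases hps : p = s
    · rw [hps, Fam.stat_vertInd fun i hi => by simp [(h.good i hi).2.root], h.total]
      exact hW
    · by_cases hpt : p = t
      · rw [hpt, Fam.stat_vertInd fun i hi => (h.good i hi).2.target, h.total]
        exact hW
      · have h3 := h.vert p hps hpt
        rw [hr.eq, wdeg_splitOff _ hr.ne_a hr.ne_b, if_neg hp, sub_zero] at h3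
        rw [h3]
        exact hr.ready.le_wdeg p (by linarith)
  linarith

theorem UndoInv.decomposes {r : Rec V K} (hr : SplitStep s t W X r X') {F : Fam V K}
    (h : Decomposes s t W X' F) {u : Undo V K} (hu : UndoInv s t r.a r.b r.v
      (fun p q => F.stat (edgeInd K p q)) (fun q => F.stat (vertInd K q)) W r.ε u)
    (hrem : u.rem = 0) (hdem : ∀ q, u.dem q = 0) : Decomposes s t W X u.F := by
  have hself : ∀ q, q ≠ r.v → u.F.stat (edgeInd K q r.v) = X q r.v - auxEdge s t W q r.v := by
    intro q hq
    have h1 := hu.edge_self q hq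
    rw [hdem, hrem, h.edge q r.v hq, hr.eq, splitOff_symm hr.ready.feasible.symm,
      splitOff_apply_left _ hr.ne_a hr.ne_b, hr.ready.feasible.symm r.v q] at h1
    rw [add_zero] at h1
    rw [h1]
    by_cases h2 : q = r.a
    · simp [h2, hr.ne]
      ring
    · by_cases h3 : q = r.b
      · simp [h3, hr.ne.symm]
        ring
      · simp [h2, h3]
  refine ⟨hu.good, hu.total, fun p q hpq => ?_, fun q hqs hqt => ?_⟩
  · by_cases hq : q = r.v
    · rw [hq]
      exact hself p (hq ▸ hpq)
    · by_cases hp : p = r.v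
      · have := hself q hq
        rw [hp, hr.ready.feasible.symm, auxEdge_symm, ← this]
        exact Finset.sum_congr rfl fun i _ => by rw [edgeInd_comm]
      · rw [hu.edge p q hpq hp hq, h.edge p q hpq, hr.eq, splitOff_apply_of_ne _ _ _ _ hp hq, hrem]
        by_cases h1 : p = r.a ∧ q = r.b
        · simp only [h1]
          simp [hr.ne]
          ring
        · by_cases h2 : p = r.b ∧ q = r.a
          · simp only [h2]
            simp [hr.ne.symm]
            ring
          · simp [h1, h2]
  · have h1 := h.vert q hqs hqt
    rw [hr.eq, wdeg_splitOff _ hr.ne_a hr.ne_b] at h1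
    by_cases hq : q = r.v
    · have h2 := hu.vert_self
      simp only [hdem, Finset.sum_const_zero, hrem, add_zero, sub_zero] at h2
      rw [hq, h2]
      rw [hq, if_pos rfl] at h1
      linear_combination h1
    · rw [hu.vert q hq, h1]
      simp [hq]

theorem Decomposes.of_splitStep {r : Rec V K} (hr : SplitStep s t W X r X') {F : Fam V K}
    (h : Decomposes s t W X' F) : ∃ F', Decomposes s t W X F' := by
  have h0 := h.undoInv (a := r.a) (b := r.b) (v := r.v) hr.nonneg
  have h1 := (h0.insert_iter hr.ne hr.ne_a hr.ne_b hr.ready.ne_source F.m).1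
  have h2 := h0.insert_rem hr.ne hr.ne_a hr.ne_b hr.ready.ne_source (hr.le_edge h) le_rfl
  have key : ∀ P : Finset V, ∃ u : Undo V K, UndoInv s t r.a r.b r.v
      (fun p q => F.stat (edgeInd K p q)) (fun q => F.stat (vertInd K q)) W r.ε u ∧
      u.rem = 0 ∧ ∀ q ∈ P, u.dem q = 0 := by
    intro P
    induction P using Finset.induction_on with
    | empty => exact ⟨_, h1, h2, by simp⟩
    | insert p P _ ih =>
      obtain ⟨u, hu, hrem, hdem⟩ := ih
      obtain ⟨k1, -, k2, k3, -⟩ := hu.attach_iter p u.F.m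
      refine ⟨_, k1, k2.trans hrem, fun q hq => ?_⟩
      by_cases hqp : q = p
      · rw [hqp]
        exact hu.attach_dem hrem (hr.vert_le h) p le_rfl
      · rw [k3 q hqp]
        exact hdem q ((Finset.mem_insert.1 hq).resolve_left hqp)
  obtain ⟨u, hu, hrem, hdem⟩ := key Finset.univ
  exact ⟨u.F, hu.decomposes hr h hrem fun q => hdem q (Finset.mem_univ q)⟩

theorem Chain.exists_decomposes {l : List (Rec V K)} (hl : Chain s t W X l X')
    (h : ∃ F, Decomposes s t W X' F) : ∃ F, Decomposes s t W X F := by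
  induction hl with
  | nil => exact h
  | snoc _ hs ih => exact ih (h.elim fun F hF => hF.of_splitStep hs)

/-- The tree with the single edge `st`. -/
def stTree (s t : V) (u : V) : Option V := if u = s ∨ u = t then some s else none

theorem stTree_isArb : IsArb s t (stTree s t) := by
  refine ⟨by simp [stTree], by simp [stTree], fun u => if u = s then 0 else 1, fun u p hp => ?_⟩
  unfold stTree at hp ⊢
  split_ifs at hp with h
  obtain rfl : s = p := by simpa using hp
  exact ⟨by simp, fun hu => by simp [hu]⟩

/-- All weight sits on `st`, which therefore weighs `2 * W`. Taking away the auxiliary edge leaves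
`W`, the weight of the single tree. Only the entries of `w` and `T` at `0` matter. -/
theorem decomposes_stTree (hst : s ≠ t) (hf : Feasible X s t) (hW : 0 < W)
    (hs : wdeg X s = 2 * W) (h : ∀ u, u ≠ s → u ≠ t → wdeg X u = 0) {w : ℕ → K}
    {T : ℕ → V → Option V} (hw : w 0 = W) (hT : T 0 = stTree s t) :
    Decomposes s t W X ⟨1, w, T⟩ := by
  have hzero : ∀ u, u ≠ s → u ≠ t → ∀ q, X u q = 0 := fun u hus hut q =>
    (Finset.sum_eq_zero_iff_of_nonneg fun q _ => hf.nonneg u q).1 (h u hus hut) q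
      (Finset.mem_univ q)
  have hXst : X s t = 2 * W := by
    rw [← hs, wdeg, Finset.sum_eq_single t]
    · intro q _ hq
      by_cases hqs : q = s
      · rw [hqs, hf.diag]
      · rw [hf.symm, hzero q hqs hq]
    · simp
  refine ⟨?_, by simp [Fam.stat, hw], ?_, ?_⟩
  · intro i hi
    obtain rfl : i = 0 := by simpa using hi
    dsimp only
    rw [hw, hT]
    exact ⟨hW, stTree_isArb⟩
  · intro p q hpq
    simp only [Fam.stat, Finset.sum_range_one, hw, hT]
    by_cases hp : p = s
    · subst hp
      by_cases hq : q = t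
      · subst hq
        simp [edgeInd, stTree, auxEdge, hXst, HasEdge]
        ring
      · rw [hf.symm, hzero q hpq.symm hq]
        simp [edgeInd, stTree, auxEdge, hq, hpq.symm, hpq, HasEdge]
    · by_cases hpt : p = t
      · subst hpt
        by_cases hq : q = s
        · subst hq
          rw [hf.symm, hXst]
          simp [edgeInd, stTree, auxEdge, HasEdge]
          ring
        · rw [hf.symm, hzero q hq hpq.symm]
          simp [edgeInd, stTree, auxEdge, hq, hpq.symm, HasEdge, Ne.symm hq]
      · rw [hzero p hp hpt]
        simp only [edgeInd, stTree, auxEdge, HasEdge, hp, hpt]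
        split_ifs <;> simp_all
  · intro u hus hut
    rw [h u hus hut]
    simp [Fam.stat, vertInd, hT, stTree, hus, hut]

/-- Splitting off by the largest possible amount `ε`. -/
theorem splitOff_max (h : Feasible X s t) (hva : a ≠ v) (hvb : b ≠ v) (hab : a ≠ b) (hvs : v ≠ s)
    (hvt : v ≠ t) (hε : 0 ≤ ε) (h1 : ε ≤ X v a) (h2 : ε ≤ X v b)
    (hcut : ∀ (S : Finset V) (u : V), u ≠ v → (s ∈ S ↔ u ∉ S) → (a ∈ S ↔ b ∈ S) →
      (a ∈ S ↔ v ∉ S) → wdeg X u + 2 * ε ≤ outWeight X S)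
    (hmax : ε = X v a ∨ ε = X v b ∨ ∃ (S : Finset V) (u : V), u ≠ v ∧ (s ∈ S ↔ u ∉ S) ∧
      (a ∈ S ↔ b ∈ S) ∧ (a ∈ S ↔ v ∉ S) ∧ outWeight X S ≤ wdeg X u + 2 * ε) :
    Feasible (splitOff X v a b ε) s t ∧ Blocked (splitOff X v a b ε) s v a b := by
  have hf := h.splitOff hva hvb hab hvs hvt hε h1 h2 hcut
  refine ⟨hf, ?_⟩
  rcases hmax with h3 | h3 | ⟨S, u, huv, hsu, habS, hav, hle⟩
  · left
    rw [splitOff_apply_left X hva hvb]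
    simp [hab, h3]
  · right; left
    rw [splitOff_apply_left X hva hvb]
    simp [hab.symm, h3]
  · right; right
    have h4 : outWeight (splitOff X v a b ε) S ≤ wdeg (splitOff X v a b ε) u := by
      rw [outWeight_splitOff_of_blocking X ε habS hav, wdeg_splitOff X hva hvb, if_neg huv]
      linarith
    -- `Blocked` asks for the side of the cut that contains `a` and `b`.
    by_cases ha : a ∈ S
    · exact ⟨S, hav.1 ha, ha, habS.1 ha, u, huv, hsu, h4⟩
    · refine ⟨Sᶜ, ?_, by simpa using ha, by simpa [← habS] using ha, u, huv, ?_, ?_⟩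
      · simp; tauto
      · simp; tauto
      · rwa [outWeight_compl hf.symm]

end Decompose

/-! ### Existence of the decomposition over an ordered field -/

section Field

variable {V K : Type*} [Fintype V] [DecidableEq V] [Field K] [LinearOrder K]
  [IsStrictOrderedRing K] {s t v a b : V} {W : K} {X : V → V → K}

/-- The amount is the minimum of finitely many bounds: the two edge weights, and half the slack of
each cut that the step would lower. The bound that attains the minimum blocks the pair afterwards.
-/
theorem exists_splitOff_max (h : Feasible X s t) (hva : a ≠ v) (hvb : b ≠ v) (hab : a ≠ b)
    (hvs : v ≠ s) (hvt : v ≠ t) : ∃ ε, 0 ≤ ε ∧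
      Feasible (splitOff X v a b ε) s t ∧ Blocked (splitOff X v a b ε) s v a b := by
  classical
  let Q : Finset (Finset V × V) := Finset.univ.filter fun z => z.2 ≠ v ∧ (s ∈ z.1 ↔ z.2 ∉ z.1) ∧
    (a ∈ z.1 ↔ b ∈ z.1) ∧ (a ∈ z.1 ↔ v ∉ z.1)
  let C : Finset K := {X v a, X v b} ∪ Q.image fun z => (outWeight X z.1 - wdeg X z.2) / 2
  have hC : C.Nonempty := ⟨X v a, by simp [C]⟩
  have hle : ∀ c ∈ C, C.min' hC ≤ c := fun c hc => C.min'_le c hc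
  have hmem := C.min'_mem hC
  generalize C.min' hC = ε at hle hmem
  have hcut : ∀ (S : Finset V) (u : V), u ≠ v → (s ∈ S ↔ u ∉ S) → (a ∈ S ↔ b ∈ S) →
      (a ∈ S ↔ v ∉ S) → wdeg X u + 2 * ε ≤ outWeight X S := by
    intro S u h1 h2 h3 h4
    have := hle ((outWeight X S - wdeg X u) / 2) (Finset.mem_union_right _
      (Finset.mem_image.2 ⟨(S, u), Finset.mem_filter.2 ⟨Finset.mem_univ _, h1, h2, h3, h4⟩, rfl⟩))
    linarith
  simp only [C, Finset.mem_union, Finset.mem_insert, Finset.mem_singleton, Finset.mem_image, Q,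
    Finset.mem_filter, Finset.mem_univ, true_and] at hmem
  have hε : 0 ≤ ε := by
    rcases hmem with (h1 | h1) | ⟨z, ⟨-, h1, -, -⟩, h2⟩
    · exact h1 ▸ h.nonneg _ _
    · exact h1 ▸ h.nonneg _ _
    · have := h.le_outWeight h1
      rw [← h2]
      linarith
  refine ⟨ε, hε, splitOff_max h hva hvb hab hvs hvt hε (hle _ (by simp [C])) (hle _ (by simp [C]))
    hcut ?_⟩
  rcases hmem with (h1 | h1) | ⟨z, ⟨h1, h2, h3, h4⟩, h5⟩
  · exact Or.inl h1
  · exact Or.inr (Or.inl h1)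
  · exact Or.inr (Or.inr ⟨z.1, z.2, h1, h2, h3, h4, by linarith⟩)

/-- Each pair is treated once, and it remains blocked during all later steps at the same vertex. -/
theorem Ready.exists_chain (h : Ready s t W X v) (P : Finset (V × V)) :
    ∃ l X', Chain s t W X l X' ∧ Ready s t W X' v ∧ (∀ u, u ≠ v → wdeg X' u = wdeg X u) ∧
      ∀ z ∈ P, z.1 ≠ z.2 → Blocked X' s v z.1 z.2 := by
  induction P using Finset.induction_on with
  | empty => exact ⟨[], X, .nil, h, fun _ _ => rfl, by simp⟩
  | insert z P _ ih =>
    obtain ⟨l, X', hl, hr, hdeg, hb⟩ := ih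
    by_cases hz : z.1 ≠ v ∧ z.2 ≠ v ∧ z.1 ≠ z.2
    · obtain ⟨h1, h2, h3⟩ := hz
      obtain ⟨ε, hε, hf, hbl⟩ := exists_splitOff_max hr.feasible h1 h2 h3 hr.ne_source hr.ne_target
      refine ⟨_, _, hl.snoc (r := ⟨v, z.1, z.2, ε⟩) ⟨hr, h1, h2, h3, hε, rfl⟩,
        hr.splitOff h1 h2 hε hf, fun u hu => ?_, fun y hy hyne => ?_⟩
      · rw [wdeg_splitOff X' h1 h2, if_neg hu, sub_zero, hdeg u hu]
      · rcases Finset.mem_insert.1 hy with rfl | hy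
        · exact hbl
        · exact (hb y hy hyne).splitOff h1 h2 hε
    · refine ⟨l, X', hl, hr, hdeg, fun y hy hyne => ?_⟩
      rcases Finset.mem_insert.1 hy with rfl | hy
      -- A pair that involves `v` is blocked because the diagonal vanishes.
      · by_cases h1 : y.1 = v
        · exact Or.inl (by rw [h1, hr.feasible.diag])
        · by_cases h2 : y.2 = v
          · exact Or.inr (Or.inl (by rw [h2, hr.feasible.diag]))
          · exact absurd ⟨h1, h2, hyne⟩ hz
      · exact hb y hy hyne

/-- Induction on the number of vertices other than `s`, `t` of positive degree. Isolating one of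
least degree changes no other degree, so the number drops. -/
theorem exists_decomposes (hst : s ≠ t) (hW : 0 < W) (hf : Feasible X s t)
    (hs : wdeg X s = 2 * W) (haux : ∀ p q, auxEdge s t W p q ≤ X p q) :
    ∃ F, Decomposes s t W X F := by
  classical
  induction hk : (Finset.univ.filter fun u => u ≠ s ∧ u ≠ t ∧ 0 < wdeg X u).card using
    Nat.strong_induction_on generalizing X with
  | _ k ih =>
    let Q := Finset.univ.filter fun u => u ≠ s ∧ u ≠ t ∧ 0 < wdeg X u
    by_cases hQ : Q.Nonempty
    · obtain ⟨v, hv, hmin⟩ := Finset.exists_min_image Q (wdeg X) hQ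
      simp only [Q, Finset.mem_filter, Finset.mem_univ, true_and] at hv hmin
      have hr : Ready s t W X v := by
        refine ⟨hf, hs, haux, hv.1, hv.2.1, fun p hp => ?_⟩
        by_cases hps : p = s
        · rw [hps]; exact hf.wdeg_le_source v
        · by_cases hpt : p = t
          · rw [hpt, hf.deg_eq]; exact hf.wdeg_le_source v
          · exact hmin p ⟨hps, hpt, hp⟩
      obtain ⟨l, X', hl, hr', hdeg, hb⟩ := hr.exists_chain Finset.univ
      have hv0 : wdeg X' v = 0 := wdeg_eq_zero_of_blocked hr'.feasible hst hv.1 hv.2.1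
        fun a b hab => hb (a, b) (Finset.mem_univ _) hab
      refine hl.exists_decomposes (ih _ ?_ hr'.feasible hr'.wdeg_source hr'.le_aux rfl)
      rw [← hk]
      refine Finset.card_lt_card ⟨fun u hu => ?_, fun hsub => ?_⟩
      · simp only [Finset.mem_filter, Finset.mem_univ, true_and] at hu ⊢
        have huv : u ≠ v := by
          rintro rfl
          exact absurd hv0 hu.2.2.ne'
        rw [← hdeg u huv]
        exact hu
      · have := hsub (x := v) (by simpa using hv)
        simp [hv0] at this
    · refine ⟨_, decomposes_stTree (w := fun _ => W) (T := fun _ => stTree s t) hst hf hW hs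
        (fun u hus hut => ?_) rfl rfl⟩
      by_contra hne
      exact hQ ⟨u, by simp [Q, hus, hut, lt_of_le_of_ne (hf.wdeg_nonneg u) (Ne.symm hne)]⟩

end Field

end Stroll

/-! ### From graphs to weight matrices and back -/

namespace Stroll

set_option linter.unusedSectionVars false

section Graphs

open Classical in
/-- The weight matrix of an edge vector. -/
noncomputable def edgeMatrix {V K : Type*} [Field K] (G : SimpleGraph V) (x : G.edgeSet → K)
    (u v : V) : K := if h : G.Adj u v then x ⟨s(u, v), h⟩ else 0

theorem edgeMatrix_symm {V K : Type*} [Field K] (G : SimpleGraph V) (x : G.edgeSet → K)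
    (u v : V) : edgeMatrix G x u v = edgeMatrix G x v u := by
  unfold edgeMatrix
  by_cases h : G.Adj u v
  · rw [dif_pos h, dif_pos h.symm]
    congr 2
    exact Sym2.eq_swap
  · rw [dif_neg h, dif_neg fun h' => h h'.symm]

variable {V K : Type*} [Fintype V] [DecidableEq V] [Field K]

/-- An edge of the cut corresponds to exactly one ordered pair, the one that starts in `S`; counting
ordered pairs thus does not double the weight. -/
theorem cutWeight_eq_outWeight (G : SimpleGraph V) (x : G.edgeSet → K) (S : Finset V) :
    cutWeight G x ↑S = outWeight (edgeMatrix G x) S := by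
  classical
  unfold cutWeight outWeight
  rw [← Fintype.sum_prod_type' (f := fun p q => if p ∈ S ∧ q ∉ S then edgeMatrix G x p q else 0)]
  have h1 : ∀ z : V × V, (if z.1 ∈ S ∧ z.2 ∉ S then edgeMatrix G x z.1 z.2 else 0) =
      if z.1 ∈ S ∧ z.2 ∉ S ∧ G.Adj z.1 z.2 then edgeMatrix G x z.1 z.2 else 0 := by
    intro z
    by_cases h : G.Adj z.1 z.2 <;> simp [h, edgeMatrix]
  simp_rw [h1]
  rw [← Finset.sum_filter]
  symm
  refine Finset.sum_bij (fun z hz => ⟨s(z.1, z.2), (Finset.mem_filter.1 hz).2.2.2⟩) ?_ ?_ ?_ ?_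
  · intro z hz
    have hz' := (Finset.mem_filter.1 hz).2
    simp only [Finset.mem_filter, Finset.mem_univ, true_and]
    exact ⟨z.1, z.2, hz'.1, hz'.2.1, rfl⟩
  · intro z hz y hy hzy
    have hz' := (Finset.mem_filter.1 hz).2
    have hy' := (Finset.mem_filter.1 hy).2
    rcases Sym2.eq_iff.1 (Subtype.mk.inj hzy) with ⟨h2, h3⟩ | ⟨h2, h3⟩
    · exact Prod.ext h2 h3
    · exact absurd hz'.1 (h2 ▸ hy'.2.1)
  · rintro ⟨e, he⟩ hmem
    obtain ⟨u, v, hu, hv, huv⟩ := (Finset.mem_filter.1 hmem).2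
    simp only at huv
    subst huv
    exact ⟨(u, v), by simpa using ⟨hu, hv, he⟩, rfl⟩
  · intro z hz
    have hz' := (Finset.mem_filter.1 hz).2
    simp [edgeMatrix, hz'.2.2]

theorem edgeMatrix_self (G : SimpleGraph V) (x : G.edgeSet → K) (u : V) :
    edgeMatrix G x u u = 0 := by simp [edgeMatrix]

variable [LinearOrder K] [IsStrictOrderedRing K]

/-- The scaled weight matrix of an edge vector, with the auxiliary edge. -/
noncomputable def scaledMatrix (G : SimpleGraph V) (x : G.edgeSet → K) (s t : V) (W : K)
    (u v : V) : K := W * edgeMatrix G x u v + auxEdge s t W u v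

theorem outWeight_add (X Y : V → V → K) (S : Finset V) :
    outWeight (fun u v => X u v + Y u v) S = outWeight X S + outWeight Y S := by
  simp only [outWeight, ← Finset.sum_add_distrib]
  refine Finset.sum_congr rfl fun p _ => Finset.sum_congr rfl fun q _ => ?_
  split_ifs <;> simp

theorem outWeight_mul (c : K) (X : V → V → K) (S : Finset V) :
    outWeight (fun u v => c * X u v) S = c * outWeight X S := by
  simp only [outWeight, Finset.mul_sum]
  refine Finset.sum_congr rfl fun p _ => Finset.sum_congr rfl fun q _ => ?_
  split_ifs <;> simp

theorem auxEdge_eq_bump {s t : V} (hst : s ≠ t) (W : K) :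
    auxEdge s t W = bump (bump (fun _ _ => 0) s t W) t s W := by
  funext p q
  by_cases h1 : p = s
  · subst h1
    simp [auxEdge, bump, hst]
  · simp [auxEdge, bump, h1]

theorem outWeight_auxEdge {s t : V} (hst : s ≠ t) (W : K) (S : Finset V) :
    outWeight (auxEdge s t W) S = if s ∈ S ↔ t ∉ S then W else 0 := by
  rw [auxEdge_eq_bump hst, outWeight_bump, outWeight_bump]
  by_cases h1 : s ∈ S <;> by_cases h2 : t ∈ S <;> simp [h1, h2, outWeight]

theorem outWeight_scaledMatrix (G : SimpleGraph V) (x : G.edgeSet → K) {s t : V} (hst : s ≠ t)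
    (W : K) (S : Finset V) : outWeight (scaledMatrix G x s t W) S =
      W * cutWeight G x S + if s ∈ S ↔ t ∉ S then W else 0 := by
  rw [cutWeight_eq_outWeight, ← outWeight_auxEdge hst, ← outWeight_mul, ← outWeight_add]
  rfl

theorem scaledMatrix_self (G : SimpleGraph V) (x : G.edgeSet → K) {s t : V} (hst : s ≠ t)
    (W : K) (u : V) : scaledMatrix G x s t W u u = 0 := by
  have : ¬ ((u = s ∧ u = t) ∨ (u = t ∧ u = s)) := by
    rintro (⟨rfl, h⟩ | ⟨h, rfl⟩) <;> exact hst h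
  simp [scaledMatrix, edgeMatrix_self, auxEdge, this]

section Polytope

variable {G : SimpleGraph V} {s t : V} {x : G.edgeSet → K} {y : V → K} {W : K}

theorem wdeg_scaledMatrix (h : (x, y) ∈ polytope K G s t) (hst : s ≠ t) (u : V) :
    wdeg (scaledMatrix G x s t W) u = W * (2 * y u) + if u = s ∨ u = t then W else 0 := by
  rw [← outWeight_singleton (scaledMatrix_self G x hst W), outWeight_scaledMatrix G x hst]
  have := h.2.2.1 u
  simp only at this
  rw [Finset.coe_singleton, this]
  congr 1
  by_cases h1 : u = s
  · subst h1
    simp [hst.symm]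
  · by_cases h2 : u = t
    · subst h2
      simp [hst]
    · simp [h1, h2, Ne.symm h1, Ne.symm h2]

theorem edgeMatrix_nonneg (h : (x, y) ∈ polytope K G s t) (u v : V) :
    0 ≤ edgeMatrix G x u v := by
  unfold edgeMatrix
  split_ifs
  · exact h.1 _
  · exact le_rfl

theorem polytope_y_source (h : (x, y) ∈ polytope K G s t) : y s = 1 / 2 := h.2.2.2.2.2.1

theorem polytope_y_target (h : (x, y) ∈ polytope K G s t) : y t = 1 / 2 := h.2.2.2.2.2.2

/-- The constraint for the complement of `{s, t}` bounds `2 * y u` by the cut of `{s, t}`, which by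
submodularity is at most the sum of the degrees of `s` and `t`, namely `2`. -/
theorem polytope_y_le_one (h : (x, y) ∈ polytope K G s t) {u : V} (hus : u ≠ s) (hut : u ≠ t) :
    y u ≤ 1 := by
  obtain ⟨hx, -, hdeg, -, hcut, hs, ht⟩ := h
  simp only at hx hdeg hcut hs ht
  have h1 := hcut ↑({s, t}ᶜ : Finset V) (by simp) (by simp) u (by simp [hus, hut])
  rw [cutWeight_eq_outWeight, outWeight_compl (edgeMatrix_symm G x)] at h1
  have h2 := hdeg s
  have h3 := hdeg t
  rw [← Finset.coe_singleton, cutWeight_eq_outWeight] at h2 h3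
  have h0 : ∀ u v, 0 ≤ edgeMatrix G x u v := by
    intro u v
    unfold edgeMatrix
    split_ifs
    · exact hx _
    · exact le_rfl
  have h4 := outWeight_inter_add_union_le h0 {s} {t}
  have h5 := outWeight_nonneg h0 ({s} ∩ {t})
  rw [show ({s} ∪ {t} : Finset V) = {s, t} from rfl] at h4
  rw [hs] at h2
  rw [ht] at h3
  linarith

/-- If `S` contains `t`, the `s`-`t` cut constraint and the auxiliary edge give a cut of weight at
least `2 * W`, which suffices for every vertex because `y ≤ 1`. If not, the auxiliary edge does not
cross the cut, and the constraint for `u ∈ S` is what is needed. -/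
theorem feasible_scaledMatrix (h : (x, y) ∈ polytope K G s t) (hst : s ≠ t) (hW : 0 ≤ W) :
    Feasible (scaledMatrix G x s t W) s t where
  symm u v := by
    unfold scaledMatrix
    rw [edgeMatrix_symm, auxEdge_symm]
  diag := scaledMatrix_self G x hst W
  nonneg u v := by
    have h1 : 0 ≤ auxEdge s t W u v := by
      unfold auxEdge
      split_ifs <;> simp [hW]
    exact add_nonneg (mul_nonneg hW (edgeMatrix_nonneg h u v)) h1
  deg_eq := by
    rw [wdeg_scaledMatrix h hst, wdeg_scaledMatrix h hst, polytope_y_source h, polytope_y_target h]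
    simp
  le_cut S u hs hu := by
    rw [wdeg_scaledMatrix h hst, outWeight_scaledMatrix G x hst]
    have hus : u ≠ s := by
      rintro rfl
      exact hs hu
    by_cases ht : t ∈ S
    · have h1 := h.2.2.2.1 ↑Sᶜ (by simpa using ht) (by simpa using hs)
      simp only at h1
      rw [cutWeight_eq_outWeight, outWeight_compl (edgeMatrix_symm G x),
        ← cutWeight_eq_outWeight] at h1
      have h2 : (if s ∈ S ↔ t ∉ S then W else 0) = W := if_pos (by simp [hs, ht])
      rw [h2]
      have h3 := mul_le_mul_of_nonneg_left h1 hW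
      by_cases hut : u = t
      · rw [hut, polytope_y_target h]
        simp
        linarith
      · have h4 := mul_le_mul_of_nonneg_left (polytope_y_le_one h hus hut) hW
        simp [hus, hut]
        linarith
    · have hut : u ≠ t := by
        rintro rfl
        exact ht hu
      have h1 := h.2.2.2.2.1 ↑S (by simpa using hs) (by simpa using ht) u (by simpa using hu)
      have h3 := mul_le_mul_of_nonneg_left h1 hW
      simpa [hs, ht, hus, hut] using h3

theorem auxEdge_le_scaledMatrix (h : (x, y) ∈ polytope K G s t) (hW : 0 ≤ W) (p q : V) :
    auxEdge s t W p q ≤ scaledMatrix G x s t W p q :=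
  le_add_of_nonneg_left (mul_nonneg hW (edgeMatrix_nonneg h p q))

end Polytope

/-- The subgraph of `G` that consists of a tree given by parent pointers. -/
def treeSubgraph (G : SimpleGraph V) (T : V → Option V) : G.Subgraph where
  verts := {u | T u ≠ none}
  Adj p q := G.Adj p q ∧ HasEdge T p q ∧ T p ≠ none ∧ T q ≠ none
  adj_sub h := h.1
  edge_vert h := h.2.2.1
  symm := ⟨fun _ _ h => ⟨h.1.symm, h.2.1.symm, h.2.2.2, h.2.2.1⟩⟩

/-- Following the pointers lowers the depth until the root is reached, which gives connectedness.
Sending each vertex other than the root to its parent edge is onto the edges, so there are at most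
as many edges as a tree has. -/
theorem treeSubgraph_isTree {G : SimpleGraph V} {T : V → Option V} {s t : V} (hT : IsArb s t T)
    (hG : ∀ p q, p ≠ q → HasEdge T p q → G.Adj p q) : (treeSubgraph G T).coe.IsTree := by
  classical
  obtain ⟨d, hd⟩ := hT.depth
  have hne : ∀ u p, u ≠ s → T u = some p → u ≠ p := by
    rintro u p hus hup rfl
    exact absurd ((hd _ _ hup).2 hus) (lt_irrefl _)
  have hs : s ∈ (treeSubgraph G T).verts := by simp [treeSubgraph, hT.root]
  have hadj : ∀ u p, (hu : T u ≠ none) → (hp : T p ≠ none) → u ≠ s → T u = some p →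
      (treeSubgraph G T).coe.Adj ⟨u, hu⟩ ⟨p, hp⟩ := fun u p hu hp hus hup =>
    ⟨hG u p (hne u p hus hup) (Or.inl hup), Or.inl hup, hu, hp⟩
  have hreach : ∀ k u (hu : T u ≠ none), d u = k →
      (treeSubgraph G T).coe.Reachable ⟨u, hu⟩ ⟨s, hs⟩ := by
    intro k
    induction k using Nat.strong_induction_on with
    | _ k ih =>
      intro u hu hk
      by_cases hus : u = s
      · subst hus
        exact SimpleGraph.Reachable.refl _
      · obtain ⟨p, hp⟩ := Option.ne_none_iff_exists'.1 hu
        obtain ⟨h1, h2⟩ := hd u p hp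
        exact (hadj u p hu h1 hus hp).reachable.trans (ih _ (hk ▸ h2 hus) p h1 rfl)
  have hconn : (treeSubgraph G T).coe.Connected := by
    have : Nonempty (treeSubgraph G T).verts := ⟨⟨s, hs⟩⟩
    refine ⟨fun u v => ?_⟩
    exact (hreach _ u.1 u.2 rfl).trans (hreach _ v.1 v.2 rfl).symm
  rw [SimpleGraph.isTree_iff_connected_and_card]
  refine ⟨hconn, le_antisymm ?_ hconn.card_vert_le_card_edgeSet_add_one⟩
  have hpar : ∀ u : {u : (treeSubgraph G T).verts // (u : V) ≠ s}, ∃ p, T u.1.1 = some p :=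
    fun u => Option.ne_none_iff_exists'.1 u.1.2
  choose par hpar using hpar
  have hsurj : Function.Surjective (fun u : {u : (treeSubgraph G T).verts // (u : V) ≠ s} =>
      (⟨s(u.1, ⟨par u, (hd _ _ (hpar u)).1⟩), hadj _ _ u.1.2 (hd _ _ (hpar u)).1 u.2 (hpar u)⟩ :
        (treeSubgraph G T).coe.edgeSet)) := by
    rintro ⟨e, he⟩
    induction e using Sym2.ind with
    | _ p q =>
      have he' : (treeSubgraph G T).coe.Adj p q := he
      obtain ⟨h1, h2, h3, h4⟩ := he'
      rcases h2 with h2 | h2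
      · have hps : (p : V) ≠ s := by
          intro hps
          rw [hps, hT.root] at h2
          exact h1.ne (hps.trans (by simpa using h2))
        refine ⟨⟨p, hps⟩, ?_⟩
        have h5 : par ⟨p, hps⟩ = q := by
          have := hpar ⟨p, hps⟩
          simp only at this
          rw [h2] at this
          simpa using this.symm
        simp [h5]
      · have hqs : (q : V) ≠ s := by
          intro hqs
          rw [hqs, hT.root] at h2
          exact h1.ne (Eq.symm (hqs.trans (by simpa using h2)))
        refine ⟨⟨q, hqs⟩, ?_⟩
        have h5 : par ⟨q, hqs⟩ = p := by
          have := hpar ⟨q, hqs⟩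
          simp only at this
          rw [h2] at this
          simpa using this.symm
        simp [h5]
  have hcard := Nat.card_le_card_of_surjective _ hsurj
  have h6 : Nat.card {u : (treeSubgraph G T).verts // (u : V) ≠ s} + 1 =
      Nat.card (treeSubgraph G T).verts := by
    have h7 : Fintype.card {u : (treeSubgraph G T).verts // ¬ u = ⟨s, hs⟩} =
      Fintype.card (treeSubgraph G T).verts - 1 := by
      rw [Fintype.card_subtype_compl, Fintype.card_subtype_eq]
    have h8 : Fintype.card {u : (treeSubgraph G T).verts // (u : V) ≠ s} =
        Fintype.card {u : (treeSubgraph G T).verts // ¬ u = ⟨s, hs⟩} := by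
      refine Fintype.card_congr (Equiv.subtypeEquivRight fun u => ?_)
      rw [Subtype.ext_iff]
    have h9 : 0 < Fintype.card (treeSubgraph G T).verts := Fintype.card_pos_iff.2 ⟨⟨s, hs⟩⟩
    rw [Nat.card_eq_fintype_card, Nat.card_eq_fintype_card]
    omega
  exact (Nat.add_le_add_right hcard 1).trans h6.le

theorem Decomposes.isDecomposition {G : SimpleGraph V} {s t : V} {x : G.edgeSet → K} {y : V → K}
    {W : K} {F : Fam V K} (h : (x, y) ∈ polytope K G s t) (hst : s ≠ t) (hW : 0 < W)
    (hF : Decomposes s t W (scaledMatrix G x s t W) F) :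
    (∀ i < F.m, ∀ p q, p ≠ q → HasEdge (F.T i) p q → G.Adj p q) ∧
    IsDecomposition s t x y (fun i : Fin F.m => treeSubgraph G (F.T i)) fun i => F.w i / W := by
  classical
  have hedge : ∀ p q, p ≠ q → F.stat (edgeInd K p q) = W * edgeMatrix G x p q := by
    intro p q hpq
    rw [hF.edge p q hpq, scaledMatrix]
    ring
  -- Every tree has positive weight, so an edge outside `G` would get a positive total, whereas the
  -- matrix vanishes there once the auxiliary edge is subtracted.
  have hadj : ∀ i < F.m, ∀ p q, p ≠ q → HasEdge (F.T i) p q → G.Adj p q := by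
    intro i hi p q hpq hT
    by_contra hcon
    have h1 := hF.good.stat_pos hi (edgeInd_nonneg (K := K) p q) (by simp [edgeInd, hT])
    rw [hedge p q hpq, edgeMatrix, dif_neg hcon] at h1
    simp at h1
  have hsum : ∑ i : Fin F.m, F.w i = W := by
    have := hF.total
    simpa [Fam.stat, Finset.sum_range] using this
  refine ⟨hadj, ?_⟩
  constructor
  · exact fun i => treeSubgraph_isTree (hF.good i i.2).2 (hadj i i.2)
  · intro i
    simp [treeSubgraph, (hF.good i i.2).2.root]
  · exact fun i => (hF.good i i.2).2.target
  · intro i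
    refine ⟨div_nonneg (hF.good i i.2).1.le hW.le, (div_le_one hW).2 ?_⟩
    rw [← hsum]
    exact Finset.single_le_sum (f := fun i : Fin F.m => F.w i)
      (fun j _ => (hF.good j j.2).1.le) (Finset.mem_univ i)
  · rw [← Finset.sum_div, hsum, div_self hW.ne']
  · rintro ⟨e, he⟩
    induction e using Sym2.ind with
    | _ p q =>
      have he' : G.Adj p q := he
      have h1 := hedge p q he'.ne
      rw [edgeMatrix, dif_pos he', Fam.stat, Finset.sum_range] at h1
      rw [Finset.sum_filter, eq_comm, ← mul_right_inj' hW.ne', ← h1, Finset.mul_sum]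
      refine Finset.sum_congr rfl fun i _ => ?_
      obtain ⟨d, hd⟩ := (hF.good i i.2).2.depth
      have h2 : s(p, q) ∈ (treeSubgraph G (F.T i)).edgeSet ↔ HasEdge (F.T i) p q := by
        rw [SimpleGraph.Subgraph.mem_edgeSet]
        refine ⟨fun h => h.2.1, fun h => ⟨he', h, ?_⟩⟩
        rcases h with h | h
        · exact ⟨by simp [h], (hd _ _ h).1⟩
        · exact ⟨(hd _ _ h).1, by simp [h]⟩
      by_cases h3 : HasEdge (F.T i) p q
      · rw [if_pos (h2.2 h3), edgeInd, if_pos h3]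
        field_simp
      · rw [if_neg fun h => h3 (h2.1 h), edgeInd, if_neg h3]
        simp
  · intro v hvs hvt
    have h1 := hF.vert v hvs hvt
    rw [wdeg_scaledMatrix h hst, if_neg (by simp [hvs, hvt]), add_zero] at h1
    have h2 : F.stat (vertInd K v) = W * y v := by linarith
    rw [Fam.stat, Finset.sum_range] at h2
    rw [Finset.sum_filter, eq_comm, ← mul_right_inj' hW.ne', ← h2, Finset.mul_sum]
    refine Finset.sum_congr rfl fun i _ => ?_
    have h3 : v ∈ (treeSubgraph G (F.T i)).verts ↔ F.T i v ≠ none := Iff.rfl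
    by_cases h4 : F.T i v = none
    · rw [if_neg fun h => h3.1 h h4, vertInd, if_pos h4]
      simp
    · rw [if_pos (h3.2 h4), vertInd, if_neg h4]
      field_simp

/-- Over a field no scaling is needed, so `W = 1` does. -/
theorem exists_isDecomposition {G : SimpleGraph V} {s t : V} {x : G.edgeSet → K} {y : V → K}
    (h : (x, y) ∈ polytope K G s t) (hst : s ≠ t) :
    ∃ (m : ℕ) (T : Fin m → G.Subgraph) (μ : Fin m → K), IsDecomposition s t x y T μ := by
  have hs : wdeg (scaledMatrix G x s t (1 : K)) s = 2 * 1 := by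
    rw [wdeg_scaledMatrix h hst, polytope_y_source h]
    simp
    norm_num
  obtain ⟨F, hF⟩ := exists_decomposes hst one_pos (feasible_scaledMatrix h hst zero_le_one) hs
    (auxEdge_le_scaledMatrix h zero_le_one)
  exact ⟨_, _, _, (hF.isDecomposition h hst one_pos).2⟩

end Graphs

end Stroll

/-! ### A language of bounded loops

Programs of this language run through loops whose bounds are registers that the program does not
change, and multiply only by constants, input words and such registers. Hence the bit lengths of
the values grow by a bounded amount in every step, and every program runs in polynomial time. -/

namespace RAM

theorem bits_le_iff {z : ℤ} {k : ℕ} : bits z ≤ k + 1 ↔ z.natAbs < 2 ^ k := by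
  rw [bits, Nat.add_le_add_iff_right, Nat.size_le]

theorem natAbs_lt_of_bits (z : ℤ) : z.natAbs < 2 ^ (bits z - 1) := by
  have h : bits z ≤ (bits z - 1) + 1 := by simp [bits]
  exact bits_le_iff.1 h

theorem one_le_bits (z : ℤ) : 1 ≤ bits z := by simp [bits]

theorem bits_add_le (a b : ℤ) : bits (a + b) ≤ max (bits a) (bits b) + 1 := by
  have ha := natAbs_lt_of_bits a
  have hb := natAbs_lt_of_bits b
  have h1 : 2 ^ (bits a - 1) ≤ 2 ^ (max (bits a) (bits b) - 1) :=
    Nat.pow_le_pow_right (by norm_num) (by omega)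
  have h2 : 2 ^ (bits b - 1) ≤ 2 ^ (max (bits a) (bits b) - 1) :=
    Nat.pow_le_pow_right (by norm_num) (by omega)
  have h3 := one_le_bits a
  rw [bits_le_iff]
  have h4 : 2 ^ max (bits a) (bits b) = 2 * 2 ^ (max (bits a) (bits b) - 1) := by
    rw [← pow_succ']
    congr 1
    omega
  have h5 := Int.natAbs_add_le a b
  omega

theorem bits_neg (a : ℤ) : bits (-a) = bits a := by simp [bits]

theorem bits_sub_le (a b : ℤ) : bits (a - b) ≤ max (bits a) (bits b) + 1 := by
  rw [sub_eq_add_neg, ← bits_neg b]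
  exact bits_add_le _ _

theorem bits_mul_le (a b : ℤ) : bits (a * b) ≤ bits a + bits b := by
  have ha := natAbs_lt_of_bits a
  have hb := natAbs_lt_of_bits b
  have h3 := one_le_bits a
  have h4 := one_le_bits b
  have h5 : bits a + bits b = ((bits a - 1) + (bits b - 1) + 1) + 1 := by omega
  rw [h5, bits_le_iff, Int.natAbs_mul]
  calc a.natAbs * b.natAbs < 2 ^ (bits a - 1) * 2 ^ (bits b - 1) := by
        exact Nat.mul_lt_mul'' ha hb
    _ = 2 ^ (bits a - 1 + (bits b - 1)) := (pow_add _ _ _).symm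
    _ ≤ _ := Nat.pow_le_pow_right (by norm_num) (by omega)

theorem bits_div_le (a b : ℤ) : bits (a / b) ≤ bits a := by
  unfold bits
  exact Nat.add_le_add_right (Nat.size_le_size (Int.natAbs_ediv_le_natAbs a b)) 1

theorem bits_le_of_natAbs_le {z : ℤ} {m : ℕ} (h : z.natAbs ≤ m) : bits z ≤ m + 1 := by
  rw [bits_le_iff]
  exact h.trans_lt Nat.lt_two_pow_self

namespace Expr

theorem bits_eval_le_cost (τ : State) (e : Expr) : bits (e.eval τ) ≤ e.cost τ := by
  cases e <;> simp [eval, cost]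

end Expr

end RAM

/-! ### Memory and expressions of the loop language, and their compilation -/

namespace Loop

open RAM (bits)

/-- The memory: the input, registers, two-dimensional arrays, and the output. -/
structure Mem where
  inp : ℤ → ℤ
  reg : ℕ → ℤ
  arr : ℕ → ℤ → ℤ → ℤ
  out : List ℤ

namespace Mem

def set (σ : Mem) (r : ℕ) (z : ℤ) : Mem := { σ with reg := Function.update σ.reg r z }

def put (σ : Mem) (a : ℕ) (i j z : ℤ) : Mem :=
  { σ with arr := fun a' i' j' => if a' = a ∧ i' = i ∧ j' = j then z else σ.arr a' i' j' }

def push (σ : Mem) (z : ℤ) : Mem := { σ with out := σ.out ++ [z] }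

variable (σ : Mem) (r a : ℕ) (i j z : ℤ)

@[simp] theorem set_inp : (σ.set r z).inp = σ.inp := rfl
@[simp] theorem set_arr : (σ.set r z).arr = σ.arr := rfl
@[simp] theorem set_out : (σ.set r z).out = σ.out := rfl
@[simp] theorem set_reg (r' : ℕ) :
    (σ.set r z).reg r' = if r' = r then z else σ.reg r' := by simp [set, Function.update_apply]
@[simp] theorem put_inp : (σ.put a i j z).inp = σ.inp := rfl
@[simp] theorem put_reg : (σ.put a i j z).reg = σ.reg := rfl
@[simp] theorem put_out : (σ.put a i j z).out = σ.out := rfl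
@[simp] theorem put_arr (a' : ℕ) (i' j' : ℤ) : (σ.put a i j z).arr a' i' j' =
    if a' = a ∧ i' = i ∧ j' = j then z else σ.arr a' i' j' := rfl
@[simp] theorem push_inp : (σ.push z).inp = σ.inp := rfl
@[simp] theorem push_reg : (σ.push z).reg = σ.reg := rfl
@[simp] theorem push_arr : (σ.push z).arr = σ.arr := rfl
@[simp] theorem push_out : (σ.push z).out = σ.out ++ [z] := rfl

end Mem

inductive Exp
  | const (z : ℤ)
  | reg (r : ℕ)
  | inp (e : Exp)
  | arr (a : ℕ) (e f : Exp)
  | add (e f : Exp)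
  | sub (e f : Exp)
  | mul (e f : Exp)
  | div (e f : Exp)

namespace Exp

def eval (σ : Mem) : Exp → ℤ
  | const z => z
  | reg r => σ.reg r
  | inp e => σ.inp (e.eval σ)
  | arr a e f => σ.arr a (e.eval σ) (f.eval σ)
  | add e f => e.eval σ + f.eval σ
  | sub e f => e.eval σ - f.eval σ
  | mul e f => e.eval σ * f.eval σ
  | div e f => e.eval σ / f.eval σ

/-- The factors of bounded length. -/
def frozen (F : List ℕ) : Exp → Bool
  | const _ => true
  | reg r => decide (r ∈ F)
  | inp _ => true
  | _ => false

/-- The second factor of a product must be frozen. This excludes repeated squaring and makes bit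
lengths grow by a bounded summand per operation. Quotients are never longer than the dividend and
need no such restriction. -/
def ok (F : List ℕ) : Exp → Bool
  | const _ => true
  | reg _ => true
  | inp e => e.ok F
  | arr _ e f => e.ok F && f.ok F
  | add e f => e.ok F && f.ok F
  | sub e f => e.ok F && f.ok F
  | mul e f => e.ok F && f.ok F && f.frozen F
  | div e f => e.ok F && f.ok F

instance : Add Exp := ⟨add⟩
instance : Sub Exp := ⟨sub⟩
instance : Mul Exp := ⟨mul⟩
instance : Div Exp := ⟨div⟩
instance (n : ℕ) : OfNat Exp n := ⟨const n⟩

variable (σ : Mem) (e f : Exp)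

@[simp] theorem eval_const (z : ℤ) : (const z).eval σ = z := rfl
@[simp] theorem eval_reg (r : ℕ) : (reg r).eval σ = σ.reg r := rfl
@[simp] theorem eval_inp : (inp e).eval σ = σ.inp (e.eval σ) := rfl
@[simp] theorem eval_arr (a : ℕ) : (arr a e f).eval σ = σ.arr a (e.eval σ) (f.eval σ) := rfl
@[simp] theorem eval_add : (e + f).eval σ = e.eval σ + f.eval σ := rfl
@[simp] theorem eval_sub : (e - f).eval σ = e.eval σ - f.eval σ := rfl
@[simp] theorem eval_mul : (e * f).eval σ = e.eval σ * f.eval σ := rfl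
@[simp] theorem eval_div : (e / f).eval σ = e.eval σ / f.eval σ := rfl
@[simp] theorem eval_zero : (0 : Exp).eval σ = 0 := rfl
@[simp] theorem eval_one : (1 : Exp).eval σ = 1 := rfl
@[simp] theorem eval_two : (2 : Exp).eval σ = 2 := rfl
@[simp] theorem eval_three : (3 : Exp).eval σ = 3 := rfl

/-- The injective function `2 z² + z` to the natural numbers. -/
def unfoldExpr (e : RAM.Expr) : RAM.Expr := .mul e (.add (.add e e) (.const 1))

/-- The address of an entry of a two-dimensional array. -/
def addrExpr (e f : RAM.Expr) : RAM.Expr :=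
  .add (.mul (.add (unfoldExpr e) (unfoldExpr f)) (.add (unfoldExpr e) (unfoldExpr f)))
    (unfoldExpr f)

/-- Array `0` of the machine holds the input, so all other arrays are shifted by one. -/
def compile : Exp → RAM.Expr
  | const z => .const z
  | reg r => .reg r
  | inp e => .arr 0 e.compile
  | arr a e f => .arr (a + 1) (addrExpr e.compile f.compile)
  | add e f => .add e.compile f.compile
  | sub e f => .sub e.compile f.compile
  | mul e f => .mul e.compile f.compile
  | div e f => .div e.compile f.compile

/-- Bounds the growth of bit lengths in the evaluation of an expression. -/
def width : Exp → ℕ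
  | const z => bits z
  | reg _ => 1
  | inp e => e.width + 1
  | arr _ e f => e.width + f.width
  | add e f => e.width + f.width + 1
  | sub e f => e.width + f.width + 1
  | mul e f => e.width + f.width + 1
  | div e f => e.width + f.width

/-- Bounds the cost of the evaluation of an expression. -/
def weight : Exp → ℕ
  | const _ => 1
  | reg _ => 1
  | inp e => e.weight + 1
  | arr _ e f => 60 * (e.weight + f.weight + 1) + 1
  | add e f => e.weight + f.weight + 1
  | sub e f => e.weight + f.weight + 1
  | mul e f => e.weight + f.weight + 1
  | div e f => e.weight + f.weight + 1

end Exp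

def unfoldInt (z : ℤ) : ℤ := z * (z + z + 1)

/-- An injective pairing computed by ring operations alone. The indices are first made nonnegative
by `unfoldInt`; the square then determines the sum of the two numbers and the last summand the
second of them. -/
def addr (i j : ℤ) : ℤ :=
  (unfoldInt i + unfoldInt j) * (unfoldInt i + unfoldInt j) + unfoldInt j

theorem unfoldInt_nonneg (z : ℤ) : 0 ≤ unfoldInt z := by
  unfold unfoldInt
  rcases le_or_gt 0 z with h | h
  · positivity
  · exact mul_nonneg_of_nonpos_of_nonpos h.le (by omega)

/-- The difference of two values factors as `(x - y) * (2 * (x + y) + 1)`, and the second factor is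
odd. -/
theorem unfoldInt_injective : Function.Injective unfoldInt := by
  intro x y h
  unfold unfoldInt at h
  have h1 : (x - y) * (2 * (x + y) + 1) = 0 := by linear_combination h
  rcases mul_eq_zero.1 h1 with h2 | h2 <;> omega

theorem addr_inj {i j i' j' : ℤ} : addr i j = addr i' j' ↔ i = i' ∧ j = j' := by
  refine ⟨fun h => ?_, fun ⟨h1, h2⟩ => by rw [h1, h2]⟩
  -- For nonnegative `a`, `b` the value `(a + b) ^ 2 + b` lies strictly below `(a + b + 1) ^ 2`.
  have key : ∀ a b c d : ℤ, 0 ≤ a → 0 ≤ b → 0 ≤ c → 0 ≤ d →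
      (a + b) * (a + b) + b = (c + d) * (c + d) + d → a + b ≤ c + d := by
    intro a b c d ha hb hc hd h
    by_contra hlt
    have : c + d + 1 ≤ a + b := by omega
    nlinarith
  unfold addr at h
  have h1 := unfoldInt_nonneg i
  have h2 := unfoldInt_nonneg j
  have h3 := unfoldInt_nonneg i'
  have h4 := unfoldInt_nonneg j'
  have h5 := le_antisymm (key _ _ _ _ h1 h2 h3 h4 h) (key _ _ _ _ h3 h4 h1 h2 h.symm)
  rw [h5] at h
  have h6 : unfoldInt j = unfoldInt j' := by linarith
  exact ⟨unfoldInt_injective (by linarith), unfoldInt_injective h6⟩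

/-- The memory `σ` is represented by the state `τ`. -/
structure Sim (σ : Mem) (τ : RAM.State) : Prop where
  inp : ∀ z, τ.arr 0 z = σ.inp z
  reg : τ.reg = σ.reg
  arr : ∀ a i j, τ.arr (a + 1) (addr i j) = σ.arr a i j
  out : τ.out = σ.out

theorem Sim.eval {σ : Mem} {τ : RAM.State} (h : Sim σ τ) (e : Exp) :
    e.compile.eval τ = e.eval σ := by
  induction e with
  | const z => rfl
  | reg r => simp [Exp.compile, RAM.Expr.eval, h.reg]
  | inp e ih => simp [Exp.compile, RAM.Expr.eval, ih, h.inp]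
  | arr a e f ih ih' =>
    simp only [Exp.compile, RAM.Expr.eval, Exp.eval, ← h.arr, Exp.addrExpr, Exp.unfoldExpr, ih, ih']
    rfl
  | add e f ih ih' => simp [Exp.compile, RAM.Expr.eval, Exp.eval, ih, ih']
  | sub e f ih ih' => simp [Exp.compile, RAM.Expr.eval, Exp.eval, ih, ih']
  | mul e f ih ih' => simp [Exp.compile, RAM.Expr.eval, Exp.eval, ih, ih']
  | div e f ih ih' => simp [Exp.compile, RAM.Expr.eval, Exp.eval, ih, ih']

theorem Sim.eval_addr {σ : Mem} {τ : RAM.State} (h : Sim σ τ) (e f : Exp) :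
    (Exp.addrExpr e.compile f.compile).eval τ = addr (e.eval σ) (f.eval σ) := by
  simp only [Exp.addrExpr, Exp.unfoldExpr, RAM.Expr.eval, h.eval]
  rfl

theorem bits_unfold_le (z : ℤ) : bits (z * (z + z + 1)) ≤ 2 * bits z + 2 := by
  have h1 := RAM.bits_mul_le z (z + z + 1)
  have h2 := RAM.bits_add_le (z + z) 1
  have h3 := RAM.bits_add_le z z
  have h4 := RAM.one_le_bits z
  have h5 : bits 1 = 2 := by decide
  omega

theorem cost_unfoldExpr_le (τ : RAM.State) (e : RAM.Expr) :
    (Exp.unfoldExpr e).cost τ ≤ 7 * e.cost τ + 7 := by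
  have h0 := RAM.Expr.bits_eval_le_cost τ e
  simp only [Exp.unfoldExpr, RAM.Expr.cost, RAM.Expr.eval]
  generalize e.eval τ = z at *
  have h1 := bits_unfold_le z
  have h2 := RAM.bits_add_le (z + z) 1
  have h3 := RAM.bits_add_le z z
  have h4 := RAM.one_le_bits z
  have h5 : bits 1 = 2 := by decide
  omega

theorem cost_addrExpr_le (τ : RAM.State) (e f : RAM.Expr) :
    (Exp.addrExpr e f).cost τ ≤ 60 * (e.cost τ + f.cost τ + 1) := by
  have h1 := cost_unfoldExpr_le τ e
  have h2 := cost_unfoldExpr_le τ f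
  have he := RAM.Expr.bits_eval_le_cost τ e
  have hf := RAM.Expr.bits_eval_le_cost τ f
  have h3 : bits ((Exp.unfoldExpr e).eval τ) ≤ 2 * e.cost τ + 2 :=
    (bits_unfold_le _).trans (by omega)
  have h4 : bits ((Exp.unfoldExpr f).eval τ) ≤ 2 * f.cost τ + 2 :=
    (bits_unfold_le _).trans (by omega)
  simp only [Exp.addrExpr, RAM.Expr.cost, RAM.Expr.eval]
  generalize (Exp.unfoldExpr e).eval τ = x at *
  generalize (Exp.unfoldExpr f).eval τ = y at *
  have h5 := RAM.bits_add_le x y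
  have h6 := RAM.bits_mul_le (x + y) (x + y)
  have h7 := RAM.bits_add_le ((x + y) * (x + y)) y
  omega

/-- All registers and array entries have bit length at most `B`. -/
structure BitsLE (B : ℕ) (σ : Mem) : Prop where
  reg : ∀ r, bits (σ.reg r) ≤ B
  arr : ∀ a i j, bits (σ.arr a i j) ≤ B

/-- The registers in `F` and the input words are bounded by `M`. -/
structure Bounded (M : ℕ) (F : List ℕ) (σ : Mem) : Prop where
  reg : ∀ r ∈ F, (σ.reg r).natAbs ≤ M
  inp : ∀ z, bits (σ.inp z) ≤ M

variable {M B : ℕ} {F : List ℕ} {σ : Mem} {τ : RAM.State}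

theorem Exp.bits_eval_of_frozen (hM : Bounded M F σ) {e : Exp} (h : e.frozen F = true) :
    bits (e.eval σ) ≤ e.width * (M + 1) := by
  cases e with
  | const z =>
    simp only [Exp.eval, Exp.width]
    exact Nat.le_mul_of_pos_right _ (by omega)
  | reg r =>
    simp only [Exp.frozen, decide_eq_true_eq] at h
    simpa [Exp.eval, Exp.width] using RAM.bits_le_of_natAbs_le (hM.reg r h)
  | inp e =>
    have := hM.inp (e.eval σ)
    simp only [Exp.eval, Exp.width]
    nlinarith [Nat.zero_le (e.width * (M + 1))]
  | _ => simp [Exp.frozen] at h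

/-- Each operation adds at most a bounded number of multiples of `M + 1` to `B`: the frozen factors
and the input words are the only contributions besides carries and constants. -/
theorem Exp.bits_eval (hM : Bounded M F σ) (hB : BitsLE B σ) {e : Exp} (h : e.ok F = true) :
    bits (e.eval σ) ≤ B + e.width * (M + 1) := by
  induction e with
  | const z =>
    have : bits z ≤ bits z * (M + 1) := Nat.le_mul_of_pos_right _ (by omega)
    simp only [Exp.eval, Exp.width]
    omega
  | reg r =>
    have := hB.reg r
    simp only [Exp.eval]
    omega
  | inp e ih =>
    have := hM.inp (e.eval σ)
    simp only [Exp.eval, Exp.width, Nat.add_mul, Nat.one_mul]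
    omega
  | arr a e f ih ih' =>
    have := hB.arr a (e.eval σ) (f.eval σ)
    simp only [Exp.eval]
    omega
  | add e f ih ih' =>
    simp only [Exp.ok, Bool.and_eq_true] at h
    have h1 := ih h.1
    have h2 := ih' h.2
    have h3 := RAM.bits_add_le (e.eval σ) (f.eval σ)
    simp only [Exp.eval, Exp.width, Nat.add_mul, Nat.one_mul] at *
    omega
  | sub e f ih ih' =>
    simp only [Exp.ok, Bool.and_eq_true] at h
    have h1 := ih h.1
    have h2 := ih' h.2
    have h3 := RAM.bits_sub_le (e.eval σ) (f.eval σ)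
    simp only [Exp.eval, Exp.width, Nat.add_mul, Nat.one_mul] at *
    omega
  | mul e f ih ih' =>
    simp only [Exp.ok, Bool.and_eq_true] at h
    have h1 := ih h.1.1
    have h2 := Exp.bits_eval_of_frozen hM h.2
    have h3 := RAM.bits_mul_le (e.eval σ) (f.eval σ)
    simp only [Exp.eval, Exp.width, Nat.add_mul, Nat.one_mul] at *
    omega
  | div e f ih ih' =>
    simp only [Exp.ok, Bool.and_eq_true] at h
    have h1 := ih h.1
    have h3 := RAM.bits_div_le (e.eval σ) (f.eval σ)
    simp only [Exp.eval, Exp.width, Nat.add_mul] at *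
    omega

theorem Exp.cost_compile (hs : Sim σ τ) (hM : Bounded M F σ) (hB : BitsLE B σ) {e : Exp}
    (h : e.ok F = true) : e.compile.cost τ ≤ e.weight * (B + e.width * (M + 1) + 1) := by
  -- The bookkeeping common to all binary operations: two operand costs and one result length.
  have hbin : ∀ (w₁ w₂ d₁ d₂ k₁ k₂ k : ℕ), k₁ ≤ w₁ * (B + d₁ * (M + 1) + 1) →
      k₂ ≤ w₂ * (B + d₂ * (M + 1) + 1) → ∀ d, d₁ ≤ d → d₂ ≤ d → k ≤ B + d * (M + 1) →
      k₁ + k₂ + k ≤ (w₁ + w₂ + 1) * (B + d * (M + 1) + 1) := by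
    intro w₁ w₂ d₁ d₂ k₁ k₂ k h1 h2 d hd1 hd2 h3
    have h4 : w₁ * (B + d₁ * (M + 1) + 1) ≤ w₁ * (B + d * (M + 1) + 1) := by gcongr
    have h5 : w₂ * (B + d₂ * (M + 1) + 1) ≤ w₂ * (B + d * (M + 1) + 1) := by gcongr
    rw [Nat.add_mul, Nat.add_mul]
    omega
  have hval := Exp.bits_eval hM hB h
  induction e with
  | const z =>
    simp only [Exp.compile, RAM.Expr.cost, Exp.weight, Exp.eval] at *
    omega
  | reg r =>
    simp only [Exp.compile, RAM.Expr.cost, Exp.weight, Exp.eval, hs.reg] at *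
    omega
  | inp e ih =>
    simp only [Exp.ok] at h
    have h1 := ih h (Exp.bits_eval hM hB h)
    simp only [Exp.compile, RAM.Expr.cost, Exp.weight, hs.eval, hs.inp, Exp.eval, Exp.width] at *
    have := hbin e.weight 0 e.width 0 _ 0 (bits (σ.inp (e.eval σ))) h1 (by simp) (e.width + 1)
      (by omega) (by omega) hval
    simpa using this
  | arr a e f ih ih' =>
    simp only [Exp.ok, Bool.and_eq_true] at h
    have h1 := ih h.1 (Exp.bits_eval hM hB h.1)
    have h2 := ih' h.2 (Exp.bits_eval hM hB h.2)
    have h3 := cost_addrExpr_le τ e.compile f.compile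
    simp only [Exp.compile, RAM.Expr.cost, Exp.weight, Exp.eval, Exp.width, hs.eval_addr,
      hs.arr] at *
    have h4 := hbin _ _ _ _ _ _ 0 h1 h2 (e.width + f.width) (by omega) (by omega) (by omega)
    have h5 : 1 ≤ B + (e.width + f.width) * (M + 1) + 1 := by omega
    rw [Nat.add_mul _ 1, Nat.one_mul, Nat.mul_assoc]
    have h6 : e.compile.cost τ + f.compile.cost τ + 1 ≤
      (e.weight + f.weight + 1) * (B + (e.width + f.width) * (M + 1) + 1) := by
      have h7 := hbin _ _ _ _ _ _ 0 h1 h2 (e.width + f.width) (by omega) (by omega) (by omega)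
      have h8 : e.weight * (B + e.width * (M + 1) + 1) ≤
        e.weight * (B + (e.width + f.width) * (M + 1) + 1) := by gcongr; omega
      have h9 : f.weight * (B + f.width * (M + 1) + 1) ≤
        f.weight * (B + (e.width + f.width) * (M + 1) + 1) := by gcongr; omega
      rw [Nat.add_mul, Nat.add_mul]
      omega
    omega
  | add e f ih ih' =>
    simp only [Exp.ok, Bool.and_eq_true] at h
    have h1 := ih h.1 (Exp.bits_eval hM hB h.1)
    have h2 := ih' h.2 (Exp.bits_eval hM hB h.2)
    simp only [Exp.compile, RAM.Expr.cost, Exp.weight, hs.eval, Exp.eval, Exp.width] at *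
    exact hbin _ _ _ _ _ _ _ h1 h2 _ (by omega) (by omega) hval
  | sub e f ih ih' =>
    simp only [Exp.ok, Bool.and_eq_true] at h
    have h1 := ih h.1 (Exp.bits_eval hM hB h.1)
    have h2 := ih' h.2 (Exp.bits_eval hM hB h.2)
    simp only [Exp.compile, RAM.Expr.cost, Exp.weight, hs.eval, Exp.eval, Exp.width] at *
    exact hbin _ _ _ _ _ _ _ h1 h2 _ (by omega) (by omega) hval
  | mul e f ih ih' =>
    simp only [Exp.ok, Bool.and_eq_true] at h
    have h1 := ih h.1.1 (Exp.bits_eval hM hB h.1.1)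
    have h2 := ih' h.1.2 (Exp.bits_eval hM hB h.1.2)
    simp only [Exp.compile, RAM.Expr.cost, Exp.weight, hs.eval, Exp.eval, Exp.width] at *
    exact hbin _ _ _ _ _ _ _ h1 h2 _ (by omega) (by omega) hval
  | div e f ih ih' =>
    simp only [Exp.ok, Bool.and_eq_true] at h
    have h1 := ih h.1 (Exp.bits_eval hM hB h.1)
    have h2 := ih' h.2 (Exp.bits_eval hM hB h.2)
    simp only [Exp.compile, RAM.Expr.cost, Exp.weight, hs.eval, Exp.eval, Exp.width] at *
    exact hbin _ _ _ _ _ _ _ h1 h2 _ (by omega) (by omega) hval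

end Loop

/-! ### Commands of the loop language, their semantics and their running time -/

namespace Loop

open RAM (bits)

inductive Cmd
  | skip
  | assign (r : ℕ) (e : Exp)
  | store (a : ℕ) (e f g : Exp)
  | emit (e : Exp)
  | seq (c d : Cmd)
  /-- if `e < f` then `c` else `d` -/
  | ite (e f : Exp) (c d : Cmd)
  /-- if `e = f` then `c` else `d` -/
  | iteq (e f : Exp) (c d : Cmd)
  /-- `c` for all values `0, …, k - 1` of the register `i`, where `k` is a register -/
  | loop (i k : ℕ) (c : Cmd)
  /-- the number of binary digits of `e`, in register `r`; register `q` is auxiliary -/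
  | log (r q : ℕ) (e : Exp)

infixr:60 " ;; " => Cmd.seq

namespace Cmd

/-- The bound of a loop is read once, at the start. The clauses also fix the final contents of
auxiliary registers as the compiled program leaves them: the counter holds the number of rounds, and
`q` holds `min (e.eval σ) 0`, since the halving loop stops at zero, or at once if the value is not
positive. -/
def exec : Cmd → Mem → Mem
  | skip, σ => σ
  | assign r e, σ => σ.set r (e.eval σ)
  | store a e f g, σ => σ.put a (e.eval σ) (f.eval σ) (g.eval σ)
  | emit e, σ => σ.push (e.eval σ)
  | seq c d, σ => d.exec (c.exec σ)
  | ite e f c d, σ => if e.eval σ < f.eval σ then c.exec σ else d.exec σ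
  | iteq e f c d, σ => if e.eval σ = f.eval σ then c.exec σ else d.exec σ
  | loop i k c, σ =>
    Stroll.iter (fun j ρ => (c.exec ρ).set i (j + 1)) (σ.reg k).toNat (σ.set i 0)
  | log r q e, σ => (σ.set q (min (e.eval σ) 0)).set r (Nat.size (e.eval σ).toNat)

/-- The registers that are changed. -/
def regs : Cmd → List ℕ
  | skip => []
  | assign r _ => [r]
  | store _ _ _ _ => []
  | emit _ => []
  | seq c d => c.regs ++ d.regs
  | ite _ _ c d => c.regs ++ d.regs
  | iteq _ _ c d => c.regs ++ d.regs
  | loop i _ c => i :: c.regs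
  | log r q _ => [r, q]

/-- The arrays that are changed. -/
def arrs : Cmd → List ℕ
  | store a _ _ _ => [a]
  | seq c d => c.arrs ++ d.arrs
  | ite _ _ c d => c.arrs ++ d.arrs
  | iteq _ _ c d => c.arrs ++ d.arrs
  | loop _ _ c => c.arrs
  | _ => []

/-- There is no output. -/
def silent : Cmd → Bool
  | emit _ => false
  | seq c d => c.silent && d.silent
  | ite _ _ c d => c.silent && d.silent
  | iteq _ _ c d => c.silent && d.silent
  | loop _ _ c => c.silent
  | _ => true

/-- The program respects the frozen registers `F`. -/
def ok (F : List ℕ) : Cmd → Bool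
  | skip => true
  | assign r e => e.ok F && decide (r ∉ F)
  | store _ e f g => e.ok F && f.ok F && g.ok F
  | emit e => e.ok F
  | seq c d => c.ok F && d.ok F
  | ite e f c d => e.ok F && f.ok F && c.ok F && d.ok F
  | iteq e f c d => e.ok F && f.ok F && c.ok F && d.ok F
  | loop i k c => decide (k ∈ F) && decide (i ∉ F) && decide (i ∉ c.regs) && c.ok F
  | log r q e => e.ok F && decide (r ∉ F) && decide (q ∉ F) && decide (r ≠ q)

/-- The machine can only test positivity, so equality is decided by testing both differences. The
empty command becomes a copy of a register to itself. -/
def compile : Cmd → RAM.Program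
  | skip => .assign 0 (.reg 0)
  | assign r e => .assign r e.compile
  | store a e f g => .store (a + 1) (Exp.addrExpr e.compile f.compile) g.compile
  | emit e => .emit e.compile
  | seq c d => .seq c.compile d.compile
  | ite e f c d => .branch (.sub f.compile e.compile) c.compile d.compile
  | iteq e f c d => .branch (.sub f.compile e.compile) d.compile
      (.branch (.sub e.compile f.compile) d.compile c.compile)
  | loop i k c => .seq (.assign i (.const 0)) (.loop (.sub (.reg k) (.reg i))
      (.seq c.compile (.assign i (.add (.reg i) (.const 1)))))
  | log r q e => .seq (.assign q e.compile) (.seq (.assign r (.const 0)) (.loop (.reg q)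
      (.seq (.assign q (.div (.reg q) (.const 2))) (.assign r (.add (.reg r) (.const 1))))))

open Polynomial in
/-- Bounds the number of steps. -/
noncomputable def steps : Cmd → ℕ[X]
  | skip => 1
  | assign _ e => C (e.weight + e.width + 1)
  | store _ e f g => C (60 * (e.weight + f.weight + 1) + g.weight + e.width + f.width + g.width + 1)
  | emit e => C (e.weight + e.width + 1)
  | seq c d => c.steps + d.steps
  | ite e f c d => C (e.weight + f.weight + 2 + (e.width + f.width + 1)) + c.steps + d.steps
  | iteq e f c d =>
    C (2 * (e.weight + f.weight + 2 + (e.width + f.width + 1))) + c.steps + d.steps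
  | loop _ _ c => X * (c.steps + C 10) + C 10
  | log _ _ e => C (e.weight + e.width + 60)

theorem exec_inp (c : Cmd) (σ : Mem) : (c.exec σ).inp = σ.inp := by
  induction c generalizing σ with
  | seq c d ih ih' => simp [exec, ih, ih']
  | ite e f c d ih ih' => simp only [exec]; split_ifs <;> simp [ih, ih']
  | iteq e f c d ih ih' => simp only [exec]; split_ifs <;> simp [ih, ih']
  | loop i k c ih =>
    simp only [exec]
    generalize (σ.reg k).toNat = n
    induction n with
    | zero => rfl
    | succ n ihn => simpa [Stroll.iter, ih] using ihn
  | _ => rfl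

theorem exec_reg {c : Cmd} {r : ℕ} (h : r ∉ c.regs) (σ : Mem) : (c.exec σ).reg r = σ.reg r := by
  induction c generalizing σ with
  | assign r' e => simp_all [exec, regs]
  | seq c d ih ih' =>
    simp only [regs, List.mem_append, not_or] at h
    simp [exec, ih h.1, ih' h.2]
  | ite e f c d ih ih' =>
    simp only [regs, List.mem_append, not_or] at h
    simp only [exec]; split_ifs <;> simp [ih h.1, ih' h.2]
  | iteq e f c d ih ih' =>
    simp only [regs, List.mem_append, not_or] at h
    simp only [exec]; split_ifs <;> simp [ih h.1, ih' h.2]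
  | loop i k c ih =>
    simp only [regs, List.mem_cons, not_or] at h
    simp only [exec]
    generalize (σ.reg k).toNat = n
    induction n with
    | zero => simp [Stroll.iter, h.1]
    | succ n ihn => simpa [Stroll.iter, ih h.2, h.1] using ihn
  | log r q e => simp_all [exec, regs]
  | _ => rfl

theorem exec_arr {c : Cmd} {a : ℕ} (h : a ∉ c.arrs) (σ : Mem) : (c.exec σ).arr a = σ.arr a := by
  induction c generalizing σ with
  | store a' e f g =>
    simp only [arrs, List.mem_singleton] at h
    funext i j
    simp [exec, h]
  | seq c d ih ih' =>
    simp only [arrs, List.mem_append, not_or] at h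
    simp [exec, ih h.1, ih' h.2]
  | ite e f c d ih ih' =>
    simp only [arrs, List.mem_append, not_or] at h
    simp only [exec]; split_ifs <;> simp [ih h.1, ih' h.2]
  | iteq e f c d ih ih' =>
    simp only [arrs, List.mem_append, not_or] at h
    simp only [exec]; split_ifs <;> simp [ih h.1, ih' h.2]
  | loop i k c ih =>
    simp only [arrs] at h
    simp only [exec]
    generalize (σ.reg k).toNat = n
    induction n with
    | zero => rfl
    | succ n ihn => simpa [Stroll.iter, ih h] using ihn
  | _ => rfl

theorem exec_out {c : Cmd} (h : c.silent = true) (σ : Mem) : (c.exec σ).out = σ.out := by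
  induction c generalizing σ with
  | emit e => simp [silent] at h
  | seq c d ih ih' =>
    simp only [silent, Bool.and_eq_true] at h
    simp [exec, ih h.1, ih' h.2]
  | ite e f c d ih ih' =>
    simp only [silent, Bool.and_eq_true] at h
    simp only [exec]; split_ifs <;> simp [ih h.1, ih' h.2]
  | iteq e f c d ih ih' =>
    simp only [silent, Bool.and_eq_true] at h
    simp only [exec]; split_ifs <;> simp [ih h.1, ih' h.2]
  | loop i k c ih =>
    simp only [silent] at h
    simp only [exec]
    generalize (σ.reg k).toNat = n
    induction n with
    | zero => rfl
    | succ n ihn => simpa [Stroll.iter, ih h] using ihn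
  | _ => rfl

theorem ok_regs {F : List ℕ} {c : Cmd} (h : c.ok F = true) {r : ℕ} (hr : r ∈ F) : r ∉ c.regs := by
  induction c with
  | assign r' e =>
    simp only [ok, Bool.and_eq_true, decide_eq_true_eq, regs, List.mem_singleton] at *
    rintro rfl
    exact h.2 hr
  | seq c d ih ih' => simp_all [ok, regs]
  | ite e f c d ih ih' => simp_all [ok, regs]
  | iteq e f c d ih ih' => simp_all [ok, regs]
  | loop i k c ih =>
    simp only [ok, Bool.and_eq_true, decide_eq_true_eq, regs, List.mem_cons, not_or] at *
    refine ⟨?_, ih h.2⟩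
    rintro rfl
    exact h.1.1.2 hr
  | log r' q e =>
    simp only [ok, Bool.and_eq_true, decide_eq_true_eq, regs, List.mem_cons, not_or] at *
    refine ⟨?_, ?_, by simp⟩
    · rintro rfl
      exact h.1.1.2 hr
    · rintro rfl
      exact h.1.2 hr
  | _ => simp [regs]

end Cmd

variable {M B : ℕ} {F : List ℕ} {σ : Mem} {τ : RAM.State}

theorem Bounded.exec (h : Bounded M F σ) {c : Cmd} (hc : c.ok F = true) :
    Bounded M F (c.exec σ) :=
  ⟨fun r hr => by rw [Cmd.exec_reg (Cmd.ok_regs hc hr)]; exact h.reg r hr,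
    fun z => by rw [Cmd.exec_inp]; exact h.inp z⟩

theorem Bounded.set (h : Bounded M F σ) {r : ℕ} (hr : r ∉ F) (z : ℤ) : Bounded M F (σ.set r z) := by
  refine ⟨fun r' hr' => ?_, h.inp⟩
  have : r' ≠ r := fun e => hr (e ▸ hr')
  simpa [this] using h.reg r' hr'

theorem Sim.set (h : Sim σ τ) (r : ℕ) (z : ℤ) :
    Sim (σ.set r z) { τ with reg := Function.update τ.reg r z } :=
  ⟨h.inp, by simp [Mem.set, h.reg], h.arr, h.out⟩

theorem Sim.put (h : Sim σ τ) (a : ℕ) (i j z : ℤ) : Sim (σ.put a i j z)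
    { τ with
      arr := Function.update τ.arr (a + 1)
        (Function.update (τ.arr (a + 1)) (addr i j) z) } := by
  refine ⟨fun w => ?_, h.reg, fun a' i' j' => ?_, h.out⟩
  · simp [h.inp]
  · simp only [Mem.put_arr, Function.update_apply, Nat.add_right_cancel_iff]
    by_cases ha : a' = a
    · subst ha
      simp [Function.update_apply, addr_inj, h.arr]
    · simp [ha, h.arr]

theorem BitsLE.mono (h : BitsLE B σ) {B' : ℕ} (hB : B ≤ B') : BitsLE B' σ :=
  ⟨fun r => (h.reg r).trans hB, fun a i j => (h.arr a i j).trans hB⟩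

theorem BitsLE.set (h : BitsLE B σ) (r : ℕ) {z : ℤ} (hz : bits z ≤ B) : BitsLE B (σ.set r z) := by
  refine ⟨fun r' => ?_, h.arr⟩
  rw [Mem.set_reg]
  split_ifs
  · exact hz
  · exact h.reg r'

theorem BitsLE.put (h : BitsLE B σ) (a : ℕ) (i j : ℤ) {z : ℤ} (hz : bits z ≤ B) :
    BitsLE B (σ.put a i j z) := by
  refine ⟨h.reg, fun a' i' j' => ?_⟩
  rw [Mem.put_arr]
  split_ifs
  · exact hz
  · exact h.arr a' i' j'

/-- The bound for the cost of a program of `T` steps. -/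
def budget (M B T : ℕ) : ℕ := T * (B + T * (M + 1) + 1) ^ 2

/-- After the first program the length bound has grown to `B + T₁ * (M + 1)`, so the bound `B + (T₁
+ T₂) * (M + 1)` serves both parts; with this common base the costs are additive in the number of
steps. -/
theorem budget_seq {k₁ k₂ T₁ T₂ : ℕ} (h₁ : k₁ ≤ budget M B T₁)
    (h₂ : k₂ ≤ budget M (B + T₁ * (M + 1)) T₂) : k₁ + k₂ ≤ budget M B (T₁ + T₂) := by
  have e₁ : budget M B T₁ ≤ T₁ * (B + (T₁ + T₂) * (M + 1) + 1) ^ 2 := by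
    unfold budget
    gcongr
    omega
  have e₂ : budget M (B + T₁ * (M + 1)) T₂ ≤ T₂ * (B + (T₁ + T₂) * (M + 1) + 1) ^ 2 := by
    have : B + T₁ * (M + 1) + T₂ * (M + 1) + 1 = B + (T₁ + T₂) * (M + 1) + 1 := by ring
    unfold budget
    rw [this]
  have e₃ : budget M B (T₁ + T₂) = T₁ * (B + (T₁ + T₂) * (M + 1) + 1) ^ 2 +
    T₂ * (B + (T₁ + T₂) * (M + 1) + 1) ^ 2 := by
    unfold budget
    ring
  omega

theorem le_budget {k w d T : ℕ} (h : k ≤ w * (B + d * (M + 1) + 1)) (hw : w ≤ T) (hd : d ≤ T) :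
    k ≤ budget M B T := by
  refine h.trans ?_
  unfold budget
  have h1 : B + d * (M + 1) + 1 ≤ B + T * (M + 1) + 1 := by gcongr
  calc w * (B + d * (M + 1) + 1) ≤ T * (B + T * (M + 1) + 1) := by gcongr
    _ ≤ _ := by
      gcongr
      exact Nat.le_self_pow (by norm_num) _

theorem budget_mono {T T' B' : ℕ} (hT : T ≤ T') (hB : B + T * (M + 1) ≤ B' + T' * (M + 1)) :
    budget M B T ≤ budget M B' T' := by
  unfold budget
  gcongr

/-- Halving removes one binary digit and the counter gains one. The parameter `b` bounds the number
of rounds and `c` the lengths of all values involved. -/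
theorem log_run {r q : ℕ} (hrq : r ≠ q) (b : ℕ) (v : ℕ) (hv : v < 2 ^ b) (τ : RAM.State)
    (hq : τ.reg q = v) (k : ℕ) (hr : τ.reg r = k) (c : ℕ) (hc : k + Nat.size v ≤ c) (hb : b ≤ c) :
    ∃ l, RAM.Run (.loop (.reg q) (.seq (.assign q (.div (.reg q) (.const 2)))
      (.assign r (.add (.reg r) (.const 1))))) τ
        { τ with reg := Function.update (Function.update τ.reg q 0) r (k + Nat.size v : ℕ) } l ∧
        l ≤ (b + 1) * (6 * c + 20) := by
  induction b generalizing v τ k with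
  | zero =>
    obtain rfl : v = 0 := by simpa using hv
    refine ⟨(RAM.Expr.reg q).cost τ + 1, ?_, ?_⟩
    · have h1 : τ =
          { τ with reg := Function.update (Function.update τ.reg q 0) r (k + Nat.size 0 : ℕ) } := by
        have h2 : Function.update τ.reg q 0 = τ.reg := by
          rw [show (0 : ℤ) = τ.reg q by simp [hq], Function.update_eq_self]
        have h3 : Function.update τ.reg r (k + Nat.size 0 : ℕ) = τ.reg := by
          rw [show ((k + Nat.size 0 : ℕ) : ℤ) = τ.reg r by simp [hr], Function.update_eq_self]
        rw [h2, h3]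
      rw [← h1]
      exact .loop_neg (by simp [RAM.Expr.eval, hq])
    · simp [RAM.Expr.cost, hq, bits]
  | succ b ih =>
    have bits_nat : ∀ (z d : ℕ), z < 2 ^ d → d ≤ c → bits (z : ℤ) ≤ c + 1 := fun z d h1 h2 =>
      RAM.bits_le_iff.2 (by simpa using h1.trans_le (Nat.pow_le_pow_right (by norm_num) h2))
    by_cases hv0 : v = 0
    · subst hv0
      obtain ⟨l, h1, h2⟩ := ih 0 (by positivity) τ hq k hr hc (by omega)
      exact ⟨l, h1, h2.trans (Nat.mul_le_mul_right _ (by omega))⟩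
    · have hsz : Nat.size v = Nat.size (v / 2) + 1 := by
        conv_lhs => rw [← Nat.bit_bodd_div2 v]
        rw [Nat.size_bit (by rwa [Nat.bit_bodd_div2]), Nat.div2_val]
      obtain ⟨l, h1, h2⟩ := ih (v / 2) (by rw [pow_succ] at hv; omega)
        { τ with reg := Function.update (Function.update τ.reg q (v / 2 : ℕ)) r (k + 1 : ℕ) }
        (by simp [hrq.symm]) (k + 1) (by simp) (by omega) (by omega)
      refine ⟨_, RAM.Run.loop_pos (by simp [RAM.Expr.eval, hq]; omega)
        (.seq (.assign _ _ _) (.assign _ _ _)) (l := l) ?_, ?_⟩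
      · have e1 : Function.update (Function.update τ.reg q (τ.reg q / 2)) r
            (Function.update τ.reg q (τ.reg q / 2) r + 1) =
            Function.update (Function.update τ.reg q (v / 2 : ℕ)) r (k + 1 : ℕ) := by
          rw [Function.update_of_ne hrq, hq, hr]
          push_cast
          rfl
        have e2 : Function.update (Function.update (Function.update (Function.update τ.reg q
            ((v / 2 : ℕ) : ℤ)) r ((k + 1 : ℕ) : ℤ)) q 0) r ((k + 1 + Nat.size (v / 2) : ℕ) : ℤ) =
            Function.update (Function.update τ.reg q 0) r ((k + Nat.size v : ℕ) : ℤ) := by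
          rw [hsz]
          funext x
          by_cases hx : x = r
          · subst hx
            simp
            ring
          · by_cases hx' : x = q
            · subst hx'
              simp [hx]
            · simp [hx, hx']
        simp only [RAM.Expr.eval]
        rw [e1]
        simp only [e2] at h1
        exact h1
      · have b1 := bits_nat v _ hv hb
        have b2 := bits_nat (v / 2) b (by rw [pow_succ] at hv; omega) (by omega)
        have b3 : bits (k : ℤ) ≤ c + 1 := RAM.bits_le_of_natAbs_le (by simp; omega)
        have b4 : bits ((k : ℤ) + 1) ≤ c + 1 := RAM.bits_le_of_natAbs_le (by omega)
        have b5 : bits 2 = 3 := by decide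
        have b6 : bits 1 = 2 := by decide
        push_cast at b2
        simp only [RAM.Expr.cost, RAM.Expr.eval, Function.update_of_ne hrq, hq, hr, b5, b6]
        have : (b + 1 + 1) * (6 * c + 20) = (b + 1) * (6 * c + 20) + (6 * c + 20) := by ring
        omega

/-- Compiled programs simulate the semantics, lengthen values by at most `M + 1` bits per step, and
stay within the budget. As `steps` is a polynomial in `M`, a fixed program runs in polynomial time
wherever frozen registers and input lengths are polynomially bounded. -/
theorem Cmd.run {c : Cmd} (hc : c.ok F = true) (hs : Sim σ τ) (hM : Bounded M F σ)
    (hB : BitsLE B σ) : ∃ τ' k, RAM.Run c.compile τ τ' k ∧ Sim (c.exec σ) τ' ∧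
      BitsLE (B + c.steps.eval M * (M + 1)) (c.exec σ) ∧ k ≤ budget M B (c.steps.eval M) := by
  induction c generalizing σ τ B with
  | skip =>
    refine ⟨_, _, .assign _ _ _, ?_, hB.mono (by omega), ?_⟩
    · have : Function.update τ.reg 0 ((RAM.Expr.reg 0).eval τ) = τ.reg := by
        simp [RAM.Expr.eval]
      rw [this]
      exact hs
    · have := hB.reg 0
      refine le_budget (w := 1) (d := 0) ?_ (by simp [steps]) (by simp)
      simp only [RAM.Expr.cost, hs.reg]
      omega
  | assign r e =>
    simp only [ok, Bool.and_eq_true] at hc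
    have h1 := Exp.bits_eval hM hB hc.1
    have h2 := Exp.cost_compile hs hM hB hc.1
    refine ⟨_, _, .assign _ _ _, ?_, ?_, ?_⟩
    · rw [hs.eval]
      exact hs.set r _
    · refine BitsLE.set (hB.mono (by omega)) r (h1.trans ?_)
      simp only [steps, Polynomial.eval_C]
      gcongr
      omega
    · refine le_budget (w := e.weight + 1) (d := e.width) ?_ ?_ ?_
      · rw [Nat.add_mul]
        omega
      · simp only [steps, Polynomial.eval_C]
        omega
      · simp only [steps, Polynomial.eval_C]
        omega
  | store a e f g =>
    simp only [ok, Bool.and_eq_true] at hc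
    have h1 := Exp.bits_eval hM hB hc.2
    have h2 := Exp.cost_compile hs hM hB hc.2
    have h3 := Exp.cost_compile hs hM hB hc.1.1
    have h4 := Exp.cost_compile hs hM hB hc.1.2
    have h5 := cost_addrExpr_le τ e.compile f.compile
    refine ⟨_, _, .store _ _ _ _, ?_, ?_, ?_⟩
    · rw [hs.eval, hs.eval_addr]
      exact hs.put a _ _ _
    · refine BitsLE.put (hB.mono (by omega)) a _ _ (h1.trans ?_)
      simp only [steps, Polynomial.eval_C]
      gcongr
      omega
    · refine le_budget (w := 60 * (e.weight + f.weight + 1) + g.weight + 1)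
        (d := e.width + f.width + g.width) ?_ ?_ ?_
      · have m1 : e.weight * (B + e.width * (M + 1) + 1) ≤
          e.weight * (B + (e.width + f.width + g.width) * (M + 1) + 1) := by gcongr; omega
        have m2 : f.weight * (B + f.width * (M + 1) + 1) ≤
          f.weight * (B + (e.width + f.width + g.width) * (M + 1) + 1) := by gcongr; omega
        have m3 : g.weight * (B + g.width * (M + 1) + 1) ≤
          g.weight * (B + (e.width + f.width + g.width) * (M + 1) + 1) := by gcongr; omega
        generalize B + (e.width + f.width + g.width) * (M + 1) = U at *
        have e1 : (60 * (e.weight + f.weight + 1) + g.weight + 1) * (U + 1) =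
          60 * (e.weight * (U + 1)) + 60 * (f.weight * (U + 1)) + 60 * (U + 1) +
            g.weight * (U + 1) + (U + 1) := by ring
        omega
      · simp only [steps, Polynomial.eval_C]
        omega
      · simp only [steps, Polynomial.eval_C]
        omega
  | emit e =>
    simp only [ok] at hc
    have h2 := Exp.cost_compile hs hM hB hc
    refine ⟨_, _, .emit _ _, ?_, ?_, ?_⟩
    · rw [hs.eval]
      exact ⟨hs.inp, hs.reg, hs.arr, by simp [exec, Mem.push, hs.out]⟩
    · exact ⟨(hB.mono (by omega)).reg, (hB.mono (by omega)).arr⟩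
    · refine le_budget (w := e.weight + 1) (d := e.width) ?_ ?_ ?_
      · rw [Nat.add_mul]
        omega
      · simp only [steps, Polynomial.eval_C]
        omega
      · simp only [steps, Polynomial.eval_C]
        omega
  | seq c d ih ih' =>
    simp only [ok, Bool.and_eq_true] at hc
    obtain ⟨τ₁, k₁, hr₁, hs₁, hB₁, hk₁⟩ := ih hc.1 hs hM hB
    obtain ⟨τ₂, k₂, hr₂, hs₂, hB₂, hk₂⟩ := ih' hc.2 hs₁ (hM.exec hc.1) hB₁
    refine ⟨τ₂, k₁ + k₂, .seq hr₁ hr₂, hs₂, hB₂.mono ?_, ?_⟩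
    · simp only [steps, Polynomial.eval_add, Nat.add_mul]
      omega
    · simp only [steps, Polynomial.eval_add]
      exact budget_seq hk₁ hk₂
  | ite e f c d ih ih' =>
    simp only [ok, Bool.and_eq_true] at hc
    obtain ⟨⟨⟨he, hf⟩, hc⟩, hd⟩ := hc
    have hsub : (Exp.sub f e).ok F = true := by simp [Exp.ok, he, hf]
    have hk : (Exp.sub f e).compile.cost τ + 1 ≤ budget M B
        (e.weight + f.weight + 2 + (e.width + f.width + 1)) := by
      have := Exp.cost_compile hs hM hB hsub
      refine le_budget (w := f.weight + e.weight + 1 + 1) (d := f.width + e.width + 1)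
        ?_ (by omega) (by omega)
      simp only [Exp.weight, Exp.width] at this
      rw [Nat.add_mul]
      omega
    have hev : (RAM.Expr.sub f.compile e.compile).eval τ = f.eval σ - e.eval σ := by
      simp [RAM.Expr.eval, hs.eval]
    simp only [exec, steps, Polynomial.eval_add, Polynomial.eval_C]
    generalize e.weight + f.weight + 2 + (e.width + f.width + 1) = T at *
    by_cases hlt : e.eval σ < f.eval σ
    · rw [if_pos hlt]
      obtain ⟨τ₁, k₁, hr₁, hs₁, hB₁, hk₁⟩ := ih hc hs hM hB
      refine ⟨τ₁, _, .branch_pos (by rw [hev]; omega) hr₁, hs₁, hB₁.mono (Nat.add_le_add_left (Nat.mul_le_mul_right _ (by omega)) _), ?_⟩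
      refine (budget_seq hk (hk₁.trans (budget_mono le_rfl (by omega)))).trans
        (budget_mono (by omega) (Nat.add_le_add_left (Nat.mul_le_mul_right _ (by omega)) _))
    · rw [if_neg hlt]
      obtain ⟨τ₁, k₁, hr₁, hs₁, hB₁, hk₁⟩ := ih' hd hs hM hB
      refine ⟨τ₁, _, .branch_neg (by rw [hev]; omega) hr₁, hs₁, hB₁.mono (Nat.add_le_add_left (Nat.mul_le_mul_right _ (by omega)) _), ?_⟩
      refine (budget_seq hk (hk₁.trans (budget_mono le_rfl (by omega)))).trans
        (budget_mono (by omega) (Nat.add_le_add_left (Nat.mul_le_mul_right _ (by omega)) _))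
  | iteq e f c d ih ih' =>
    simp only [ok, Bool.and_eq_true] at hc
    obtain ⟨⟨⟨he, hf⟩, hc⟩, hd⟩ := hc
    have hk : ∀ e f : Exp, e.ok F = true → f.ok F = true → (Exp.sub f e).compile.cost τ + 1 ≤
        budget M B (e.weight + f.weight + 2 + (e.width + f.width + 1)) := by
      intro e f he hf
      have hsub : (Exp.sub f e).ok F = true := by simp [Exp.ok, he, hf]
      have := Exp.cost_compile hs hM hB hsub
      refine le_budget (w := f.weight + e.weight + 1 + 1) (d := f.width + e.width + 1)
        ?_ (by omega) (by omega)
      simp only [Exp.weight, Exp.width] at this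
      rw [Nat.add_mul]
      omega
    have hk1 := hk e f he hf
    have hk2 := hk f e hf he
    rw [Nat.add_comm f.weight, Nat.add_comm f.width] at hk2
    have hev : (RAM.Expr.sub f.compile e.compile).eval τ = f.eval σ - e.eval σ := by
      simp [RAM.Expr.eval, hs.eval]
    have hev' : (RAM.Expr.sub e.compile f.compile).eval τ = e.eval σ - f.eval σ := by
      simp [RAM.Expr.eval, hs.eval]
    simp only [exec, steps, Polynomial.eval_add, Polynomial.eval_C]
    generalize e.weight + f.weight + 2 + (e.width + f.width + 1) = T at *
    by_cases heq : e.eval σ = f.eval σ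
    · rw [if_pos heq]
      obtain ⟨τ₁, k₁, hr₁, hs₁, hB₁, hk₁⟩ := ih hc hs hM hB
      refine ⟨τ₁, _, .branch_neg (by rw [hev]; omega) (.branch_neg (by rw [hev']; omega) hr₁), hs₁,
        hB₁.mono (Nat.add_le_add_left (Nat.mul_le_mul_right _ (by omega)) _), ?_⟩
      refine (budget_seq hk1 (budget_seq (hk2.trans (budget_mono le_rfl (by omega)))
        (hk₁.trans (budget_mono le_rfl ?_)))).trans (budget_mono ?_ ?_)
      · omega
      · omega
      · exact Nat.add_le_add_left (Nat.mul_le_mul_right _ (by omega)) _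
    · rw [if_neg heq]
      obtain ⟨τ₁, k₁, hr₁, hs₁, hB₁, hk₁⟩ := ih' hd hs hM hB
      rcases lt_or_gt_of_ne heq with hlt | hlt
      · refine ⟨τ₁, _, .branch_pos (by rw [hev]; omega) hr₁, hs₁, hB₁.mono (Nat.add_le_add_left (Nat.mul_le_mul_right _ (by omega)) _), ?_⟩
        refine (budget_seq hk1 (hk₁.trans (budget_mono le_rfl (by omega)))).trans
          (budget_mono (by omega) (Nat.add_le_add_left (Nat.mul_le_mul_right _ (by omega)) _))
      · refine ⟨τ₁, _, .branch_neg (by rw [hev]; omega) (.branch_pos (by rw [hev']; omega) hr₁),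
          hs₁, hB₁.mono (Nat.add_le_add_left (Nat.mul_le_mul_right _ (by omega)) _), ?_⟩
        refine (budget_seq hk1 (budget_seq (hk2.trans (budget_mono le_rfl (by omega)))
          (hk₁.trans (budget_mono le_rfl ?_)))).trans (budget_mono ?_ ?_)
        · omega
        · omega
        · exact Nat.add_le_add_left (Nat.mul_le_mul_right _ (by omega)) _
  | loop i k c ih =>
    simp only [ok, Bool.and_eq_true, decide_eq_true_eq] at hc
    obtain ⟨⟨⟨hkF, hiF⟩, hic⟩, hc⟩ := hc
    have hik : k ≠ i := by
      rintro rfl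
      exact hiF hkF
    have hn : (σ.reg k).toNat ≤ M := by
      have := hM.reg k hkF
      omega
    simp only [exec, steps, Polynomial.eval_add, Polynomial.eval_C, Polynomial.eval_mul,
      Polynomial.eval_X]
    set T := c.steps.eval M with hT
    set n := (σ.reg k).toNat with hndef
    set f : ℕ → Mem → Mem := fun j ρ => (c.exec ρ).set i (j + 1) with hf
    set body : RAM.Program := .seq c.compile (.assign i (.add (.reg i) (.const 1))) with hbody
    set test : RAM.Expr := .sub (.reg k) (.reg i) with htest
    set U := B + (M * (T + 10) + 10) * (M + 1) + 1 with hU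
    have hMU : M + 1 ≤ U := by nlinarith [Nat.zero_le (M * (T + 10)), Nat.zero_le B]
    have hUU : U ≤ U ^ 2 := Nat.le_self_pow (by norm_num) _
    -- Runs of a loop are built from their last round backwards. The invariant after `j` rounds is
    -- therefore phrased as a continuation: every run from the present state extends to one from the
    -- start. The summand `1` in the length bound is for the counter, and `10` in the cost for test
    -- and increment.
    have key : ∀ j ≤ n, ∃ τ' l, Sim (Stroll.iter f j (σ.set i 0)) τ' ∧
        Bounded M F (Stroll.iter f j (σ.set i 0)) ∧ (Stroll.iter f j (σ.set i 0)).reg i = j ∧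
        (Stroll.iter f j (σ.set i 0)).reg k = σ.reg k ∧
        BitsLE (B + (1 + j * T) * (M + 1)) (Stroll.iter f j (σ.set i 0)) ∧
        l ≤ j * ((T + 10) * U ^ 2) ∧
        ∀ τ'' l', RAM.Run (.loop test body) τ' τ'' l' →
          RAM.Run (.loop test body) { τ with reg := Function.update τ.reg i 0 } τ'' (l + l') := by
      intro j
      induction j with
      | zero =>
        intro _
        refine ⟨_, 0, hs.set i 0, hM.set hiF 0, by simp [Stroll.iter], by simp [Stroll.iter, hik],
          ?_, by simp, fun τ'' l' h => by simpa using h⟩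
        have : bits 0 = 1 := by decide
        refine BitsLE.set (hB.mono (by omega)) i ?_
        rw [this]
        nlinarith [Nat.zero_le B]
      | succ j ihj =>
        intro hj
        obtain ⟨τ₁, l, h1, h2, h3, h4, h5, h6, h7⟩ := ihj (by omega)
        set ρ := Stroll.iter f j (σ.set i 0) with hρ
        obtain ⟨τ₂, l₂, g1, g2, g3, g4⟩ := ih hc h1 h2 h5
        have hregi : (c.exec ρ).reg i = j := by rw [Cmd.exec_reg hic, h3]
        have hregk : (c.exec ρ).reg k = σ.reg k := by
          rw [Cmd.exec_reg (Cmd.ok_regs hc hkF), h4]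
        have hbj : bits (j : ℤ) ≤ M + 1 := RAM.bits_le_of_natAbs_le (by simp; omega)
        have hbj1 : bits ((j : ℤ) + 1) ≤ M + 1 := RAM.bits_le_of_natAbs_le (by omega)
        have hbk : bits (σ.reg k) ≤ M + 1 := RAM.bits_le_of_natAbs_le (hM.reg k hkF)
        have hbkj : bits (σ.reg k - j) ≤ M + 1 := by
          have h8 := hM.reg k hkF
          refine RAM.bits_le_of_natAbs_le ?_
          clear hregk hregi h3 h4
          omega
        have hgrow : B + (1 + j * T) * (M + 1) + T * (M + 1) = B + (1 + (j + 1) * T) * (M + 1) := by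
          ring
        have hgrow' : (1 + (j + 1) * T) * (M + 1) ≤ (M * (T + 10) + 10) * (M + 1) := by
          have h8 : (j + 1) * T ≤ M * T := Nat.mul_le_mul_right _ (by omega)
          exact Nat.mul_le_mul_right _ (by nlinarith)
        refine ⟨{ τ₂ with reg := Function.update τ₂.reg i ((j : ℤ) + 1) },
          l + (test.cost τ₁ + 1 + (l₂ + (RAM.Expr.cost τ₂ (.add (.reg i) (.const 1)) + 1))),
          g2.set i _,
          (h2.exec hc).set hiF _, ?_, ?_,
          ?_, ?_, fun τ'' l' h => ?_⟩
        · simp [Stroll.iter, hf]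
        · simp only [Stroll.iter]
          rw [← hρ]
          simp [hf, hik, hregk]
        · rw [hgrow] at g3
          refine g3.set i (hbj1.trans ?_)
          nlinarith [Nat.zero_le B, Nat.zero_le ((j + 1) * T)]
        · have b6 : bits 1 = 2 := by decide
          have e1 : test.cost τ₁ ≤ 3 * (M + 1) := by
            simp only [htest, RAM.Expr.cost, RAM.Expr.eval, h1.reg, h3, h4]
            omega
          have e2 : RAM.Expr.cost τ₂ (.add (.reg i) (.const 1)) ≤ 2 * (M + 1) + 2 := by
            simp only [RAM.Expr.cost, RAM.Expr.eval, g2.reg, hregi]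
            omega
          have e3 : l₂ ≤ T * U ^ 2 := by
            refine g4.trans ?_
            unfold budget
            rw [hgrow]
            gcongr
            omega
          have e4 : (j + 1) * ((T + 10) * U ^ 2) = j * ((T + 10) * U ^ 2) + T * U ^ 2 +
            10 * U ^ 2 := by ring
          omega
        · have := h7 τ'' _ (RAM.Run.loop_pos (e := test) (c := body) (σ := τ₁) ?_
            (.seq g1 (.assign i (.add (.reg i) (.const 1)) τ₂)) (l := l') ?_)
          · convert this using 1
            omega
          · simp only [htest, RAM.Expr.eval, h1.reg, h3, h4]
            omega
          · simpa [RAM.Expr.eval, g2.reg, hregi] using h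
    obtain ⟨τ', l, h1, h2, h3, h4, h5, h6, h7⟩ := key n le_rfl
    have b0 : bits 0 = 1 := by decide
    refine ⟨τ', _, .seq (.assign i (.const 0) τ) (h7 _ _ (.loop_neg ?_)), h1, h5.mono ?_, ?_⟩
    · simp only [htest, RAM.Expr.eval, h1.reg, h3, h4]
      omega
    · have : n * T ≤ M * T := by gcongr
      have h8 : 1 + n * T ≤ M * (T + 10) + 10 := by nlinarith
      exact Nat.add_le_add_left (Nat.mul_le_mul_right _ h8) _
    · have hbj : bits (n : ℤ) ≤ M + 1 := RAM.bits_le_of_natAbs_le (by simp; omega)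
      have hbk : bits (σ.reg k) ≤ M + 1 := RAM.bits_le_of_natAbs_le (hM.reg k hkF)
      have hbkj := RAM.bits_sub_le (σ.reg k) n
      have e1 : test.cost τ' ≤ 3 * (M + 1) + 1 := by
        simp only [htest, RAM.Expr.cost, RAM.Expr.eval, h1.reg, h3, h4]
        omega
      have e0 : (RAM.Expr.const 0).cost τ = 1 := by simp [RAM.Expr.cost, b0]
      have e2 : n * ((T + 10) * U ^ 2) ≤ M * ((T + 10) * U ^ 2) := by gcongr
      have e3 : budget M B (M * (T + 10) + 10) = M * ((T + 10) * U ^ 2) + 10 * U ^ 2 := by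
        unfold budget
        rw [← hU]
        ring
      rw [e0]
      omega
  | log r q e =>
    simp only [ok, Bool.and_eq_true, decide_eq_true_eq] at hc
    obtain ⟨⟨⟨he, -⟩, -⟩, hrq⟩ := hc
    have h1 := Exp.bits_eval hM hB he
    have h2 := Exp.cost_compile hs hM hB he
    set z := e.eval σ with hz
    set β := B + e.width * (M + 1) with hβ
    have hzb := RAM.one_le_bits z
    have b0 : bits 0 = 1 := by decide
    have hsize : Nat.size z.toNat ≤ bits z := by
      unfold RAM.bits
      have : z.toNat ≤ z.natAbs := by omega
      have := Nat.size_le_size this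
      omega
    have hmin : bits (min z 0) ≤ β := by
      rcases le_total z 0 with h | h
      · rwa [min_eq_left h]
      · rw [min_eq_right h, b0]
        omega
    have hsz : bits ((Nat.size z.toNat : ℕ) : ℤ) ≤ β := by
      rcases Nat.eq_zero_or_pos (Nat.size z.toNat) with h0 | h0
      · rw [h0]
        simp [b0]
        omega
      · have h3 : bits ((Nat.size z.toNat : ℕ) : ℤ) ≤ Nat.size z.toNat + 1 :=
          RAM.bits_le_of_natAbs_le (by simp)
        have h4 : Nat.size z.toNat + 1 ≤ bits z := by
          unfold RAM.bits
          have : z.toNat ≤ z.natAbs := by omega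
          have := Nat.size_le_size this
          omega
        omega
    have hfin : BitsLE β ((σ.set q (min z 0)).set r (Nat.size z.toNat)) :=
      ((hB.mono (by omega)).set q hmin).set r hsz
    have hβT : β ≤ B + (e.weight + e.width + 60) * (M + 1) := by
      rw [hβ]
      gcongr
      omega
    simp only [exec, steps, Polynomial.eval_C]
    set U := B + (e.weight + e.width + 60) * (M + 1) + 1 with hU
    have hUU : U ≤ U ^ 2 := Nat.le_self_pow (by norm_num) _
    have hbud : budget M B (e.weight + e.width + 60) = e.weight * U ^ 2 + e.width * U ^ 2 +
        60 * U ^ 2 := by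
      unfold budget
      rw [← hU]
      ring
    have hcost : e.compile.cost τ ≤ e.weight * U ^ 2 := by
      refine h2.trans ?_
      gcongr
      omega
    have h60 : 60 ≤ U := by
      rw [hU]
      nlinarith [Nat.zero_le B, Nat.zero_le (e.weight * (M + 1)), Nat.zero_le (e.width * (M + 1))]
    set τ₁ : RAM.State := { τ with reg := Function.update (Function.update τ.reg q z) r 0 } with hτ₁
    have hτeq : Sim ((σ.set q z).set r 0) τ₁ := (hs.set q z).set r 0
    have hrun : ∀ τ' l, RAM.Run (.loop (.reg q) (.seq (.assign q (.div (.reg q) (.const 2)))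
        (.assign r (.add (.reg r) (.const 1))))) τ₁ τ' l →
        RAM.Run (Cmd.log r q e).compile τ τ' (e.compile.cost τ + 1 + (2 + l)) := by
      intro τ' l h
      have := RAM.Run.seq (RAM.Run.assign q e.compile τ) (RAM.Run.seq (RAM.Run.assign r (.const 0) _)
        (by simpa [hs.eval, RAM.Expr.eval] using h))
      simpa [RAM.Expr.cost, b0, RAM.Expr.eval, compile] using this
    by_cases hpos : 0 < z
    · obtain ⟨l, g1, g2⟩ := log_run hrq (Nat.size z.toNat) z.toNat (Nat.lt_size_self _) τ₁
        (by simp [hτ₁, hrq.symm]; omega) 0 (by simp [hτ₁]) (bits z) (by omega) hsize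
      refine ⟨_, _, hrun _ _ g1, ?_, hfin.mono hβT, ?_⟩
      · refine ⟨hs.inp, ?_, hs.arr, hs.out⟩
        funext x
        simp only [hτ₁, Mem.set_reg, Function.update_apply, hs.reg]
        by_cases hx : x = r <;> by_cases hx' : x = q <;> simp [hx, hx', ← hz, min_eq_right hpos.le]
      · have e1 : (Nat.size z.toNat + 1) * (6 * bits z + 20) ≤ U * (26 * U) := by
          gcongr
          · omega
          · omega
        have e2 : U * (26 * U) = 26 * U ^ 2 := by ring
        omega
    · refine ⟨_, _, hrun _ _ (.loop_neg ?_), ?_, hfin.mono hβT, ?_⟩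
      · simp [RAM.Expr.eval, hτ₁, hrq.symm]
        omega
      · rw [min_eq_left (by omega), show z.toNat = 0 by omega]
        simpa using hτeq
      · have : (RAM.Expr.reg q).cost τ₁ = bits z := by
          simp [RAM.Expr.cost, hτ₁, hrq.symm]
        rw [this]
        omega

end Loop

/-! ### Reasoning about loops -/

namespace Loop

/-- `ρ` arises from `σ` by changes of the registers `R`, the arrays `A` and the output. -/
structure Frame (R A : List ℕ) (σ ρ : Mem) : Prop where
  inp : ρ.inp = σ.inp
  reg : ∀ r, r ∉ R → ρ.reg r = σ.reg r
  arr : ∀ a, a ∉ A → ρ.arr a = σ.arr a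

theorem Cmd.frame (c : Cmd) (σ : Mem) : Frame c.regs c.arrs σ (c.exec σ) :=
  ⟨c.exec_inp σ, fun _ h => exec_reg h σ, fun _ h => exec_arr h σ⟩

theorem Frame.refl (R A : List ℕ) (σ : Mem) : Frame R A σ σ :=
  ⟨rfl, fun _ _ => rfl, fun _ _ => rfl⟩

theorem Frame.trans {R A : List ℕ} {σ ρ ξ : Mem} (h : Frame R A σ ρ) (h' : Frame R A ρ ξ) :
    Frame R A σ ξ :=
  ⟨h'.inp.trans h.inp, fun r hr => (h'.reg r hr).trans (h.reg r hr),
    fun a ha => (h'.arr a ha).trans (h.arr a ha)⟩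

theorem Frame.mono {R A R' A' : List ℕ} {σ ρ : Mem} (h : Frame R A σ ρ) (hR : R ⊆ R')
    (hA : A ⊆ A') : Frame R' A' σ ρ :=
  ⟨h.inp, fun r hr => h.reg r fun h1 => hr (hR h1), fun a ha => h.arr a fun h1 => ha (hA h1)⟩

theorem Frame.set {R A : List ℕ} {σ ρ : Mem} (h : Frame R A σ ρ) {r : ℕ} (hr : r ∈ R) (z : ℤ) :
    Frame R A σ (ρ.set r z) := by
  refine ⟨h.inp, fun r' hr' => ?_, h.arr⟩
  have : r' ≠ r := fun e => hr' (e ▸ hr)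
  simp [this, h.reg r' hr']

namespace Cmd

section

variable (σ : Mem) (c d : Cmd) (e f g : Exp) (a r : ℕ)

theorem exec_skip : skip.exec σ = σ := rfl
theorem exec_assign : (assign r e).exec σ = σ.set r (e.eval σ) := rfl
theorem exec_store : (store a e f g).exec σ = σ.put a (e.eval σ) (f.eval σ) (g.eval σ) := rfl
theorem exec_emit : (emit e).exec σ = σ.push (e.eval σ) := rfl
theorem exec_seq : (c ;; d).exec σ = d.exec (c.exec σ) := rfl

variable {σ e f}

theorem exec_ite_pos (h : e.eval σ < f.eval σ) : (ite e f c d).exec σ = c.exec σ := if_pos h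
theorem exec_ite_neg (h : ¬ e.eval σ < f.eval σ) : (ite e f c d).exec σ = d.exec σ := if_neg h
theorem exec_iteq_pos (h : e.eval σ = f.eval σ) : (iteq e f c d).exec σ = c.exec σ := if_pos h
theorem exec_iteq_neg (h : ¬ e.eval σ = f.eval σ) : (iteq e f c d).exec σ = d.exec σ := if_neg h

end

variable {i j k n : ℕ} {c : Cmd} {σ : Mem}

/-- The body is reasoned about together with its frame, so an invariant need not mention anything
that the body leaves alone. Stability under assignment to `i` is required because the counter is
increased outside the body. -/
theorem loop_induct (hn : σ.reg k = n) (I : ℕ → Mem → Prop)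
    (hset : ∀ l ρ z, I l ρ → I l (ρ.set i z)) (h0 : I 0 σ)
    (hstep : ∀ l < n, ∀ ρ, Frame (i :: c.regs) c.arrs σ ρ → ρ.reg i = l → I l ρ →
      I (l + 1) (c.exec ρ)) : I n ((loop i k c).exec σ) := by
  have key : ∀ l ≤ n, Frame (i :: c.regs) c.arrs σ
      (Stroll.iter (fun j ρ => (c.exec ρ).set i (j + 1)) l (σ.set i 0)) ∧
      (Stroll.iter (fun j ρ => (c.exec ρ).set i (j + 1)) l (σ.set i 0)).reg i = l ∧
      I l (Stroll.iter (fun j ρ => (c.exec ρ).set i (j + 1)) l (σ.set i 0)) := by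
    intro l
    induction l with
    | zero =>
      exact fun _ => ⟨(Frame.refl _ _ _).set (by simp) _, by simp [Stroll.iter], hset _ _ _ h0⟩
    | succ l ih =>
      intro hl
      obtain ⟨h1, h2, h3⟩ := ih (by omega)
      refine ⟨Frame.set (h1.trans ((c.frame _).mono (by simp) (by simp))) (by simp) _,
        by simp [Stroll.iter], hset _ _ _ (hstep l hl _ h1 h2 h3)⟩
  have := (key n le_rfl).2.2
  simpa [exec, hn] using this

/-- Invariants are indexed by the set of treated indices rather than by their number, which suits
sums, products and universally quantified statements. -/
theorem loop_fin (hn : σ.reg k = n) (I : Finset (Fin n) → Mem → Prop)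
    (hset : ∀ D ρ z, I D ρ → I D (ρ.set i z)) (h0 : I ∅ σ)
    (hstep : ∀ D (p : Fin n), p ∉ D → ∀ ρ, Frame (i :: c.regs) c.arrs σ ρ → ρ.reg i = (p : ℕ) →
      I D ρ → I (insert p D) (c.exec ρ)) : I Finset.univ ((loop i k c).exec σ) := by
  have := loop_induct (c := c) (i := i) hn
    (fun l ρ => I (Finset.univ.filter fun p : Fin n => (p : ℕ) < l) ρ)
    (fun l ρ z h => hset _ _ _ h) (by simpa using h0) (fun l hl ρ hF hi h => ?_)
  · simpa using this
  · have h1 := hstep _ ⟨l, hl⟩ (by simp) ρ hF hi h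
    convert h1 using 1
    ext p
    simp [Fin.ext_iff]
    omega

theorem loop_fin₂ (hn : σ.reg k = n) (I : Finset (Fin n × Fin n) → Mem → Prop)
    (hset : ∀ D ρ z, I D ρ → I D (ρ.set i z)) (hset' : ∀ D ρ z, I D ρ → I D (ρ.set j z))
    (h0 : I ∅ σ) (hi : i ∉ j :: c.regs) (hk : k ∉ i :: j :: c.regs)
    (hstep : ∀ D (p q : Fin n), (p, q) ∉ D → ∀ ρ, Frame (i :: j :: c.regs) c.arrs σ ρ →
      ρ.reg i = (p : ℕ) → ρ.reg j = (q : ℕ) → I D ρ → I (insert (p, q) D) (c.exec ρ)) :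
    I Finset.univ ((loop i k (loop j k c)).exec σ) := by
  have := loop_fin (c := loop j k c) (i := i) hn (fun D ρ => I (D ×ˢ Finset.univ) ρ)
    (fun D ρ z h => hset _ _ _ h) (by simpa using h0) (fun D p hp ρ hF hρ h => ?_)
  · simpa using this
  -- Within row `p` the treated pairs are the finished rows and the part `E` of the current one.
  · have h1 := loop_fin (c := c) (i := j) (k := k) (σ := ρ) (n := n)
      ((hF.reg k hk).trans hn) (fun E ρ => I (D ×ˢ Finset.univ ∪ {p} ×ˢ E) ρ)
      (fun D ρ z h => hset' _ _ _ h) (by simpa using h) (fun E q hq ξ hF' hξ h => ?_)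
    · convert h1 using 1
      ext ⟨x, y⟩
      simp [or_comm, eq_comm]
    · have h2 := hstep _ p q (by simp [hp, hq]) ξ (hF.trans (hF'.mono
        (List.subset_cons_self _ _) (List.Subset.refl _)))
        ((hF'.reg i hi).trans hρ) hξ h
      convert h2 using 1
      ext ⟨x, y⟩
      simp only [Finset.mem_union, Finset.mem_product, Finset.mem_univ, Finset.mem_insert,
        Finset.mem_singleton, Prod.mk.injEq]
      tauto

end Cmd

/-- The array `a` as a matrix. -/
def Mem.mat (n : ℕ) (σ : Mem) (a : ℕ) (p q : Fin n) : ℤ := σ.arr a (p : ℕ) (q : ℕ)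

/-- Row `0` of the array `a` as a vector. -/
def Mem.vec (n : ℕ) (σ : Mem) (a : ℕ) (p : Fin n) : ℤ := σ.arr a 0 (p : ℕ)

namespace Cmd

/-- Add `g` to the entry `(e, f)` of the array `a`. -/
def addTo (a : ℕ) (e f g : Exp) : Cmd := store a e f (.arr a e f + g)

theorem exec_addTo {n : ℕ} {σ : Mem} {a : ℕ} {e f g : Exp} {p q : Fin n}
    (he : e.eval σ = (p : ℕ)) (hf : f.eval σ = (q : ℕ)) :
    ((addTo a e f g).exec σ).mat n a = Stroll.bump (σ.mat n a) p q (g.eval σ) := by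
  funext i j
  simp only [addTo, exec, Mem.mat, Mem.put_arr, he, hf, Stroll.bump, Exp.eval_add, Exp.eval_arr]
  by_cases h : i = p ∧ j = q
  · simp [h]
  · rw [if_neg h, if_neg]
    · simp
    · simpa [Fin.val_inj] using h

end Cmd

end Loop

/-! ### Maximum flows by capacity scaling -/

namespace Stroll

section Flow

variable {n : ℕ} {R : Fin n → Fin n → ℤ} {Δ : ℤ} {s u : Fin n}

/-- `l` rounds of a breadth first search along the entries of `R` that are at least `Δ`: the
vertices found have positive rank, and `pred` is the predecessor on a path from `s`. -/
structure Search (R : Fin n → Fin n → ℤ) (Δ : ℤ) (s : Fin n) (l : ℕ) (rank pred : Fin n → ℤ) :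
    Prop where
  root : rank s = 1
  nonneg : ∀ j, 0 ≤ rank j
  le : ∀ j, rank j ≤ l + 1
  pred : ∀ j, j ≠ s → rank j ≠ 0 → ∃ i : Fin n, pred j = (i : ℕ) ∧ 0 < rank i ∧ rank i < rank j ∧
    Δ ≤ R i j
  progress : (∀ i j, rank i ≠ 0 → rank j = 0 → R i j < Δ) ∨
    l + 1 ≤ (Finset.univ.filter fun j => rank j ≠ 0).card

theorem Search.start {rank pred : Fin n → ℤ} (hs : rank s = 1) (h : ∀ j, j ≠ s → rank j = 0) :
    Search R Δ s 0 rank pred where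
  root := hs
  nonneg j := by
    by_cases hj : j = s
    · simp [hj, hs]
    · simp [h j hj]
  le j := by
    by_cases hj : j = s
    · simp [hj, hs]
    · simp [h j hj]
  pred j hj hr := absurd (h j hj) hr
  progress := Or.inr (Finset.card_pos.2 ⟨s, by simp [hs]⟩)

/-- After `n` rounds the other alternative would require `n + 1` vertices. -/
theorem Search.closed {rank pred : Fin n → ℤ} (h : Search R Δ s n rank pred) :
    ∀ i j, rank i ≠ 0 → rank j = 0 → R i j < Δ := by
  rcases h.progress with h1 | h1
  · exact h1
  · have := Finset.card_le_univ (Finset.univ.filter fun j => rank j ≠ 0)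
    rw [Fintype.card_fin] at this
    omega

/-- The state within a round, after the pairs in `D` have been treated. -/
structure SearchRound (R : Fin n → Fin n → ℤ) (Δ : ℤ) (l : ℕ) (rank₀ pred₀ : Fin n → ℤ)
    (D : Finset (Fin n × Fin n)) (rank pred : Fin n → ℤ) : Prop where
  old : ∀ j, rank₀ j ≠ 0 → rank j = rank₀ j ∧ pred j = pred₀ j
  new : ∀ j, rank₀ j = 0 → rank j = 0 ∨ (rank j = l + 2 ∧
    ∃ i : Fin n, 0 < rank₀ i ∧ pred j = (i : ℕ) ∧ Δ ≤ R i j)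
  done : ∀ i j, (i, j) ∈ D → rank₀ i ≠ 0 → Δ ≤ R i j → rank j ≠ 0

/-- Either the vertices found before the round were already closed, and the round finds nothing, or
the round finds at least one new vertex. -/
theorem SearchRound.search {l : ℕ} {rank₀ pred₀ rank pred : Fin n → ℤ}
    (h : SearchRound R Δ l rank₀ pred₀ Finset.univ rank pred)
    (h₀ : Search R Δ s l rank₀ pred₀) : Search R Δ s (l + 1) rank pred := by
  have hold : ∀ j, rank₀ j ≠ 0 → rank j = rank₀ j := fun j hj => (h.old j hj).1
  refine ⟨by rw [hold s (by simp [h₀.root]), h₀.root], fun j => ?_, fun j => ?_, fun j hjs hj => ?_,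
    ?_⟩
  · by_cases hj : rank₀ j = 0
    · rcases h.new j hj with h1 | ⟨h1, -⟩ <;> omega
    · rw [hold j hj]
      exact h₀.nonneg j
  · by_cases hj : rank₀ j = 0
    · rcases h.new j hj with h1 | ⟨h1, -⟩ <;> push_cast <;> omega
    · rw [hold j hj]
      have := h₀.le j
      push_cast
      omega
  · by_cases hj0 : rank₀ j = 0
    · rcases h.new j hj0 with h1 | ⟨h1, i, hi, hp, hR⟩
      · exact absurd h1 hj
      · refine ⟨i, hp, ?_, ?_, hR⟩ <;> rw [hold i hi.ne']
        · exact hi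
        · have := h₀.le i
          omega
    · obtain ⟨i, hp, hi, hlt, hR⟩ := h₀.pred j hjs hj0
      refine ⟨i, (h.old j hj0).2.trans hp, ?_, ?_, hR⟩ <;> rw [hold i hi.ne']
      · exact hi
      · rwa [hold j hj0]
  · by_cases hcl : ∀ i j, rank₀ i ≠ 0 → rank₀ j = 0 → R i j < Δ
    · left
      have hzero : ∀ j, rank₀ j = 0 → rank j = 0 := by
        intro j hj
        rcases h.new j hj with h1 | ⟨-, i, hi, -, hR⟩
        · exact h1
        · exact absurd (hcl i j hi.ne' hj) (not_lt.2 hR)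
      intro i j hi hj
      refine hcl i j (fun h1 => hi (hzero i h1)) ?_
      by_contra h1
      exact h1 (by rw [← hold j h1, hj])
    · right
      have h1 := h₀.progress.resolve_left hcl
      push Not at hcl
      obtain ⟨i, j, hi, hj, hR⟩ := hcl
      refine Nat.succ_le_of_lt (lt_of_le_of_lt h1 (Finset.card_lt_card ⟨fun k hk => ?_,
        fun hsub => ?_⟩))
      · simp only [Finset.mem_filter, Finset.mem_univ, true_and] at hk ⊢
        rwa [hold k hk]
      · have := hsub (x := j) (by simpa using h.done i j (Finset.mem_univ _) hi hR)
        simp [hj] at this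

/-- `R` is the residual matrix of a flow of value `f` from `s` to `u` in `X`. -/
structure Residual (X R : Fin n → Fin n → ℤ) (s u : Fin n) (f : ℤ) : Prop where
  nonneg : ∀ i j, 0 ≤ R i j
  outWeight : ∀ S : Finset (Fin n), s ∈ S → u ∉ S → outWeight R S = outWeight X S - f

/-- The state while the flow is augmented by `Δ` along a path from `s` to `u`, from its end up to
the vertex `cur`. -/
structure Augmenting (R₀ : Fin n → Fin n → ℤ) (Δ : ℤ) (s u : Fin n) (rank pred : Fin n → ℤ)
    (cur : Fin n) (R : Fin n → Fin n → ℤ) : Prop where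
  nonneg : ∀ i j, 0 ≤ R i j
  rank_ne : rank cur ≠ 0
  pred : ∀ j, j ≠ s → rank j ≠ 0 → rank j ≤ rank cur →
    ∃ i : Fin n, pred j = (i : ℕ) ∧ 0 < rank i ∧ rank i < rank j ∧ Δ ≤ R i j
  outWeight : ∀ S : Finset (Fin n), s ∈ S → u ∉ S → outWeight R S =
    outWeight R₀ S - if cur ∈ S then Δ else 0

/-- Only the entry into `cur` is lowered, and `cur` has larger rank than its predecessor `p`. All
entries needed for the rest of the path thus keep their capacity. The cuts lose `Δ` exactly when the
path moves to the side of `s`. -/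
theorem Augmenting.step {R₀ : Fin n → Fin n → ℤ} {rank pred : Fin n → ℤ} {cur : Fin n}
    (h : Augmenting R₀ Δ s u rank pred cur R) (hcur : cur ≠ s) (hΔ : 0 ≤ Δ) :
    ∃ p : Fin n, pred cur = (p : ℕ) ∧ rank p < rank cur ∧
      Augmenting R₀ Δ s u rank pred p (bump (bump R p cur (-Δ)) cur p Δ) := by
  obtain ⟨p, hp, hpos, hlt, hR⟩ := h.pred cur hcur h.rank_ne le_rfl
  have hne : p ≠ cur := by
    rintro rfl
    exact lt_irrefl _ hlt
  refine ⟨p, hp, hlt, ⟨fun i j => ?_, hpos.ne', fun j hjs hj hle => ?_, fun S hs hu => ?_⟩⟩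
  · have := h.nonneg i j
    unfold bump
    by_cases h1 : i = p ∧ j = cur
    · obtain ⟨rfl, rfl⟩ := h1
      simp only [and_self, if_true]
      split_ifs <;> linarith
    · rw [if_neg h1]
      split_ifs <;> linarith
  · obtain ⟨i, h1, h2, h3, h4⟩ := h.pred j hjs hj (hle.trans hlt.le)
    refine ⟨i, h1, h2, h3, h4.trans ?_⟩
    have : ¬ (i = p ∧ j = cur) := by
      rintro ⟨-, rfl⟩
      omega
    unfold bump
    rw [if_neg this]
    split_ifs <;> linarith
  · rw [outWeight_bump, outWeight_bump, h.outWeight S hs hu]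
    by_cases h1 : p ∈ S <;> by_cases h2 : cur ∈ S <;> simp [h1, h2]
    ring

theorem Search.augmenting {rank pred : Fin n → ℤ} {l : ℕ} (h : Search R Δ s l rank pred)
    (hR : ∀ i j, 0 ≤ R i j) (hu : rank u ≠ 0) : Augmenting R Δ s u rank pred u R :=
  ⟨hR, hu, fun j hjs hj _ => h.pred j hjs hj, fun S _ hu => by simp [hu]⟩

/-- Within a phase of the scaling algorithm, `k` augmentations by `Δ` have been made, or there is
no further one. -/
def PhaseInv (R : Fin n → Fin n → ℤ) (Δ : ℤ) (s u : Fin n) (flag : ℤ) (k : ℕ) : Prop :=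
  (flag = 1 ∧ ∃ S : Finset (Fin n), s ∈ S ∧ u ∉ S ∧ ∀ i ∈ S, ∀ j ∉ S, R i j < Δ) ∨
    (flag = 0 ∧ ∃ S : Finset (Fin n), s ∈ S ∧ u ∉ S ∧
      outWeight R S + k * Δ ≤ 2 * n ^ 2 * Δ)

theorem outWeight_le_of_le {S : Finset (Fin n)} {c : ℤ} (hc : 0 ≤ c)
    (h : ∀ i ∈ S, ∀ j ∉ S, R i j ≤ c) : outWeight R S ≤ n ^ 2 * c := by
  have : outWeight R S ≤ ∑ _p : Fin n, ∑ _q : Fin n, c := by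
    refine Finset.sum_le_sum fun p _ => Finset.sum_le_sum fun q _ => ?_
    split_ifs with h1
    · exact h p h1.1 q h1.2
    · exact hc
  refine this.trans (le_of_eq ?_)
  simp
  ring

theorem PhaseInv.start (hΔ : 0 ≤ Δ) (h : ∃ S : Finset (Fin n), s ∈ S ∧ u ∉ S ∧
    ∀ i ∈ S, ∀ j ∉ S, R i j ≤ 2 * Δ) : PhaseInv R Δ s u 0 0 := by
  obtain ⟨S, hs, hu, hS⟩ := h
  refine Or.inr ⟨rfl, S, hs, hu, ?_⟩
  have := outWeight_le_of_le (by omega) hS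
  push_cast
  linarith

/-- More than `2 * n ^ 2` augmentations would make the residual weight of a cut negative, so the
search has failed. Its cut has entries below `Δ`, hence at most `2 * (Δ / 2)` even for odd `Δ`,
which is the starting condition of the next phase. -/
theorem PhaseInv.finish (hΔ : 0 < Δ) {flag : ℤ} {k : ℕ} (hk : 2 * n ^ 2 < k)
    (hR : ∀ i j, 0 ≤ R i j) (h : PhaseInv R Δ s u flag k) :
    ∃ S : Finset (Fin n), s ∈ S ∧ u ∉ S ∧ ∀ i ∈ S, ∀ j ∉ S, R i j ≤ 2 * (Δ / 2) := by
  rcases h with ⟨-, S, hs, hu, hS⟩ | ⟨-, S, hs, hu, hS⟩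
  · refine ⟨S, hs, hu, fun i hi j hj => ?_⟩
    have := hS i hi j hj
    omega
  · have h1 := outWeight_nonneg hR S
    have h2 : (2 * n ^ 2 : ℤ) < k := by exact_mod_cast hk
    nlinarith

end Flow

end Stroll

/-! ### Registers and arrays of the program; breadth first search -/

namespace Loop

notation "rN" => (0 : ℕ)
notation "rS" => (1 : ℕ)
notation "rT" => (2 : ℕ)
notation "rD" => (3 : ℕ)
notation "rW" => (4 : ℕ)
notation "rK" => (5 : ℕ)
notation "rL" => (6 : ℕ)
notation "rI" => (7 : ℕ)
notation "rJ" => (8 : ℕ)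
notation "rH" => (9 : ℕ)
notation "rG" => (10 : ℕ)
notation "rQ" => (11 : ℕ)
notation "rC" => (12 : ℕ)
notation "rP" => (13 : ℕ)
notation "rFlag" => (14 : ℕ)
notation "rDelta" => (15 : ℕ)
notation "rFlow" => (16 : ℕ)
notation "rU" => (17 : ℕ)
notation "aX" => (0 : ℕ)
notation "aDeg" => (1 : ℕ)
notation "aR" => (2 : ℕ)
notation "aRank" => (3 : ℕ)
notation "aPred" => (4 : ℕ)

prefix:max "◦" => Exp.reg

namespace Mem

variable {n : ℕ} (σ : Mem) (r a : ℕ) (z : ℤ)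

@[simp] theorem vec_set : (σ.set r z).vec n a = σ.vec n a := rfl
@[simp] theorem mat_set : (σ.set r z).mat n a = σ.mat n a := rfl

@[simp] theorem vec_put (p : Fin n) :
    (σ.put a 0 (p : ℕ) z).vec n a = Function.update (σ.vec n a) p z := by
  funext q
  simp [vec, Function.update_apply, Fin.val_inj]

@[simp] theorem vec_put_of_ne {a' : ℕ} (h : a' ≠ a) (i j : ℤ) :
    (σ.put a i j z).vec n a' = σ.vec n a' := by
  funext q
  simp [vec, h]

@[simp] theorem mat_put_of_ne {a' : ℕ} (h : a' ≠ a) (i j : ℤ) :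
    (σ.put a i j z).mat n a' = σ.mat n a' := by
  funext p q
  simp [mat, h]

theorem mat_put (p q : Fin n) : (σ.put a (p : ℕ) (q : ℕ) z).mat n a =
    Function.update (σ.mat n a) p (Function.update (σ.mat n a p) q z) := by
  funext i j
  simp only [mat, put_arr, Function.update_apply, true_and, Nat.cast_inj, Fin.val_inj]
  by_cases h : i = p <;> by_cases h' : j = q <;> simp [h, h', mat]

theorem arr_eq_mat (p q : Fin n) : σ.arr a (p : ℕ) (q : ℕ) = σ.mat n a p q := rfl

theorem arr_eq_vec (p : Fin n) : σ.arr a 0 (p : ℕ) = σ.vec n a p := rfl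

end Mem

theorem Frame.vec {R A : List ℕ} {σ ρ : Mem} (h : Frame R A σ ρ) {a : ℕ} (ha : a ∉ A) (n : ℕ) :
    ρ.vec n a = σ.vec n a := by
  funext p
  simp [Mem.vec, h.arr a ha]

theorem Frame.mat {R A : List ℕ} {σ ρ : Mem} (h : Frame R A σ ρ) {a : ℕ} (ha : a ∉ A) (n : ℕ) :
    ρ.mat n a = σ.mat n a := by
  funext p q
  simp [Mem.mat, h.arr a ha]

namespace Cmd

/-- The test against `◦rQ + 2` admits only vertices found in earlier rounds: those found in the
current round carry exactly this rank. -/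
def searchStep : Cmd :=
  ite 0 (.arr aRank 0 ◦rI) (ite (.arr aRank 0 ◦rI) (◦rQ + 2) (iteq (.arr aRank 0 ◦rJ) 0
    (ite (.arr aR ◦rI ◦rJ) ◦rDelta skip
      (store aRank 0 ◦rJ (◦rQ + 2) ;; store aPred 0 ◦rJ ◦rI)) skip) skip) skip

def searchRound : Cmd := loop rI rN (loop rJ rN searchStep)

def search : Cmd :=
  loop rI rN (store aRank 0 ◦rI 0) ;; store aRank 0 ◦rS 1 ;; loop rQ rN searchRound

variable {n : ℕ} {σ : Mem} {s u : Fin n}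

theorem exec_searchRound {l : ℕ} (hn : σ.reg rN = n) (hQ : σ.reg rQ = l)
    (h : Stroll.Search (σ.mat n aR) (σ.reg rDelta) s l (σ.vec n aRank) (σ.vec n aPred)) :
    Stroll.Search (σ.mat n aR) (σ.reg rDelta) s (l + 1) ((searchRound.exec σ).vec n aRank)
      ((searchRound.exec σ).vec n aPred) := by
  refine Stroll.SearchRound.search (rank₀ := σ.vec n aRank) (pred₀ := σ.vec n aPred) ?_ h
  refine loop_fin₂ hn (fun D ρ => Stroll.SearchRound (σ.mat n aR) (σ.reg rDelta) l
    (σ.vec n aRank) (σ.vec n aPred) D (ρ.vec n aRank) (ρ.vec n aPred))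
    (fun _ _ _ h => h) (fun _ _ _ h => h) ⟨fun _ _ => ⟨rfl, rfl⟩, fun _ h => Or.inl h, by simp⟩
    (by decide) (by decide) ?_
  intro D p q _ ρ hF hp hq hρ
  have hR := hF.mat (a := aR) (by decide) n
  have hD := hF.reg rDelta (by decide)
  have hQ' := (hF.reg rQ (by decide)).trans hQ
  have hlep := h.le p
  have hnp := h.nonneg p
  -- Ranks are updated in place, and yet the two tests recognise the vertices that had been found
  -- before the round.
  have hrank : 0 < ρ.vec n aRank p ∧ ρ.vec n aRank p < l + 2 ↔ σ.vec n aRank p ≠ 0 := by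
    by_cases h0 : σ.vec n aRank p = 0
    · rcases hρ.new p h0 with h1 | ⟨h1, -⟩ <;> simp [h0, h1]
    · rw [(hρ.old p h0).1]
      omega
  have hmono : ∀ D', (∀ i j, (i, j) ∈ D' → (i, j) ∈ D ∨ (i = p ∧ j = q)) →
      (σ.vec n aRank p ≠ 0 → σ.reg rDelta ≤ σ.mat n aR p q → ρ.vec n aRank q ≠ 0) →
      Stroll.SearchRound (σ.mat n aR) (σ.reg rDelta) l (σ.vec n aRank) (σ.vec n aPred) D'
        (ρ.vec n aRank) (ρ.vec n aPred) := by
    intro D' hD' hpq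
    refine ⟨hρ.old, hρ.new, fun i j hij => ?_⟩
    rcases hD' i j hij with h1 | ⟨rfl, rfl⟩
    · exact hρ.done i j h1
    · exact hpq
  simp only [searchStep, exec, Exp.eval_zero, Exp.eval_arr, Exp.eval_reg, Exp.eval_add,
    Exp.eval_two, hp, hq, hQ', hD, Mem.arr_eq_mat, Mem.arr_eq_vec, hR]
  have hins : ∀ i j, (i, j) ∈ insert (p, q) D → (i, j) ∈ D ∨ (i = p ∧ j = q) := by
    intro i j hij
    rcases Finset.mem_insert.1 hij with h1 | h1
    · exact Or.inr (by simpa using h1)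
    · exact Or.inl h1
  split_ifs with h1 h2 h3 h4
  · exact hmono _ hins fun _ h5 => absurd h4 (not_lt.2 h5)
  · have hp0 := hrank.1 ⟨h1, h2⟩
    simp only [Mem.vec_put, Mem.vec_put_of_ne, Mem.put_reg, hq, hp, ne_eq,
      Nat.reduceEqDiff, not_false_eq_true]
    have hq0 : σ.vec n aRank q = 0 := by
      by_contra hne
      exact hne (by rw [← (hρ.old q hne).1, h3])
    refine ⟨fun j hj => ?_, fun j hj => ?_, fun i j hij hi hRij => ?_⟩
    · have hjq : j ≠ q := by
        rintro rfl
        exact hj hq0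
      simpa [hjq] using hρ.old j hj
    · by_cases hjq : j = q
      · subst hjq
        right
        refine ⟨by simp, p, ?_, by simp, not_lt.1 h4⟩
        omega
      · simpa [hjq] using hρ.new j hj
    · by_cases hjq : j = q
      · subst hjq
        simp
        omega
      · rw [Function.update_of_ne hjq]
        refine hρ.done i j ?_ hi hRij
        rcases hins i j hij with h5 | h5
        · exact h5
        · exact absurd h5.2 hjq
  · exact hmono _ hins fun _ _ => h3
  · exact hmono _ hins fun h5 => absurd (hrank.2 h5).2 h2
  · exact hmono _ hins fun h5 => absurd (hrank.2 h5).1 h1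

theorem exec_search (hn : σ.reg rN = n) (hs : σ.reg rS = (s : ℕ)) :
    Stroll.Search (σ.mat n aR) (σ.reg rDelta) s n ((search.exec σ).vec n aRank)
      ((search.exec σ).vec n aPred) := by
  simp only [search, exec_seq, exec_store]
  set ρ := (loop rI rN (store aRank 0 ◦rI 0)).exec σ with hρ
  have hF := (loop rI rN (store aRank 0 ◦rI 0)).frame σ
  rw [← hρ] at hF
  have h0 : ∀ j ∈ Finset.univ, ρ.vec n aRank j = 0 := by
    refine loop_fin hn (fun D ρ => ∀ j ∈ D, ρ.vec n aRank j = 0) (fun _ _ _ h => h) (by simp) ?_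
    intro D p _ ρ hF hp h j hj
    simp only [exec, Exp.eval_zero, Exp.eval_reg, hp, Mem.vec_put]
    by_cases hjp : j = p
    · simp [hjp]
    · simpa [hjp] using h j ((Finset.mem_insert.1 hj).resolve_left hjp)
  have hs' : ρ.reg rS = (s : ℕ) := (hF.reg rS (by decide)).trans hs
  simp only [Exp.eval_zero, Exp.eval_reg, Exp.eval_one, hs']
  set ξ := ρ.put aRank 0 (s : ℕ) 1 with hξ
  have hm : ξ.mat n aR = σ.mat n aR := by
    rw [hξ, Mem.mat_put_of_ne _ _ _ (by decide)]
    exact hF.mat (by decide) n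
  have hD : ξ.reg rDelta = σ.reg rDelta := hF.reg rDelta (by decide)
  have hn' : ξ.reg rN = n := (hF.reg rN (by decide)).trans hn
  refine loop_induct hn' (fun l ρ => Stroll.Search (σ.mat n aR) (σ.reg rDelta) s l
    (ρ.vec n aRank) (ρ.vec n aPred)) (fun _ _ _ h => h) (Stroll.Search.start ?_ fun j hj => ?_) ?_
  · simp [hξ]
  · simp [hξ, hj, h0 j (Finset.mem_univ j)]
  · intro l _ κ hF hl h
    have e1 : κ.mat n aR = σ.mat n aR := (hF.mat (by decide) n).trans hm
    have e2 : κ.reg rDelta = σ.reg rDelta := (hF.reg rDelta (by decide)).trans hD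
    rw [← e1, ← e2] at h ⊢
    exact exec_searchRound ((hF.reg rN (by decide)).trans hn') hl h

end Cmd

end Loop

/-! ### Augmentation and capacity scaling -/

namespace Loop

namespace Cmd

def augmentStep : Cmd :=
  iteq ◦rC ◦rS skip (assign rP (.arr aPred 0 ◦rC) ;; addTo aR ◦rP ◦rC (0 - ◦rDelta) ;;
    addTo aR ◦rC ◦rP ◦rDelta ;; assign rC ◦rP)

def augment : Cmd := assign rC ◦rU ;; loop rI rN augmentStep

def phaseStep : Cmd :=
  iteq ◦rFlag 0 (search ;; ite 0 (.arr aRank 0 ◦rU) (augment ;; assign rFlow (◦rFlow + ◦rDelta))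
    (assign rFlag 1)) skip

def phase : Cmd := assign rFlag 0 ;; loop rG rL phaseStep ;; assign rDelta (◦rDelta / 2)

/-- The value of a maximum flow from `s` to `u`. -/
def maxFlow : Cmd :=
  loop rI rN (loop rJ rN (store aR ◦rI ◦rJ (.arr aX ◦rI ◦rJ))) ;; assign rFlow 0 ;;
    assign rDelta ◦rW ;; loop rH rK phase

variable {n : ℕ} {σ : Mem} {s u : Fin n}

theorem exec_augmentStep {cur : Fin n} (hs : σ.reg rS = (s : ℕ)) (hc : σ.reg rC = (cur : ℕ)) :
    (cur = s → augmentStep.exec σ = σ) ∧ ∀ p : Fin n, cur ≠ s →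
      σ.vec n aPred cur = (p : ℕ) → (augmentStep.exec σ).reg rC = (p : ℕ) ∧
      (augmentStep.exec σ).mat n aR = Stroll.bump (Stroll.bump (σ.mat n aR) p cur (-σ.reg rDelta))
        cur p (σ.reg rDelta) := by
  constructor
  · rintro rfl
    rw [augmentStep, exec_iteq_pos _ _ (by simp [hc, hs]), exec_skip]
  · intro p hne hp
    have h1 : ¬ σ.reg rC = σ.reg rS := by
      rw [hc, hs]
      simpa [Fin.val_inj] using hne
    have h2 : σ.arr aPred 0 (σ.reg rC) = (p : ℕ) := by
      rw [hc]
      exact hp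
    rw [augmentStep, exec_iteq_neg _ _ (by simpa using h1)]
    simp only [exec_seq, exec_assign, Exp.eval_reg, Exp.eval_arr, Exp.eval_zero, h2]
    set ρ := σ.set rP (p : ℕ) with hρ
    have hρC : ρ.reg rC = (cur : ℕ) := by simp [hρ, hc]
    have hρP : ρ.reg rP = (p : ℕ) := by simp [hρ]
    have e1 := exec_addTo (σ := ρ) (a := aR) (e := ◦rP) (f := ◦rC) (g := 0 - ◦rDelta) hρP hρC
    have hF := (addTo aR ◦rP ◦rC (0 - ◦rDelta)).frame ρ
    set ξ := (addTo aR ◦rP ◦rC (0 - ◦rDelta)).exec ρ with hξ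
    have hξC : ξ.reg rC = (cur : ℕ) := (hF.reg rC (by decide)).trans hρC
    have hξP : ξ.reg rP = (p : ℕ) := (hF.reg rP (by decide)).trans hρP
    have hξD : ξ.reg rDelta = σ.reg rDelta := by rw [hF.reg rDelta (by decide)]; simp [hρ]
    have e2 := exec_addTo (σ := ξ) (a := aR) (e := ◦rC) (f := ◦rP) (g := ◦rDelta) hξC hξP
    refine ⟨?_, ?_⟩
    · simp [addTo, exec_store, hξP]
    · rw [Mem.mat_set, e2, e1]
      simp [hρ, hξD]

/-- The rank of the current vertex is at most `n + 1` at first and drops in each round until `s` is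
reached. After `n` rounds the vertex is `s`, since any other one has a predecessor of smaller
positive rank. -/
theorem exec_augment (hn : σ.reg rN = n) (hs : σ.reg rS = (s : ℕ)) (hu : σ.reg rU = (u : ℕ))
    (hΔ : 0 ≤ σ.reg rDelta) (hR : ∀ i j, 0 ≤ σ.mat n aR i j)
    (h : Stroll.Search (σ.mat n aR) (σ.reg rDelta) s n (σ.vec n aRank) (σ.vec n aPred))
    (hru : σ.vec n aRank u ≠ 0) : (∀ i j, 0 ≤ (augment.exec σ).mat n aR i j) ∧
      ∀ S : Finset (Fin n), s ∈ S → u ∉ S → Stroll.outWeight ((augment.exec σ).mat n aR) S =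
        Stroll.outWeight (σ.mat n aR) S - σ.reg rDelta := by
  simp only [augment, exec_seq, exec_assign, Exp.eval_reg, hu]
  set ρ := σ.set rC (u : ℕ) with hρ
  have hn' : ρ.reg rN = n := by simp [hρ, hn]
  have key := loop_induct (i := rI) (c := augmentStep) hn' (fun l ξ => ∃ cur : Fin n,
    ξ.reg rC = (cur : ℕ) ∧ (cur = s ∨ σ.vec n aRank cur + l ≤ n + 1) ∧
    Stroll.Augmenting (σ.mat n aR) (σ.reg rDelta) s u (σ.vec n aRank) (σ.vec n aPred) cur
      (ξ.mat n aR)) ?_ ?_ ?_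
  · obtain ⟨cur, -, h1, h2⟩ := key
    obtain rfl : cur = s := by
      rcases h1 with h1 | h1
      · exact h1
      · by_contra hne
        obtain ⟨i, -, h3, h4, -⟩ := h2.pred cur hne h2.rank_ne le_rfl
        omega
    refine ⟨h2.nonneg, fun S hs hu => ?_⟩
    rw [h2.outWeight S hs hu, if_pos hs]
  · rintro l ξ z ⟨cur, h1, h2⟩
    exact ⟨cur, by simpa using h1, h2⟩
  · refine ⟨u, by simp [hρ], ?_, h.augmenting hR hru⟩
    right
    have := h.le u
    push_cast
    omega
  · rintro l _ ξ hF - ⟨cur, h1, h2, h3⟩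
    have hsξ : ξ.reg rS = (s : ℕ) := by rw [hF.reg rS (by decide)]; simp [hρ, hs]
    have hDξ : ξ.reg rDelta = σ.reg rDelta := by rw [hF.reg rDelta (by decide)]; simp [hρ]
    have hPξ : ξ.vec n aPred = σ.vec n aPred := by rw [hF.vec (by decide)]; simp [hρ]
    obtain ⟨h4, h5⟩ := exec_augmentStep hsξ h1
    by_cases hc : cur = s
    · rw [h4 hc]
      exact ⟨cur, h1, Or.inl hc, h3⟩
    · obtain ⟨p, hp, hlt, hA⟩ := h3.step hc hΔ
      obtain ⟨h6, h7⟩ := h5 p hc (by rw [hPξ, hp])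
      refine ⟨p, h6, Or.inr ?_, by rwa [h7, hDξ]⟩
      have := h2.resolve_left hc
      push_cast
      omega

/-- If the search reaches `u`, an augmentation lowers every cut by `Δ`, in particular the one in the
invariant. If not, the vertices reached form the cut with small entries, and the flag disables all
further rounds of the phase. -/
theorem exec_phaseStep {X : Fin n → Fin n → ℤ} {k : ℕ} (hn : σ.reg rN = n)
    (hs : σ.reg rS = (s : ℕ)) (hu : σ.reg rU = (u : ℕ)) (hΔ : 0 ≤ σ.reg rDelta)
    (h : Stroll.Residual X (σ.mat n aR) s u (σ.reg rFlow))
    (hP : Stroll.PhaseInv (σ.mat n aR) (σ.reg rDelta) s u (σ.reg rFlag) k) :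
    Stroll.Residual X ((phaseStep.exec σ).mat n aR) s u ((phaseStep.exec σ).reg rFlow) ∧
    Stroll.PhaseInv ((phaseStep.exec σ).mat n aR) (σ.reg rDelta) s u
      ((phaseStep.exec σ).reg rFlag) (k + 1) := by
  rw [phaseStep]
  by_cases hf : Exp.eval σ ◦rFlag = Exp.eval σ 0
  · rw [exec_iteq_pos _ _ hf, exec_seq]
    simp only [Exp.eval_reg, Exp.eval_zero] at hf
    have hS := exec_search hn hs
    have hF := search.frame σ
    set ρ := search.exec σ with hρ
    have hm : ρ.mat n aR = σ.mat n aR := hF.mat (by decide) n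
    have hD : ρ.reg rDelta = σ.reg rDelta := hF.reg rDelta (by decide)
    have hfl : ρ.reg rFlow = σ.reg rFlow := hF.reg rFlow (by decide)
    have hu' : ρ.reg rU = (u : ℕ) := (hF.reg rU (by decide)).trans hu
    have hs' : ρ.reg rS = (s : ℕ) := (hF.reg rS (by decide)).trans hs
    have hn' : ρ.reg rN = n := (hF.reg rN (by decide)).trans hn
    rw [← hm, ← hD] at hS
    have hru : Exp.eval ρ (.arr aRank 0 ◦rU) = ρ.vec n aRank u := by simp [hu', Mem.vec]
    by_cases hr : Exp.eval ρ 0 < Exp.eval ρ (.arr aRank 0 ◦rU)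
    · rw [exec_ite_pos _ _ hr, exec_seq, exec_assign]
      rw [hru, Exp.eval_zero] at hr
      obtain ⟨h1, h2⟩ := exec_augment hn' hs' hu' (by rwa [hD]) (by rw [hm]; exact h.nonneg) hS
        hr.ne'
      have hF' := augment.frame ρ
      set ξ := augment.exec ρ with hξ
      have hD' : ξ.reg rDelta = σ.reg rDelta := (hF'.reg rDelta (by decide)).trans hD
      have hfl' : ξ.reg rFlow = σ.reg rFlow := (hF'.reg rFlow (by decide)).trans hfl
      have hfg : ξ.reg rFlag = 0 := by
        rw [hF'.reg rFlag (by decide), hF.reg rFlag (by decide), hf]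
      refine ⟨⟨h1, fun S hs hu => ?_⟩, ?_⟩
      · simp only [Mem.mat_set, Mem.set_reg, if_true, Exp.eval_add, Exp.eval_reg, hD', hfl',
          h2 S hs hu, hm, hD, h.outWeight S hs hu]
        ring
      · rcases hP with ⟨hP, -⟩ | ⟨-, S, hsS, huS, hle⟩
        · omega
        · refine Or.inr ⟨by simp [hfg], S, hsS, huS, ?_⟩
          rw [Mem.mat_set, h2 S hsS huS, hm, hD]
          push_cast
          linarith
    · rw [exec_ite_neg _ _ hr, exec_assign]
      rw [hru, Exp.eval_zero] at hr
      refine ⟨by simpa [hm, hfl] using h, Or.inl ⟨by simp, Finset.univ.filter fun j =>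
        ρ.vec n aRank j ≠ 0, by simp [hS.root], ?_, ?_⟩⟩
      · have := hS.nonneg u
        simp
        omega
      · intro i hi j hj
        have := hS.closed i j (by simpa using hi) (by simpa using hj)
        rw [Mem.mat_set, ← hD]
        exact this
  · rw [exec_iteq_neg _ _ hf, exec_skip]
    refine ⟨h, Or.inl ?_⟩
    rcases hP with hP | ⟨h1, -⟩
    · exact hP
    · exact absurd h1 hf

theorem exec_phase {X : Fin n → Fin n → ℤ} {N : ℕ} (hn : σ.reg rN = n)
    (hN : σ.reg rL = N) (hnN : 2 * n ^ 2 < N)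
    (hs : σ.reg rS = (s : ℕ)) (hu : σ.reg rU = (u : ℕ)) (hΔ : 0 < σ.reg rDelta)
    (h : Stroll.Residual X (σ.mat n aR) s u (σ.reg rFlow))
    (hP : ∃ S : Finset (Fin n), s ∈ S ∧ u ∉ S ∧
      ∀ i ∈ S, ∀ j ∉ S, σ.mat n aR i j ≤ 2 * σ.reg rDelta) :
    (phase.exec σ).reg rDelta = σ.reg rDelta / 2 ∧
    Stroll.Residual X ((phase.exec σ).mat n aR) s u ((phase.exec σ).reg rFlow) ∧
    ∃ S : Finset (Fin n), s ∈ S ∧ u ∉ S ∧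
      ∀ i ∈ S, ∀ j ∉ S, (phase.exec σ).mat n aR i j ≤ 2 * (σ.reg rDelta / 2) := by
  simp only [phase, exec_seq, exec_assign, Exp.eval_zero]
  set ρ := σ.set rFlag 0 with hρ
  have hN' : ρ.reg rL = N := by simp [hρ, hN]
  have key := loop_induct (i := rG) (c := phaseStep) hN' (fun k ξ =>
    Stroll.Residual X (ξ.mat n aR) s u (ξ.reg rFlow) ∧
    Stroll.PhaseInv (ξ.mat n aR) (σ.reg rDelta) s u (ξ.reg rFlag) k) ?_ ?_ ?_
  · have hF := (loop rG rL phaseStep).frame ρ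
    set ξ := (loop rG rL phaseStep).exec ρ with hξ
    have hD : ξ.reg rDelta = σ.reg rDelta := by rw [hF.reg rDelta (by decide)]; simp [hρ]
    refine ⟨by simp [hD], by simpa using key.1, ?_⟩
    rw [Mem.mat_set]
    exact key.2.finish hΔ hnN key.1.nonneg
  · intro k ξ z hξ
    simpa using hξ
  · refine ⟨by simpa [hρ] using h, ?_⟩
    have := Stroll.PhaseInv.start hΔ.le hP
    simpa [hρ] using this
  · rintro k _ ξ hF - ⟨h1, h2⟩
    have hD : ξ.reg rDelta = σ.reg rDelta := by rw [hF.reg rDelta (by decide)]; simp [hρ]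
    rw [← hD] at h2 ⊢
    refine exec_phaseStep ?_ ?_ ?_ (by rw [hD]; exact hΔ.le) h1 h2
    · rw [hF.reg rN (by decide)]; simp [hρ, hn]
    · rw [hF.reg rS (by decide)]; simp [hρ, hs]
    · rw [hF.reg rU (by decide)]; simp [hρ, hu]

/-- At the start of phase `l` the value of `Δ` is `W / 2 ^ l`, and some cut has residual entries of
at most `2 * Δ`; initially this is `{s}`, by the bound `2 * W`. The number of phases is the number
of digits of `W`, and each has more than `2 * n ^ 2` rounds. -/
theorem exec_maxFlow {N W : ℕ} (hn : σ.reg rN = n) (hN : σ.reg rL = N) (hnN : 2 * n ^ 2 < N)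
    (hs : σ.reg rS = (s : ℕ)) (hu : σ.reg rU = (u : ℕ)) (hsu : s ≠ u) (hW : σ.reg rW = W)
    (hK : σ.reg rK = Nat.size W) (h0 : ∀ i j, 0 ≤ σ.mat n aX i j)
    (h1 : ∀ i j, σ.mat n aX i j ≤ 2 * W) :
    (∀ S : Finset (Fin n), s ∈ S → u ∉ S →
      (maxFlow.exec σ).reg rFlow ≤ Stroll.outWeight (σ.mat n aX) S) ∧
    ∃ S : Finset (Fin n), s ∈ S ∧ u ∉ S ∧
      (maxFlow.exec σ).reg rFlow = Stroll.outWeight (σ.mat n aX) S := by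
  simp only [maxFlow, exec_seq, exec_assign]
  have hR : ∀ z ∈ (Finset.univ : Finset (Fin n × Fin n)), ((loop rI rN (loop rJ rN (store aR ◦rI ◦rJ
      (.arr aX ◦rI ◦rJ)))).exec σ).mat n aR z.1 z.2 = σ.mat n aX z.1 z.2 := by
    refine loop_fin₂ hn (fun D ρ => ∀ z ∈ D, ρ.mat n aR z.1 z.2 = σ.mat n aX z.1 z.2)
      (fun _ _ _ h => h) (fun _ _ _ h => h) (by simp) (by decide) (by decide) ?_
    intro D p q _ ρ hF hp hq h z hz
    simp only [exec_store, Exp.eval_reg, Exp.eval_arr, hp, hq, Mem.mat, Mem.put_arr, true_and]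
    split_ifs with h2
    · simp only [Nat.cast_inj, Fin.val_inj] at h2
      rw [h2.1, h2.2, hF.arr aX (by decide)]
    · refine h z ((Finset.mem_insert.1 hz).resolve_left ?_)
      rintro rfl
      simp at h2
  have hF := (loop rI rN (loop rJ rN (store aR ◦rI ◦rJ (.arr aX ◦rI ◦rJ)))).frame σ
  set ρ := (loop rI rN (loop rJ rN (store aR ◦rI ◦rJ (.arr aX ◦rI ◦rJ)))).exec σ with hρ
  have hWρ : ρ.reg rW = W := (hF.reg rW (by decide)).trans hW
  simp only [Exp.eval_zero, Exp.eval_reg]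
  set ξ := (ρ.set rFlow 0).set rDelta ((ρ.set rFlow 0).reg rW) with hξ
  have hr : ∀ r, r ∉ [rI, rJ, rFlow, rDelta] → ξ.reg r = σ.reg r := by
    intro r hr
    simp only [List.mem_cons, List.not_mem_nil, or_false, not_or] at hr
    rw [← hF.reg r (by simp [regs]; tauto), hξ]
    simp [hr]
  have hKξ : ξ.reg rK = Nat.size W := by rw [hr _ (by decide), hK]
  have hm : ξ.mat n aR = σ.mat n aX := by
    funext i j
    exact hR (i, j) (Finset.mem_univ _)
  have key := loop_induct (i := rH) (c := phase) hKξ (fun l κ => κ.reg rDelta = (W / 2 ^ l : ℕ) ∧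
    Stroll.Residual (σ.mat n aX) (κ.mat n aR) s u (κ.reg rFlow) ∧
    ∃ S : Finset (Fin n), s ∈ S ∧ u ∉ S ∧
      ∀ i ∈ S, ∀ j ∉ S, κ.mat n aR i j ≤ 2 * κ.reg rDelta) ?_ ?_ ?_
  · obtain ⟨h2, h3, S, hsS, huS, h4⟩ := key
    -- With `Δ = 0` the last cut has no residual capacity, so its weight equals the value of the
    -- flow.
    have hz : W / 2 ^ Nat.size W = 0 := Nat.div_eq_of_lt (Nat.lt_size_self W)
    rw [h2, hz] at h4
    refine ⟨fun S hs hu => ?_, S, hsS, huS, ?_⟩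
    · have h5 := Stroll.outWeight_nonneg h3.nonneg S
      rw [h3.outWeight S hs hu] at h5
      omega
    · have h5 := Stroll.outWeight_le_of_le le_rfl h4
      have h6 := Stroll.outWeight_nonneg h3.nonneg S
      rw [h3.outWeight S hsS huS] at h5 h6
      simp at h5
      omega
  · intro l κ z hκ
    simpa using hκ
  · refine ⟨by simp [hξ, hWρ], ⟨by rw [hm]; exact h0, fun S _ _ => by rw [hm]; simp [hξ]⟩,
      {s}, by simp, by simpa using hsu.symm, fun i _ j _ => ?_⟩
    rw [hm]
    simpa [hξ, hWρ] using h1 i j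
  · rintro l hl κ hF' - ⟨h2, h3, h4⟩
    have hκ : ∀ r, r ∉ [rI, rJ, rFlow, rDelta] → r ∉ rH :: phase.regs → κ.reg r = σ.reg r :=
      fun r h h' => (hF'.reg r h').trans (hr r h)
    have hpos : 0 < W / 2 ^ l := Nat.div_pos (Nat.lt_size.1 hl) (by positivity)
    obtain ⟨h5, h6, h7⟩ := exec_phase (X := σ.mat n aX)
      (by rw [hκ _ (by decide) (by decide), hn]) (by rw [hκ _ (by decide) (by decide), hN]) hnN
      (by rw [hκ _ (by decide) (by decide), hs]) (by rw [hκ _ (by decide) (by decide), hu])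
      (by rw [h2]; exact_mod_cast hpos) h3 h4
    refine ⟨?_, h6, by rwa [h5]⟩
    rw [h5, h2, pow_succ, ← Nat.div_div_eq_div_mul]
    simp

end Cmd

end Loop

/-! ### The computation of the splitting steps -/

namespace Stroll

set_option linter.unusedSectionVars false

section Integral

variable {V : Type*} [Fintype V] [DecidableEq V] {X : V → V → ℤ} {s t v a b : V} {W : ℤ}

/-- The amounts may be negative, so a tentative step can be corrected by a second one. -/
theorem splitOff_splitOff (X : V → V → ℤ) (v a b : V) (ε δ : ℤ) :
    splitOff (splitOff X v a b ε) v a b δ = splitOff X v a b (ε + δ) := by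
  funext p q
  have h : ∀ (c : Prop) [Decidable c] (x y : ℤ),
      (if c then x + y else 0) = (if c then x else 0) + if c then y else 0 := by
    intro c _ x y
    split_ifs <;> simp
  simp only [splitOff, bump, neg_add, h]
  ring

/-- A cut is the sum of the degrees inside minus the weight of the ordered pairs inside, and the
latter is even because each pair occurs in both orders. -/
theorem even_outWeight (hs : ∀ u v, X u v = X v u) (hd : ∀ u, X u u = 0)
    (he : ∀ u, Even (wdeg X u)) (S : Finset V) : Even (outWeight X S) := by
  have h1 : outWeight X S + ∑ p, ∑ q, (if p ∈ S ∧ q ∈ S then X p q else 0) =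
      ∑ p, if p ∈ S then wdeg X p else 0 := by
    simp only [outWeight, ← Finset.sum_add_distrib]
    refine Finset.sum_congr rfl fun p _ => ?_
    by_cases hp : p ∈ S
    · simp only [hp, true_and, if_true, wdeg]
      refine Finset.sum_congr rfl fun q _ => ?_
      by_cases hq : q ∈ S <;> simp [hq]
    · simp [hp]
  have h2 : Even (∑ p, if p ∈ S then wdeg X p else 0) :=
    Finset.even_sum _ fun p _ => by split_ifs <;> simp [he]
  have h3 : Even (∑ p, ∑ q, if p ∈ S ∧ q ∈ S then X p q else 0) := by
    rw [← Finset.sum_product', even_iff_two_dvd]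
    refine (ZMod.intCast_zmod_eq_zero_iff_dvd _ 2).1 ?_
    rw [Int.cast_sum]
    -- Modulo two the pairs cancel under the swap; its fixed points are diagonal and contribute
    -- nothing.
    refine Finset.sum_involution (fun z _ => (z.2, z.1)) (fun z _ => ?_) (fun z _ hz => ?_)
      (fun z _ => by simp) (fun z _ => rfl)
    · simp only [hs z.2 z.1, and_comm (a := z.2 ∈ S)]
      exact CharTwo.add_self_eq_zero _
    · rintro h
      have : z.2 = z.1 := congrArg Prod.fst h
      simp [this, hd] at hz
  rw [← h1] at h2
  exact (Int.even_add.1 h2).2 h3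

/-- The largest amount that can be split off, in terms of the deficit that arises if as much as
possible is split off. -/
theorem splitOff_deficit (h : Feasible X s t) (he : ∀ u, Even (wdeg X u)) (hva : a ≠ v)
    (hvb : b ≠ v) (hab : a ≠ b) (hvs : v ≠ s) (hvt : v ≠ t) {e δ : ℤ}
    (h1 : e ≤ X v a) (h2 : e ≤ X v b) (h3 : e = X v a ∨ e = X v b) (hδ : 0 ≤ δ)
    (hle : ∀ u, u ≠ s → u ≠ v → ∀ S : Finset V, s ∈ S → u ∉ S →
      wdeg X u - δ ≤ outWeight (splitOff X v a b e) S)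
    (hδ' : δ = 0 ∨ ∃ u, u ≠ s ∧ u ≠ v ∧ ∃ S : Finset V, s ∈ S ∧ u ∉ S ∧
      δ = wdeg X u - outWeight (splitOff X v a b e) S) :
    0 ≤ e - δ / 2 ∧ Feasible (splitOff X v a b (e - δ / 2)) s t ∧
      Blocked (splitOff X v a b (e - δ / 2)) s v a b := by
  have he0 : 0 ≤ e := by
    rcases h3 with h3 | h3 <;> rw [h3] <;> exact h.nonneg _ _
  have hsymm := splitOff_symm h.symm v a b e
  -- A cut that has become too small must be one whose weight was lowered, since all others still
  -- satisfy feasibility. Its loss was `2 * e`.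
  have hblock : δ ≠ 0 → ∃ u, u ≠ s ∧ u ≠ v ∧ ∃ S : Finset V, s ∈ S ∧ u ∉ S ∧ (a ∈ S ↔ b ∈ S) ∧
      (a ∈ S ↔ v ∉ S) ∧ δ = wdeg X u - outWeight X S + 2 * e := by
    intro hne
    obtain ⟨u, hus, huv, S, hsS, huS, hS⟩ := hδ'.resolve_left hne
    refine ⟨u, hus, huv, S, hsS, huS, ?_⟩
    by_cases hbl : (a ∈ S ↔ b ∈ S) ∧ (a ∈ S ↔ v ∉ S)
    · refine ⟨hbl.1, hbl.2, ?_⟩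
      rw [outWeight_splitOff_of_blocking X e hbl.1 hbl.2] at hS
      linarith
    · rw [outWeight_splitOff_of_not_blocking X e hbl] at hS
      have := h.le_outWeight (S := S) (u := u) ⟨fun _ => huS, fun _ => hsS⟩
      omega
  -- Degrees and cuts are even, hence so is the deficit, and halving it loses nothing.
  have heven : 2 * (δ / 2) = δ := by
    by_cases hne : δ = 0
    · simp [hne]
    · obtain ⟨u, -, -, S, -, -, -, -, hS⟩ := hblock hne
      have h4 : Even δ := by
        rw [hS]
        exact ((he u).sub (even_outWeight h.symm h.diag he S)).add (even_two_mul e)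
      exact Int.two_mul_ediv_two_of_even h4
  -- The cut was large enough before the step, so its deficit is at most `2 * e`.
  have hε : 0 ≤ e - δ / 2 := by
    by_cases hne : δ = 0
    · simpa [hne] using he0
    · obtain ⟨u, -, -, S, hsS, huS, -, -, hS⟩ := hblock hne
      have := h.le_outWeight (S := S) (u := u) ⟨fun _ => huS, fun _ => hsS⟩
      omega
  refine ⟨hε, splitOff_max h hva hvb hab hvs hvt hε (by omega) (by omega) ?_ ?_⟩
  · intro S u huv hsu habS havS
    have key : ∀ S : Finset V, (a ∈ S ↔ b ∈ S) → (a ∈ S ↔ v ∉ S) → s ∈ S → u ∉ S →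
        wdeg X u + 2 * (e - δ / 2) ≤ outWeight X S := by
      intro S habS havS hs hu
      have hus : u ≠ s := by
        rintro rfl
        exact hu hs
      have := hle u hus huv S hs hu
      rw [outWeight_splitOff_of_blocking X e habS havS] at this
      linarith
    by_cases hs : s ∈ S
    · exact key S habS havS hs (hsu.1 hs)
    · rw [← outWeight_compl h.symm]
      refine key Sᶜ (by simp only [Finset.mem_compl, habS]) (by simp only [Finset.mem_compl, havS])
        (by simpa using hs) fun hu => hs (hsu.2 (by simpa using hu))
  · by_cases hne : δ = 0
    · rcases h3 with h3 | h3
      · left; simp [hne, h3]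
      · right; left; simp [hne, h3]
    · right; right
      obtain ⟨u, -, huv, S, hsS, huS, hab, hav, hS⟩ := hblock hne
      exact ⟨S, u, huv, ⟨fun _ => huS, fun _ => hsS⟩, hab, hav, by linarith⟩

/-- The tentative matrix may violate cut conditions, but it still has nonnegative entries, as the
flow computation requires. -/
theorem splitOff_nonneg (h : Feasible X s t) (hva : a ≠ v) (hvb : b ≠ v) (hab : a ≠ b) {e : ℤ}
    (he : 0 ≤ e) (h1 : e ≤ X v a) (h2 : e ≤ X v b) (p q : V) : 0 ≤ splitOff X v a b e p q := by
  have hv : ∀ q, 0 ≤ splitOff X v a b e v q := by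
    intro q
    rw [splitOff_apply_left X hva hvb]
    have := h.nonneg v q
    by_cases hqa : q = a
    · subst hqa
      simp [hab]
      exact h1
    · by_cases hqb : q = b
      · subst hqb
        simp [hab.symm]
        exact h2
      · simpa [hqa, hqb] using this
  by_cases hp : p = v
  · rw [hp]
    exact hv q
  · by_cases hq : q = v
    · rw [hq, splitOff_symm h.symm]
      exact hv p
    · rw [splitOff_apply_of_ne X a b e hp hq]
      have := h.nonneg p q
      split_ifs <;> linarith

/-- An entry is at most its row sum, which the step does not increase. This is the capacity bound
with which scaling starts. -/
theorem splitOff_le (h : Feasible X s t) (hva : a ≠ v) (hvb : b ≠ v) (hab : a ≠ b) {e : ℤ}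
    (he : 0 ≤ e) (h1 : e ≤ X v a) (h2 : e ≤ X v b) (p q : V) :
    splitOff X v a b e p q ≤ wdeg X s := by
  have h3 : wdeg (splitOff X v a b e) p ≤ wdeg X p := by
    rw [wdeg_splitOff X hva hvb]
    split_ifs <;> linarith
  refine ((Finset.single_le_sum (fun q _ => splitOff_nonneg h hva hvb hab he h1 h2 p q)
    (Finset.mem_univ q)).trans h3).trans (h.wdeg_le_source p)

end Integral

end Stroll

/-! ### The program for one splitting step -/

namespace Loop

notation "rV" => (18 : ℕ)
notation "rA" => (19 : ℕ)
notation "rB" => (20 : ℕ)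
notation "rE" => (21 : ℕ)
notation "rDf" => (22 : ℕ)
notation "rCnt" => (23 : ℕ)
notation "rZ" => (24 : ℕ)
notation "aRec" => (5 : ℕ)

/-- The registers that stay constant: the number of vertices, `s`, `t`, the total weight `W`, the
number of its digits, and a large number `N`. -/
structure Env (n N W : ℕ) (s t : Fin n) (σ : Mem) : Prop where
  n : σ.reg rN = n
  s : σ.reg rS = (s : ℕ)
  t : σ.reg rT = (t : ℕ)
  K : σ.reg rK = Nat.size W
  W : σ.reg rW = W
  N : σ.reg rL = N

theorem Env.of_frame {n N W : ℕ} {s t : Fin n} {σ ρ : Mem} {R A : List ℕ} (h : Env n N W s t σ)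
    (hF : Frame R A σ ρ) (hR : ∀ r ∈ [rN, rS, rT, rW, rK, rL], r ∉ R) : Env n N W s t ρ :=
  ⟨(hF.reg _ (hR _ (by decide))).trans h.n, (hF.reg _ (hR _ (by decide))).trans h.s,
    (hF.reg _ (hR _ (by decide))).trans h.t, (hF.reg _ (hR _ (by decide))).trans h.K,
    (hF.reg _ (hR _ (by decide))).trans h.W, (hF.reg _ (hR _ (by decide))).trans h.N⟩

namespace Cmd

/-- Split off at `va`, `vb` by the value of the register `r`. -/
def split (r : ℕ) : Cmd :=
  addTo aX ◦rV ◦rA (0 - ◦r) ;; addTo aX ◦rA ◦rV (0 - ◦r) ;; addTo aX ◦rV ◦rB (0 - ◦r) ;;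
    addTo aX ◦rB ◦rV (0 - ◦r) ;; addTo aX ◦rA ◦rB ◦r ;; addTo aX ◦rB ◦rA ◦r

def deficitStep : Cmd :=
  iteq ◦rU ◦rS skip (iteq ◦rU ◦rV skip (maxFlow ;;
    ite ◦rDf (.arr aDeg 0 ◦rU - ◦rFlow) (assign rDf (.arr aDeg 0 ◦rU - ◦rFlow)) skip))

/-- The largest deficit of a cut. -/
def deficit : Cmd := assign rDf 0 ;; loop rU rN deficitStep

def record : Cmd :=
  store aRec ◦rCnt 0 ◦rV ;; store aRec ◦rCnt 1 ◦rA ;; store aRec ◦rCnt 2 ◦rB ;;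
    store aRec ◦rCnt 3 ◦rE ;; assign rCnt (◦rCnt + 1)

/-- Split off at `va`, `vb` as much as possible, where `rE` is the smaller weight. -/
def splitLargest : Cmd :=
  split rE ;; deficit ;; assign rDf (0 - ◦rDf / 2) ;; split rDf ;; assign rE (◦rE + ◦rDf) ;;
    store aDeg 0 ◦rV (.arr aDeg 0 ◦rV - ◦rE - ◦rE) ;; record

def smaller : Cmd :=
  ite (.arr aX ◦rV ◦rA) (.arr aX ◦rV ◦rB) (assign rE (.arr aX ◦rV ◦rA))
    (assign rE (.arr aX ◦rV ◦rB))

/-- Pairs that contain `v` need no separate test: the diagonal entry makes the smaller weight zero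
or less, and nothing is split off. -/
def splitPair : Cmd := iteq ◦rA ◦rB skip (smaller ;; ite 0 ◦rE splitLargest skip)

variable {n N W : ℕ} {σ : Mem} {s t v a b : Fin n}

theorem exec_split {r : ℕ} (hv : σ.reg rV = (v : ℕ)) (ha : σ.reg rA = (a : ℕ))
    (hb : σ.reg rB = (b : ℕ)) : ((split r).exec σ).mat n aX =
      Stroll.splitOff (σ.mat n aX) v a b (σ.reg r) := by
  have hreg : ∀ (ρ : Mem) (e f g : Exp), ((addTo aX e f g).exec ρ).reg = ρ.reg := fun _ _ _ _ => rfl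
  simp only [split, exec_seq]
  rw [exec_addTo (p := b) (q := a), exec_addTo (p := a) (q := b), exec_addTo (p := b) (q := v),
    exec_addTo (p := v) (q := b), exec_addTo (p := a) (q := v), exec_addTo (p := v) (q := a)]
  · simp only [Exp.eval_sub, Exp.eval_zero, Exp.eval_reg, hreg, zero_sub]
    rfl
  all_goals simp [hreg, hv, ha, hb]

/-- By maximum flows the register `rDf` collects the largest amount by which a minimum cut falls
short of a degree, and zero if there is no shortfall. -/
theorem exec_deficit (hE : Env n N W s t σ) (hN : 2 * n ^ 2 < N) (hv : σ.reg rV = (v : ℕ))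
    (h0 : ∀ i j, 0 ≤ σ.mat n aX i j) (h1 : ∀ i j, σ.mat n aX i j ≤ 2 * W) :
    0 ≤ (deficit.exec σ).reg rDf ∧
    (∀ u, u ≠ s → u ≠ v → ∀ S : Finset (Fin n), s ∈ S → u ∉ S →
      σ.vec n aDeg u - (deficit.exec σ).reg rDf ≤ Stroll.outWeight (σ.mat n aX) S) ∧
    ((deficit.exec σ).reg rDf = 0 ∨ ∃ u, u ≠ s ∧ u ≠ v ∧ ∃ S : Finset (Fin n), s ∈ S ∧ u ∉ S ∧
      (deficit.exec σ).reg rDf = σ.vec n aDeg u - Stroll.outWeight (σ.mat n aX) S) := by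
  simp only [deficit, exec_seq, exec_assign, Exp.eval_zero]
  have key := loop_fin (i := rU) (k := rN) (σ := σ.set rDf 0) (c := deficitStep) (n := n)
    (by simp [hE.n]) (fun D ρ => 0 ≤ ρ.reg rDf ∧
    (∀ u ∈ D, u ≠ s → u ≠ v → ∀ S : Finset (Fin n), s ∈ S → u ∉ S →
      σ.vec n aDeg u - ρ.reg rDf ≤ Stroll.outWeight (σ.mat n aX) S) ∧
    (ρ.reg rDf = 0 ∨ ∃ u, u ≠ s ∧ u ≠ v ∧ ∃ S : Finset (Fin n), s ∈ S ∧ u ∉ S ∧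
      ρ.reg rDf = σ.vec n aDeg u - Stroll.outWeight (σ.mat n aX) S)) ?_ ?_ ?_
  · simpa using key
  · intro D ρ z h
    simpa using h
  · simp
  · rintro D u _ ρ hF hu ⟨h2, h3, h4⟩
    have hm : ρ.mat n aX = σ.mat n aX := by rw [hF.mat (by decide)]; simp
    have hd : ρ.vec n aDeg = σ.vec n aDeg := by rw [hF.vec (by decide)]; simp
    have hr : ∀ r, r ∉ rU :: deficitStep.regs → r ≠ rDf → ρ.reg r = σ.reg r := by
      intro r h h'
      rw [hF.reg r h]
      simp [h']
    have hskip : u = s ∨ u = v → 0 ≤ ρ.reg rDf ∧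
        (∀ w ∈ insert u D, w ≠ s → w ≠ v → ∀ S : Finset (Fin n), s ∈ S → w ∉ S →
          σ.vec n aDeg w - ρ.reg rDf ≤ Stroll.outWeight (σ.mat n aX) S) ∧
        (ρ.reg rDf = 0 ∨ ∃ u, u ≠ s ∧ u ≠ v ∧ ∃ S : Finset (Fin n), s ∈ S ∧ u ∉ S ∧
          ρ.reg rDf = σ.vec n aDeg u - Stroll.outWeight (σ.mat n aX) S) := by
      refine fun hcase => ⟨h2, fun w hw hws hwv => ?_, h4⟩
      rcases Finset.mem_insert.1 hw with rfl | hw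
      · tauto
      · exact h3 w hw hws hwv
    have hs' : ρ.reg rS = (s : ℕ) := by rw [hr _ (by decide) (by decide), hE.s]
    have hv' : ρ.reg rV = (v : ℕ) := by rw [hr _ (by decide) (by decide), hv]
    rw [deficitStep]
    by_cases hus : u = s
    · rw [exec_iteq_pos _ _ (by simp [hu, hs', hus]), exec_skip]
      exact hskip (Or.inl hus)
    rw [exec_iteq_neg _ _ (by simpa [hu, hs', Fin.val_inj] using hus)]
    by_cases huv : u = v
    · rw [exec_iteq_pos _ _ (by simp [hu, hv', huv]), exec_skip]
      exact hskip (Or.inr huv)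
    rw [exec_iteq_neg _ _ (by simpa [hu, hv', Fin.val_inj] using huv), exec_seq]
    obtain ⟨h5, S, hsS, huS, h6⟩ := exec_maxFlow (σ := ρ) (n := n) (s := s) (u := u) (N := N)
      (W := W) (by rw [hr _ (by decide) (by decide), hE.n])
      (by rw [hr _ (by decide) (by decide), hE.N]) hN hs' hu (Ne.symm hus)
      (by rw [hr _ (by decide) (by decide), hE.W]) (by rw [hr _ (by decide) (by decide), hE.K])
      (by rw [hm]; exact h0) (by rw [hm]; exact h1)
    rw [hm] at h5 h6
    have hF' := maxFlow.frame ρ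
    set ξ := maxFlow.exec ρ with hξ
    have hdf : ξ.reg rDf = ρ.reg rDf := hF'.reg rDf (by decide)
    have hdeg : Exp.eval ξ (.arr aDeg 0 ◦rU - ◦rFlow) = σ.vec n aDeg u - ξ.reg rFlow := by
      rw [Exp.eval_sub, Exp.eval_arr, Exp.eval_reg, Exp.eval_zero, Exp.eval_reg,
        hF'.reg rU (by decide), hF'.arr aDeg (by decide), hu, ← hd]
      rfl
    by_cases hlt : Exp.eval ξ ◦rDf < Exp.eval ξ (.arr aDeg 0 ◦rU - ◦rFlow)
    · rw [exec_ite_pos _ _ hlt, exec_assign, hdeg]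
      rw [hdeg, Exp.eval_reg, hdf] at hlt
      simp only [Mem.set_reg, if_true]
      refine ⟨by omega, fun w hw hws hwv S hsS hwS => ?_, Or.inr ⟨u, hus, huv, S, hsS, huS, ?_⟩⟩
      · rcases Finset.mem_insert.1 hw with rfl | hw
        · have := h5 S hsS hwS
          omega
        · have := h3 w hw hws hwv S hsS hwS
          omega
      · rw [h6]
    · rw [exec_ite_neg _ _ hlt, exec_skip, hdf]
      rw [hdeg, Exp.eval_reg, hdf] at hlt
      refine ⟨h2, fun w hw hws hwv S hsS hwS => ?_, h4⟩
      rcases Finset.mem_insert.1 hw with rfl | hw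
      · have := h5 S hsS hwS
        omega
      · exact h3 w hw hws hwv S hsS hwS

/-- The steps `l` are recorded. -/
structure Records (l : List (Stroll.Rec (Fin n) ℤ)) (σ : Mem) : Prop where
  count : σ.reg rCnt = l.length
  entry : ∀ (k : ℕ) (r : Stroll.Rec (Fin n) ℤ), l[k]? = some r →
    σ.arr aRec k 0 = (r.v : ℕ) ∧ σ.arr aRec k 1 = (r.a : ℕ) ∧ σ.arr aRec k 2 = (r.b : ℕ) ∧ σ.arr aRec k 3 = r.ε

theorem exec_record {l : List (Stroll.Rec (Fin n) ℤ)} (h : Records l σ) (hv : σ.reg rV = (v : ℕ))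
    (ha : σ.reg rA = (a : ℕ)) (hb : σ.reg rB = (b : ℕ)) :
    Records (l ++ [⟨v, a, b, σ.reg rE⟩]) (record.exec σ) := by
  refine ⟨?_, fun k r hk => ?_⟩
  · simp [record, exec, h.count]
  · simp only [record, exec, Exp.eval_reg, Exp.eval_zero, Exp.eval_one, Exp.eval_two,
      Exp.eval_three, Mem.set_arr, Mem.put_arr, Mem.put_reg, h.count]
    by_cases hkl : k = l.length
    · subst hkl
      obtain rfl : _ = r := by simpa using hk
      simp [hv, ha, hb]
    · have hk' : l[k]? = some r := by
        rw [List.getElem?_append] at hk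
        split_ifs at hk with h1
        · exact hk
        · obtain ⟨h2, -⟩ := List.getElem?_eq_some_iff.1 hk
          simp at h2
          omega
      have := h.entry k r hk'
      simpa [hkl] using this

/-- The state of the splitting process: the steps `l` led from `X₀` to the current matrix. -/
structure SplitInv (W : ℕ) (s t : Fin n) (X₀ : Fin n → Fin n → ℤ)
    (l : List (Stroll.Rec (Fin n) ℤ)) (σ : Mem) : Prop where
  chain : Stroll.Chain s t (W : ℤ) X₀ l (σ.mat n aX)
  deg : σ.vec n aDeg = Stroll.wdeg (σ.mat n aX)
  even : ∀ u, Even (Stroll.wdeg (σ.mat n aX) u)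
  records : Records l σ

theorem SplitInv.set {X₀ : Fin n → Fin n → ℤ} {l : List (Stroll.Rec (Fin n) ℤ)}
    (h : SplitInv W s t X₀ l σ) {r : ℕ} (hr : r ≠ rCnt) (z : ℤ) :
    SplitInv W s t X₀ l (σ.set r z) :=
  ⟨h.chain, h.deg, h.even, ⟨by simpa [hr.symm] using h.records.count, h.records.entry⟩⟩

/-- The smaller weight is split off tentatively, and half the resulting deficit is given back. The
degree of `v` is updated by the final amount, which is also the one recorded for the reversal. -/
theorem exec_splitLargest {X₀ : Fin n → Fin n → ℤ} {l : List (Stroll.Rec (Fin n) ℤ)}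
    (hE : Env n N W s t σ) (hN : 2 * n ^ 2 < N) (hv : σ.reg rV = (v : ℕ))
    (ha : σ.reg rA = (a : ℕ)) (hb : σ.reg rB = (b : ℕ)) (h : SplitInv W s t X₀ l σ)
    (hr : Stroll.Ready s t (W : ℤ) (σ.mat n aX) v) (hva : a ≠ v) (hvb : b ≠ v) (hab : a ≠ b)
    (h0 : 0 ≤ σ.reg rE) (h1 : σ.reg rE ≤ σ.mat n aX v a) (h2 : σ.reg rE ≤ σ.mat n aX v b)
    (h3 : σ.reg rE = σ.mat n aX v a ∨ σ.reg rE = σ.mat n aX v b) :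
    ∃ ε, 0 ≤ ε ∧ (splitLargest.exec σ).mat n aX = Stroll.splitOff (σ.mat n aX) v a b ε ∧
      Stroll.Feasible (Stroll.splitOff (σ.mat n aX) v a b ε) s t ∧
      Stroll.Blocked (Stroll.splitOff (σ.mat n aX) v a b ε) s v a b ∧
      SplitInv W s t X₀ (l ++ [⟨v, a, b, ε⟩]) (splitLargest.exec σ) := by
  simp only [splitLargest, exec_seq, exec_assign, exec_store]
  have hm₁ := exec_split (r := rE) hv ha hb
  have hF₁ := (split rE).frame σ
  set σ₁ := (split rE).exec σ with hσ₁
  have hW : Stroll.wdeg (σ.mat n aX) s = 2 * W := hr.wdeg_source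
  obtain ⟨d1, d2, d3⟩ := exec_deficit (σ := σ₁) (v := v) (hE.of_frame hF₁ (by decide)) hN
    (by rw [hF₁.reg _ (by decide), hv])
    (by rw [hm₁]; exact Stroll.splitOff_nonneg hr.feasible hva hvb hab h0 h1 h2)
    (by rw [hm₁, ← hW]; exact Stroll.splitOff_le hr.feasible hva hvb hab h0 h1 h2)
  have hd₁ : σ₁.vec n aDeg = Stroll.wdeg (σ.mat n aX) := by
    rw [hF₁.vec (by decide), h.deg]
  rw [hm₁, hd₁] at d2 d3
  have hF₂ := deficit.frame σ₁
  set σ₂ := deficit.exec σ₁ with hσ₂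
  obtain ⟨hε, hf, hbl⟩ := Stroll.splitOff_deficit hr.feasible h.even hva hvb hab hr.ne_source
    hr.ne_target h1 h2 h3 d1 d2 d3
  set ε := σ.reg rE - σ₂.reg rDf / 2 with hεdef
  simp only [Exp.eval_sub, Exp.eval_zero, Exp.eval_div, Exp.eval_reg, Exp.eval_two, Exp.eval_add,
    Exp.eval_arr, zero_sub]
  -- From here on `rDf` holds the correction, a splitting amount that is not positive.
  set σ₃ := σ₂.set rDf (-(σ₂.reg rDf / 2)) with hσ₃
  have hreg₃ : ∀ r, r ∉ (split rE).regs ++ deficit.regs → r ≠ rDf → σ₃.reg r = σ.reg r := by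
    intro r hr hr'
    simp only [List.mem_append, not_or] at hr
    rw [hσ₃, Mem.set_reg, if_neg hr', hF₂.reg r hr.2, hF₁.reg r hr.1]
  have hm₄ := exec_split (σ := σ₃) (r := rDf) (v := v) (a := a) (b := b)
    (by rw [hreg₃ _ (by decide) (by decide), hv]) (by rw [hreg₃ _ (by decide) (by decide), ha])
    (by rw [hreg₃ _ (by decide) (by decide), hb])
  have hF₄ := (split rDf).frame σ₃
  set σ₄ := (split rDf).exec σ₃ with hσ₄
  have hm₃ : σ₃.mat n aX = Stroll.splitOff (σ.mat n aX) v a b (σ.reg rE) := by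
    rw [hσ₃, Mem.mat_set, hF₂.mat (by decide), hm₁]
  have hreg₄ : ∀ r, r ∉ (split rE).regs ++ deficit.regs → r ≠ rDf → σ₄.reg r = σ.reg r :=
    fun r hr hr' => (hF₄.reg r (by simp [split, regs, addTo])).trans (hreg₃ r hr hr')
  have hdf₄ : σ₄.reg rDf = -(σ₂.reg rDf / 2) := by
    rw [hF₄.reg _ (by decide)]
    simp [hσ₃]
  have hdf₃ : σ₃.reg rDf = -(σ₂.reg rDf / 2) := by simp [hσ₃]
  rw [hm₃, Stroll.splitOff_splitOff, hdf₃, ← sub_eq_add_neg, ← hεdef] at hm₄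
  have hE₄ : σ₄.reg rE = σ.reg rE := hreg₄ _ (by decide) (by decide)
  have hV₄ : σ₄.reg rV = (v : ℕ) := by rw [hreg₄ _ (by decide) (by decide), hv]
  have hA₄ : σ₄.reg rA = (a : ℕ) := by rw [hreg₄ _ (by decide) (by decide), ha]
  have hB₄ : σ₄.reg rB = (b : ℕ) := by rw [hreg₄ _ (by decide) (by decide), hb]
  have hd₄ : σ₄.vec n aDeg = Stroll.wdeg (σ.mat n aX) := by
    rw [hF₄.vec (by decide), hσ₃, Mem.vec_set, hF₂.vec (by decide), hd₁]
  have hrec₄ : Records l σ₄ := by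
    refine ⟨?_, fun k r hk => ?_⟩
    · rw [hreg₄ _ (by decide) (by decide), h.records.count]
    · rw [hF₄.arr _ (by decide), hσ₃, Mem.set_arr, hF₂.arr _ (by decide), hF₁.arr _ (by decide)]
      exact h.records.entry k r hk
  rw [hE₄, hdf₄, ← sub_eq_add_neg, ← hεdef]
  set σ₅ := σ₄.set rE ε with hσ₅
  have hV₅ : σ₅.reg rV = (v : ℕ) := by simp [hσ₅, hV₄]
  have hE₅ : σ₅.reg rE = ε := by simp [hσ₅]
  rw [hV₅, hE₅]
  set σ₆ := σ₅.put aDeg 0 (v : ℕ) (σ₅.arr aDeg 0 (v : ℕ) - ε - ε) with hσ₆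
  have hrec₆ : Records l σ₆ := ⟨by simpa [hσ₆, hσ₅] using hrec₄.count, fun k r hk => by
    simpa [hσ₆, hσ₅] using hrec₄.entry k r hk⟩
  have hrec := exec_record (a := a) (b := b) hrec₆ hV₅ (by simp [hσ₆, hσ₅, hA₄])
    (by simp [hσ₆, hσ₅, hB₄])
  rw [show σ₆.reg rE = ε from hE₅] at hrec
  have hF₇ := record.frame σ₆
  set σ₇ := record.exec σ₆ with hσ₇
  have hm₇ : σ₇.mat n aX = Stroll.splitOff (σ.mat n aX) v a b ε := by
    rw [hF₇.mat (by decide), hσ₆, Mem.mat_put_of_ne _ _ _ (by decide), hσ₅, Mem.mat_set, hm₄]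
  have hwd := Stroll.wdeg_splitOff (σ.mat n aX) hva hvb ε
  refine ⟨ε, hε, hm₇, hf, hbl, ⟨?_, ?_, ?_, hrec⟩⟩
  · rw [hm₇]
    exact h.chain.snoc ⟨hr, hva, hvb, hab, hε, rfl⟩
  · rw [hm₇, hF₇.vec (by decide), hσ₆, Mem.vec_put, hσ₅, Mem.vec_set, Mem.set_arr,
      Mem.arr_eq_vec, hd₄]
    funext u
    rw [hwd]
    by_cases huv : u = v
    · subst huv
      simp
      ring
    · simp [huv]
  · intro u
    rw [hm₇, hwd]
    refine (h.even u).sub ?_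
    split_ifs
    · exact even_two_mul ε
    · simp

theorem exec_splitPair {X₀ : Fin n → Fin n → ℤ} {l : List (Stroll.Rec (Fin n) ℤ)}
    (hE : Env n N W s t σ) (hN : 2 * n ^ 2 < N) (hv : σ.reg rV = (v : ℕ))
    (ha : σ.reg rA = (a : ℕ)) (hb : σ.reg rB = (b : ℕ)) (h : SplitInv W s t X₀ l σ)
    (hr : Stroll.Ready s t (W : ℤ) (σ.mat n aX) v) :
    ∃ l', l'.length ≤ l.length + 1 ∧ SplitInv W s t X₀ l' (splitPair.exec σ) ∧
      Stroll.Ready s t (W : ℤ) ((splitPair.exec σ).mat n aX) v ∧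
      (∀ u, u ≠ v → Stroll.wdeg ((splitPair.exec σ).mat n aX) u = Stroll.wdeg (σ.mat n aX) u) ∧
      (a ≠ b → Stroll.Blocked ((splitPair.exec σ).mat n aX) s v a b) ∧
      ∀ c d, Stroll.Blocked (σ.mat n aX) s v c d →
        Stroll.Blocked ((splitPair.exec σ).mat n aX) s v c d := by
  rw [splitPair]
  by_cases hab : a = b
  · rw [exec_iteq_pos _ _ (by simp [ha, hb, hab]), exec_skip]
    exact ⟨l, by omega, h, hr, fun _ _ => rfl, fun hne => absurd hab hne, fun _ _ h => h⟩
  rw [exec_iteq_neg _ _ (by simpa [ha, hb, Fin.val_inj] using hab), exec_seq]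
  obtain ⟨e, hsm, h1, h2, h3⟩ : ∃ e, smaller.exec σ = σ.set rE e ∧ e ≤ σ.mat n aX v a ∧
      e ≤ σ.mat n aX v b ∧ (e = σ.mat n aX v a ∨ e = σ.mat n aX v b) := by
    have ea : Exp.eval σ (.arr aX ◦rV ◦rA) = σ.mat n aX v a := by simp [hv, ha, Mem.mat]
    have eb : Exp.eval σ (.arr aX ◦rV ◦rB) = σ.mat n aX v b := by simp [hv, hb, Mem.mat]
    rw [smaller]
    by_cases hlt : Exp.eval σ (.arr aX ◦rV ◦rA) < Exp.eval σ (.arr aX ◦rV ◦rB)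
    · refine ⟨_, exec_ite_pos _ _ hlt, ea.le, ?_, Or.inl ea⟩
      rw [← eb]
      exact hlt.le
    · refine ⟨_, exec_ite_neg _ _ hlt, ?_, eb.le, Or.inr eb⟩
      rw [← ea]
      exact not_lt.1 hlt
  rw [hsm]
  set ρ := σ.set rE e with hρ
  have hreg : ∀ r, r ≠ rE → ρ.reg r = σ.reg r := fun r hr => by simp [hρ, hr]
  have hm : ρ.mat n aX = σ.mat n aX := rfl
  have hinv : SplitInv W s t X₀ l ρ := h.set (by decide) e
  by_cases hpos : Exp.eval ρ 0 < Exp.eval ρ ◦rE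
  · rw [exec_ite_pos _ _ hpos]
    have hpos : 0 < e := by simpa [hρ] using hpos
    have hva : a ≠ v := by
      rintro rfl
      rw [hr.feasible.diag] at h1
      omega
    have hvb : b ≠ v := by
      rintro rfl
      rw [hr.feasible.diag] at h2
      omega
    have hρE : ρ.reg rE = e := by simp [hρ]
    obtain ⟨ε, hε, k1, k2, k3, k4⟩ := exec_splitLargest (σ := ρ) (v := v) (a := a) (b := b)
      ⟨by rw [hreg _ (by decide), hE.n], by rw [hreg _ (by decide), hE.s],
        by rw [hreg _ (by decide), hE.t], by rw [hreg _ (by decide), hE.K],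
        by rw [hreg _ (by decide), hE.W], by rw [hreg _ (by decide), hE.N]⟩ hN
      (by rw [hreg _ (by decide), hv]) (by rw [hreg _ (by decide), ha])
      (by rw [hreg _ (by decide), hb]) hinv hr hva hvb hab (by omega) (by rwa [hρE]) (by rwa [hρE])
      (by rwa [hρE])
    refine ⟨_, by simp, k4, ?_⟩
    rw [k1]
    refine ⟨hr.splitOff hva hvb hε k2, fun u hu => ?_, fun _ => k3,
      fun c d hcd => hcd.splitOff hva hvb hε⟩
    rw [Stroll.wdeg_splitOff _ hva hvb, if_neg hu, sub_zero, hm]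
  · rw [exec_ite_neg _ _ hpos, exec_skip]
    have hpos : ¬ 0 < e := by simpa [hρ] using hpos
    refine ⟨l, by omega, hinv, hr, fun _ _ => rfl, fun _ => ?_, fun _ _ h => h⟩
    rcases h3 with h3 | h3
    · exact Or.inl (by rw [hm]; omega)
    · exact Or.inr (Or.inl (by rw [hm]; omega))

end Cmd

end Loop

/-! ### The program for the whole splitting process -/

namespace Loop

namespace Cmd

def chooseStep : Cmd :=
  iteq ◦rU ◦rS skip (iteq ◦rU ◦rT skip (ite 0 (.arr aDeg 0 ◦rU)
    (ite ◦rV 0 (assign rV ◦rU)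
      (ite (.arr aDeg 0 ◦rU) (.arr aDeg 0 ◦rV) (assign rV ◦rU) skip)) skip))

/-- Choose a vertex `v ≠ s, t` of least positive degree. -/
def choose : Cmd := assign rV (0 - 1) ;; loop rU rN chooseStep

def splitVertex : Cmd := loop rA rN (loop rB rN splitPair)

def splitRound : Cmd := choose ;; ite ◦rV 0 skip splitVertex

def splitAll : Cmd := assign rCnt 0 ;; loop rZ rN splitRound

variable {n N W : ℕ} {σ : Mem} {s t v : Fin n}

/-- `rV` holds a vertex of least positive degree among those in `D`, if there is one. -/
def Chosen (s t : Fin n) (d : Fin n → ℤ) (D : Finset (Fin n)) (z : ℤ) : Prop :=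
  (z = -1 ∧ ∀ u ∈ D, u ≠ s → u ≠ t → d u ≤ 0) ∨ ∃ v : Fin n, z = (v : ℕ) ∧ v ≠ s ∧ v ≠ t ∧
    0 < d v ∧ ∀ u ∈ D, u ≠ s → u ≠ t → 0 < d u → d v ≤ d u

theorem exec_choose (hE : Env n N W s t σ) :
    Chosen s t (σ.vec n aDeg) Finset.univ ((choose.exec σ).reg rV) := by
  simp only [choose, exec_seq, exec_assign, Exp.eval_zero, Exp.eval_sub, Exp.eval_one, zero_sub]
  refine loop_fin (i := rU) (k := rN) (σ := σ.set rV (-1)) (c := chooseStep) (n := n)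
    (by simp [hE.n]) (fun D ρ => Chosen s t (σ.vec n aDeg) D (ρ.reg rV)) ?_ ?_ ?_
  · intro D ρ z h
    simpa using h
  · simp [Chosen]
  · rintro D u _ ρ hF hu h
    have hd : ρ.vec n aDeg = σ.vec n aDeg := by rw [hF.vec (by decide)]; simp
    have hs : ρ.reg rS = (s : ℕ) := by rw [hF.reg _ (by decide)]; simp [hE.s]
    have ht : ρ.reg rT = (t : ℕ) := by rw [hF.reg _ (by decide)]; simp [hE.t]
    have hdu : Exp.eval ρ (.arr aDeg 0 ◦rU) = σ.vec n aDeg u := by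
      rw [← hd]
      simp [hu, Mem.vec]
    have hskip : u = s ∨ u = t ∨ σ.vec n aDeg u ≤ 0 →
        Chosen s t (σ.vec n aDeg) (insert u D) (ρ.reg rV) := by
      intro hcase
      rcases h with ⟨h1, h2⟩ | ⟨v, h1, h2, h3, h4, h5⟩
      · refine Or.inl ⟨h1, fun w hw hws hwt => ?_⟩
        rcases Finset.mem_insert.1 hw with rfl | hw
        · tauto
        · exact h2 w hw hws hwt
      · refine Or.inr ⟨v, h1, h2, h3, h4, fun w hw hws hwt hpos => ?_⟩
        rcases Finset.mem_insert.1 hw with rfl | hw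
        · rcases hcase with hc | hc | hc
          · exact absurd hc hws
          · exact absurd hc hwt
          · omega
        · exact h5 w hw hws hwt hpos
    rw [chooseStep]
    by_cases hus : u = s
    · rw [exec_iteq_pos _ _ (by simp [hu, hs, hus]), exec_skip]
      exact hskip (Or.inl hus)
    rw [exec_iteq_neg _ _ (by simpa [hu, hs, Fin.val_inj] using hus)]
    by_cases hut : u = t
    · rw [exec_iteq_pos _ _ (by simp [hu, ht, hut]), exec_skip]
      exact hskip (Or.inr (Or.inl hut))
    rw [exec_iteq_neg _ _ (by simpa [hu, ht, Fin.val_inj] using hut)]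
    by_cases hpos : Exp.eval ρ 0 < Exp.eval ρ (.arr aDeg 0 ◦rU)
    swap
    · rw [exec_ite_neg _ _ hpos, exec_skip]
      rw [hdu, Exp.eval_zero] at hpos
      exact hskip (Or.inr (Or.inr (not_lt.1 hpos)))
    rw [exec_ite_pos _ _ hpos]
    rw [hdu, Exp.eval_zero] at hpos
    rcases h with ⟨h1, h2⟩ | ⟨v, h1, h2, h3, h4, h5⟩
    · rw [exec_ite_pos _ _ (by simp [h1]), exec_assign]
      refine Or.inr ⟨u, by simp [hu], hus, hut, hpos, fun w hw hws hwt hw0 => ?_⟩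
      rcases Finset.mem_insert.1 hw with rfl | hw
      · exact le_rfl
      · exact absurd hw0 (not_lt.2 (h2 w hw hws hwt))
    · rw [exec_ite_neg _ _ (by simp [h1])]
      have hdv : Exp.eval ρ (.arr aDeg 0 ◦rV) = σ.vec n aDeg v := by
        rw [← hd]
        simp [h1, Mem.vec]
      by_cases hlt : Exp.eval ρ (.arr aDeg 0 ◦rU) < Exp.eval ρ (.arr aDeg 0 ◦rV)
      · rw [exec_ite_pos _ _ hlt, exec_assign]
        rw [hdu, hdv] at hlt
        refine Or.inr ⟨u, by simp [hu], hus, hut, hpos, fun w hw hws hwt hw0 => ?_⟩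
        rcases Finset.mem_insert.1 hw with rfl | hw
        · exact le_rfl
        · exact hlt.le.trans (h5 w hw hws hwt hw0)
      · rw [exec_ite_neg _ _ hlt, exec_skip]
        rw [hdu, hdv] at hlt
        refine Or.inr ⟨v, h1, h2, h3, h4, fun w hw hws hwt hw0 => ?_⟩
        rcases Finset.mem_insert.1 hw with rfl | hw
        · exact not_lt.1 hlt
        · exact h5 w hw hws hwt hw0

theorem exec_splitVertex {X₀ : Fin n → Fin n → ℤ} {l : List (Stroll.Rec (Fin n) ℤ)} (hst : s ≠ t)
    (hE : Env n N W s t σ) (hN : 2 * n ^ 2 < N) (hv : σ.reg rV = (v : ℕ))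
    (h : SplitInv W s t X₀ l σ) (hr : Stroll.Ready s t (W : ℤ) (σ.mat n aX) v) :
    ∃ l', l'.length ≤ l.length + n ^ 2 ∧ SplitInv W s t X₀ l' (splitVertex.exec σ) ∧
      Stroll.Ready s t (W : ℤ) ((splitVertex.exec σ).mat n aX) v ∧
      (∀ u, u ≠ v → Stroll.wdeg ((splitVertex.exec σ).mat n aX) u =
        Stroll.wdeg (σ.mat n aX) u) ∧ Stroll.wdeg ((splitVertex.exec σ).mat n aX) v = 0 := by
  have key := loop_fin₂ (i := rA) (j := rB) (k := rN) (c := splitPair) hE.n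
    (fun D ρ => ∃ l', l'.length ≤ l.length + D.card ∧ SplitInv W s t X₀ l' ρ ∧
      Stroll.Ready s t (W : ℤ) (ρ.mat n aX) v ∧
      (∀ u, u ≠ v → Stroll.wdeg (ρ.mat n aX) u = Stroll.wdeg (σ.mat n aX) u) ∧
      ∀ z ∈ D, z.1 ≠ z.2 → Stroll.Blocked (ρ.mat n aX) s v z.1 z.2)
    (fun D ρ z ⟨l', h1, h2, h3⟩ => ⟨l', h1, h2.set (by decide) z, h3⟩)
    (fun D ρ z ⟨l', h1, h2, h3⟩ => ⟨l', h1, h2.set (by decide) z, h3⟩)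
    ⟨l, by simp, h, hr, fun _ _ => rfl, by simp⟩ (by decide) (by decide) ?_
  · obtain ⟨l', h1, h2, h3, h4, h5⟩ := key
    refine ⟨l', ?_, h2, h3, h4, Stroll.wdeg_eq_zero_of_blocked h3.feasible hst h3.ne_source
      h3.ne_target fun a b hab => h5 (a, b) (Finset.mem_univ _) hab⟩
    simpa [sq] using h1
  · rintro D p q hpq ρ hF hp hq ⟨l', h1, h2, h3, h4, h5⟩
    obtain ⟨l'', k1, k2, k3, k4, k5, k6⟩ := exec_splitPair (hE.of_frame hF (by decide)) hN
      ((hF.reg _ (by decide)).trans hv) hp hq h2 h3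
    refine ⟨l'', ?_, k2, k3, fun u hu => (k4 u hu).trans (h4 u hu), fun z hz hne => ?_⟩
    · rw [Finset.card_insert_of_notMem hpq]
      omega
    · rcases Finset.mem_insert.1 hz with rfl | hz
      · exact k5 hne
      · exact k6 _ _ (h5 z hz hne)

/-- The matrix is feasible and dominates the auxiliary edge. -/
structure Dominates (W : ℕ) (s t : Fin n) (X : Fin n → Fin n → ℤ) : Prop where
  feasible : Stroll.Feasible X s t
  wdeg_source : Stroll.wdeg X s = 2 * W
  le_aux : ∀ p q, Stroll.auxEdge s t (W : ℤ) p q ≤ X p q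

/-- The vertices at which edges have to be split off. -/
def active (s t : Fin n) (X : Fin n → Fin n → ℤ) : Finset (Fin n) :=
  Finset.univ.filter fun u => u ≠ s ∧ u ≠ t ∧ 0 < Stroll.wdeg X u

/-- A round isolates the chosen vertex and leaves the other degrees unchanged, so the set of active
vertices shrinks unless it is empty. -/
theorem exec_splitRound {X₀ : Fin n → Fin n → ℤ} {l : List (Stroll.Rec (Fin n) ℤ)} (hst : s ≠ t)
    (hE : Env n N W s t σ) (hN : 2 * n ^ 2 < N) (h : SplitInv W s t X₀ l σ)
    (hX : Dominates W s t (σ.mat n aX)) :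
    ∃ l', l'.length ≤ l.length + n ^ 2 ∧ SplitInv W s t X₀ l' (splitRound.exec σ) ∧
      Dominates W s t ((splitRound.exec σ).mat n aX) ∧
      (active s t ((splitRound.exec σ).mat n aX) = ∅ ∨
        (active s t ((splitRound.exec σ).mat n aX)).card < (active s t (σ.mat n aX)).card) := by
  rw [splitRound, exec_seq]
  have hch := exec_choose hE
  have hF := choose.frame σ
  set ρ := choose.exec σ with hρ
  have hm : ρ.mat n aX = σ.mat n aX := hF.mat (by decide) n
  have hρ : SplitInv W s t X₀ l ρ := by
    refine ⟨by rw [hm]; exact h.chain, by rw [hm, hF.vec (by decide), h.deg],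
      by rw [hm]; exact h.even, by rw [hF.reg _ (by decide), h.records.count], fun k r hk => ?_⟩
    rw [hF.arr _ (by decide)]
    exact h.records.entry k r hk
  rw [h.deg] at hch
  rcases hch with ⟨h1, h2⟩ | ⟨v, h1, h2, h3, h4, h5⟩
  · rw [exec_ite_pos _ _ (by simp [h1]), exec_skip, hm]
    refine ⟨l, by omega, hρ, hX, Or.inl ?_⟩
    rw [active, Finset.filter_eq_empty_iff]
    rintro u - ⟨hus, hut, hu⟩
    exact absurd hu (not_lt.2 (h2 u (Finset.mem_univ u) hus hut))
  · rw [exec_ite_neg _ _ (by simp [h1])]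
    have hr : Stroll.Ready s t (W : ℤ) (ρ.mat n aX) v := by
      rw [hm]
      refine ⟨hX.feasible, hX.wdeg_source, hX.le_aux, h2, h3, fun p hp => ?_⟩
      by_cases hps : p = s
      · rw [hps]; exact hX.feasible.wdeg_le_source v
      · by_cases hpt : p = t
        · rw [hpt, hX.feasible.deg_eq]; exact hX.feasible.wdeg_le_source v
        · exact h5 p (Finset.mem_univ p) hps hpt hp
    obtain ⟨l', k1, k2, k3, k4, k5⟩ := exec_splitVertex hst (hE.of_frame hF (by decide)) hN h1 hρ hr
    rw [hm] at k4
    refine ⟨l', k1, k2, ⟨k3.feasible, k3.wdeg_source, k3.le_aux⟩, Or.inr ?_⟩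
    refine Finset.card_lt_card ⟨fun u hu => ?_, fun hsub => ?_⟩
    · simp only [active, Finset.mem_filter, Finset.mem_univ, true_and] at hu ⊢
      have huv : u ≠ v := by
        rintro rfl
        exact absurd k5 hu.2.2.ne'
      rwa [← k4 u huv]
    · have := hsub (x := v) (by simp [active, h2, h3, h4])
      simp [active, k5] at this

/-- There are at most `n` active vertices, so `n` rounds suffice. Each of them records at most one
step per ordered pair, in total at most `n ^ 3`. -/
theorem exec_splitAll (hst : s ≠ t) (hE : Env n N W s t σ) (hN : 2 * n ^ 2 < N)
    (hX : Dominates W s t (σ.mat n aX)) (hd : σ.vec n aDeg = Stroll.wdeg (σ.mat n aX))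
    (he : ∀ u, Even (Stroll.wdeg (σ.mat n aX) u)) :
    ∃ l X', l.length ≤ n ^ 3 ∧ Stroll.Chain s t (W : ℤ) (σ.mat n aX) l X' ∧
      Dominates W s t X' ∧ (∀ u, u ≠ s → u ≠ t → Stroll.wdeg X' u = 0) ∧
      Records l (splitAll.exec σ) := by
  rw [splitAll, exec_seq, exec_assign, Exp.eval_zero]
  have key := loop_induct (i := rZ) (k := rN) (c := splitRound) (n := n)
    (σ := σ.set rCnt 0) (by simp [hE.n]) (fun k ρ => ∃ l, l.length ≤ k * n ^ 2 ∧
      SplitInv W s t (σ.mat n aX) l ρ ∧ Dominates W s t (ρ.mat n aX) ∧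
      (active s t (ρ.mat n aX)).card ≤ n - k) ?_ ?_ ?_
  · obtain ⟨l, h1, h2, h3, h4⟩ := key
    refine ⟨l, _, by rwa [pow_succ' n 2], h2.chain, h3, fun u hus hut => ?_, h2.records⟩
    rw [Nat.sub_self, Nat.le_zero, Finset.card_eq_zero, active, Finset.filter_eq_empty_iff] at h4
    by_contra hne
    exact h4 (Finset.mem_univ u) ⟨hus, hut,
      lt_of_le_of_ne (h3.feasible.wdeg_nonneg u) (Ne.symm hne)⟩
  · rintro k ρ z ⟨l, h1, h2, h3⟩
    exact ⟨l, h1, h2.set (by decide) z, h3⟩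
  · refine ⟨[], by simp, ⟨.nil, hd, he, ⟨by simp, by simp⟩⟩, hX, ?_⟩
    simpa using Finset.card_le_univ (active s t (σ.mat n aX))
  · rintro k - ρ hF - ⟨l, h1, h2, h3, h4⟩
    have hE₀ : Env n N W s t (σ.set rCnt 0) := ⟨by simp [hE.n], by simp [hE.s], by simp [hE.t],
      by simp [hE.K], by simp [hE.W], by simp [hE.N]⟩
    obtain ⟨l', k1, k2, k3, k4⟩ := exec_splitRound hst (hE₀.of_frame hF (by decide)) hN h2 h3
    refine ⟨l', ?_, k2, k3, ?_⟩
    · rw [Nat.add_mul]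
      omega
    · rcases k4 with k4 | k4
      · simp [k4]
      · omega

end Cmd

end Loop

/-! ### The reversal of the splitting steps by a program -/

namespace Loop

notation "rM" => (25 : ℕ)
notation "rRem" => (26 : ℕ)
notation "rTop" => (27 : ℕ)
notation "rBot" => (28 : ℕ)
notation "rOk" => (29 : ℕ)
notation "rBelow" => (30 : ℕ)
notation "rAmt" => (31 : ℕ)
notation "rStep" => (32 : ℕ)
notation "rTree" => (33 : ℕ)
notation "rVtx" => (34 : ℕ)
notation "aPar" => (6 : ℕ)
notation "aWt" => (7 : ℕ)
notation "aDem" => (8 : ℕ)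

/-- The code of a parent pointer. -/
def code {n : ℕ} (o : Option (Fin n)) : ℤ := o.elim (-1) fun p => (p : ℕ)

section

variable {n : ℕ}

@[simp] theorem code_none : code (none : Option (Fin n)) = -1 := rfl

@[simp] theorem code_some (p : Fin n) : code (some p) = (p : ℕ) := rfl

theorem code_eq_iff {o : Option (Fin n)} {p : Fin n} : code o = (p : ℕ) ↔ o = some p := by
  cases o with
  | none => simp
  | some q => simp [Fin.val_inj]

theorem code_neg_iff {o : Option (Fin n)} : code o < 0 ↔ o = none := by
  cases o <;> simp

/-- The family `F` is stored in memory. -/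
structure Holds (F : Stroll.Fam (Fin n) ℤ) (σ : Mem) : Prop where
  m : σ.reg rM = F.m
  w : ∀ i < F.m, σ.arr aWt 0 i = F.w i
  par : ∀ i < F.m, ∀ u : Fin n, σ.arr aPar i (u : ℕ) = code (F.T i u)

variable {F : Stroll.Fam (Fin n) ℤ} {σ ρ : Mem}

theorem Holds.congr (h : Holds F σ) (hM : ρ.reg rM = σ.reg rM) (hw : ρ.arr aWt = σ.arr aWt)
    (hp : ρ.arr aPar = σ.arr aPar) : Holds F ρ :=
  ⟨hM.trans h.m, fun i hi => by rw [hw, h.w i hi], fun i hi u => by rw [hp, h.par i hi u]⟩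

theorem Holds.set (h : Holds F σ) {r : ℕ} (hr : r ≠ rM) (z : ℤ) : Holds F (σ.set r z) :=
  h.congr (by simp [hr.symm]) rfl rfl

theorem Holds.put_par (h : Holds F σ) (i : ℕ) (v : Fin n) (o : Option (Fin n)) :
    Holds { F with T := Function.update F.T i (Function.update (F.T i) v o) }
      (σ.put aPar i (v : ℕ) (code o)) := by
  refine ⟨h.m, fun j hj => ?_, fun j hj u => ?_⟩
  · simpa using h.w j hj
  · have := h.par j hj u
    by_cases hji : j = i
    · subst hji
      by_cases huv : u = v
      · simp [huv]
      · simpa [huv, Fin.val_inj] using this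
    · simpa [hji] using this

/-- The state of the reversal of a splitting step is stored in memory. -/
structure HoldsUndo (u : Stroll.Undo (Fin n) ℤ) (σ : Mem) : Prop where
  fam : Holds u.F σ
  rem : σ.reg rRem = u.rem
  dem : σ.vec n aDem = u.dem

end

namespace Cmd

/-- If the weight of the current tree is more than `rAmt`, cut it into two copies. -/
def carve : Cmd :=
  ite ◦rAmt (.arr aWt 0 ◦rTree)
    (store aWt 0 ◦rM (.arr aWt 0 ◦rTree - ◦rAmt) ;;
      loop rU rN (store aPar ◦rM ◦rU (.arr aPar ◦rTree ◦rU)) ;;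
      store aWt 0 ◦rTree ◦rAmt ;; assign rM (◦rM + 1)) skip

def ends : Cmd :=
  iteq (.arr aPar ◦rTree ◦rB) ◦rA (assign rOk 1 ;; assign rTop ◦rA ;; assign rBot ◦rB)
    (iteq (.arr aPar ◦rTree ◦rA) ◦rB (assign rOk 1 ;; assign rTop ◦rB ;; assign rBot ◦rA)
      (assign rOk 0))

/-- A negative code means that there is no parent, and `rC` stays where it is, in accordance with
`up`. -/
def descendsStep : Cmd :=
  iteq ◦rC ◦rBot (assign rBelow 1) skip ;; assign rP (.arr aPar ◦rTree ◦rC) ;;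
    ite ◦rP 0 skip (assign rC ◦rP)

def descends : Cmd := assign rC ◦rV ;; assign rBelow 0 ;; loop rI rN descendsStep

def insertVertex : Cmd :=
  descends ;; assign rAmt ◦rRem ;; carve ;; assign rAmt (.arr aWt 0 ◦rTree) ;;
    assign rRem (◦rRem - ◦rAmt) ;; assign rP (.arr aPar ◦rTree ◦rV) ;;
    ite ◦rP 0 (store aPar ◦rTree ◦rV ◦rTop)
      (iteq ◦rBelow 1
        (store aDem 0 ◦rP (.arr aDem 0 ◦rP + ◦rAmt) ;; store aPar ◦rTree ◦rV ◦rTop)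
        (store aDem 0 ◦rTop (.arr aDem 0 ◦rTop + ◦rAmt))) ;;
    store aPar ◦rTree ◦rBot ◦rV

def insertStep : Cmd :=
  ite ◦rTree ◦rM (ite 0 ◦rRem (ends ;; iteq ◦rOk 1 insertVertex skip) skip) skip

def attachVertex : Cmd :=
  assign rAmt (.arr aDem 0 ◦rVtx) ;; carve ;; store aPar ◦rTree ◦rV ◦rVtx ;;
    store aDem 0 ◦rVtx (.arr aDem 0 ◦rVtx - .arr aWt 0 ◦rTree)

def attachStep : Cmd :=
  ite ◦rTree ◦rM (ite 0 (.arr aDem 0 ◦rVtx) (ite (.arr aPar ◦rTree ◦rVtx) 0 skip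
    (ite (.arr aPar ◦rTree ◦rV) 0 attachVertex skip)) skip) skip

variable {n : ℕ} {F : Stroll.Fam (Fin n) ℤ} {σ : Mem} {i : ℕ} {a b v : Fin n}

/-- The copy is written at the free index before the weight of the original is overwritten, so both
new weights are computed from the old one. -/
theorem exec_carve (hn : σ.reg rN = n) (h : Holds F σ) (hi : σ.reg rTree = i) (him : i < F.m) :
    Holds (F.carve i (σ.reg rAmt)) (carve.exec σ) := by
  have hw : Exp.eval σ (.arr aWt 0 ◦rTree) = F.w i := by simp [hi, h.w i him]
  rw [carve, Stroll.Fam.carve]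
  by_cases hlt : Exp.eval σ ◦rAmt < Exp.eval σ (.arr aWt 0 ◦rTree)
  swap
  · rw [exec_ite_neg _ _ hlt, exec_skip, if_neg]
    · exact h
    · rwa [hw] at hlt
  rw [exec_ite_pos _ _ hlt]
  rw [hw, Exp.eval_reg] at hlt
  rw [if_pos hlt]
  simp only [exec_seq, exec_store, exec_assign, Exp.eval_sub, hw, Exp.eval_zero, Exp.eval_reg,
    Exp.eval_add, Exp.eval_one, h.m]
  set ρ := σ.put aWt 0 (F.m : ℤ) (F.w i - σ.reg rAmt) with hρ
  have hp : ∀ j u, ρ.arr aPar j u = σ.arr aPar j u := fun j u => by simp [hρ]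
  have key := loop_fin (i := rU) (k := rN) (σ := ρ) (n := n)
    (c := store aPar ◦rM ◦rU (.arr aPar ◦rTree ◦rU)) hn
    (fun D ξ => (∀ j < F.m, ∀ u : Fin n, ξ.arr aPar j (u : ℕ) = code (F.T j u)) ∧
      ∀ u ∈ D, ξ.arr aPar F.m (u : ℕ) = code (F.T i u)) (fun _ _ _ h => h) ?_ ?_
  · have hF := (loop rU rN (store aPar ◦rM ◦rU (.arr aPar ◦rTree ◦rU))).frame ρ
    set ξ := (loop rU rN (store aPar ◦rM ◦rU (.arr aPar ◦rTree ◦rU))).exec ρ with hξ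
    have hr : ∀ r, r ≠ rU → ξ.reg r = σ.reg r := fun r hr => hF.reg r (by simpa [regs] using hr)
    have hwt : ξ.arr aWt = ρ.arr aWt := hF.arr aWt (by decide)
    refine ⟨by simp [hr, h.m], fun j (hj : j < F.m + 1) => ?_, fun j (hj : j < F.m + 1) u => ?_⟩
    · simp only [Mem.set_arr, Mem.put_arr, hr rTree (by decide), hi, hwt, true_and, Nat.cast_inj,
        hr rAmt (by decide)]
      by_cases hji : j = i
      · subst hji
        simp [him.ne]
      · by_cases hjm : j = F.m
        · subst hjm
          simp [hji, hρ]
        · rw [if_neg hji, hρ, Mem.put_arr, if_neg (by simpa using hjm), h.w j (by omega)]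
          simp [hji, hjm]
    · simp only [Mem.set_arr, Mem.put_arr]
      rw [if_neg (by simp)]
      by_cases hjm : j = F.m
      · subst hjm
        simpa using key.2 u (Finset.mem_univ u)
      · simpa [hjm] using key.1 j (by omega) u
  · exact ⟨fun j hj u => by rw [hp, h.par j hj u], by simp⟩
  · rintro D u _ ξ hF hu ⟨h1, h2⟩
    have hM : ξ.reg rM = F.m := by rw [hF.reg _ (by decide)]; exact h.m
    have hT : ξ.reg rTree = i := by rw [hF.reg _ (by decide)]; exact hi
    simp only [exec_store, Exp.eval_reg, Exp.eval_arr, hM, hT, hu, h1 i him u]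
    refine ⟨fun j hj u' => ?_, fun u' hu' => ?_⟩
    · rw [Mem.put_arr, if_neg, h1 j hj u']
      simp [hj.ne]
    · by_cases huu : u' = u
      · simp [huu]
      · simpa [huu, Fin.val_inj] using h2 u' ((Finset.mem_insert.1 hu').resolve_left huu)

theorem exec_ends (h : Holds F σ) (hi : σ.reg rTree = i) (him : i < F.m)
    (ha : σ.reg rA = (a : ℕ)) (hb : σ.reg rB = (b : ℕ)) :
    ((ends.exec σ).reg rOk = 1 ↔ Stroll.HasEdge (F.T i) a b) ∧
    (Stroll.HasEdge (F.T i) a b → (ends.exec σ).reg rTop = ((Stroll.topEnd (F.T i) a b : Fin n) : ℕ) ∧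
      (ends.exec σ).reg rBot = ((Stroll.botEnd (F.T i) a b : Fin n) : ℕ)) := by
  have e1 : Exp.eval σ (.arr aPar ◦rTree ◦rB) = Exp.eval σ ◦rA ↔ F.T i b = some a := by
    simp [hi, ha, hb, h.par i him, code_eq_iff]
  have e2 : Exp.eval σ (.arr aPar ◦rTree ◦rA) = Exp.eval σ ◦rB ↔ F.T i a = some b := by
    simp [hi, ha, hb, h.par i him, code_eq_iff]
  rw [ends]
  by_cases h1 : F.T i b = some a
  · rw [exec_iteq_pos _ _ (e1.2 h1)]
    simp [exec_seq, exec_assign, Stroll.topEnd, Stroll.botEnd, Stroll.HasEdge, h1, ha, hb]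
  · rw [exec_iteq_neg _ _ (mt e1.1 h1)]
    by_cases h2 : F.T i a = some b
    · rw [exec_iteq_pos _ _ (e2.2 h2)]
      simp [exec_seq, exec_assign, Stroll.topEnd, Stroll.botEnd, Stroll.HasEdge, h1, h2, ha, hb]
    · rw [exec_iteq_neg _ _ (mt e2.1 h2)]
      simp [exec_assign, Stroll.HasEdge, h1, h2]

theorem exec_descends (hn : σ.reg rN = n) (h : Holds F σ) (hi : σ.reg rTree = i) (him : i < F.m)
    (hv : σ.reg rV = (v : ℕ)) {bot : Fin n} (hbot : σ.reg rBot = (bot : ℕ)) :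
    (descends.exec σ).reg rBelow = 1 ↔ Stroll.Below (F.T i) v bot := by
  simp only [descends, exec_seq, exec_assign, Exp.eval_reg, Exp.eval_zero, hv]
  have key := loop_induct (i := rI) (k := rN) (c := descendsStep) (n := n)
    (σ := (σ.set rC (v : ℕ)).set rBelow 0) (by simp [hn])
    (fun j ξ => ξ.reg rC = (((Stroll.up (F.T i))^[j] v : Fin n) : ℕ) ∧
      (ξ.reg rBelow = 1 ↔ ∃ k < j, (Stroll.up (F.T i))^[k] v = bot)) ?_ ?_ ?_
  · rw [key.2, Stroll.Below, Fintype.card_fin]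
  · intro j ξ z hξ
    simpa using hξ
  · simp
  · rintro j - ξ hF - ⟨h1, h2⟩
    have hb : ξ.reg rBot = (bot : ℕ) := by rw [hF.reg _ (by decide)]; simp [hbot]
    have hT : ξ.reg rTree = i := by rw [hF.reg _ (by decide)]; simp [hi]
    have hp : ∀ u : Fin n, ξ.arr aPar i (u : ℕ) = code (F.T i u) := fun u => by
      rw [hF.arr _ (by decide)]; exact h.par i him u
    set cur := (Stroll.up (F.T i))^[j] v with hcur
    obtain ⟨ξ', hξ', k1, k2, k3⟩ : ∃ ξ', (iteq ◦rC ◦rBot (assign rBelow 1) skip).exec ξ = ξ' ∧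
        (ξ'.reg rBelow = 1 ↔ ∃ k < j + 1, (Stroll.up (F.T i))^[k] v = bot) ∧
        (∀ r, r ≠ rBelow → ξ'.reg r = ξ.reg r) ∧ ξ'.arr = ξ.arr := by
      refine ⟨_, rfl, ?_⟩
      have hlast : (∃ k < j + 1, (Stroll.up (F.T i))^[k] v = bot) ↔
          (∃ k < j, (Stroll.up (F.T i))^[k] v = bot) ∨ cur = bot := by
        constructor
        · rintro ⟨k, hk, hkb⟩
          rcases Nat.lt_succ_iff_lt_or_eq.1 hk with hk | rfl
          · exact Or.inl ⟨k, hk, hkb⟩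
          · exact Or.inr hkb
        · rintro (⟨k, hk, hkb⟩ | hc)
          · exact ⟨k, by omega, hkb⟩
          · exact ⟨j, by omega, hc⟩
      by_cases hc : cur = bot
      · rw [exec_iteq_pos _ _ (by simp [h1, hb, hc]), exec_assign]
        exact ⟨by rw [hlast]; simp [hc], fun r hr => by simp [hr], rfl⟩
      · rw [exec_iteq_neg _ _ (by simpa [h1, hb, Fin.val_inj] using hc), exec_skip]
        exact ⟨by rw [h2, hlast]; simp [hc], fun _ _ => rfl, rfl⟩
    simp only [descendsStep, exec_seq, hξ', exec_assign, Exp.eval_arr, Exp.eval_reg, k3,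
      k2 rTree (by decide), k2 rC (by decide), h1, hT, hp]
    rw [Function.iterate_succ_apply', ← hcur]
    cases hTc : F.T i cur with
    | none =>
      rw [exec_ite_pos _ _ (by simp), exec_skip]
      refine ⟨?_, by simpa using k1⟩
      simp [Stroll.up, hTc, k2, h1]
    | some p =>
      rw [exec_ite_neg _ _ (by simp), exec_assign]
      refine ⟨?_, by simpa using k1⟩
      simp [Stroll.up, hTc]

/-- The program distinguishes the cases of `reroute` and `leftOver`: `v` absent, `v` below `bot`,
`v` elsewhere. All of them end by making `v` the parent of `bot`. -/
theorem exec_insertVertex {u : Stroll.Undo (Fin n) ℤ} (hn : σ.reg rN = n) (h : HoldsUndo u σ)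
    (hi : σ.reg rTree = i) (him : i < u.F.m) (hv : σ.reg rV = (v : ℕ))
    (htop : σ.reg rTop = ((Stroll.topEnd (u.F.T i) a b : Fin n) : ℕ))
    (hbot : σ.reg rBot = ((Stroll.botEnd (u.F.T i) a b : Fin n) : ℕ)) :
    HoldsUndo { F := u.F.replace i u.rem (Stroll.insertTree (u.F.T i) a b v)
                rem := u.rem - min u.rem (u.F.w i)
                dem := fun q => u.dem q + if Stroll.insertLeft (u.F.T i) a b v = some q then
                  min u.rem (u.F.w i) else 0 } (insertVertex.exec σ) := by
  set top := Stroll.topEnd (u.F.T i) a b with htopdef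
  set bot := Stroll.botEnd (u.F.T i) a b with hbotdef
  have hbel := exec_descends hn h.fam hi him hv hbot
  have hF₁ := descends.frame σ
  simp only [insertVertex, exec_seq]
  set σ₁ := descends.exec σ with hσ₁
  have h₁ : Holds u.F σ₁ := h.fam.congr (hF₁.reg _ (by decide)) (hF₁.arr _ (by decide))
    (hF₁.arr _ (by decide))
  rw [exec_assign σ₁ ◦rRem]
  set σ₂ := σ₁.set rAmt (Exp.eval σ₁ ◦rRem) with hσ₂
  have hr₂ : ∀ r, r ≠ rAmt → r ∉ descends.regs → σ₂.reg r = σ.reg r := fun r hr hr' => by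
    rw [hσ₂, Mem.set_reg, if_neg hr, hF₁.reg r hr']
  have ham : σ₂.reg rAmt = u.rem := by
    rw [hσ₂, Mem.set_reg, if_pos rfl, Exp.eval_reg, hF₁.reg _ (by decide), h.rem]
  have h₃ := exec_carve (σ := σ₂) (by rw [hr₂ _ (by decide) (by decide), hn]) (h₁.set (by decide) _)
    (by rw [hr₂ _ (by decide) (by decide), hi]) him
  rw [ham] at h₃
  have hF₃ := carve.frame σ₂
  set σ₃ := carve.exec σ₂ with hσ₃
  set F' := u.F.carve i u.rem with hF'
  have him' : i < F'.m := him.trans_le (Stroll.Fam.le_carve_m _)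
  -- After carving, the weight of the current tree is the replaced amount, so the program reads the
  -- minimum off the weight array.
  set w := min u.rem (u.F.w i) with hw
  have hwi : F'.w i = w := Stroll.Fam.carve_w him _
  have hTi : F'.T i = u.F.T i := Stroll.Fam.carve_T him _
  have hr₃ : ∀ r, r ≠ rAmt → r ∉ descends.regs → r ∉ carve.regs → σ₃.reg r = σ.reg r :=
    fun r h1 h2 h3 => (hF₃.reg r h3).trans (hr₂ r h1 h2)
  have hdem₃ : σ₃.vec n aDem = u.dem := by
    rw [hF₃.vec (by decide), hσ₂, Mem.vec_set, hF₁.vec (by decide), h.dem]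
  have hi₃ : σ₃.reg rTree = i := by rw [hr₃ _ (by decide) (by decide) (by decide), hi]
  simp only [exec_assign, Exp.eval_arr, Exp.eval_zero, Exp.eval_reg, Exp.eval_sub, hi₃,
    h₃.w i him', hwi]
  simp only [Mem.set_reg, Mem.set_arr, if_true, show ¬ (rRem = rAmt) by decide,
    show ¬ (rTree = rRem) by decide, show ¬ (rTree = rAmt) by decide, if_false, hi₃,
    show ¬ (rV = rRem) by decide, show ¬ (rV = rAmt) by decide,
    hr₃ rV (by decide) (by decide) (by decide), hr₃ rRem (by decide) (by decide) (by decide), hv,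
    h.rem, h₃.par i him', hTi]
  set σ₄ := ((σ₃.set rAmt w).set rRem (u.rem - w)).set rP (code (u.F.T i v)) with hσ₄
  have h₄ : Holds F' σ₄ := ((h₃.set (by decide) _).set (by decide) _).set (by decide) _
  have hrem₄ : σ₄.reg rRem = u.rem - w := by simp [hσ₄]
  have hamt₄ : σ₄.reg rAmt = w := by simp [hσ₄]
  have hP₄ : σ₄.reg rP = code (u.F.T i v) := by simp [hσ₄]
  have hr₄ : ∀ r, r ∉ [rAmt, rRem, rP] → r ∉ descends.regs → r ∉ carve.regs →
      σ₄.reg r = σ.reg r := by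
    intro r h1 h2 h3
    simp only [List.mem_cons, List.not_mem_nil, or_false, not_or] at h1
    simp [hσ₄, h1, hr₃ r h1.1 h2 h3]
  have hi₄ : σ₄.reg rTree = i := by rw [hr₄ _ (by decide) (by decide) (by decide), hi]
  have hv₄ : σ₄.reg rV = (v : ℕ) := by rw [hr₄ _ (by decide) (by decide) (by decide), hv]
  have htop₄ : σ₄.reg rTop = (top : ℕ) := by rw [hr₄ _ (by decide) (by decide) (by decide), htop]
  have hbot₄ : σ₄.reg rBot = (bot : ℕ) := by rw [hr₄ _ (by decide) (by decide) (by decide), hbot]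
  have hbel₄ : σ₄.reg rBelow = 1 ↔ Stroll.Below (u.F.T i) v bot := by
    have : σ₄.reg rBelow = σ₁.reg rBelow := by
      simp [hσ₄, hF₃.reg rBelow (by decide), hσ₂]
    rw [this, hbel]
  have hdem₄ : σ₄.vec n aDem = u.dem := hdem₃
  have harr₄ : ∀ q : Fin n, σ₄.arr aDem 0 (q : ℕ) = u.dem q := fun q => congrFun hdem₄ q
  clear_value σ₄
  -- the tree in which `v` is the parent of `bot`
  have fin : ∀ (ξ : Mem) (T : Fin n → Option (Fin n)), Holds { F' with T := Function.update F'.T i T } ξ →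
      ξ.reg rTree = i → ξ.reg rV = (v : ℕ) → ξ.reg rBot = (bot : ℕ) →
      Function.update T bot (some v) = Stroll.insertTree (u.F.T i) a b v →
      Holds (u.F.replace i u.rem (Stroll.insertTree (u.F.T i) a b v))
        ((store aPar ◦rTree ◦rBot ◦rV).exec ξ) := by
    intro ξ T h1 h2 h3 h4 h5
    rw [exec_store, Exp.eval_reg, Exp.eval_reg, Exp.eval_reg, h2, h3, h4]
    have := h1.put_par i bot (some v)
    simp only [Function.update_self, Function.update_idem, h5] at this
    exact this
  -- In the case where the pointer of `v` is kept, the family is written as a trivial update, so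
  -- that `fin` covers this case too.
  have hcase : ∀ T : Fin n → Option (Fin n), T = u.F.T i →
      Function.update F'.T i T = F'.T := by
    rintro T rfl
    rw [← hTi, Function.update_eq_self]
  cases hTv : u.F.T i v with
  | none =>
    have e : (store aPar ◦rTree ◦rV ◦rTop).exec σ₄ = σ₄.put aPar i (v : ℕ) (top : ℕ) := by
      rw [exec_store, Exp.eval_reg, Exp.eval_reg, Exp.eval_reg, hi₄, hv₄, htop₄]
    rw [exec_ite_pos _ _ (by simp [hP₄, hTv]), e]
    have h5 := h₄.put_par i v (some top)
    rw [hTi] at h5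
    refine ⟨fin _ _ h5 (by simp [hi₄]) (by simp [hv₄]) (by simp [hbot₄]) ?_, ?_, ?_⟩
    · simp [Stroll.insertTree, Stroll.reroute, hTv, htopdef, hbotdef]
    · simp [exec_store, hrem₄]
    · simp [exec_store, hdem₄, Stroll.insertLeft, Stroll.leftOver, hTv]
  | some p =>
    rw [exec_ite_neg _ _ (by simp [hP₄, hTv])]
    rw [hTv, code_some] at hP₄
    by_cases hB : Stroll.Below (u.F.T i) v bot
    · have e : (store aDem 0 ◦rP (.arr aDem 0 ◦rP + ◦rAmt) ;; store aPar ◦rTree ◦rV ◦rTop).exec σ₄ =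
          (σ₄.put aDem 0 (p : ℕ) (u.dem p + w)).put aPar i (v : ℕ) (top : ℕ) := by
        simp only [exec_seq, exec_store, Exp.eval_zero, Exp.eval_reg, Exp.eval_add, Exp.eval_arr,
          hP₄, harr₄, hamt₄, Mem.put_reg, hi₄, hv₄, htop₄]
      rw [exec_iteq_pos _ _ (by simpa using hbel₄.2 hB), e]
      have h5 : Holds F' (σ₄.put aDem 0 (p : ℕ) (u.dem p + w)) := h₄.congr rfl rfl rfl
      have h6 := h5.put_par i v (some top)
      rw [hTi] at h6
      refine ⟨fin _ _ h6 (by simp [hi₄]) (by simp [hv₄]) (by simp [hbot₄]) ?_, ?_, ?_⟩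
      · simp [Stroll.insertTree, Stroll.reroute, ← htopdef, ← hbotdef, hB]
      · simp [exec_store, hrem₄]
      · rw [exec_store, Mem.vec_put_of_ne _ _ _ (by decide), Mem.vec_put_of_ne _ _ _ (by decide),
          Mem.vec_put, hdem₄]
        funext q
        simp only [Stroll.insertLeft, Stroll.leftOver, ← hbotdef, hB, hTv, not_true, and_false,
          if_false, Option.some.injEq]
        by_cases hqp : q = p
        · simp [hqp]
        · simp [hqp, Ne.symm hqp]
    · have e : (store aDem 0 ◦rTop (.arr aDem 0 ◦rTop + ◦rAmt)).exec σ₄ =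
          σ₄.put aDem 0 (top : ℕ) (u.dem top + w) := by
        simp only [exec_store, Exp.eval_zero, Exp.eval_reg, Exp.eval_add, Exp.eval_arr, htop₄,
          harr₄, hamt₄]
      rw [exec_iteq_neg _ _ (by simpa using mt hbel₄.1 hB), e]
      have h5 : Holds { F' with T := Function.update F'.T i (u.F.T i) }
          (σ₄.put aDem 0 (top : ℕ) (u.dem top + w)) := by
        rw [hcase _ rfl]
        exact h₄.congr rfl rfl rfl
      refine ⟨fin _ _ h5 (by simp [hi₄]) (by simp [hv₄]) (by simp [hbot₄]) ?_, ?_, ?_⟩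
      · simp [Stroll.insertTree, Stroll.reroute, hTv, ← hbotdef, hB]
      · simp [exec_store, hrem₄]
      · rw [exec_store, Mem.vec_put_of_ne _ _ _ (by decide), Mem.vec_put, hdem₄]
        funext q
        simp only [Stroll.insertLeft, Stroll.leftOver, ← hbotdef, ← htopdef, hB, hTv, ne_eq,
          reduceCtorEq, not_false_eq_true, and_self, if_true, Option.some.injEq]
        by_cases hqp : q = top
        · simp [hqp]
        · simp [hqp, Ne.symm hqp]

theorem exec_insertStep {u : Stroll.Undo (Fin n) ℤ} (hn : σ.reg rN = n) (h : HoldsUndo u σ)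
    (hi : σ.reg rTree = i) (hv : σ.reg rV = (v : ℕ)) (ha : σ.reg rA = (a : ℕ))
    (hb : σ.reg rB = (b : ℕ)) : HoldsUndo (u.insertStep a b v i) (insertStep.exec σ) := by
  rw [insertStep, Stroll.Undo.insertStep]
  by_cases him : i < u.F.m
  swap
  · rw [exec_ite_neg _ _ (by simpa [hi, h.fam.m] using him), exec_skip, if_neg (by tauto)]
    exact h
  rw [exec_ite_pos _ _ (by simpa [hi, h.fam.m] using him)]
  by_cases hrem : 0 < u.rem
  swap
  · rw [exec_ite_neg _ _ (by simpa [h.rem] using hrem), exec_skip, if_neg (by tauto)]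
    exact h
  rw [exec_ite_pos _ _ (by simpa [h.rem] using hrem), exec_seq]
  obtain ⟨h1, h2⟩ := exec_ends h.fam hi him ha hb
  have hF := ends.frame σ
  set ρ := ends.exec σ with hρ
  have h' : HoldsUndo u ρ := ⟨h.fam.congr (hF.reg _ (by decide)) (hF.arr _ (by decide))
    (hF.arr _ (by decide)), by rw [hF.reg _ (by decide), h.rem], by rw [hF.vec (by decide), h.dem]⟩
  by_cases he : Stroll.HasEdge (u.F.T i) a b
  · rw [exec_iteq_pos _ _ (by simpa using h1.2 he), if_pos ⟨him, hrem, he⟩]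
    exact exec_insertVertex (by rw [hF.reg _ (by decide), hn]) h'
      (by rw [hF.reg _ (by decide), hi]) him (by rw [hF.reg _ (by decide), hv]) (h2 he).1 (h2 he).2
  · rw [exec_iteq_neg _ _ (by simpa using mt h1.1 he), exec_skip, if_neg (by tauto)]
    exact h'

theorem exec_attachStep {u : Stroll.Undo (Fin n) ℤ} {p : Fin n} (hn : σ.reg rN = n)
    (h : HoldsUndo u σ) (hi : σ.reg rTree = i) (hv : σ.reg rV = (v : ℕ))
    (hp : σ.reg rVtx = (p : ℕ)) : HoldsUndo (u.attachStep v p i) (attachStep.exec σ) := by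
  have hdp : ∀ q : Fin n, σ.arr aDem 0 (q : ℕ) = u.dem q := fun q => congrFun h.dem q
  rw [attachStep, Stroll.Undo.attachStep]
  by_cases him : i < u.F.m
  swap
  · rw [exec_ite_neg _ _ (by simpa [hi, h.fam.m] using him), exec_skip, if_neg (by tauto)]
    exact h
  rw [exec_ite_pos _ _ (by simpa [hi, h.fam.m] using him)]
  by_cases hdem : 0 < u.dem p
  swap
  · rw [exec_ite_neg _ _ (by simpa [hp, hdp] using hdem), exec_skip, if_neg (by tauto)]
    exact h
  rw [exec_ite_pos _ _ (by simpa [hp, hdp] using hdem)]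
  by_cases hTp : u.F.T i p = none
  · rw [exec_ite_pos _ _ (by simp [hp, hi, h.fam.par i him, hTp]), exec_skip, if_neg (by tauto)]
    exact h
  rw [exec_ite_neg _ _ (by simpa [hp, hi, h.fam.par i him, ← not_lt, code_neg_iff] using hTp)]
  by_cases hTv : u.F.T i v = none
  swap
  · rw [exec_ite_neg _ _ (by simpa [hv, hi, h.fam.par i him, ← not_lt, code_neg_iff] using hTv),
      exec_skip, if_neg (by tauto)]
    exact h
  rw [exec_ite_pos _ _ (by simp [hv, hi, h.fam.par i him, hTv]), if_pos ⟨him, hdem, hTp, hTv⟩]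
  simp only [attachVertex, exec_seq]
  rw [exec_assign]
  set ρ := σ.set rAmt (Exp.eval σ (.arr aDem 0 ◦rVtx)) with hρ
  have ham : ρ.reg rAmt = u.dem p := by simp [hρ, hp, hdp]
  have h₁ := exec_carve (σ := ρ) (F := u.F) (i := i) (by simp [hρ, hn]) (h.fam.set (by decide) _)
    (by simp [hρ, hi]) him
  rw [ham] at h₁
  have hF := carve.frame ρ
  set ξ := carve.exec ρ with hξ
  have hr : ∀ r, r ≠ rAmt → r ∉ carve.regs → ξ.reg r = σ.reg r := fun r h1 h2 => by
    rw [hF.reg r h2, hρ, Mem.set_reg, if_neg h1]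
  have him' : i < (u.F.carve i (u.dem p)).m := him.trans_le (Stroll.Fam.le_carve_m _)
  have hdem' : ξ.vec n aDem = u.dem := by rw [hF.vec (by decide), hρ, Mem.vec_set, h.dem]
  have h₂ := h₁.put_par i v (some p)
  rw [Stroll.Fam.carve_T him] at h₂
  have hiξ : ξ.reg rTree = i := by rw [hr _ (by decide) (by decide), hi]
  have hvξ : ξ.reg rV = (v : ℕ) := by rw [hr _ (by decide) (by decide), hv]
  have hpξ : ξ.reg rVtx = (p : ℕ) := by rw [hr _ (by decide) (by decide), hp]
  have hwξ : ξ.arr aWt 0 i = min (u.dem p) (u.F.w i) := by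
    rw [h₁.w i him', Stroll.Fam.carve_w him]
  have hdξ : ξ.arr aDem 0 (p : ℕ) = u.dem p := congrFun hdem' p
  simp only [exec_store, Exp.eval_reg, Exp.eval_zero, Exp.eval_sub, Exp.eval_arr, Mem.put_reg, hiξ,
    hvξ, hpξ]
  refine ⟨h₂.congr rfl rfl rfl, ?_, ?_⟩
  · rw [Mem.put_reg, Mem.put_reg, hr _ (by decide) (by decide), h.rem]
  · rw [Mem.vec_put, Mem.vec_put_of_ne _ _ _ (by decide), hdem']
    simp [hwξ, hdξ]

end Cmd

end Loop

/-! ### The program for the reversal of all steps -/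

namespace Loop

theorem HoldsUndo.set {n : ℕ} {u : Stroll.Undo (Fin n) ℤ} {σ : Mem} (h : HoldsUndo u σ) {r : ℕ}
    (hr : r ≠ rM) (hr' : r ≠ rRem) (z : ℤ) : HoldsUndo u (σ.set r z) :=
  ⟨h.fam.set hr z, by rw [Mem.set_reg, if_neg hr'.symm, h.rem], by rw [Mem.vec_set, h.dem]⟩

namespace Cmd

def fetch : Cmd :=
  assign rCnt (◦rCnt - 1) ;; assign rV (.arr aRec ◦rCnt 0) ;; assign rA (.arr aRec ◦rCnt 1) ;;
    assign rB (.arr aRec ◦rCnt 2) ;; assign rRem (.arr aRec ◦rCnt 3)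

def reverse : Cmd :=
  loop rVtx rN (store aDem 0 ◦rVtx 0) ;; loop rTree rL insertStep ;;
    loop rVtx rN (loop rTree rL attachStep)

def undoRecord : Cmd := ite 0 ◦rCnt (fetch ;; reverse) skip

def initFamily : Cmd :=
  assign rM 1 ;; store aWt 0 0 ◦rW ;; loop rU rN (store aPar 0 ◦rU (0 - 1)) ;;
    store aPar 0 ◦rS ◦rS ;; store aPar 0 ◦rT ◦rS

def undoAll : Cmd := initFamily ;; loop rStep rL undoRecord

variable {n N W : ℕ} {s t : Fin n} {σ : Mem}

theorem exec_fetch {l : List (Stroll.Rec (Fin n) ℤ)} {r : Stroll.Rec (Fin n) ℤ}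
    (h : Records (l ++ [r]) σ) : Records l (fetch.exec σ) ∧
      (fetch.exec σ).reg rV = (r.v : ℕ) ∧ (fetch.exec σ).reg rA = (r.a : ℕ) ∧
      (fetch.exec σ).reg rB = (r.b : ℕ) ∧ (fetch.exec σ).reg rRem = r.ε := by
  have hc : σ.reg rCnt - 1 = (l.length : ℤ) := by simp [h.count]
  obtain ⟨h1, h2, h3, h4⟩ := h.entry l.length r (by simp)
  refine ⟨⟨?_, fun k r' hk => ?_⟩, ?_, ?_, ?_, ?_⟩
  · simp [fetch, exec, hc]
  · have := h.entry k r' (by rw [List.getElem?_append_left (List.getElem?_eq_some_iff.1 hk).1, hk])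
    simpa [fetch, exec] using this
  all_goals simp [fetch, exec, hc, h1, h2, h3, h4]

/-- The insertion pass adds at most one tree and so does the attachment pass for each vertex. Since
`N` exceeds all these sizes, loops of length `N` reach every tree. -/
theorem exec_reverse {X X' : Fin n → Fin n → ℤ} {r : Stroll.Rec (Fin n) ℤ}
    {F : Stroll.Fam (Fin n) ℤ} (hn : σ.reg rN = n) (hL : σ.reg rL = N)
    (hr : Stroll.SplitStep s t (W : ℤ) X r X') (h : Stroll.Decomposes s t (W : ℤ) X' F)
    (hF : Holds F σ) (hv : σ.reg rV = (r.v : ℕ)) (ha : σ.reg rA = (r.a : ℕ))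
    (hb : σ.reg rB = (r.b : ℕ)) (hε : σ.reg rRem = r.ε) (hN : F.m + 1 + n ≤ N) :
    ∃ F', Stroll.Decomposes s t (W : ℤ) X F' ∧ F'.m ≤ F.m + 1 + n ∧ Holds F' (reverse.exec σ) := by
  rw [reverse, exec_seq, exec_seq]
  have hF₁ := (loop rVtx rN (store aDem 0 ◦rVtx 0)).frame σ
  have h₁ : HoldsUndo (Stroll.Undo.start F r.ε) ((loop rVtx rN (store aDem 0 ◦rVtx 0)).exec σ) := by
    refine ⟨hF.congr (hF₁.reg _ (by decide)) (hF₁.arr _ (by decide)) (hF₁.arr _ (by decide)),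
      by rw [hF₁.reg _ (by decide), hε]; rfl, ?_⟩
    have key := loop_fin (i := rVtx) (c := store aDem 0 ◦rVtx 0) hn
      (fun D ρ => ∀ q ∈ D, ρ.vec n aDem q = 0) (fun _ _ _ h => h) (by simp) ?_
    · funext q
      exact key q (Finset.mem_univ q)
    · rintro D p _ ρ - hp h1 q hq
      rw [exec_store, Exp.eval_zero, Exp.eval_reg, hp, Mem.vec_put]
      by_cases hqp : q = p
      · simp [hqp]
      · simp [hqp, h1 q ((Finset.mem_insert.1 hq).resolve_left hqp)]
  set σ₁ := (loop rVtx rN (store aDem 0 ◦rVtx 0)).exec σ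

  have hF₂ := (loop rTree rL insertStep).frame σ₁
  have h₂ : HoldsUndo (Stroll.iter (Stroll.Undo.insertStep r.a r.b r.v) N (Stroll.Undo.start F r.ε))
      ((loop rTree rL insertStep).exec σ₁) := by
    refine loop_induct (i := rTree) (c := insertStep) (by rw [hF₁.reg _ (by decide), hL])
      (fun k ρ => HoldsUndo (Stroll.iter (Stroll.Undo.insertStep r.a r.b r.v) k
        (Stroll.Undo.start F r.ε)) ρ) (fun k ρ z h => h.set (by decide) (by decide) z) h₁ ?_
    rintro k - ρ hρ hk h1
    exact exec_insertStep (by rw [hρ.reg _ (by decide), hF₁.reg _ (by decide), hn]) h1 hk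
      (by rw [hρ.reg _ (by decide), hF₁.reg _ (by decide), hv])
      (by rw [hρ.reg _ (by decide), hF₁.reg _ (by decide), ha])
      (by rw [hρ.reg _ (by decide), hF₁.reg _ (by decide), hb])
  set σ₂ := (loop rTree rL insertStep).exec σ₁
  have h0 := h.undoInv (a := r.a) (b := r.b) (v := r.v) hr.nonneg
  obtain ⟨g1, g2, -⟩ := h0.insert_iter hr.ne hr.ne_a hr.ne_b hr.ready.ne_source N
  have g3 := h0.insert_rem hr.ne hr.ne_a hr.ne_b hr.ready.ne_source (hr.le_edge h)
    (N := N) (by change F.m ≤ N; omega)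
  have key := loop_fin (i := rVtx) (k := rN) (c := loop rTree rL attachStep) (σ := σ₂) (n := n)
    (by rw [hF₂.reg _ (by decide), hF₁.reg _ (by decide), hn])
    (fun P ρ => ∃ u : Stroll.Undo (Fin n) ℤ, Stroll.UndoInv s t r.a r.b r.v
      (fun p q => F.stat (Stroll.edgeInd ℤ p q)) (fun q => F.stat (Stroll.vertInd ℤ q)) (W : ℤ) r.ε u ∧
      u.rem = 0 ∧ (∀ q ∈ P, u.dem q = 0) ∧ u.F.m ≤ F.m + 1 + P.card ∧ HoldsUndo u ρ)
    (fun D ρ z ⟨u, k1, k2, k3, k4, k5⟩ => ⟨u, k1, k2, k3, k4, k5.set (by decide) (by decide) z⟩)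
    ⟨_, g1, g3, by simp, by simpa [Stroll.Undo.start] using g2, h₂⟩ ?_
  · obtain ⟨u, k1, k2, k3, k4, k5⟩ := key
    exact ⟨u.F, k1.decomposes hr h k2 fun q => k3 q (Finset.mem_univ q), by simpa using k4, k5.fam⟩
  · rintro D p hp ρ hρ hpi ⟨u, k1, k2, k3, k4, k5⟩
    have hD : D.card + 1 ≤ n := by
      have := Finset.card_le_univ (insert p D)
      rwa [Finset.card_insert_of_notMem hp, Fintype.card_fin] at this
    obtain ⟨m1, m2, m3, m4, -⟩ := k1.attach_iter p N
    refine ⟨_, m1, m3.trans k2, fun q hq => ?_, ?_, ?_⟩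
    · by_cases hqp : q = p
      · rw [hqp]
        exact k1.attach_dem k2 (hr.vert_le h) p (by omega)
      · rw [m4 q hqp]
        exact k3 q ((Finset.mem_insert.1 hq).resolve_left hqp)
    · rw [Finset.card_insert_of_notMem hp]
      omega
    · have hreg : ∀ x, x ∉ rVtx :: (loop rTree rL attachStep).regs →
          x ∉ (loop rTree rL insertStep).regs →
          x ∉ (loop rVtx rN (store aDem 0 ◦rVtx 0)).regs → ρ.reg x = σ.reg x := fun x e1 e2 e3 => by
        rw [hρ.reg x e1, hF₂.reg x e2, hF₁.reg x e3]
      refine loop_induct (i := rTree) (c := attachStep)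
        (by rw [hreg _ (by decide) (by decide) (by decide), hL])
        (fun k ρ => HoldsUndo (Stroll.iter (Stroll.Undo.attachStep r.v p) k u) ρ)
        (fun k ρ z h => h.set (by decide) (by decide) z) k5 ?_
      rintro k - ξ hξ hk e1
      exact exec_attachStep
        (by rw [hξ.reg _ (by decide), hreg _ (by decide) (by decide) (by decide), hn]) e1 hk
        (by rw [hξ.reg _ (by decide), hreg _ (by decide) (by decide) (by decide), hv])
        (by rw [hξ.reg _ (by decide), hpi])

theorem exec_undoRecord {X X' : Fin n → Fin n → ℤ} {l : List (Stroll.Rec (Fin n) ℤ)}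
    {r : Stroll.Rec (Fin n) ℤ} {F : Stroll.Fam (Fin n) ℤ} (hn : σ.reg rN = n) (hL : σ.reg rL = N)
    (hr : Stroll.SplitStep s t (W : ℤ) X r X') (h : Stroll.Decomposes s t (W : ℤ) X' F)
    (hF : Holds F σ) (hl : Records (l ++ [r]) σ) (hN : F.m + 1 + n ≤ N) :
    ∃ F', Stroll.Decomposes s t (W : ℤ) X F' ∧ F'.m ≤ F.m + 1 + n ∧
      Holds F' (undoRecord.exec σ) ∧ Records l (undoRecord.exec σ) := by
  rw [undoRecord, exec_ite_pos _ _ (by simp [hl.count]), exec_seq]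
  obtain ⟨h1, h2, h3, h4, h5⟩ := exec_fetch hl
  have hf := fetch.frame σ
  obtain ⟨F', k1, k2, k3⟩ := exec_reverse (σ := fetch.exec σ) (by rw [hf.reg _ (by decide), hn])
    (by rw [hf.reg _ (by decide), hL]) hr h (hF.congr (hf.reg _ (by decide)) (hf.arr _ (by decide))
      (hf.arr _ (by decide))) h2 h3 h4 h5 hN
  have hf' := reverse.frame (fetch.exec σ)
  refine ⟨F', k1, k2, k3, ⟨by rw [hf'.reg _ (by decide), h1.count], fun k r hk => ?_⟩⟩
  rw [hf'.arr _ (by decide)]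
  exact h1.entry k r hk

theorem exec_initFamily (hE : Env n N W s t σ) :
    Holds ⟨1, fun _ => (W : ℤ), fun _ => Stroll.stTree s t⟩ (initFamily.exec σ) := by
  simp only [initFamily, exec_seq, exec_assign]
  set ρ := (store aWt 0 0 ◦rW).exec (σ.set rM (Exp.eval σ 1)) with hρ
  have hF := (loop rU rN (store aPar 0 ◦rU (0 - 1))).frame ρ
  have key := loop_fin (i := rU) (k := rN) (c := store aPar 0 ◦rU (0 - 1)) (σ := ρ) (n := n)
    (by simp [hρ, exec, hE.n]) (fun D ξ => ∀ q ∈ D, ξ.vec n aPar q = -1) (fun _ _ _ h => h)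
    (by simp) ?_
  · set ξ := (loop rU rN (store aPar 0 ◦rU (0 - 1))).exec ρ
    have hs : ξ.reg rS = (s : ℕ) := by rw [hF.reg _ (by decide)]; simp [hρ, exec, hE.s]
    have ht : ξ.reg rT = (t : ℕ) := by rw [hF.reg _ (by decide)]; simp [hρ, exec, hE.t]
    have hw : ξ.arr aWt 0 0 = W := by rw [hF.arr _ (by decide)]; simp [hρ, exec, hE.W]
    have hM : ξ.reg rM = 1 := by rw [hF.reg _ (by decide)]; simp [hρ, exec]
    simp only [exec_store, Exp.eval_zero, Exp.eval_reg, Mem.put_reg, hs, ht]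
    refine ⟨by simp [hM], fun i hi => ?_, fun i hi u => ?_⟩
    · obtain rfl : i = 0 := Nat.lt_one_iff.1 hi
      simpa using hw
    · obtain rfl : i = 0 := Nat.lt_one_iff.1 hi
      have h1 : ξ.arr aPar 0 (u : ℕ) = -1 := key u (Finset.mem_univ u)
      by_cases hus : u = s
      · simp [hus, Stroll.stTree]
      · by_cases hut : u = t
        · simp [hut, Stroll.stTree]
        · simp [hus, hut, Stroll.stTree, Fin.val_inj, h1]
  · rintro D p _ ξ - hp h1 q hq
    rw [exec_store, Exp.eval_zero, Exp.eval_reg, hp, Mem.vec_put]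
    by_cases hqp : q = p
    · simp [hqp]
    · simp [hqp, h1 q ((Finset.mem_insert.1 hq).resolve_left hqp)]

/-- The number of trees plus `n + 1` per outstanding record never increases, which keeps the family
within `N`. Rounds after the last record find the counter at zero and do nothing. -/
theorem exec_undoAll {X X' : Fin n → Fin n → ℤ} {l : List (Stroll.Rec (Fin n) ℤ)} (hst : s ≠ t)
    (hW : 0 < W) (hE : Env n N W s t σ) (hc : Stroll.Chain s t (W : ℤ) X l X')
    (hX : Dominates W s t X') (hd : ∀ u, u ≠ s → u ≠ t → Stroll.wdeg X' u = 0)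
    (hl : Records l σ) (hN : 1 + (n + 1) * l.length ≤ N) :
    ∃ F, Stroll.Decomposes s t (W : ℤ) X F ∧ F.m ≤ N ∧ Holds F (undoAll.exec σ) := by
  rw [undoAll, exec_seq]
  have hF := initFamily.frame σ
  have key := loop_induct (i := rStep) (k := rL) (c := undoRecord) (n := N)
    (σ := initFamily.exec σ) (by rw [hF.reg _ (by decide), hE.N])
    (fun k ρ => ∃ l' X'' F, Stroll.Chain s t (W : ℤ) X l' X'' ∧
      Stroll.Decomposes s t (W : ℤ) X'' F ∧ F.m + (n + 1) * l'.length ≤ 1 + (n + 1) * l.length ∧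
      l'.length ≤ l.length - k ∧ Holds F ρ ∧ Records l' ρ) ?_ ?_ ?_
  · obtain ⟨l', X'', F, k1, k2, k3, k4, k5, -⟩ := key
    have : l.length ≤ N := by nlinarith
    have hl' : l'.length = 0 := by omega
    cases k1 with
    | nil => exact ⟨F, k2, by simp at k3; omega, k5⟩
    | snoc => simp at hl'
  · rintro k ρ z ⟨l', X'', F, k1, k2, k3, k4, k5, k6⟩
    exact ⟨l', X'', F, k1, k2, k3, k4, k5.set (by decide) z, by simpa using k6.count, k6.entry⟩
  · refine ⟨l, X', _, hc, ?_, ?_, le_rfl, exec_initFamily hE, ?_, fun k r hk => ?_⟩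
    · exact Stroll.decomposes_stTree hst hX.feasible (by exact_mod_cast hW) hX.wdeg_source hd rfl rfl
    · simp
    · rw [hF.reg _ (by decide), hl.count]
    · rw [hF.arr _ (by decide)]
      exact hl.entry k r hk
  · rintro k - ρ hρ - ⟨l', X'', F, k1, k2, k3, k4, k5, k6⟩
    cases k1 with
    | nil =>
      rw [undoRecord, exec_ite_neg _ _ (by simp [k6.count])]
      exact ⟨[], X, F, .nil, k2, k3, by simp, k5, k6⟩
    | @snoc l' r X₁ _ hc' hs =>
      simp only [List.length_append, List.length_singleton, mul_add, mul_one] at k3 k4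
      obtain ⟨F', m1, m2, m3, m4⟩ := exec_undoRecord (N := N)
        (by rw [hρ.reg _ (by decide), hF.reg _ (by decide), hE.n])
        (by rw [hρ.reg _ (by decide), hF.reg _ (by decide), hE.N]) hs k2 k5 k6 (by nlinarith)
      exact ⟨l', X₁, F', hc', m1, by nlinarith, by omega, m3, m4⟩

end Cmd

end Loop

/-! ### The output -/

namespace Loop

namespace Cmd

theorem loop_out {i k n : ℕ} {c : Cmd} {σ : Mem} (hn : σ.reg k = n) (f : ℕ → List ℤ)
    (h : ∀ l < n, ∀ ρ, Frame (i :: c.regs) c.arrs σ ρ → ρ.reg i = l →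
      (c.exec ρ).out = ρ.out ++ f l) :
    ((loop i k c).exec σ).out = σ.out ++ (List.range n).flatMap f := by
  refine loop_induct (i := i) (c := c) hn (fun l ρ => ρ.out = σ.out ++ (List.range l).flatMap f)
    (fun _ _ _ h => h) (by simp) fun l hl ρ hF hi h1 => ?_
  rw [h l hl ρ hF hi, h1, List.range_succ, List.flatMap_append, List.append_assoc]
  simp

theorem loop_out_fin {i k n : ℕ} {c : Cmd} {σ : Mem} (hn : σ.reg k = n) (f : Fin n → List ℤ)
    (h : ∀ p : Fin n, ∀ ρ, Frame (i :: c.regs) c.arrs σ ρ → ρ.reg i = (p : ℕ) →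
      (c.exec ρ).out = ρ.out ++ f p) :
    ((loop i k c).exec σ).out = σ.out ++ (List.finRange n).flatMap f := by
  rw [loop_out hn (fun l => if hl : l < n then f ⟨l, hl⟩ else [])
    fun l hl ρ hF hi => by rw [h ⟨l, hl⟩ ρ hF hi, dif_pos hl], ← List.map_coe_finRange_eq_range,
    List.flatMap_map]
  simp

def emitVertex : Cmd := ite (.arr aPar ◦rTree ◦rU) 0 (emit 0) (emit 1)

/-- The diagonal is treated first, since the root is its own parent without being adjacent to
itself. -/
def emitEdge : Cmd :=
  iteq ◦rU ◦rI (emit 0) (iteq (.arr aPar ◦rTree ◦rU) ◦rI (emit 1)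
    (iteq (.arr aPar ◦rTree ◦rI) ◦rU (emit 1) (emit 0)))

def emitTree : Cmd := loop rU rN emitVertex ;; loop rU rN (loop rI rN emitEdge)

/-- The number of trees is not a frozen register and cannot bound a loop. The loop runs to the
frozen bound and skips indices that are too large. -/
def emitFamily : Cmd :=
  emit ◦rM ;; loop rTree rL (ite ◦rTree ◦rM
    (emit (.arr aWt 0 ◦rTree) ;; emit ◦rW ;; emitTree) skip)

variable {n N W i : ℕ} {s t : Fin n} {σ : Mem} {F : Stroll.Fam (Fin n) ℤ} {G : SimpleGraph (Fin n)}

theorem exec_emitTree (hn : σ.reg rN = n) (h : Holds F σ) (hi : σ.reg rTree = i) (him : i < F.m)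
    (hF : Stroll.IsArb s t (F.T i))
    (hG : ∀ p q, p ≠ q → Stroll.HasEdge (F.T i) p q → G.Adj p q) :
    (emitTree.exec σ).out = σ.out ++ Stroll.encodeSubgraph (Stroll.treeSubgraph G (F.T i)) := by
  classical
  rw [emitTree, exec_seq, Stroll.encodeSubgraph, ← List.append_assoc]
  have hf := (loop rU rN emitVertex).frame σ
  have h1 : ((loop rU rN emitVertex).exec σ).out = σ.out ++ (List.finRange n).map fun v =>
      if v ∈ (Stroll.treeSubgraph G (F.T i)).verts then 1 else 0 := by
    rw [List.map_eq_flatMap]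
    refine loop_out_fin hn _ fun p ρ hρ hp => ?_
    have hc : Exp.eval ρ (.arr aPar ◦rTree ◦rU) = code (F.T i p) := by
      simp only [Exp.eval_arr, Exp.eval_reg, hp]
      rw [hρ.reg _ (by decide), hρ.arr _ (by decide), hi, h.par i him]
    have hv : p ∈ (Stroll.treeSubgraph G (F.T i)).verts ↔ F.T i p ≠ none := Iff.rfl
    by_cases hT : F.T i p = none
    · rw [emitVertex, exec_ite_pos _ _ (by rw [hc, Exp.eval_zero, code_neg_iff, hT]), exec_emit]
      simp [hv, hT]
    · rw [emitVertex, exec_ite_neg _ _ (by rwa [hc, Exp.eval_zero, code_neg_iff]), exec_emit]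
      simp [hv, hT]
  rw [← h1]
  set ρ := (loop rU rN emitVertex).exec σ
  refine loop_out_fin (by rw [hf.reg _ (by decide), hn]) _ fun p ξ hξ hp => ?_
  rw [List.map_eq_flatMap]
  refine loop_out_fin (by rw [hξ.reg _ (by decide), hf.reg _ (by decide), hn]) _
    fun q ζ hζ hq => ?_
  have hp' : ζ.reg rU = (p : ℕ) := by rw [hζ.reg _ (by decide), hp]
  have hc : ∀ u : Fin n, ζ.arr aPar (ζ.reg rTree) (u : ℕ) = code (F.T i u) := fun u => by
    rw [hζ.reg _ (by decide), hξ.reg _ (by decide), hf.reg _ (by decide), hζ.arr _ (by decide),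
      hξ.arr _ (by decide), hf.arr _ (by decide), hi, h.par i him]
  obtain ⟨d, hd⟩ := hF.depth
  have hadj : (Stroll.treeSubgraph G (F.T i)).Adj p q ↔ p ≠ q ∧ Stroll.HasEdge (F.T i) p q := by
    refine ⟨fun h => ⟨h.1.ne, h.2.1⟩, fun ⟨hpq, hT⟩ => ⟨hG p q hpq hT, hT, ?_⟩⟩
    rcases hT with hT | hT
    · exact ⟨by simp [hT], (hd _ _ hT).1⟩
    · exact ⟨(hd _ _ hT).1, by simp [hT]⟩
  rw [emitEdge]
  by_cases hpq : p = q
  · rw [exec_iteq_pos _ _ (by simp [hp', hq, hpq]), exec_emit, if_neg fun hA => (hadj.1 hA).1 hpq]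
    rfl
  rw [exec_iteq_neg _ _ (by simp [hp', hq, Fin.val_inj, hpq])]
  by_cases h2 : F.T i p = some q
  · rw [exec_iteq_pos _ _ (by simp [hp', hq, hc, h2]), exec_emit,
      if_pos (hadj.2 ⟨hpq, Or.inl h2⟩)]
    rfl
  rw [exec_iteq_neg _ _ (by simp [hp', hq, hc, code_eq_iff, h2])]
  by_cases h3 : F.T i q = some p
  · rw [exec_iteq_pos _ _ (by simp [hp', hq, hc, h3]), exec_emit,
      if_pos (hadj.2 ⟨hpq, Or.inr h3⟩)]
    rfl
  rw [exec_iteq_neg _ _ (by simp [hp', hq, hc, code_eq_iff, h3]), exec_emit, if_neg]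
  · rfl
  · rw [hadj]
    rintro ⟨-, h4 | h4⟩
    · exact h2 h4
    · exact h3 h4

theorem exec_emitFamily (hE : Env n N W s t σ) (h : Holds F σ) (hN : F.m ≤ N)
    (hF : F.Good s t) (hG : ∀ i < F.m, ∀ p q, p ≠ q → Stroll.HasEdge (F.T i) p q → G.Adj p q) :
    (emitFamily.exec σ).out = σ.out ++ Stroll.encodeFamily
      (fun i : Fin F.m => Stroll.treeSubgraph G (F.T i)) (fun i => F.w i) fun _ => (W : ℤ) := by
  rw [emitFamily, exec_seq, exec_emit, Exp.eval_reg, h.m, Stroll.encodeFamily]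
  rw [loop_out (n := N) (by simp [hE.N]) (fun i => if i < F.m then [F.w i, (W : ℤ)] ++
    Stroll.encodeSubgraph (Stroll.treeSubgraph G (F.T i)) else [])]
  · have key : ∀ {f : ℕ → List ℤ} {m : ℕ}, m ≤ N →
        (List.range N).flatMap (fun i => if i < m then f i else []) =
          (List.finRange m).flatMap fun i : Fin m => f i := by
      intro f m hm
      obtain ⟨k, rfl⟩ := Nat.exists_eq_add_of_le hm
      rw [List.range_add, List.flatMap_append, List.flatMap_map]
      have e : ∀ i : ℕ, i ∈ List.range m → (if i < m then f i else []) = f i := fun i hi => by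
        simp [List.mem_range.1 hi]
      rw [List.flatMap_congr e, ← List.map_coe_finRange_eq_range, List.flatMap_map]
      simp
    rw [key hN]
    simp
  · rintro i - ρ hρ hi
    have hm : ρ.reg rM = F.m := by rw [hρ.reg _ (by decide)]; simp [h.m]
    by_cases him : i < F.m
    · rw [exec_ite_pos _ _ (by simpa [hi, hm] using him), if_pos him, exec_seq, exec_seq]
      have hw : ρ.arr aWt 0 i = F.w i := by rw [hρ.arr _ (by decide)]; simp [h.w i him]
      have hW : ρ.reg rW = W := by rw [hρ.reg _ (by decide)]; simp [hE.W]
      rw [exec_emit, exec_emit, exec_emitTree (i := i) (F := F) (s := s) (t := t) (G := G)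
        (by rw [Mem.push_reg, Mem.push_reg, hρ.reg _ (by decide)]; simp [hE.n])
        (h.congr (by rw [Mem.push_reg, Mem.push_reg, hρ.reg _ (by decide)]; rfl)
          (by rw [Mem.push_arr, Mem.push_arr, hρ.arr _ (by decide)]; rfl)
          (by rw [Mem.push_arr, Mem.push_arr, hρ.arr _ (by decide)]; rfl)) (by simp [hi]) him
        (hF i him).2 (hG i him)]
      simp [hi, hw, hW]
    · rw [exec_ite_neg _ _ (by simpa [hi, hm] using him), if_neg him, exec_skip]
      simp

end Cmd

end Loop

namespace Stroll

/-! ### Passing from the integers to the rationals -/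

section Cast

set_option linter.unusedSectionVars false

variable {V : Type*} [Fintype V] [DecidableEq V] {X : V → V → ℤ} {s t : V} {W : ℤ}

theorem cast_wdeg (X : V → V → ℤ) (u : V) :
    wdeg (fun p q => (X p q : ℚ)) u = ((wdeg X u : ℤ) : ℚ) := by
  simp [wdeg]

theorem cast_outWeight (X : V → V → ℤ) (S : Finset V) :
    outWeight (fun p q => (X p q : ℚ)) S = ((outWeight X S : ℤ) : ℚ) := by
  simp [outWeight]

theorem cast_auxEdge (s t : V) (W : ℤ) (p q : V) :
    auxEdge s t (W : ℚ) p q = ((auxEdge s t W p q : ℤ) : ℚ) := by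
  simp [auxEdge]

theorem Feasible.of_cast (h : Feasible (fun p q => (X p q : ℚ)) s t) : Feasible X s t where
  symm u v := by exact_mod_cast h.symm u v
  diag u := by exact_mod_cast h.diag u
  nonneg u v := by exact_mod_cast h.nonneg u v
  deg_eq := by
    have := h.deg_eq
    rw [cast_wdeg, cast_wdeg] at this
    exact_mod_cast this
  le_cut S u hs hu := by
    have := h.le_cut S u hs hu
    rw [cast_wdeg, cast_outWeight] at this
    exact_mod_cast this

theorem Decomposes.cast {F : Fam V ℤ} (h : Decomposes s t W X F) :
    Decomposes s t (W : ℚ) (fun p q => (X p q : ℚ)) ⟨F.m, fun i => (F.w i : ℚ), F.T⟩ := by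
  have hedge : ∀ p q (T : V → Option V), edgeInd ℚ p q T = ((edgeInd ℤ p q T : ℤ) : ℚ) := fun p q T => by
    simp [edgeInd]
  have hvert : ∀ u (T : V → Option V), vertInd ℚ u T = ((vertInd ℤ u T : ℤ) : ℚ) := fun u T => by
    simp [vertInd]
  have hstat : ∀ (φ : (V → Option V) → ℤ) (ψ : (V → Option V) → ℚ), (∀ T, ψ T = φ T) →
      Fam.stat ⟨F.m, fun i => (F.w i : ℚ), F.T⟩ ψ = ((F.stat φ : ℤ) : ℚ) := fun φ ψ h => by
    simp [Fam.stat, h]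
  refine ⟨fun i hi => ⟨Int.cast_pos.2 (h.good i hi).1, (h.good i hi).2⟩, ?_, fun p q hpq => ?_,
    fun u hus hut => ?_⟩
  · rw [hstat _ _ fun _ => Int.cast_one.symm, h.total]
  · rw [hstat _ _ (hedge p q), h.edge p q hpq, cast_auxEdge]
    push_cast
    rfl
  · rw [hstat _ _ (hvert u), cast_wdeg, ← h.vert u hus hut]
    push_cast
    rfl

end Cast

/-! ### Reading the input -/

theorem getElem?_flatMap {α β : Type*} {L : ℕ} {f : α → List β} {l : List α}
    (hf : ∀ a, (f a).length = L) {i j : ℕ} {a : α} (ha : l[i]? = some a) (hj : j < L) :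
    (l.flatMap f)[i * L + j]? = (f a)[j]? := by
  induction l generalizing i with
  | nil => simp at ha
  | cons b l ih =>
    rw [List.flatMap_cons]
    cases i with
    | zero =>
      obtain rfl : b = a := by simpa using ha
      rw [Nat.zero_mul, Nat.zero_add, List.getElem?_append_left (by rw [hf]; exact hj)]
    | succ i =>
      rw [List.getElem?_append_right (by rw [hf, Nat.succ_mul]; omega), hf, ← ih (by simpa using ha)]
      congr 1
      rw [Nat.succ_mul]
      omega

namespace Input

variable (I : Input)

open Classical in
/-- The entry of the input word for the pair `(u, v)`. -/
noncomputable def entry (u v : Fin I.n) : List ℤ :=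
  if h : I.G.Adj u v then [1, (I.x ⟨s(u, v), h⟩).num, ((I.x ⟨s(u, v), h⟩).den : ℤ)]
  else [0, 0, 1]

theorem entry_length (u v : Fin I.n) : (I.entry u v).length = 3 := by
  unfold entry
  split_ifs <;> rfl

theorem entry_num (u v : Fin I.n) : (I.entry u v)[1]? = some (edgeMatrix I.G I.x u v).num := by
  unfold entry edgeMatrix
  split_ifs <;> simp

theorem entry_den (u v : Fin I.n) :
    (I.entry u v)[2]? = some ((edgeMatrix I.G I.x u v).den : ℤ) := by
  unfold entry edgeMatrix
  split_ifs <;> simp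

theorem encode_entry (u v : Fin I.n) {j : ℕ} (hj : j < 3) :
    I.encode[((u : ℕ) * I.n + v) * 3 + 3 + j]? = (I.entry u v)[j]? := by
  have hin : ∀ u, ((List.finRange I.n).flatMap (I.entry u)).length = I.n * 3 := fun u => by
    simp [List.length_flatMap, entry_length]
  have h1 : ((List.finRange I.n).flatMap fun u => (List.finRange I.n).flatMap (I.entry u))[
      (u : ℕ) * (I.n * 3) + ((v : ℕ) * 3 + j)]? = (I.entry u v)[j]? := by
    rw [getElem?_flatMap hin (a := u) (by simp) (by have := v.2; omega),
      getElem?_flatMap (I.entry_length u) (a := v) (by simp) hj]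
  have h2 : (u : ℕ) * (I.n * 3) + ((v : ℕ) * 3 + j) <
      ((List.finRange I.n).flatMap fun u => (List.finRange I.n).flatMap (I.entry u)).length := by
    obtain ⟨h3, -⟩ := List.getElem?_eq_some_iff.1
      (h1.trans (List.getElem?_eq_getElem (by rw [entry_length]; exact hj)))
    exact h3
  have h3 : ((u : ℕ) * I.n + v) * 3 + 3 + j = 3 + ((u : ℕ) * (I.n * 3) + ((v : ℕ) * 3 + j)) := by
    ring
  rw [h3, encode, List.append_assoc, List.getElem?_append_right (by simp)]
  simp only [List.length_cons, List.length_nil, Nat.zero_add, Nat.reduceAdd, Nat.add_sub_cancel_left]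
  rw [List.getElem?_append_left, ← h1]
  · rfl
  · exact h2

/-- The scaling factor: the product of all denominators. -/
noncomputable def scale : ℕ := ∏ z : Fin I.n × Fin I.n, (edgeMatrix I.G I.x z.1 z.2).den

theorem scale_pos : 0 < I.scale := Finset.prod_pos fun _ _ => Rat.den_pos _

/-- The scaled weight matrix. -/
noncomputable def matrix (u v : Fin I.n) : ℤ :=
  (I.scale : ℤ) / (edgeMatrix I.G I.x u v).den * (edgeMatrix I.G I.x u v).num * 2

/-- The denominator divides the product of all denominators, so the integer division is exact. -/
theorem cast_matrix (u v : Fin I.n) :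
    (I.matrix u v : ℚ) = ((2 * I.scale : ℕ) : ℚ) * edgeMatrix I.G I.x u v := by
  have h1 : (edgeMatrix I.G I.x u v).den ∣ I.scale :=
    Finset.dvd_prod_of_mem (fun z : Fin I.n × Fin I.n => (edgeMatrix I.G I.x z.1 z.2).den)
      (Finset.mem_univ (u, v))
  obtain ⟨k, hk⟩ := h1

  have h3 : (I.scale : ℤ) / (edgeMatrix I.G I.x u v).den = k := by
    rw [hk]
    push_cast
    rw [Int.mul_ediv_cancel_left]
    exact_mod_cast (Rat.den_pos _).ne'
  rw [matrix, h3, hk]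
  have h4 := Rat.mul_den_eq_num (edgeMatrix I.G I.x u v)
  push_cast
  linear_combination (-2 * (k : ℚ)) * h4

/-- The matrix with which the algorithm starts. -/
noncomputable def start (u v : Fin I.n) : ℤ :=
  I.matrix u v + auxEdge I.s I.t ((2 * I.scale : ℕ) : ℤ) u v

theorem cast_start : (fun u v => (I.start u v : ℚ)) =
    scaledMatrix I.G I.x I.s I.t ((2 * I.scale : ℕ) : ℚ) := by
  funext u v
  rw [start, Int.cast_add, cast_matrix, scaledMatrix, ← cast_auxEdge]
  simp

/-- This is the purpose of the factor `2` in both the matrix and the auxiliary weight: it provides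
the parity that keeps all splitting amounts integral. -/
theorem even_wdeg_start (u : Fin I.n) : Even (wdeg I.start u) := by
  refine Finset.even_sum _ fun v _ => ?_
  unfold start matrix auxEdge
  refine Even.add (by simp) ?_
  split_ifs <;> simp

variable {I}

theorem Valid.dominates (h : I.Valid) :
    Loop.Cmd.Dominates (2 * I.scale) I.s I.t I.start := by
  have hW : (0 : ℚ) ≤ ((2 * I.scale : ℕ) : ℚ) := by positivity
  refine ⟨Feasible.of_cast ?_, ?_, fun p q => ?_⟩
  · rw [cast_start]
    exact feasible_scaledMatrix h.2 h.1 hW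
  · have h1 := cast_wdeg I.start I.s
    rw [cast_start, wdeg_scaledMatrix h.2 h.1, polytope_y_source h.2, if_pos (Or.inl rfl)] at h1
    have h2 : ((wdeg I.start I.s : ℤ) : ℚ) = ((2 * (2 * I.scale : ℕ) : ℤ) : ℚ) := by
      rw [← h1]
      push_cast
      ring
    exact_mod_cast h2
  · have h1 := auxEdge_le_scaledMatrix h.2 hW p q
    rw [← congrFun (congrFun I.cast_start p) q] at h1
    have h2 := cast_auxEdge I.s I.t ((2 * I.scale : ℕ) : ℤ) p q
    rw [Int.cast_natCast] at h2
    rw [h2] at h1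
    exact_mod_cast h1

theorem Valid.isSolution (h : I.Valid) {F : Fam (Fin I.n) ℤ}
    (hF : Decomposes I.s I.t ((2 * I.scale : ℕ) : ℤ) I.start F) :
    (∀ i < F.m, ∀ p q, p ≠ q → HasEdge (F.T i) p q → I.G.Adj p q) ∧
    IsSolution I (encodeFamily (fun i : Fin F.m => treeSubgraph I.G (F.T i)) (fun i => F.w i)
      fun _ => ((2 * I.scale : ℕ) : ℤ)) := by
  have hpos := I.scale_pos
  have h1 := hF.cast
  rw [cast_start, Int.cast_natCast] at h1
  obtain ⟨h2, h3⟩ := h1.isDecomposition h.2 h.1 (by positivity)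
  exact ⟨h2, _, _, _, _, fun _ => by positivity, by simpa using h3, rfl⟩

end Input

end Stroll

/-! ### Reading and scaling the input by a program -/

namespace Loop

/-- The input words of `I`. -/
structure Reads (I : Stroll.Input) (σ : Mem) : Prop where
  n : σ.inp 0 = I.n
  s : σ.inp 1 = (I.s : ℕ)
  t : σ.inp 2 = (I.t : ℕ)
  num : ∀ u v : Fin I.n, σ.inp (((u : ℕ) * I.n + (v : ℕ)) * 3 + 4) =
    (Stroll.edgeMatrix I.G I.x u v).num
  den : ∀ u v : Fin I.n, σ.inp (((u : ℕ) * I.n + (v : ℕ)) * 3 + 5) =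
    ((Stroll.edgeMatrix I.G I.x u v).den : ℤ)

notation "rAux" => (35 : ℕ)

theorem Frame.reads {I : Stroll.Input} {R A : List ℕ} {σ ρ : Mem} (h : Frame R A σ ρ) (hI : Reads I σ) : Reads I ρ :=
  ⟨by rw [h.inp, hI.n], by rw [h.inp, hI.s], by rw [h.inp, hI.t], fun u v => by rw [h.inp, hI.num],
    fun u v => by rw [h.inp, hI.den]⟩

namespace Cmd

/-- Three words precede the table and each pair takes three words, so the numerator is found with `j
= 4` and the denominator with `j = 5`. -/
def position (j : ℤ) : Exp := (◦rU * ◦rN + ◦rI) * 3 + .const j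

def readSizes : Cmd := assign rS (.inp 1) ;; assign rT (.inp 2) ;; assign rN (.inp 0)

/-- The running product is multiplied by input words, which count as factors of bounded length, so
its length grows only additively. -/
def readScale : Cmd :=
  assign rD 1 ;; loop rU rN (loop rI rN (assign rD (◦rD * .inp (position 5))))

def readMatrix : Cmd :=
  loop rU rN (loop rI rN
    (store aX ◦rU ◦rI (◦rD / .inp (position 5) * .inp (position 4) * 2)))

def addAux : Cmd := assign rW (◦rD * 2) ;; addTo aX ◦rS ◦rT ◦rW ;; addTo aX ◦rT ◦rS ◦rW

def degrees : Cmd :=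
  loop rU rN (loop rI rN (store aDeg 0 ◦rU (.arr aDeg 0 ◦rU + .arr aX ◦rU ◦rI)))

/-- The common loop bound is built by multiplying by the frozen register `rN` only. The digit count
of the total weight needs the command `log`, since the weight itself may be exponentially large. -/
def bounds : Cmd := log rK rAux ◦rW ;; assign rL ((◦rN + 1) * ◦rN * ◦rN * ◦rN + 1)

def prepare : Cmd := readScale ;; readMatrix ;; addAux ;; degrees ;; bounds

variable {I : Stroll.Input} {σ : Mem}

theorem exec_readScale (hI : Reads I σ) (hn : σ.reg rN = I.n) :
    (readScale.exec σ).reg rD = I.scale := by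
  rw [readScale, exec_seq, exec_assign, Stroll.Input.scale]
  have key := loop_fin₂ (i := rU) (j := rI) (k := rN) (n := I.n) (σ := σ.set rD (Exp.eval σ 1))
    (c := assign rD (◦rD * .inp (position 5))) (by simp [hn])
    (fun D ρ => ρ.reg rD = ((∏ z ∈ D, (Stroll.edgeMatrix I.G I.x z.1 z.2).den : ℕ) : ℤ))
    (fun D ρ z h => by simpa using h) (fun D ρ z h => by simpa using h) (by simp) (by decide)
    (by decide) ?_
  · exact key
  · intro D p q hpq ρ hF hp hq h
    have hn' : ρ.reg rN = I.n := by rw [hF.reg _ (by decide)]; simp [hn]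
    rw [exec_assign, Finset.prod_insert hpq]
    simp only [position, Exp.eval_mul, Exp.eval_reg, Exp.eval_inp, Exp.eval_add, Exp.eval_three,
      Exp.eval_const, Mem.set_reg, if_true, h, hp, hq, hn']
    rw [hF.inp, Mem.set_inp, hI.den]
    push_cast
    ring

theorem exec_readMatrix (hI : Reads I σ) (hn : σ.reg rN = I.n) (hD : σ.reg rD = I.scale) :
    (readMatrix.exec σ).mat I.n aX = I.matrix := by
  have key := loop_fin₂ (i := rU) (j := rI) (k := rN) (n := I.n) (σ := σ)
    (c := store aX ◦rU ◦rI (◦rD / .inp (position 5) * .inp (position 4) * 2)) hn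
    (fun D ρ => ∀ z ∈ D, ρ.mat I.n aX z.1 z.2 = I.matrix z.1 z.2)
    (fun _ _ _ h => h) (fun _ _ _ h => h) (by simp) (by decide) (by decide) ?_
  · funext u v
    exact key (u, v) (Finset.mem_univ _)
  · intro D p q hpq ρ hF hp hq h z hz
    have hn' : ρ.reg rN = I.n := by rw [hF.reg _ (by decide), hn]
    have hD' : ρ.reg rD = I.scale := by rw [hF.reg _ (by decide), hD]
    rw [exec_store]
    simp only [position, Exp.eval_mul, Exp.eval_reg, Exp.eval_inp, Exp.eval_add, Exp.eval_three,
      Exp.eval_const, Exp.eval_div, Exp.eval_two, hp, hq, hn', hD']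
    rw [hF.inp, hI.den, hI.num, Mem.mat_put]
    by_cases hzp : z = (p, q)
    · simp [hzp, Stroll.Input.matrix]
    · have h1 := h z ((Finset.mem_insert.1 hz).resolve_left hzp)
      by_cases h2 : z.1 = p
      · have h3 : z.2 ≠ q := fun h3 => hzp (Prod.ext h2 h3)
        rw [h2] at h1 ⊢
        simp [h3, h1]
      · simp [h2, h1]

theorem exec_degrees {n : ℕ} (hn : σ.reg rN = n) (h0 : ∀ u : Fin n, σ.arr aDeg 0 (u : ℕ) = 0) :
    (degrees.exec σ).vec n aDeg = Stroll.wdeg (σ.mat n aX) := by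
  have key := loop_fin₂ (i := rU) (j := rI) (k := rN) (n := n) (σ := σ)
    (c := store aDeg 0 ◦rU (.arr aDeg 0 ◦rU + .arr aX ◦rU ◦rI)) hn
    (fun D ρ => ∀ u, ρ.vec n aDeg u = ∑ z ∈ D, if z.1 = u then σ.mat n aX z.1 z.2 else 0)
    (fun _ _ _ h => h) (fun _ _ _ h => h) (by simpa [Mem.vec] using h0) (by decide) (by decide) ?_
  · funext u
    rw [degrees, key u, Fintype.sum_prod_type, Stroll.wdeg]
    rw [Finset.sum_eq_single u]
    · simp
    · intro b _ hb
      simp [hb]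
    · simp
  · intro D p q hpq ρ hF hp hq h u
    have hX : ρ.mat n aX p q = σ.mat n aX p q := by rw [hF.mat (by decide)]
    rw [exec_store, Finset.sum_insert hpq, Exp.eval_zero, Exp.eval_reg, hp, Mem.vec_put]
    simp only [Exp.eval_add, Exp.eval_arr, Exp.eval_zero, Exp.eval_reg, hp, hq, Mem.arr_eq_vec,
      Mem.arr_eq_mat, h, hX]
    by_cases hup : u = p
    · simp [hup]
      ring
    · simp [hup, Ne.symm hup, h]

/-- A bound for the number of rounds of all loops. -/
def rounds (n : ℕ) : ℕ := (n + 1) * n ^ 3 + 1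

theorem exec_prepare (hst : I.s ≠ I.t) (hI : Reads I σ) (hn : σ.reg rN = I.n)
    (hs : σ.reg rS = (I.s : ℕ)) (ht : σ.reg rT = (I.t : ℕ)) (h0 : ∀ u : Fin I.n, σ.arr aDeg 0 (u : ℕ) = 0) :
    Env I.n (rounds I.n) (2 * I.scale) I.s I.t (prepare.exec σ) ∧
      (prepare.exec σ).mat I.n aX = I.start ∧
      (prepare.exec σ).vec I.n aDeg = Stroll.wdeg I.start := by
  simp only [prepare, exec_seq]
  have hF₁ := readScale.frame σ
  have hD₁ := exec_readScale hI hn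
  set σ₁ := readScale.exec σ
  have hF₂ := readMatrix.frame σ₁
  have hX₂ := exec_readMatrix (hF₁.reads hI) (by rw [hF₁.reg _ (by decide), hn]) hD₁
  set σ₂ := readMatrix.exec σ₁
  have hn₂ : σ₂.reg rN = I.n := by rw [hF₂.reg _ (by decide), hF₁.reg _ (by decide), hn]
  have hs₂ : σ₂.reg rS = (I.s : ℕ) := by rw [hF₂.reg _ (by decide), hF₁.reg _ (by decide), hs]
  have ht₂ : σ₂.reg rT = (I.t : ℕ) := by rw [hF₂.reg _ (by decide), hF₁.reg _ (by decide), ht]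
  have hD₂ : σ₂.reg rD = I.scale := by rw [hF₂.reg _ (by decide), hD₁]
  have h0₂ : ∀ u : Fin I.n, σ₂.arr aDeg 0 (u : ℕ) = 0 := fun u => by
    rw [hF₂.arr _ (by decide), hF₁.arr _ (by decide), h0]
  clear_value σ₂
  have hF₃ := addAux.frame σ₂
  have hW₃ : (addAux.exec σ₂).reg rW = ((2 * I.scale : ℕ) : ℤ) := by
    simp [addAux, addTo, exec, hD₂, mul_comm]
  have hX₃ : (addAux.exec σ₂).mat I.n aX = I.start := by
    rw [addAux, exec_seq, exec_seq, exec_assign]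
    rw [exec_addTo (p := I.t) (q := I.s) (by simp [addTo, exec, ht₂]) (by simp [addTo, exec, hs₂]),
      exec_addTo (p := I.s) (q := I.t) (by simp [hs₂]) (by simp [ht₂]), Mem.mat_set, hX₂]
    have hW : (((addTo aX ◦rS ◦rT ◦rW).exec (σ₂.set rW (Exp.eval σ₂ (◦rD * 2)))).reg rW) =
        ((2 * I.scale : ℕ) : ℤ) := by simp [addTo, exec, hD₂, mul_comm]
    have hW' : (σ₂.set rW (Exp.eval σ₂ (◦rD * 2))).reg rW = ((2 * I.scale : ℕ) : ℤ) := by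
      simp [hD₂, mul_comm]
    rw [Exp.eval_reg, Exp.eval_reg, hW, hW']
    funext u v
    rw [Stroll.Input.start, Stroll.bump, Stroll.bump, Stroll.auxEdge, add_assoc]
    congr 1
    by_cases h1 : u = I.s ∧ v = I.t
    · have h2 : ¬ (u = I.t ∧ v = I.s) := fun h => hst (h1.1.symm.trans h.1)
      simp [h1, hst]
    · simp [h1]
  set σ₃ := addAux.exec σ₂
  have hn₃ : σ₃.reg rN = I.n := by rw [hF₃.reg _ (by decide), hn₂]
  have hd₄ := exec_degrees hn₃ fun u => by rw [hF₃.arr _ (by decide), h0₂]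
  have hF₄ := degrees.frame σ₃
  set σ₄ := degrees.exec σ₃
  have hX₄ : σ₄.mat I.n aX = I.start := by rw [hF₄.mat (by decide), hX₃]
  rw [hX₃] at hd₄
  have hF₅ := bounds.frame σ₄
  have hn₄ : σ₄.reg rN = I.n := by rw [hF₄.reg _ (by decide), hn₃]
  have hW₄ : σ₄.reg rW = ((2 * I.scale : ℕ) : ℤ) := by rw [hF₄.reg _ (by decide), hW₃]
  refine ⟨⟨?_, ?_, ?_, ?_, ?_, ?_⟩, ?_, ?_⟩
  · rw [hF₅.reg _ (by decide), hn₄]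
  · rw [hF₅.reg _ (by decide), hF₄.reg _ (by decide), hF₃.reg _ (by decide), hs₂]
  · rw [hF₅.reg _ (by decide), hF₄.reg _ (by decide), hF₃.reg _ (by decide), ht₂]
  · simp only [bounds, exec, Exp.eval_reg, hW₄, Int.toNat_natCast]
    simp
  · rw [hF₅.reg _ (by decide), hW₄]
  · simp [bounds, exec, hn₄, rounds]
    ring
  · rw [hF₅.mat (by decide), hX₄]
  · rw [hF₅.vec (by decide), hd₄]

end Cmd

end Loop

/-! ### The algorithm -/

namespace Loop

/-- The memory at the start. -/
def Mem.init (w : List ℤ) : Mem where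
  inp z := if 0 ≤ z then w.getD z.toNat 0 else 0
  reg r := if r = 0 then w.length else 0
  arr _ _ _ := 0
  out := []

theorem sim_init (w : List ℤ) : Sim (Mem.init w) (RAM.init w) :=
  ⟨fun z => by simp [RAM.init, Mem.init], rfl, fun a i j => by simp [RAM.init, Mem.init], rfl⟩

theorem bits_getD_le (w : List ℤ) (k : ℕ) : RAM.bits (w.getD k 0) ≤ RAM.size w + 1 := by
  rw [List.getD_eq_getElem?_getD]
  cases h : w[k]? with
  | none => simp [RAM.bits]
  | some z =>
    have h1 : z ∈ w := List.mem_of_getElem? h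
    have h2 : RAM.bits z ≤ RAM.size w := List.le_sum_of_mem (List.mem_map_of_mem h1)
    simpa using h2.trans (Nat.le_succ _)

theorem length_le_size (w : List ℤ) : w.length ≤ RAM.size w := by
  induction w with
  | nil => simp
  | cons z w ih =>
    have := RAM.one_le_bits z
    simp only [RAM.size, List.map_cons, List.sum_cons, List.length_cons] at ih ⊢
    omega

theorem bitsLE_init (w : List ℤ) : BitsLE (RAM.size w + 1) (Mem.init w) := by
  refine ⟨fun r => ?_, fun a i j => by simp [Mem.init, RAM.bits]⟩
  by_cases hr : r = 0
  · have := length_le_size w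
    simp only [Mem.init, hr, if_true]
    exact RAM.bits_le_of_natAbs_le (by simpa using this)
  · simp [Mem.init, hr, RAM.bits]

theorem bits_inp_init (w : List ℤ) (z : ℤ) : RAM.bits ((Mem.init w).inp z) ≤ RAM.size w + 1 := by
  simp only [Mem.init]
  split_ifs
  · exact bits_getD_le w _
  · simp [RAM.bits]

variable {I : Stroll.Input}

theorem reads_init (I : Stroll.Input) : Reads I (Mem.init I.encode) := by
  have key : ∀ (u v : Fin I.n) (j : ℕ), j < 3 → ∀ z : ℤ, (I.entry u v)[j]? = some z →
      (Mem.init I.encode).inp (((u : ℕ) * I.n + (v : ℕ)) * 3 + 3 + j) = z := by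
    intro u v j hj z hz
    have h1 : (((u : ℕ) * I.n + (v : ℕ)) * 3 + 3 + j : ℤ) =
        ((((u : ℕ) * I.n + v) * 3 + 3 + j : ℕ) : ℤ) := by push_cast; ring
    rw [h1]
    simp only [Mem.init, Int.natCast_nonneg, if_true, Int.toNat_natCast]
    rw [List.getD_eq_getElem?_getD, I.encode_entry u v hj, hz]
    rfl
  refine ⟨?_, ?_, ?_, fun u v => ?_, fun u v => ?_⟩
  · simp [Mem.init, Stroll.Input.encode]
  · simp [Mem.init, Stroll.Input.encode]
  · simp [Mem.init, Stroll.Input.encode]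
  · rw [← key u v 1 (by norm_num) _ (I.entry_num u v)]
    congr 1
  · rw [← key u v 2 (by norm_num) _ (I.entry_den u v)]
    congr 1

/-- The word lists data for all vertices and pairs, so `n` itself, and not merely its bit length, is
bounded by the input size and may serve as a loop bound. -/
theorem le_size_encode (I : Stroll.Input) : I.n ≤ RAM.size I.encode := by
  refine le_trans ?_ (length_le_size _)
  simp [Stroll.Input.encode, List.length_flatMap]
  omega

namespace Cmd

def finish : Cmd := splitAll ;; undoAll ;; emitFamily

variable {σ : Mem}

theorem exec_finish (hI : I.Valid) (hE : Env I.n (rounds I.n) (2 * I.scale) I.s I.t σ)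
    (hX : σ.mat I.n aX = I.start) (hd : σ.vec I.n aDeg = Stroll.wdeg I.start) (ho : σ.out = []) :
    Stroll.IsSolution I (finish.exec σ).out := by
  have hn : 1 ≤ I.n := I.s.pos
  -- The same bound serves the rounds of a scaling phase and the number of trees, which is at most
  -- `1 + (n + 1) * n ^ 3`.
  have hN : 2 * I.n ^ 2 < rounds I.n := by
    rw [rounds, Nat.lt_succ_iff]
    have h1 : I.n ^ 2 ≤ I.n ^ 3 := Nat.pow_le_pow_right hn (by norm_num)
    exact Nat.mul_le_mul (by omega) h1
  obtain ⟨l, X', h1, h2, h3, h4, h5⟩ := exec_splitAll hI.1 hE hN (by rw [hX]; exact hI.dominates)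
    (by rw [hX, hd]) (by rw [hX]; exact I.even_wdeg_start)
  rw [hX] at h2
  have hF₁ := splitAll.frame σ
  have hE₁ := hE.of_frame hF₁ (by decide)
  obtain ⟨F, k1, k2, k3⟩ := exec_undoAll hI.1 (by have := I.scale_pos; omega) hE₁ h2 h3 h4 h5
    (by rw [rounds, add_comm]; gcongr)
  have hF₂ := undoAll.frame (splitAll.exec σ)
  have hE₂ := hE₁.of_frame hF₂ (by decide)
  obtain ⟨m1, m2⟩ := hI.isSolution k1
  have h6 := exec_emitFamily hE₂ k3 k2 k1.good m1
  rw [exec_out (c := undoAll) (by decide), exec_out (c := splitAll) (by decide), ho,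
    List.nil_append] at h6
  rw [finish, exec_seq, exec_seq, h6]
  exact m2

end Cmd

open Polynomial in
/-- Tree decompositions of points of the stroll polytope are computed in polynomial time. -/
theorem solvable :
    RAM.SolvableInPolyTime Stroll.Input.encode Stroll.Input.Valid Stroll.IsSolution := by
  let budgetPoly : ℕ[X] → ℕ[X] → ℕ[X] → ℕ[X] := fun M B T => T * (B + T * (M + 1) + 1) ^ 2
  have hbudget : ∀ (M B T : ℕ[X]) (S : ℕ),
      (budgetPoly M B T).eval S = budget (M.eval S) (B.eval S) (T.eval S) := fun M B T S => by
    simp [budgetPoly, budget]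
  -- The program has three stages, because a register can be frozen only after it has been computed:
  -- none at first, then `rN`, then also `rK` and `rL`.
  let M₁ : ℕ[X] := X + 1
  let T₁ := Cmd.readSizes.steps.comp M₁
  let B₁ := M₁ + T₁ * (M₁ + 1)
  let T₂ := Cmd.prepare.steps.comp M₁
  let B₂ := B₁ + T₂ * (M₁ + 1)
  let M₃ := B₂ + ((M₁ + 1) * M₁ ^ 3 + 1)
  let T₃ := Cmd.finish.steps.comp M₃
  refine ⟨.seq Cmd.readSizes.compile (.seq Cmd.prepare.compile Cmd.finish.compile),
    budgetPoly M₁ M₁ T₁ + (budgetPoly M₁ B₁ T₂ + budgetPoly M₃ B₂ T₃), fun I hI => ?_⟩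
  set S := RAM.size I.encode with hS
  have hnS := le_size_encode I
  have hread := reads_init I
  set σ := Mem.init I.encode with hσ
  have e₁ : M₁.eval S = S + 1 := by simp [M₁]
  have hM₁ : Bounded (M₁.eval S) [] σ := ⟨by simp, fun z => by rw [e₁]; exact bits_inp_init _ z⟩
  obtain ⟨τ₁, k₁, r₁, s₁, b₁, c₁⟩ := Cmd.run (c := Cmd.readSizes) (F := []) (by decide)
    (sim_init I.encode) hM₁ (B := M₁.eval S) (by rw [e₁]; exact bitsLE_init _)
  have hF₁ := Cmd.readSizes.frame σ
  have hn₁ : (Cmd.readSizes.exec σ).reg rN = I.n := by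
    simp [Cmd.readSizes, Cmd.exec, hread.n]
  have hs₁ : (Cmd.readSizes.exec σ).reg rS = (I.s : ℕ) := by
    simp [Cmd.readSizes, Cmd.exec, hread.s]
  have ht₁ : (Cmd.readSizes.exec σ).reg rT = (I.t : ℕ) := by
    simp [Cmd.readSizes, Cmd.exec, hread.t]
  have hread₁ := hF₁.reads hread
  have hz₁ : ∀ u : Fin I.n, (Cmd.readSizes.exec σ).arr aDeg 0 (u : ℕ) = 0 := fun u => by
    rw [hF₁.arr _ (by decide)]
    rfl
  have ho₁ : (Cmd.readSizes.exec σ).out = [] := by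
    rw [Cmd.exec_out (by decide)]
    rfl
  have hM₂ : Bounded (M₁.eval S) [rN] (Cmd.readSizes.exec σ) := by
    refine ⟨fun r hr => ?_, fun z => by rw [hF₁.inp]; exact hM₁.inp z⟩
    obtain rfl := List.mem_singleton.1 hr
    rw [hn₁, e₁, Int.natAbs_natCast]
    omega
  obtain ⟨τ₂, k₂, r₂, s₂, b₂, c₂⟩ := Cmd.run (c := Cmd.prepare) (by decide) s₁ hM₂ b₁
  have hF₂ := Cmd.prepare.frame (Cmd.readSizes.exec σ)
  obtain ⟨hE, hX, hd⟩ := Cmd.exec_prepare hI.1 hread₁ hn₁ hs₁ ht₁ hz₁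
  have ho₂ : (Cmd.prepare.exec (Cmd.readSizes.exec σ)).out = [] := by
    rw [Cmd.exec_out (by decide), ho₁]
  have hB₁ : M₁.eval S + Cmd.readSizes.steps.eval (M₁.eval S) * (M₁.eval S + 1) = B₁.eval S := by
    simp [B₁, T₁, eval_comp]
  rw [hB₁] at b₂ c₂
  have hB₂ : B₁.eval S + Cmd.prepare.steps.eval (M₁.eval S) * (M₁.eval S + 1) = B₂.eval S := by
    simp [B₂, T₂, eval_comp]
  rw [hB₂] at b₂
  have e₃ : M₃.eval S = B₂.eval S + ((S + 1 + 1) * (S + 1) ^ 3 + 1) := by simp [M₃, e₁]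
  have hM₃ : Bounded (M₃.eval S) [rN, rK, rL] (Cmd.prepare.exec (Cmd.readSizes.exec σ)) := by
    have h1 : S + 1 ≤ B₂.eval S := by rw [← hB₂, ← hB₁, e₁]; omega
    refine ⟨fun r hr => ?_, fun z => ?_⟩
    · rw [e₃]
      simp only [List.mem_cons, List.not_mem_nil, or_false] at hr
      rcases hr with rfl | rfl | rfl
      · rw [hE.n, Int.natAbs_natCast]
        omega
      -- The digit count of the total weight is at most its bit length, which the length bound of
      -- the second stage controls.
      · have h2 := b₂.reg rW
        rw [hE.W, RAM.bits, Int.natAbs_natCast] at h2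
        rw [hE.K, Int.natAbs_natCast]
        omega
      · rw [hE.N, Int.natAbs_natCast, Cmd.rounds]
        have h2 : (I.n + 1) * I.n ^ 3 ≤ (S + 1 + 1) * (S + 1) ^ 3 := by
          gcongr <;> omega
        omega
    · rw [hF₂.inp]
      have h2 := hM₂.inp z
      omega
  obtain ⟨τ₃, k₃, r₃, s₃, -, c₃⟩ := Cmd.run (c := Cmd.finish) (by decide) s₂ hM₃ b₂
  refine ⟨τ₃, _, .seq r₁ (.seq r₂ r₃), ?_, ?_⟩
  · simp only [eval_add, hbudget]
    refine Nat.add_le_add (c₁.trans ?_) (Nat.add_le_add (c₂.trans ?_) (c₃.trans ?_)) <;>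
      simp [T₁, T₂, T₃, eval_comp]
  · rw [s₃.out]
    exact Cmd.exec_finish hI hE hX hd ho₂

end Loop

theorem lemma4 :
    (∀ (V : Type*) [Fintype V] (G : SimpleGraph V) (s t : V) (_ : s ≠ t)
        (x : G.edgeSet → ℝ) (y : V → ℝ), (x, y) ∈ Stroll.polytope ℝ G s t →
        ∃ (m : ℕ) (T : Fin m → G.Subgraph) (μ : Fin m → ℝ),
          Stroll.IsDecomposition s t x y T μ) ∧
      RAM.SolvableInPolyTime Stroll.Input.encode Stroll.Input.Valid Stroll.IsSolution := by
  refine ⟨fun V _ G s t hst x y h => ?_, ?_⟩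
  · classical
    exact Stroll.exists_isDecomposition h hst
  · exact Loop.solvable
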